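/- **Matsuno's modulus formula.** Let $P\in\mathbb N$, let $c_1,\dots,c_P\in\mathbb C\setminus\{0\}$, let $z_1,\dots,z_P$ have positive imaginary parts and real parts strictly increasing with the index, and suppose that $u_0(x)=\sum_{p=1}^P\frac{c_p}{x-z_p}+\mathrm{c.c.}$ belongs to $L^1(\mathbb R)$. Suppose that $u_0<0$ on $\mathbb R$ and that $u_0$ is a rational Klaus–Shaw potential: for some $x_c\in\mathbb R$ it is strictly monotone on each of $(-\infty,x_c)$ and $(x_c,\infty)$. Let $\lambda$ lie in the bulk $\mathcal B=(-\sup u_0,-\inf u_0)$ (so $\lambda>0$). For $\epsilon>0$ let the reflection coefficient $\beta(\lambda)=\beta(\lambda;\epsilon)$ of the Benjamin–Ono equation $u_t+2uu_x+\epsilon\mathcal H[u_{xx}]=0$ with potential $u_0$ be defined as follows. Put $M=2\pi i\sum_p c_p$ and $h(x;\mu)=\mu x+f(x)$ with $$f(x)=\sum_{p=1}^P\Big[c_p\big(\mathrm{Log}(i(x-z_p))+\tfrac{\pi i}2\big)+\overline{c_p}\big(\mathrm{Log}(-i(x-\overline{z_p}))-\tfrac{\pi i}2\big)\Big],$$ $\mathrm{Log}$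 being the principal branch. For $\mu<0$ set $$A_{mp}(\mu)=\int_{C_m}\frac{e^{-ih(z;\mu)/\epsilon}}{z-z_p}\,dz,\qquad b_m(\mu)=-\mu\int_{C_m}e^{-ih(z;\mu)/\epsilon}\,dz ,$$ where $C_m$ lies in the domain of analyticity of $f$, begins at $i\infty$ to the left of $\mathrm{Re}\,z=\mathrm{Re}\,z_1$, and ends at $i\infty$ to the right of $\mathrm{Re}\,z=\mathrm{Re}\,z_m$ and (if $m<P$) to the left of $\mathrm{Re}\,z=\mathrm{Re}\,z_{m+1}$, unless $ic_m/\epsilon$ is a negative integer, in which case $C_m$ ends at $z_m$. Let $\mathbf A^>(\lambda),\mathbf b^>(\lambda)$ be the boundary values at $\lambda>0$, from the upper half-plane, of the analytic continuations of $\mathbf A,\mathbf b$ to $\mathbb C\setminus[0,\infty)$. With $\mathbf v$ solving $\mathbf A^>(\lambda)\mathbf v=\mathbf b^>(\lambda)$, $$\beta(\lambda)=\frac i\epsilon e^{iM/\epsilon}\int_{-\infty}^{\infty}e^{-ih(x;\lambda)/\epsilon}\Big(u_0(x)-\sum_{p=1}^P\frac{v_p}{x-z_p}\Big)dx$$ (a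 convergent improper integral). Then $\beta(\lambda)$ is well defined for all sufficiently small $\epsilon>0$, the equation $u_0(x)=-\lambda$ has exactly two real solutions $x_-(\lambda)<x_+(\lambda)$, and $$\lim_{\epsilon\downarrow0}\epsilon\,|\beta(\lambda)|^2=2\pi\lambda\,\big(x_+(\lambda)-x_-(\lambda)\big).$$ -/

import Mathlib

open Filter Topology MeasureTheory

noncomputable section

/-- A real rational potential `u₀(x) = ∑ₚ cₚ / (x - zₚ) + c.c.` in `L¹(ℝ)`, with nonzero `cₚ` and
simple poles `zₚ` in the open upper half-plane whose real parts increase strictly with `p`. -/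
structure RationalPotential (P : ℕ) where
  c : Fin P → ℂ
  z : Fin P → ℂ
  c_ne_zero : ∀ p, c p ≠ 0
  z_im_pos : ∀ p, 0 < (z p).im
  z_re_strictMono : StrictMono fun p => (z p).re
  integrable : Integrable fun x : ℝ => 2 * (∑ p, c p / ((x : ℂ) - z p)).re

namespace RationalPotential

variable {P : ℕ} (u : RationalPotential P)

/-- The potential `u₀` itself; a sum plus its complex conjugate is twice its real part. -/
def u₀ (x : ℝ) : ℝ := 2 * (∑ p, u.c p / ((x : ℂ) - u.z p)).re

/-- Klaus-Shaw: for some `x_c`, strictly monotone on each of `(-∞, x_c)` and `(x_c, ∞)`. -/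
def IsKlausShaw : Prop :=
  ∃ xc : ℝ,
    (StrictMonoOn u.u₀ (Set.Iio xc) ∨ StrictAntiOn u.u₀ (Set.Iio xc)) ∧
    (StrictMonoOn u.u₀ (Set.Ioi xc) ∨ StrictAntiOn u.u₀ (Set.Ioi xc))

/-- The bulk `(-sup u₀, -inf u₀)`. -/
def bulk : Set ℝ := Set.Ioo (-(⨆ x, u.u₀ x)) (-(⨅ x, u.u₀ x))

/-- `M = 2πi (c₁ + ⋯ + c_P)`, the integral of `u₀`. -/
def M : ℂ := 2 * Real.pi * Complex.I * ∑ p, u.c p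

/-- The antiderivative `f` of `u₀`, with principal logarithms. Its branch cuts are the vertical
half-lines from `zₚ` to `+i∞` and from the conjugate of `zₚ` to `-i∞`. -/
def f (x : ℂ) : ℂ :=
  ∑ p, (u.c p * (Complex.log (Complex.I * (x - u.z p)) + Real.pi * Complex.I / 2) +
    star (u.c p) * (Complex.log (-Complex.I * (x - star (u.z p))) - Real.pi * Complex.I / 2))

/-- `h(x; λ) = λ x + f(x)`. -/
def h (lam : ℝ) (x : ℂ) : ℂ := lam * x + u.f x

/-- An abscissa to the left of all the poles (`m` only witnesses that there is a pole). -/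
def leftAbscissa (m : Fin P) : ℝ := (u.z ⟨0, m.pos⟩).re - 1

/-- An abscissa to the right of `zₘ` and, if there is a next pole, to the left of it. -/
def rightAbscissa (m : Fin P) : ℝ :=
  if hm : (m : ℕ) + 1 < P then ((u.z m).re + (u.z ⟨m + 1, hm⟩).re) / 2 else (u.z m).re + 1

/-- `i cₘ / ε` is a negative integer. -/
def IsExceptional (ε : ℝ) (m : Fin P) : Prop :=
  ∃ n : ℕ, 0 < n ∧ Complex.I * u.c m / ε = -(n : ℂ)

open Classical in
/-- The integral of `F` over the contour `Cₘ` used for `λ < 0`. The contour comes down from `i∞`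
along a vertical line to the left of all poles, follows the real axis, and then
* if `i cₘ / ε` is not a negative integer, goes up to `i∞` along a vertical line to the right of
  `zₘ` and to the left of the next pole;
* otherwise goes up vertically to `zₘ` and ends there.
It lies in the domain of analyticity of `f`. -/
def contourIntegral (ε : ℝ) (m : Fin P) (F : ℂ → ℂ) : ℂ :=
  if u.IsExceptional ε m then
    -(Complex.I * ∫ y in Set.Ioi (0 : ℝ), F (u.leftAbscissa m + y * Complex.I))
      + (∫ x in (u.leftAbscissa m)..(u.z m).re, F x)
      + Complex.I * ∫ y in (0 : ℝ)..(u.z m).im, F ((u.z m).re + y * Complex.I)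
  else
    -(Complex.I * ∫ y in Set.Ioi (0 : ℝ), F (u.leftAbscissa m + y * Complex.I))
      + (∫ x in (u.leftAbscissa m)..(u.rightAbscissa m), F x)
      + Complex.I * ∫ y in Set.Ioi (0 : ℝ), F (u.rightAbscissa m + y * Complex.I)

/-- The matrix entry `A_{mp}(λ)`, `λ < 0`. -/
def entryA (ε : ℝ) (m p : Fin P) (lam : ℝ) : ℂ :=
  u.contourIntegral ε m fun x => Complex.exp (-Complex.I * u.h lam x / ε) / (x - u.z p)

/-- The right-hand side entry `b_m(λ)`, `λ < 0`. -/
def entryB (ε : ℝ) (m : Fin P) (lam : ℝ) : ℂ :=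
  -lam * u.contourIntegral ε m fun x => Complex.exp (-Complex.I * u.h lam x / ε)

end RationalPotential

/-- `a` is the boundary value at `lam` from the upper half-plane of the analytic continuation
to `ℂ ∖ [0, ∞)` of the function `F` given on `(-∞, 0)`. -/
def IsUpperBoundaryValue (F : ℝ → ℂ) (lam : ℝ) (a : ℂ) : Prop :=
  ∃ G : ℂ → ℂ, DifferentiableOn ℂ G {w : ℂ | w.im ≠ 0 ∨ w.re < 0} ∧
    (∀ x : ℝ, x < 0 → G x = F x) ∧
    Tendsto G (𝓝[{w : ℂ | 0 < w.im}] (lam : ℂ)) (𝓝 a)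

namespace RationalPotential

variable {P : ℕ} (u : RationalPotential P)

/-- `v` solves the linear system `A^>(λ) v = b^>(λ)`, where `A^>` and `b^>` are the boundary
values of `A` and `b` on the positive half-line from the upper half-plane. -/
def SolvesJostSystem (ε lam : ℝ) (v : Fin P → ℂ) : Prop :=
  ∃ (A : Matrix (Fin P) (Fin P) ℂ) (b : Fin P → ℂ),
    (∀ m p, IsUpperBoundaryValue (u.entryA ε m p) lam (A m p)) ∧
    (∀ m, IsUpperBoundaryValue (u.entryB ε m) lam (b m)) ∧
    A.mulVec v = b

/-- `β` is the reflection coefficient of `u₀` at `λ > 0`: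
`β = (i/ε) e^{iM/ε} ∫_ℝ e^{-ih(x;λ)/ε} (u₀(x) - ∑ₚ vₚ / (x - zₚ)) dx`
(a convergent improper integral) with `v` a solution of the linear system. -/
def IsReflectionCoefficient (ε lam : ℝ) (β : ℂ) : Prop :=
  ∃ v : Fin P → ℂ, u.SolvesJostSystem ε lam v ∧
    Tendsto
      (fun R : ℝ × ℝ => Complex.I / ε * Complex.exp (Complex.I * u.M / ε) *
        ∫ x in R.1..R.2, Complex.exp (-Complex.I * u.h lam x / ε) *
          ((u.u₀ x : ℂ) - ∑ p, v p / ((x : ℂ) - u.z p)))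
      (atBot ×ˢ atTop) (𝓝 β)

end RationalPotential

end

/-! Everything is read off from a Jost function: a function w, holomorphic in the closed upper
half-plane, that solves iεw' + (λ + u₀)w = q with q = κλ + Σ v_p/(z − z_p) and tends to κ at −∞ on
the real line. Its existence, an exact formula for |β|, and the limit of the data v are the three
ingredients.

Existence (`exists_system`). A primitive of e^{-ih/ε}q divided by e^{-ih/ε} solves the equation on
the plane cut upwards from the poles. A second primitive, normalised at −∞, does the same on the
plane cut downwards and has the right limit at −∞. Continuing the half-line integrals to λ > 0 turns
the rows of A v = κ b into the conditions that let the two solutions be glued successively across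
the poles. The glued solution is bounded near each z_p, so its singularities there are removable.

Exact formula (`IsJost.exists_limit`, `IsJost.exists_reflection`). Put k = q − λw. Then e^{-ih/ε}k
tends to 0 at −∞ and to some K at +∞ (up to a unimodular constant), and |β| = |K|/λ when κ = 1. With
q# the reflection of q in the real axis, (|k|² − |q|²)' = (2λ/ε) Im[w(−iε q#' + u₀ q#)]. Closing the
contour in the upper half-plane, only the poles z_p contribute, and they give the residue sum Σ v_p
q#(z_p), whose real part is λ Re(κ̄ Σ v_p). Hence ε|β|² = 4π Re Σ v_p, with no error term.

Limit of the data (`coeffSmall_vanishOrder`, `re_sum_eq_of_nu_eq_zero`). An estimate on the real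
line and Phragmén–Lindelöf give w = O(1/ε) in the closed upper half-plane. At a zero ζ of λ + u₀ of
multiplicity m the phase has m + 1 valleys. Along a valley contained in the closed upper half-plane
the phase integral of q equals −iεw(ζ) + O(ε), with the same w(ζ) for all valleys. Comparing n + 1
valleys forces the first n Taylor coefficients at ζ of the numerator of q to tend to 0. An interior
zero has all its m + 1 valleys available, so n = m. At a real zero m = 2k + 1 is odd and k + 1
valleys lie above the axis, so n = k at the right turning point. At the left one w stays bounded on
the real axis to the left, which gives access to one further valley just below the axis, so n = k +
1. The 2P zeros of λ + u₀ are symmetric under conjugation, so these orders add up to P, the degree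
of the numerator, and the limiting numerator is κλ ∏(z − ζ)^n. Comparing the coefficients of
z^{P−1}, with Re Σ c_p = 0 by integrability, yields 2 Re Σ v_p → λ(x₊ − x₋).

All estimates are proportional to the size of (κ, v). Compactness of normalised data
(`exists_bound_size`) then excludes κ = 0 for small ε, which makes A invertible and bounds v. -/

noncomputable section

/-! ### Complex-analytic preliminaries -/

theorem exists_primitive_of_convex {s : Set ℂ} (hs : Convex ℝ s) (ho : IsOpen s) {f : ℂ → ℂ}
    (hf : DifferentiableOn ℂ f s) : ∃ F : ℂ → ℂ, ∀ z ∈ s, HasDerivAt F (f z) z := by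
  obtain ⟨F, hF⟩ := hs.exists_forall_hasDerivWithinAt hf
  exact ⟨F, fun z hz => (hF z hz).hasDerivAt (ho.mem_nhds hz)⟩

theorem eqOn_of_deriv_zero {s : Set ℂ} (hs : Convex ℝ s) {f : ℂ → ℂ}
    (hf : ∀ z ∈ s, HasDerivAt f 0 z) {x y : ℂ} (hx : x ∈ s) (hy : y ∈ s) : f x = f y := by
  have := hs.norm_image_sub_le_of_norm_hasDerivWithin_le (f := f) (f' := fun _ => 0) (C := 0)
    (fun z hz => (hf z hz).hasDerivWithinAt) (fun z _ => by simp) hy hx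
  simpa [sub_eq_zero] using this

/-- A holomorphic integrand with an integrable majorant, locally uniform in the parameter, has a
holomorphic integral. -/
theorem differentiableAt_integral_of_dominated {α : Type*} [MeasurableSpace α] {ν : Measure α}
    {F : ℂ → α → ℂ} {s₀ : ℂ} {r : ℝ} (hr : 0 < r) {bound : α → ℝ} (hb : Integrable bound ν)
    (hm : ∀ s ∈ Metric.ball s₀ r, AEStronglyMeasurable (F s) ν)
    (hd : ∀ᵐ a ∂ν, DifferentiableOn ℂ (fun s => F s a) (Metric.ball s₀ r))
    (hle : ∀ᵐ a ∂ν, ∀ s ∈ Metric.ball s₀ r, ‖F s a‖ ≤ bound a) :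
    DifferentiableAt ℂ (fun s => ∫ a, F s a ∂ν) s₀ := by
  have hsub : Metric.ball s₀ (r / 2) ⊆ Metric.ball s₀ r := Metric.ball_subset_ball (by linarith)
  have hdiff : ∀ᵐ a ∂ν, ∀ s ∈ Metric.ball s₀ (r / 2),
      HasDerivAt (fun s => F s a) (deriv (fun s => F s a) s) s := by
    filter_upwards [hd] with a ha s hs
    exact ((ha s (hsub hs)).differentiableAt (Metric.isOpen_ball.mem_nhds (hsub hs))).hasDerivAt
  have h0 : s₀ ∈ Metric.ball s₀ r := Metric.mem_ball_self hr
  refine (hasDerivAt_integral_of_dominated_loc_of_deriv_le (μ := ν) (F := F)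
    (F' := fun s a => deriv (fun s => F s a) s)
    (bound := fun a => bound a / (r / 4))
    (Metric.ball_mem_nhds s₀ (ε := r / 4) (by linarith)) ?_ ?_ ?_ ?_ ?_ ?_).2.differentiableAt
  · filter_upwards [Metric.ball_mem_nhds s₀ hr] with s hs using hm s hs
  · exact hb.mono' (hm s₀ h0) (by filter_upwards [hle] with a ha using ha s₀ h0)
  -- The parameter derivative is measurable as an almost everywhere limit of difference quotients
  -- along a null sequence; the factor r/2 keeps the shifted parameter inside the ball.
  · have hu : Tendsto (fun n : ℕ => ((r / 2 * (1 / ((n : ℝ) + 1)) : ℝ) : ℂ)) atTop (𝓝[≠] 0) := by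
      rw [tendsto_nhdsWithin_iff]
      constructor
      · have := (tendsto_one_div_add_atTop_nhds_zero_nat (𝕜 := ℝ)).const_mul (r / 2)
        rw [mul_zero] at this
        exact_mod_cast (Complex.continuous_ofReal.tendsto 0).comp this
      · refine Eventually.of_forall fun n => ?_
        simp only [Set.mem_compl_iff, Set.mem_singleton_iff, Complex.ofReal_eq_zero]
        positivity
    refine aestronglyMeasurable_of_tendsto_ae (u := atTop)
      (f := fun (n : ℕ) a => ((r / 2 * (1 / ((n : ℝ) + 1)) : ℝ) : ℂ)⁻¹ •
        (F (s₀ + ((r / 2 * (1 / ((n : ℝ) + 1)) : ℝ) : ℂ)) a - F s₀ a)) ?_ ?_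
    · intro n
      have hmem : s₀ + ((r / 2 * (1 / ((n : ℝ) + 1)) : ℝ) : ℂ) ∈ Metric.ball s₀ r := ?_
      · exact ((hm _ hmem).sub (hm _ h0)).const_smul (((r / 2 * (1 / ((n : ℝ) + 1)) : ℝ) : ℂ)⁻¹)
      have h1 : 1 / ((n : ℝ) + 1) ≤ 1 := by
        rw [div_le_one (by positivity)]; linarith [(Nat.cast_nonneg n : (0 : ℝ) ≤ n)]
      have h2 : 0 < 1 / ((n : ℝ) + 1) := by positivity
      simp only [Metric.mem_ball, dist_self_add_left, Complex.norm_real, Real.norm_eq_abs]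
      rw [abs_of_nonneg (by positivity)]
      nlinarith
    · filter_upwards [hdiff] with a ha
      exact (ha s₀ (Metric.mem_ball_self (by linarith))).tendsto_slope_zero.comp hu
  · filter_upwards [hd, hle] with a ha hla s hs
    have hs' : s ∈ Metric.ball s₀ (r / 4) := hs
    have hsub4 : Metric.closedBall s (r / 4) ⊆ Metric.ball s₀ r := by
      intro z hz
      rw [Metric.mem_closedBall] at hz
      rw [Metric.mem_ball] at *
      linarith [dist_triangle z s s₀]
    -- Cauchy's estimate on circles of radius r/4: the majorant of the integrand also majorises its
    -- derivative, at the cost of the factor 4/r.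
    refine Complex.norm_deriv_le_of_forall_mem_sphere_norm_le (by linarith) ?_ ?_
    · refine DifferentiableOn.diffContOnCl ?_
      rw [closure_ball _ (by linarith)]
      exact ha.mono hsub4
    · intro z hz
      exact hla z (hsub4 (Metric.sphere_subset_closedBall hz))
  · exact hb.div_const _
  · filter_upwards [hdiff] with a ha s hs
    exact ha s (Metric.ball_subset_ball (by linarith) hs)

/-- The integral along the real line of a function holomorphic in the closed upper half-plane
and decaying quadratically vanishes. -/
theorem integral_eq_zero_of_decay {G : ℂ → ℂ} (hG : ∀ z : ℂ, 0 ≤ z.im → DifferentiableAt ℂ G z)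
    {C : ℝ} (hC : ∀ z : ℂ, 0 ≤ z.im → ‖G z‖ ≤ C / (1 + ‖z‖ ^ 2)) :
    ∫ x : ℝ, G x = 0 := by
  have hC0 : 0 ≤ C := by
    have := (norm_nonneg _).trans (hC 0 (by simp))
    simpa using this
  have hint : ∀ y : ℝ, 0 ≤ y → Integrable fun x : ℝ => G (x + y * Complex.I) := by
    intro y hy
    refine (integrable_inv_one_add_sq.const_mul C).mono' ?_ ?_
    · refine Continuous.aestronglyMeasurable ?_
      refine continuous_iff_continuousAt.2 fun x => ?_
      refine ContinuousAt.comp (g := G) (hG _ (by simpa using hy)).continuousAt ?_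
      fun_prop
    · refine Eventually.of_forall fun x => (hC _ (by simpa using hy)).trans ?_
      rw [← div_eq_mul_inv]
      have : x ^ 2 ≤ ‖(x + y * Complex.I : ℂ)‖ ^ 2 := by
        rw [Complex.sq_norm, Complex.normSq_add_mul_I]; nlinarith
      gcongr
  have hshift : ∀ y : ℝ, 0 ≤ y → ∫ x : ℝ, G x = ∫ x : ℝ, G (x + y * Complex.I) := by
    intro y hy
    have h1 := intervalIntegral_tendsto_integral (by simpa using hint 0 le_rfl)
      (tendsto_neg_atTop_atBot) (tendsto_id (α := ℝ) (x := atTop))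
    have h2 := intervalIntegral_tendsto_integral (hint y hy)
      (tendsto_neg_atTop_atBot) (tendsto_id (α := ℝ) (x := atTop))
    have h3 := h1.sub h2
    -- Cauchy's theorem on the rectangle with base [−R, R] and height y: the vertical sides
    -- contribute at most 2Cy/R².
    have key : Tendsto (fun R : ℝ => (∫ x in (-R)..R, G x) - ∫ x in (-R)..R, G (x + y * Complex.I))
        atTop (𝓝 0) := by
      refine squeeze_zero_norm' (a := fun R : ℝ => 2 * (C / R ^ 2 * y)) ?_ ?_
      · filter_upwards [eventually_gt_atTop 0] with R hR
        have hrect := Complex.integral_boundary_rect_eq_zero_of_differentiableOn G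
          ((-R : ℝ) : ℂ) (R + y * Complex.I) (fun z hz => (hG z (by
            have := hz.2
            simp only [Complex.ofReal_im, Complex.add_im, Complex.mul_im, Complex.ofReal_re,
              Complex.I_im, Complex.I_re, mul_one, mul_zero, add_zero, zero_add] at this
            rw [Set.uIcc_of_le hy] at this
            exact this.1)).differentiableWithinAt)
        simp only [Complex.ofReal_re, Complex.ofReal_im, Complex.add_re, Complex.mul_re,
          Complex.I_re, mul_zero, Complex.I_im, sub_zero, add_zero, Complex.add_im,
          Complex.mul_im, mul_one, zero_add, smul_eq_mul, Complex.ofReal_zero, zero_mul] at hrect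
        have hb : ∀ a : ℝ, R ≤ |a| → ‖∫ t in (0 : ℝ)..y, G (a + t * Complex.I)‖ ≤ C / R ^ 2 * y := by
          intro a ha
          have := intervalIntegral.norm_integral_le_of_norm_le_const (a := (0 : ℝ)) (b := y)
            (C := C / R ^ 2) (f := fun t : ℝ => G (a + t * Complex.I)) (fun t ht => by
              rw [Set.uIoc_of_le hy] at ht
              refine (hC _ (by simpa using ht.1.le)).trans ?_
              have : R ^ 2 ≤ ‖(a + t * Complex.I : ℂ)‖ ^ 2 := by
                rw [Complex.sq_norm, Complex.normSq_add_mul_I]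
                have := sq_le_sq' (by linarith [abs_nonneg a]) ha
                rw [sq_abs] at this
                nlinarith [sq_nonneg t]
              gcongr
              linarith)
          simpa [abs_of_nonneg hy] using this
        have e1 := hb R (le_abs_self R)
        have e2 := hb (-R) (by rw [abs_neg]; exact le_abs_self R)
        have : (∫ x in (-R)..R, G x) - ∫ x in (-R)..R, G (x + y * Complex.I) =
            Complex.I * (∫ t in (0 : ℝ)..y, G ((-R : ℝ) + t * Complex.I)) -
            Complex.I * ∫ t in (0 : ℝ)..y, G (R + t * Complex.I) := by
          linear_combination hrect
        rw [this]
        refine (norm_sub_le _ _).trans ?_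
        simp only [norm_mul, Complex.norm_I, one_mul]
        linarith
      · have : Tendsto (fun R : ℝ => 2 * (C * (R ^ 2)⁻¹ * y)) atTop (𝓝 (2 * (C * 0 * y))) :=
          (((tendsto_inv_atTop_zero.comp (tendsto_pow_atTop two_ne_zero)).const_mul C).mul_const
            y).const_mul 2
        simpa [div_eq_mul_inv] using this
    exact sub_eq_zero.1 (tendsto_nhds_unique (by simpa using h3) key)
  -- The integral over the line at height y does not depend on y. Letting y → ∞ shows that it is 0.
  have hlim : Tendsto (fun y : ℝ => ∫ x : ℝ, G (x + y * Complex.I)) atTop (𝓝 0) := by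
    have h0 : (0 : ℂ) = ∫ _ : ℝ, (0 : ℂ) := by simp
    rw [h0]
    refine tendsto_integral_filter_of_dominated_convergence (fun x : ℝ => C * (1 + x ^ 2)⁻¹)
      ?_ ?_ (integrable_inv_one_add_sq.const_mul C) ?_
    · filter_upwards [eventually_ge_atTop 0] with y hy using (hint y hy).aestronglyMeasurable
    · filter_upwards [eventually_ge_atTop 0] with y hy
      refine Eventually.of_forall fun x => (hC _ (by simpa using hy)).trans ?_
      rw [← div_eq_mul_inv]
      have : x ^ 2 ≤ ‖(x + y * Complex.I : ℂ)‖ ^ 2 := by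
        rw [Complex.sq_norm, Complex.normSq_add_mul_I]; nlinarith
      gcongr
    · refine Eventually.of_forall fun x => ?_
      refine squeeze_zero_norm' (a := fun y : ℝ => C * (y ^ 2)⁻¹) ?_ ?_
      · filter_upwards [eventually_gt_atTop 0] with y hy
        refine (hC _ (by simpa using hy.le)).trans ?_
        rw [← div_eq_mul_inv]
        have : y ^ 2 ≤ ‖(x + y * Complex.I : ℂ)‖ ^ 2 := by
          rw [Complex.sq_norm, Complex.normSq_add_mul_I]; nlinarith [sq_nonneg x]
        gcongr
        linarith
      · simpa using (tendsto_inv_atTop_zero.comp (tendsto_pow_atTop two_ne_zero)).const_mul C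
  have hc : Tendsto (fun y : ℝ => ∫ x : ℝ, G (x + y * Complex.I)) atTop (𝓝 (∫ x : ℝ, G x)) :=
    tendsto_const_nhds.congr' (by
      filter_upwards [eventually_ge_atTop 0] with y hy using hshift y hy)
  exact tendsto_nhds_unique hc hlim

/-- Phragmén–Lindelöf in the upper half-plane. -/
theorem norm_le_of_upper_half_plane {w : ℂ → ℂ} (hd : ∀ z : ℂ, 0 ≤ z.im → DifferentiableAt ℂ w z)
    {A B R : ℝ} (hg : ∀ z : ℂ, 0 ≤ z.im → R ≤ ‖z‖ → ‖w z‖ ≤ A * Real.exp (B * ‖z‖))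
    {D : ℝ} (hi : ∀ y : ℝ, R ≤ y → ‖w (y * Complex.I)‖ ≤ D)
    {C : ℝ} (hC : ∀ x : ℝ, ‖w x‖ ≤ C) {z : ℂ} (hz : 0 ≤ z.im) : ‖w z‖ ≤ C := by
  have hre : ∀ ζ : ℂ, (Complex.I * ζ).im = ζ.re := fun ζ => by simp
  -- After a quarter turn the imaginary half-axis becomes the positive real one. The bound along it
  -- is essential: e^{-iz} has growth of order one and modulus 1 on the real line.
  have := PhragmenLindelof.right_half_plane_of_bounded_on_real (f := fun ζ => w (Complex.I * ζ))
    (C := C) (z := -Complex.I * z) ?_ ?_ ?_ ?_ (by simpa using hz)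
  · simpa [← mul_assoc] using this
  · refine DifferentiableOn.diffContOnCl fun ζ hζ => ?_
    rw [Complex.closure_setOfPred_lt_re] at hζ
    refine DifferentiableAt.differentiableWithinAt ?_
    exact DifferentiableAt.comp (g := w) ζ (hd _ (by rw [hre]; exact hζ)) (by fun_prop)
  · refine ⟨1, by norm_num, B, Asymptotics.IsBigO.of_bound A ?_⟩
    rw [eventually_inf_principal]
    filter_upwards [(hasBasis_cobounded_norm).mem_of_mem (i := R) trivial] with ζ hζ hζ'
    have hn : ‖Complex.I * ζ‖ = ‖ζ‖ := by simp
    have := hg (Complex.I * ζ) (by rw [hre]; exact le_of_lt hζ') (by rw [hn]; exact hζ)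
    rw [hn] at this
    simpa using this
  · refine ⟨D, ?_⟩
    rw [eventually_map]
    filter_upwards [eventually_ge_atTop R] with x hx
    have := hi x hx
    rwa [mul_comm] at this
  · intro x
    have : Complex.I * (x * Complex.I) = ((-x : ℝ) : ℂ) := by
      push_cast; linear_combination (x : ℂ) * Complex.I_mul_I
    rw [this]
    exact hC _


/-- From |z| ≤ |z − a| + |a|. It turns a mere distance from the pole into decay at infinity with an
explicit constant. -/
theorem norm_inv_sub_le {a z : ℂ} {d : ℝ} (hd : 0 < d) (h : d ≤ ‖z - a‖) :
    ‖(z - a)⁻¹‖ ≤ ((1 + ‖a‖) / d + 1) / (1 + ‖z‖) := by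
  have hz : 0 < ‖z - a‖ := hd.trans_le h
  rw [norm_inv, inv_eq_one_div, div_le_div_iff₀ hz (by positivity)]
  have h1 : ‖z‖ ≤ ‖z - a‖ + ‖a‖ := by simpa using norm_add_le (z - a) a
  have h2 : 1 + ‖a‖ ≤ (1 + ‖a‖) / d * ‖z - a‖ := by
    rw [div_mul_eq_mul_div, le_div_iff₀ hd]
    have : 0 ≤ ‖a‖ := norm_nonneg a
    nlinarith
  nlinarith

theorem continuous_inv_ofReal_sub {a : ℂ} (ha : a.im ≠ 0) :
    Continuous fun x : ℝ => ((x : ℂ) - a)⁻¹ := by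
  refine Continuous.inv₀ (by fun_prop) fun x h => ha ?_
  have := congrArg Complex.im h
  simpa using this

/-! ### Decay of the potential and the turning points -/

namespace RationalPotential

variable {P : ℕ} (u : RationalPotential P)

/-- The rational function `u₀` on the complex plane. -/
def uC (z : ℂ) : ℂ := ∑ p, (u.c p / (z - u.z p) + star (u.c p) / (z - star (u.z p)))

theorem uC_ofReal (x : ℝ) : u.uC x = u.u₀ x := by
  have : ∀ p, star (u.c p) / ((x : ℂ) - star (u.z p)) =
      (starRingEnd ℂ) (u.c p / ((x : ℂ) - u.z p)) := fun p => by
    simp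
  simp only [uC, u₀, this, Complex.add_conj, Complex.re_sum, Finset.mul_sum]
  push_cast
  rfl

theorem continuous_u₀ : Continuous u.u₀ := by
  unfold u₀
  refine continuous_const.mul (Complex.continuous_re.comp ?_)
  refine continuous_finsetSum _ fun p _ => ?_
  simp only [div_eq_mul_inv]
  exact continuous_const.mul (continuous_inv_ofReal_sub (u.z_im_pos p).ne')

theorem exists_dist_real_pos : ∃ d : ℝ, 0 < d ∧ ∀ p, d ≤ (u.z p).im := by
  rcases isEmpty_or_nonempty (Fin P) with h | h
  · exact ⟨1, one_pos, fun p => h.elim p⟩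
  · obtain ⟨p, hp⟩ := Finite.exists_min fun p => (u.z p).im
    exact ⟨_, u.z_im_pos p, hp⟩

/-- Distance at least `d` from all poles of `u₀` and their conjugates. -/
def Away (d : ℝ) (z : ℂ) : Prop := ∀ p, d ≤ ‖z - u.z p‖ ∧ d ≤ ‖z - star (u.z p)‖

theorem exists_away_real : ∃ d : ℝ, 0 < d ∧ ∀ x : ℝ, u.Away d x := by
  obtain ⟨d, hd, h⟩ := u.exists_dist_real_pos
  refine ⟨d, hd, fun x p => ⟨?_, ?_⟩⟩
  · refine (h p).trans ((le_abs_self _).trans ?_)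
    have := Complex.abs_im_le_norm ((x : ℂ) - u.z p)
    simpa using this
  · refine (h p).trans ((le_abs_self _).trans ?_)
    have := Complex.abs_im_le_norm ((x : ℂ) - star (u.z p))
    simpa using this

/-- Each term is z/(z − a) = 1 + a/(z − a). The subtracted constant is the coefficient of 1/z in the
expansion of the potential at infinity. -/
theorem mul_uC_sub (z : ℂ) (hz : ∀ p, z ≠ u.z p ∧ z ≠ star (u.z p)) :
    z * u.uC z - 2 * (∑ p, u.c p).re =
      ∑ p, (u.c p * u.z p * (z - u.z p)⁻¹ +
        star (u.c p) * star (u.z p) * (z - star (u.z p))⁻¹) := by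
  have h2 : (2 * (∑ p, u.c p).re : ℂ) = ∑ p, (u.c p + star (u.c p)) := by
    have : ∀ p, u.c p + star (u.c p) = ((2 * (u.c p).re : ℝ) : ℂ) := fun p =>
      Complex.add_conj (u.c p)
    simp only [this, ← Complex.ofReal_sum, ← Finset.mul_sum, ← Complex.re_sum]
    push_cast; rfl
  rw [h2, uC, Finset.mul_sum, ← Finset.sum_sub_distrib]
  refine Finset.sum_congr rfl fun p _ => ?_
  have h1 := sub_ne_zero.2 (hz p).1
  have h3 := sub_ne_zero.2 (hz p).2
  field_simp
  ring

theorem exists_bound_mul_uC {d : ℝ} (hd : 0 < d) : ∃ C, 0 ≤ C ∧ ∀ z, u.Away d z →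
    ‖u.uC z‖ ≤ C / (1 + ‖z‖) ∧ ‖z * u.uC z - 2 * (∑ p, u.c p).re‖ ≤ C / (1 + ‖z‖) := by
  set K : Fin P → ℝ := fun p => (1 + ‖u.z p‖) / d + 1
  have hK : ∀ p, 0 ≤ K p := fun p => by positivity
  refine ⟨∑ p, (‖u.c p‖ * (1 + ‖u.z p‖) * K p + ‖u.c p‖ * (1 + ‖u.z p‖) * K p),
    Finset.sum_nonneg fun p _ => by have := hK p; positivity, fun z hz => ?_⟩
  have hb : ∀ p, ‖(z - u.z p)⁻¹‖ ≤ K p / (1 + ‖z‖) := fun p => norm_inv_sub_le hd (hz p).1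
  have hb' : ∀ p, ‖(z - star (u.z p))⁻¹‖ ≤ K p / (1 + ‖z‖) := fun p => by
    have := norm_inv_sub_le hd (hz p).2
    rwa [norm_star] at this
  have hne : ∀ p, z ≠ u.z p ∧ z ≠ star (u.z p) := fun p => by
    constructor <;> intro h
    · have := (hz p).1; rw [h, sub_self, norm_zero] at this; linarith
    · have := (hz p).2; rw [h, sub_self, norm_zero] at this; linarith
  rw [Finset.sum_div]
  constructor
  · refine norm_sum_le_of_le _ fun p _ => ?_
    refine (norm_add_le _ _).trans ?_
    rw [div_eq_mul_inv, div_eq_mul_inv, norm_mul, norm_mul, norm_star, add_div]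
    have e : ‖u.c p‖ * (K p / (1 + ‖z‖)) ≤ ‖u.c p‖ * (1 + ‖u.z p‖) * K p / (1 + ‖z‖) := by
      rw [← mul_div_assoc]
      gcongr
      have := hK p
      exact le_mul_of_one_le_right (norm_nonneg _) (by linarith [norm_nonneg (u.z p)])
    exact add_le_add ((mul_le_mul_of_nonneg_left (hb p) (norm_nonneg _)).trans e)
      ((mul_le_mul_of_nonneg_left (hb' p) (norm_nonneg _)).trans e)
  · rw [u.mul_uC_sub z hne]
    refine norm_sum_le_of_le _ fun p _ => ?_
    refine (norm_add_le _ _).trans ?_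
    simp only [norm_mul, norm_star]
    rw [add_div]
    have e : ‖u.c p‖ * ‖u.z p‖ * (K p / (1 + ‖z‖)) ≤
        ‖u.c p‖ * (1 + ‖u.z p‖) * K p / (1 + ‖z‖) := by
      rw [← mul_div_assoc]
      have := hK p
      gcongr
      linarith
    exact add_le_add ((mul_le_mul_of_nonneg_left (hb p) (by positivity)).trans e)
      ((mul_le_mul_of_nonneg_left (hb' p) (by positivity)).trans e)

/-- With s = Re Σ c_p the potential differs from 2s/x by an O(1/x²) term on (1, ∞). Integrability of
u₀ would make s/x integrable there, which forces s = 0. -/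
theorem re_sum_c : (∑ p, u.c p).re = 0 := by
  by_contra hne
  obtain ⟨d, hd, haw⟩ := u.exists_away_real
  obtain ⟨C, hC, h⟩ := u.exists_bound_mul_uC hd
  set s := (∑ p, u.c p).re
  have h1 : IntegrableOn u.u₀ (Set.Ioi 1) := u.integrable.integrableOn
  have h2 : IntegrableOn (fun x : ℝ => u.u₀ x - 2 * s * x⁻¹) (Set.Ioi 1) := by
    refine Integrable.mono' (g := fun x : ℝ => C * 2 * (1 + x ^ 2)⁻¹)
      (integrable_inv_one_add_sq.const_mul _).integrableOn ?_ ?_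
    · refine ContinuousOn.aestronglyMeasurable ?_ measurableSet_Ioi
      refine u.continuous_u₀.continuousOn.sub (continuousOn_const.mul
        (continuousOn_inv₀.mono fun x hx => ?_))
      simp only [Set.mem_Ioi] at hx
      simp only [Set.mem_compl_iff, Set.mem_singleton_iff]; linarith
    · refine (ae_restrict_iff' measurableSet_Ioi).2 (Eventually.of_forall fun x hx => ?_)
      simp only [Set.mem_Ioi] at hx
      have hb := (h x (haw x)).2
      rw [u.uC_ofReal] at hb
      have e : ((x : ℂ) * u.u₀ x - 2 * s) = ((x * u.u₀ x - 2 * s : ℝ) : ℂ) := by push_cast; ring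
      rw [e, Complex.norm_real, Complex.norm_real, Real.norm_eq_abs, Real.norm_eq_abs,
        abs_of_pos (by linarith : 0 < x)] at hb
      have e2 : u.u₀ x - 2 * s * x⁻¹ = (x * u.u₀ x - 2 * s) * x⁻¹ := by
        field_simp
      rw [e2, Real.norm_eq_abs, abs_mul, abs_of_pos (by positivity : 0 < x⁻¹)]
      calc |x * u.u₀ x - 2 * s| * x⁻¹ ≤ C / (1 + x) * x⁻¹ := by gcongr
        _ ≤ C * 2 * (1 + x ^ 2)⁻¹ := by
          rw [← div_eq_mul_inv, ← div_eq_mul_inv, div_div, div_le_div_iff₀ (by positivity)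
            (by positivity)]
          have : 1 + x ^ 2 ≤ 2 * ((1 + x) * x) := by nlinarith
          nlinarith
  have h3 := h1.sub h2
  have h4 : IntegrableOn (fun x : ℝ => x⁻¹) (Set.Ioi 1) := by
    have := h3.const_mul (2 * s)⁻¹
    refine this.congr (Eventually.of_forall fun x => ?_)
    simp only [Pi.sub_apply]
    field_simp
    ring
  exact not_integrableOn_Ioi_inv h4

/-- The coefficient of 1/z at infinity vanishes, so the decay improves from first to second order.
All integrability statements below rest on this. -/
theorem exists_bound_uC {d : ℝ} (hd : 0 < d) : ∃ C, 0 ≤ C ∧ ∀ z, u.Away d z →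
    ‖u.uC z‖ ≤ C / (1 + ‖z‖ ^ 2) := by
  obtain ⟨C, hC, h⟩ := u.exists_bound_mul_uC hd
  refine ⟨2 * C, by positivity, fun z hz => ?_⟩
  obtain ⟨h1, h2⟩ := h z hz
  rw [u.re_sum_c] at h2
  simp only [Complex.ofReal_zero, mul_zero, sub_zero, norm_mul] at h2
  have h0 : 0 ≤ ‖z‖ := norm_nonneg z
  rw [le_div_iff₀ (by positivity)] at h1 h2 ⊢
  have := norm_nonneg (u.uC z)
  nlinarith [mul_nonneg this h0]

theorem tendsto_u₀ {l : Filter ℝ} (hl : Tendsto (fun x : ℝ => |x|) l atTop) :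
    Tendsto u.u₀ l (𝓝 0) := by
  obtain ⟨d, hd, haw⟩ := u.exists_away_real
  obtain ⟨C, hC, h⟩ := u.exists_bound_mul_uC hd
  have : Tendsto (fun x : ℝ => C / (1 + |x|)) l (𝓝 0) :=
    tendsto_const_nhds.div_atTop (tendsto_atTop_add_const_left _ 1 hl)
  refine squeeze_zero_norm (fun x => ?_) this
  have := (h x (haw x)).1
  rw [uC_ofReal, Complex.norm_real, Complex.norm_real] at this
  simpa using this

theorem tendsto_u₀_atTop : Tendsto u.u₀ atTop (𝓝 0) := u.tendsto_u₀ tendsto_abs_atTop_atTop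

theorem tendsto_u₀_atBot : Tendsto u.u₀ atBot (𝓝 0) := u.tendsto_u₀ tendsto_abs_atBot_atTop

/-- The two turning points, with the sign of `λ + u₀` off them. -/
structure TurningPoints (lam xm xp : ℝ) : Prop where
  lam_pos : 0 < lam
  lt : xm < xp
  eq_left : lam + u.u₀ xm = 0
  eq_right : lam + u.u₀ xp = 0
  pos_left : ∀ x < xm, 0 < lam + u.u₀ x
  neg_mid : ∀ x, xm < x → x < xp → lam + u.u₀ x < 0
  pos_right : ∀ x, xp < x → 0 < lam + u.u₀ x
  anti_left : ∀ a < xm, ∀ x ≤ a, u.u₀ a ≤ u.u₀ x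

variable {u} in
-- A negative function tending to 0 at both ends can only decrease before x_c and increase after it.
-- So x_c is the strict global minimum, and the intermediate value theorem gives one crossing of the
-- level −λ on each side.
theorem exists_turningPoints (hKS : u.IsKlausShaw) (hneg : ∀ x, u.u₀ x < 0) {lam : ℝ}
    (hlam : lam ∈ u.bulk) : ∃ xm xp, u.TurningPoints lam xm xp := by
  obtain ⟨xc, hL, hR⟩ := hKS
  have hL' : StrictAntiOn u.u₀ (Set.Iio xc) := by
    refine hL.resolve_left fun hm => ?_
    have : (0 : ℝ) ≤ u.u₀ (xc - 1) := by
      refine le_of_tendsto u.tendsto_u₀_atBot ?_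
      filter_upwards [eventually_lt_atBot (xc - 1)] with y hy
      exact (hm (by simp only [Set.mem_Iio]; linarith) (by simp) hy).le
    exact absurd (hneg (xc - 1)) (not_lt.2 this)
  have hR' : StrictMonoOn u.u₀ (Set.Ioi xc) := by
    refine hR.resolve_right fun hm => ?_
    have : (0 : ℝ) ≤ u.u₀ (xc + 1) := by
      refine le_of_tendsto u.tendsto_u₀_atTop ?_
      filter_upwards [eventually_gt_atTop (xc + 1)] with y hy
      exact (hm (by simp) (by simp only [Set.mem_Ioi]; linarith) hy).le
    exact absurd (hneg (xc + 1)) (not_lt.2 this)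
  -- Monotonicity is assumed on open half-lines only. Continuity extends it to x_c, and the midpoint
  -- keeps the inequality strict.
  have hcl : ∀ x < xc, u.u₀ xc < u.u₀ x := by
    intro x hx
    have h1 : u.u₀ xc ≤ u.u₀ ((x + xc) / 2) := by
      refine le_of_tendsto (u.continuous_u₀.continuousWithinAt (s := Set.Iio xc) (x := xc)) ?_
      have : Set.Ioi ((x + xc) / 2) ∈ 𝓝 xc := Ioi_mem_nhds (by linarith)
      filter_upwards [self_mem_nhdsWithin, mem_nhdsWithin_of_mem_nhds this] with y hy hy'
      exact (hL' (by simp only [Set.mem_Iio]; linarith) hy hy').le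
    exact h1.trans_lt (hL' hx (by simp only [Set.mem_Iio]; linarith) (by linarith))
  have hcr : ∀ x > xc, u.u₀ xc < u.u₀ x := by
    intro x hx
    have h1 : u.u₀ xc ≤ u.u₀ ((x + xc) / 2) := by
      refine le_of_tendsto (u.continuous_u₀.continuousWithinAt (s := Set.Ioi xc) (x := xc)) ?_
      have : Set.Iio ((x + xc) / 2) ∈ 𝓝 xc := Iio_mem_nhds (by linarith)
      filter_upwards [self_mem_nhdsWithin, mem_nhdsWithin_of_mem_nhds this] with y hy hy'
      exact (hR' hy (by simp only [Set.mem_Ioi]; linarith) hy').le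
    exact h1.trans_lt (hR' (by simp only [Set.mem_Ioi]; linarith) hx (by linarith))
  have hpos : 0 < lam := by
    have : (⨆ x, u.u₀ x) ≤ 0 := ciSup_le fun x => (hneg x).le
    linarith [hlam.1]
  have hmin : u.u₀ xc < -lam := by
    obtain ⟨x, hx⟩ := exists_lt_of_ciInf_lt (show (⨅ x, u.u₀ x) < -lam by linarith [hlam.2])
    rcases lt_trichotomy x xc with h | h | h
    · exact (hcl x h).trans hx
    · exact h ▸ hx
    · exact (hcr x h).trans hx
  obtain ⟨a, ha, hac⟩ : ∃ a, -lam < u.u₀ a ∧ a < xc :=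
    (((u.tendsto_u₀_atBot.eventually_const_lt (by linarith : -lam < 0)).and
      (eventually_lt_atBot xc))).exists
  obtain ⟨b, hb, hbc⟩ : ∃ b, -lam < u.u₀ b ∧ xc < b :=
    (((u.tendsto_u₀_atTop.eventually_const_lt (by linarith : -lam < 0)).and
      (eventually_gt_atTop xc))).exists
  obtain ⟨xm, hxm, hm⟩ := intermediate_value_Ioo' hac.le u.continuous_u₀.continuousOn ⟨hmin, ha⟩
  obtain ⟨xp, hxp, hp⟩ := intermediate_value_Ioo hbc.le u.continuous_u₀.continuousOn ⟨hmin, hb⟩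
  refine ⟨xm, xp, hpos, hxm.2.trans hxp.1, by linarith, by linarith, ?_, ?_, ?_, ?_⟩
  · intro x hx
    have := hL' (hx.trans hxm.2) hxm.2 hx
    linarith
  · intro x h1 h2
    rcases lt_trichotomy x xc with h | h | h
    · have := hL' hxm.2 h h1; linarith
    · rw [h]; linarith
    · have := hR' h hxp.1 h2; linarith
  · intro x hx
    have := hR' hxp.1 (hxp.1.trans hx) hx
    linarith
  · intro a' ha' x hx
    rcases hx.eq_or_lt with h | h
    · rw [h]
    · exact (hL' (h.trans (ha'.trans hxm.2)) (ha'.trans hxm.2) h).le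

variable {u} in
theorem TurningPoints.setOf_eq {lam xm xp : ℝ} (h : u.TurningPoints lam xm xp) :
    {x : ℝ | u.u₀ x = -lam} = {xm, xp} := by
  ext x
  simp only [Set.mem_ofPred_eq, Set.mem_insert_iff, Set.mem_singleton_iff]
  constructor
  · intro hx
    rcases lt_trichotomy x xm with h1 | h1 | h1
    · linarith [h.pos_left x h1]
    · exact Or.inl h1
    · rcases lt_trichotomy x xp with h2 | h2 | h2
      · linarith [h.neg_mid x h1 h2]
      · exact Or.inr h2
      · linarith [h.pos_right x h2]
  · rintro (rfl | rfl)
    · linarith [h.eq_left]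
    · linarith [h.eq_right]

end RationalPotential


/-! ### Comparison estimates along lines, and the Jost equation on the real axis -/

theorem hasDerivAt_comp_line {w : ℂ → ℂ} {w' a b : ℂ} {t : ℝ} (h : HasDerivAt w w' (a + t * b)) :
    HasDerivAt (fun t : ℝ => w (a + t * b)) (b * w') t := by
  have h1 : HasDerivAt (fun s : ℂ => a + s * b) b (t : ℂ) := by
    simpa using ((hasDerivAt_id (t : ℂ)).mul_const b).const_add a
  have := (HasDerivAt.comp (t : ℂ) h h1).comp_ofReal
  rwa [mul_comm] at this

/-- Comparison with D arctan, whose derivative is the majorant D/(1 + x²). -/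
theorem norm_sub_le_arctan {E E' : ℝ → ℂ} {b D : ℝ} (hE : ∀ x ≤ b, HasDerivAt E (E' x) x)
    (hD : ∀ x ≤ b, ‖E' x‖ ≤ D * (1 + x ^ 2)⁻¹) {a : ℝ} (hab : a ≤ b) :
    ‖E b - E a‖ ≤ D * (Real.arctan b - Real.arctan a) := by
  have := image_norm_le_of_norm_deriv_right_le_deriv_boundary (a := a) (b := b)
    (f := fun x => E x - E a) (f' := E') (B := fun x => D * (Real.arctan x - Real.arctan a))
    (B' := fun x => D * (1 + x ^ 2)⁻¹)
    (fun x hx => ((hE x hx.2).sub_const _).continuousAt.continuousWithinAt)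
    (fun x hx => ((hE x hx.2.le).sub_const _).hasDerivWithinAt) (by simp)
    (fun x => by
      have := ((Real.hasDerivAt_arctan x).sub_const (Real.arctan a)).const_mul D
      simpa using this)
    (fun x hx => hD x hx.2.le) ⟨hab, le_rfl⟩
  exact this

/-- The starting point is sent to −∞; π is the total variation of arctan. -/
theorem norm_le_of_tendsto_atBot {E E' : ℝ → ℂ} {b D : ℝ} (hD0 : 0 ≤ D)
    (hE : ∀ x ≤ b, HasDerivAt E (E' x) x) (hD : ∀ x ≤ b, ‖E' x‖ ≤ D * (1 + x ^ 2)⁻¹)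
    (hlim : Tendsto E atBot (𝓝 0)) : ‖E b‖ ≤ D * Real.pi := by
  have h1 : Tendsto (fun a => ‖E b - E a‖) atBot (𝓝 ‖E b - 0‖) := (hlim.const_sub _).norm
  rw [sub_zero] at h1
  refine le_of_tendsto h1 ?_
  filter_upwards [eventually_le_atBot b] with a ha
  refine (norm_sub_le_arctan hE hD ha).trans (mul_le_mul_of_nonneg_left ?_ hD0)
  linarith [Real.arctan_lt_pi_div_two b, Real.neg_pi_div_two_lt_arctan a]

/-- Grönwall for a linear differential inequality with equal constants. -/
theorem norm_le_of_norm_deriv_le {g g' : ℝ → ℂ} {K T δ : ℝ} (hK : 0 < K)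
    (hg : ∀ t ∈ Set.Icc 0 T, HasDerivAt g (g' t) t) (h0 : ‖g 0‖ ≤ δ)
    (hb : ∀ t ∈ Set.Icc 0 T, ‖g' t‖ ≤ K * (‖g t‖ + 1)) {t : ℝ} (ht : t ∈ Set.Icc 0 T) :
    ‖g t‖ ≤ (δ + 1) * Real.exp (K * t) := by
  have := norm_le_gronwallBound_of_norm_deriv_right_le (f := g) (f' := g') (δ := δ) (K := K)
    (ε := K) (a := 0) (b := T)
    (fun x hx => (hg x hx).continuousAt.continuousWithinAt)
    (fun x hx => (hg x ⟨hx.1, hx.2.le⟩).hasDerivWithinAt) h0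
    (fun x hx => (hb x ⟨hx.1, hx.2.le⟩).trans (by linarith)) t ht
  refine this.trans ?_
  rw [gronwallBound_of_K_ne_0 hK.ne', div_self hK.ne']
  simp only [sub_zero]
  linarith

namespace RationalPotential

variable {P : ℕ} (u : RationalPotential P)

/-- The right-hand side `κ λ + ∑ₚ vₚ / (z - zₚ)` of the Jost equation. -/
def q (lam : ℝ) (κ : ℂ) (v : Fin P → ℂ) (z : ℂ) : ℂ := κ * lam + ∑ p, v p / (z - u.z p)

/-- The derivative of `q`. -/
def q' (v : Fin P → ℂ) (z : ℂ) : ℂ := -∑ p, v p / (z - u.z p) ^ 2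

/-- The derivative of `uC`. -/
def uC' (z : ℂ) : ℂ :=
  -∑ p, (u.c p / (z - u.z p) ^ 2 + star (u.c p) / (z - star (u.z p)) ^ 2)

/-- The size of the data `(κ, v)`. -/
def size (κ : ℂ) (v : Fin P → ℂ) : ℝ := ‖κ‖ + ∑ p, ‖v p‖

theorem size_nonneg (κ : ℂ) (v : Fin P → ℂ) : 0 ≤ size κ v := by
  unfold size; positivity

theorem norm_le_size (κ : ℂ) (v : Fin P → ℂ) : ‖κ‖ ≤ size κ v :=
  le_add_of_nonneg_right (by positivity)

theorem norm_apply_le_size (κ : ℂ) (v : Fin P → ℂ) (p : Fin P) : ‖v p‖ ≤ size κ v :=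
  (Finset.single_le_sum (f := fun p => ‖v p‖) (fun _ _ => norm_nonneg _)
    (Finset.mem_univ p)).trans (le_add_of_nonneg_left (norm_nonneg _))

theorem hasDerivAt_div_sub (c a z : ℂ) (h : z ≠ a) :
    HasDerivAt (fun z => c / (z - a)) (-(c / (z - a) ^ 2)) z := by
  have h0 := sub_ne_zero.2 h
  have := (((hasDerivAt_id z).sub_const a).inv h0).const_mul c
  refine this.congr_deriv ?_
  simp only [id]
  ring

theorem hasDerivAt_q (lam : ℝ) (κ : ℂ) (v : Fin P → ℂ) {z : ℂ} (hz : ∀ p, z ≠ u.z p) :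
    HasDerivAt (u.q lam κ v) (u.q' v z) z := by
  have := (HasDerivAt.fun_sum (u := Finset.univ)
    fun p _ => hasDerivAt_div_sub (v p) (u.z p) z (hz p)).const_add (κ * lam)
  refine this.congr_deriv ?_
  simp [q']

theorem hasDerivAt_uC {z : ℂ} (hz : ∀ p, z ≠ u.z p ∧ z ≠ star (u.z p)) :
    HasDerivAt u.uC (u.uC' z) z := by
  have := HasDerivAt.fun_sum (u := Finset.univ)
    fun p _ => (hasDerivAt_div_sub (u.c p) (u.z p) z (hz p).1).add
      (hasDerivAt_div_sub (star (u.c p)) (star (u.z p)) z (hz p).2)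
  refine this.congr_deriv ?_
  simp only [uC', ← Finset.sum_neg_distrib]
  exact Finset.sum_congr rfl fun p _ => by ring

variable {u} in
theorem Away.ne {d : ℝ} (hd : 0 < d) {z : ℂ} (h : u.Away d z) (p : Fin P) :
    z ≠ u.z p ∧ z ≠ star (u.z p) := by
  constructor <;> intro e
  · have := (h p).1; rw [e, sub_self, norm_zero] at this; linarith
  · have := (h p).2; rw [e, sub_self, norm_zero] at this; linarith

theorem ofReal_ne (x : ℝ) (p : Fin P) : (x : ℂ) ≠ u.z p ∧ (x : ℂ) ≠ star (u.z p) := by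
  obtain ⟨d, hd, h⟩ := u.exists_away_real
  exact (h x).ne hd p

theorem norm_sq_inv_le {a z : ℂ} {d K : ℝ} (hd : 0 < d) (h : d ≤ ‖z - a‖)
    (hK : (1 + ‖a‖) / d + 1 ≤ K) : ‖((z - a) ^ 2)⁻¹‖ ≤ K ^ 2 / (1 + ‖z‖ ^ 2) := by
  have h1 := norm_inv_sub_le hd h
  have h0 : 0 ≤ ‖z‖ := norm_nonneg z
  have hK0 : 0 ≤ (1 + ‖a‖) / d + 1 := by positivity
  rw [← inv_pow, norm_pow]
  calc ‖(z - a)⁻¹‖ ^ 2 ≤ (K / (1 + ‖z‖)) ^ 2 := by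
        gcongr
        exact h1.trans (by gcongr)
    _ = K ^ 2 / (1 + ‖z‖) ^ 2 := by rw [div_pow]
    _ ≤ K ^ 2 / (1 + ‖z‖ ^ 2) := by gcongr; nlinarith

/-- The constant depends only on d and λ. By linearity in (κ, v), every later estimate is
proportional to `size κ v` and uniform in ε. -/
theorem exists_bound_q {d : ℝ} (hd : 0 < d) (lam : ℝ) : ∃ C, 0 ≤ C ∧ ∀ (κ : ℂ) (v : Fin P → ℂ) z,
    (∀ p, d ≤ ‖z - u.z p‖) → ‖u.q lam κ v z‖ ≤ C * size κ v ∧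
      ‖u.q' v z‖ ≤ C * size κ v / (1 + ‖z‖ ^ 2) := by
  set K : ℝ := ∑ p, ((1 + ‖u.z p‖) / d + 1)
  have hKp : ∀ p, (1 + ‖u.z p‖) / d + 1 ≤ K := fun p =>
    Finset.single_le_sum (f := fun p => (1 + ‖u.z p‖) / d + 1) (fun _ _ => by positivity)
      (Finset.mem_univ p)
  refine ⟨|lam| + d⁻¹ + K ^ 2, by positivity, fun κ v z hz => ⟨?_, ?_⟩⟩
  · have h1 : ‖u.q lam κ v z‖ ≤ ‖κ‖ * |lam| + ∑ p, ‖v p‖ * d⁻¹ := by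
      refine (norm_add_le _ _).trans (add_le_add ?_ (norm_sum_le_of_le _ fun p _ => ?_))
      · rw [norm_mul, Complex.norm_real, Real.norm_eq_abs]
      · rw [norm_div, div_eq_mul_inv]
        gcongr
        exact hz p
    refine h1.trans ?_
    rw [← Finset.sum_mul]
    unfold size
    have a1 : 0 ≤ ‖κ‖ := norm_nonneg _
    have a2 : 0 ≤ ∑ p, ‖v p‖ := by positivity
    have a3 : 0 ≤ d⁻¹ := by positivity
    nlinarith [mul_nonneg a1 a3, mul_nonneg a2 (abs_nonneg lam), mul_nonneg a1 (sq_nonneg K),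
      mul_nonneg a2 (sq_nonneg K)]
  · have h1 : ‖u.q' v z‖ ≤ ∑ p, ‖v p‖ * (K ^ 2 / (1 + ‖z‖ ^ 2)) := by
      rw [q', norm_neg]
      refine norm_sum_le_of_le _ fun p _ => ?_
      rw [div_eq_mul_inv, norm_mul]
      gcongr
      exact norm_sq_inv_le hd (hz p) (hKp p)
    refine h1.trans ?_
    rw [← Finset.sum_mul, mul_div_assoc', div_le_div_iff_of_pos_right (by positivity)]
    unfold size
    have a1 : 0 ≤ ‖κ‖ := norm_nonneg _
    have a2 : 0 ≤ ∑ p, ‖v p‖ := by positivity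
    have a3 : 0 ≤ |lam| + d⁻¹ := by positivity
    nlinarith [mul_nonneg a1 a3, mul_nonneg a2 a3, mul_nonneg a1 (sq_nonneg K)]

theorem exists_bound_uC' {d : ℝ} (hd : 0 < d) : ∃ C, 0 ≤ C ∧ ∀ z, u.Away d z →
    ‖u.uC' z‖ ≤ C / (1 + ‖z‖ ^ 2) := by
  set K : Fin P → ℝ := fun p => (1 + ‖u.z p‖) / d + 1
  refine ⟨∑ p, (‖u.c p‖ * K p ^ 2 + ‖u.c p‖ * K p ^ 2), by positivity, fun z hz => ?_⟩
  rw [uC', norm_neg, Finset.sum_div]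
  refine norm_sum_le_of_le _ fun p _ => ?_
  refine (norm_add_le _ _).trans ?_
  rw [div_eq_mul_inv, div_eq_mul_inv, norm_mul, norm_mul, norm_star, add_div, mul_div_assoc]
  refine add_le_add ?_ ?_
  · gcongr
    exact norm_sq_inv_le hd (hz p).1 le_rfl
  · gcongr
    exact norm_sq_inv_le hd (hz p).2 (by rw [norm_star])

/-- A Jost function: holomorphic in the closed upper half-plane, solving
`iε w' + (λ + u₀) w = κ λ + ∑ₚ vₚ / (z - zₚ)`, with limit `κ` at `-∞`. -/
structure IsJost (ε lam : ℝ) (κ : ℂ) (v : Fin P → ℂ) (w : ℂ → ℂ) : Prop where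
  diff : ∀ z : ℂ, 0 ≤ z.im → DifferentiableAt ℂ w z
  ode : ∀ z : ℂ, 0 ≤ z.im → (∀ p, z ≠ u.z p) →
    Complex.I * ε * deriv w z + (lam + u.uC z) * w z = u.q lam κ v z
  lim : Tendsto (fun x : ℝ => w x) atBot (𝓝 κ)

/-- The real phase on the real line. -/
def phase (lam : ℝ) (x : ℝ) : ℝ := ∫ t in (0 : ℝ)..x, (lam + u.u₀ t)

/-- The oscillating factor `e^{-ih/ε}` on the real line. -/
def osc (ε lam : ℝ) (x : ℝ) : ℂ := Complex.exp (-Complex.I * (u.phase lam x : ℝ) / ε)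

theorem norm_osc (ε lam x : ℝ) : ‖u.osc ε lam x‖ = 1 := by
  have : -Complex.I * (u.phase lam x : ℝ) / ε = ((-(u.phase lam x / ε) : ℝ) : ℂ) * Complex.I := by
    push_cast; ring
  rw [osc, this, Complex.norm_exp_ofReal_mul_I]

theorem hasDerivAt_osc (ε lam x : ℝ) : HasDerivAt (u.osc ε lam)
    (u.osc ε lam x * (-Complex.I / ε * (lam + u.uC x))) x := by
  have hc : Continuous fun t => lam + u.u₀ t := continuous_const.add u.continuous_u₀
  have h1 : HasDerivAt (u.phase lam) (lam + u.u₀ x) x :=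
    intervalIntegral.integral_hasDerivAt_right (hc.intervalIntegrable _ _)
      (hc.stronglyMeasurableAtFilter _ _) hc.continuousAt
  have h2 := ((h1.ofReal_comp.const_mul (-Complex.I)).div_const (ε : ℂ)).cexp
  refine h2.congr_deriv ?_
  rw [uC_ofReal, osc]
  push_cast
  ring

/-- The factor `osc` is an integrating factor of the Jost operator, and it is unimodular on the real
line. An estimate of a right-hand side is therefore an estimate of the solution. -/
theorem hasDerivAt_osc_mul {ε lam x : ℝ} (hε : ε ≠ 0) {g : ℝ → ℂ} {g' r : ℂ}
    (hg : HasDerivAt g g' x) (h : Complex.I * ε * g' + (lam + u.uC x) * g x = r) :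
    HasDerivAt (fun x => u.osc ε lam x * g x) (u.osc ε lam x * (r / (Complex.I * ε))) x := by
  have hε' : (ε : ℂ) ≠ 0 := by exact_mod_cast hε
  refine ((u.hasDerivAt_osc ε lam x).mul hg).congr_deriv ?_
  rw [← h]
  have : Complex.I * Complex.I = -1 := Complex.I_mul_I
  field_simp
  linear_combination (u.osc ε lam x * g x * (lam + u.uC x)) * (-1 : ℂ) * (Complex.I_sq)

theorem tendsto_q_atBot (lam : ℝ) (κ : ℂ) (v : Fin P → ℂ) :
    Tendsto (fun x : ℝ => u.q lam κ v x) atBot (𝓝 (κ * lam)) := by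
  have : Tendsto (fun x : ℝ => κ * lam + ∑ p, v p / ((x : ℂ) - u.z p)) atBot
      (𝓝 (κ * lam + ∑ _p : Fin P, 0)) := by
    refine tendsto_const_nhds.add (tendsto_finsetSum _ fun p _ => ?_)
    have h : Tendsto (fun x : ℝ => ‖(x : ℂ) - u.z p‖) atBot atTop := by
      refine tendsto_atTop_mono (fun x => ?_)
        (tendsto_atTop_add_const_right _ (-‖u.z p‖) tendsto_abs_atBot_atTop)
      have := norm_sub_norm_le (x : ℂ) (u.z p)
      rw [Complex.norm_real, Real.norm_eq_abs] at this
      linarith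
    refine tendsto_zero_iff_norm_tendsto_zero.2 ?_
    simp only [norm_div]
    exact tendsto_const_nhds.div_atTop h
  simpa [q] using this

variable {u}

namespace IsJost

variable {ε lam : ℝ} {κ : ℂ} {v : Fin P → ℂ} {w : ℂ → ℂ}

theorem hasDerivAt_ofReal (hw : u.IsJost ε lam κ v w) (x : ℝ) :
    HasDerivAt (fun x : ℝ => w x) (deriv w x) x :=
  (hw.diff x (by simp)).hasDerivAt.comp_ofReal

theorem ode_ofReal (hw : u.IsJost ε lam κ v w) (x : ℝ) :
    Complex.I * ε * deriv w x + (lam + u.uC x) * w x = u.q lam κ v x :=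
  hw.ode x (by simp) fun p => (u.ofReal_ne x p).1

/-- `k = q - λ w` multiplied by the oscillating factor. -/
theorem hasDerivAt_osc_mul_k (hε : ε ≠ 0) (hw : u.IsJost ε lam κ v w) (x : ℝ) :
    HasDerivAt (fun x : ℝ => u.osc ε lam x * (u.q lam κ v x - lam * w x))
      (u.osc ε lam x * ((Complex.I * ε * u.q' v x + u.uC x * u.q lam κ v x) /
        (Complex.I * ε))) x := by
  have hq := (u.hasDerivAt_q lam κ v fun p => (u.ofReal_ne x p).1).comp_ofReal
  refine u.hasDerivAt_osc_mul hε (hq.sub ((hw.hasDerivAt_ofReal x).const_mul (lam : ℂ))) ?_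
  linear_combination (-lam : ℂ) * hw.ode_ofReal x

theorem tendsto_osc_mul_k (hw : u.IsJost ε lam κ v w) :
    Tendsto (fun x : ℝ => u.osc ε lam x * (u.q lam κ v x - lam * w x)) atBot (𝓝 0) := by
  refine tendsto_zero_iff_norm_tendsto_zero.2 ?_
  simp only [norm_mul, norm_osc, one_mul]
  have := ((u.tendsto_q_atBot lam κ v).sub (hw.lim.const_mul (lam : ℂ))).norm
  simpa [mul_comm] using this

end IsJost

variable (u)

/-- For k = q − λw the right-hand side of the equation is iεq' + u₀q: the term λq has cancelled and
what remains decays quadratically. -/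
theorem exists_bound_deriv_k (lam : ℝ) : ∃ C, 0 ≤ C ∧ ∀ (ε : ℝ) (κ : ℂ) (v : Fin P → ℂ) (x : ℝ),
    0 < ε → ε ≤ 1 → ‖u.osc ε lam x * ((Complex.I * ε * u.q' v x + u.uC x * u.q lam κ v x) /
        (Complex.I * ε))‖ ≤ C * size κ v / ε * (1 + x ^ 2)⁻¹ := by
  obtain ⟨d, hd, haw⟩ := u.exists_away_real
  obtain ⟨C₁, hC₁, h₁⟩ := u.exists_bound_q hd lam
  obtain ⟨C₂, hC₂, h₂⟩ := u.exists_bound_uC hd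
  refine ⟨C₁ + C₂ * C₁, by positivity, fun ε κ v x hε hε1 => ?_⟩
  have a := h₁ κ v x fun p => (haw x p).1
  have b := h₂ x (haw x)
  have hx : ‖(x : ℂ)‖ ^ 2 = x ^ 2 := by rw [Complex.norm_real, Real.norm_eq_abs, sq_abs]
  rw [hx] at a b
  have hN := size_nonneg κ v
  rw [norm_mul, norm_osc, one_mul, norm_div, norm_mul, Complex.norm_I, one_mul, Complex.norm_real,
    Real.norm_of_nonneg hε.le, div_mul_eq_mul_div]
  gcongr
  refine (norm_add_le _ _).trans ?_
  rw [norm_mul, norm_mul, norm_mul, Complex.norm_I, one_mul, Complex.norm_real,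
    Real.norm_of_nonneg hε.le]
  calc ε * ‖u.q' v x‖ + ‖u.uC x‖ * ‖u.q lam κ v x‖
      ≤ 1 * (C₁ * size κ v / (1 + x ^ 2)) + C₂ / (1 + x ^ 2) * (C₁ * size κ v) := by
        gcongr
        · exact a.2
        · exact a.1
    _ = (C₁ + C₂ * C₁) * size κ v * (1 + x ^ 2)⁻¹ := by
        rw [div_eq_mul_inv, div_eq_mul_inv]; ring

/-- Integrate the derivative of e^{-ih/ε}k from −∞, where k tends to 0. Division by iε costs one
power of ε. -/
theorem exists_bound_real {lam : ℝ} (hlam : 0 < lam) : ∃ C, 0 ≤ C ∧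
    ∀ (ε : ℝ) (κ : ℂ) (v : Fin P → ℂ) (w : ℂ → ℂ), 0 < ε → ε ≤ 1 → u.IsJost ε lam κ v w →
    ∀ x : ℝ, ‖w x‖ ≤ C * size κ v / ε := by
  obtain ⟨d, hd, haw⟩ := u.exists_away_real
  obtain ⟨C₁, hC₁, h₁⟩ := u.exists_bound_q hd lam
  obtain ⟨C₂, hC₂, h₂⟩ := u.exists_bound_deriv_k lam
  refine ⟨(C₁ + C₂ * Real.pi) / lam, by positivity, fun ε κ v w hε hε1 hw x => ?_⟩
  have hN := size_nonneg κ v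
  have h3 := norm_le_of_tendsto_atBot (b := x) (D := C₂ * size κ v / ε) (by positivity)
    (fun y _ => hw.hasDerivAt_osc_mul_k hε.ne' y) (fun y _ => h₂ ε κ v y hε hε1)
    hw.tendsto_osc_mul_k
  rw [norm_mul, norm_osc, one_mul] at h3
  have h4 := (h₁ κ v x fun p => (haw x p).1).1
  have h5 : lam * ‖w x‖ ≤ ‖u.q lam κ v x‖ + ‖u.q lam κ v x - lam * w x‖ := by
    have : (lam : ℂ) * w x = u.q lam κ v x - (u.q lam κ v x - lam * w x) := by ring
    calc lam * ‖w x‖ = ‖(lam : ℂ) * w x‖ := by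
          rw [norm_mul, Complex.norm_real, Real.norm_of_nonneg hlam.le]
      _ = ‖u.q lam κ v x - (u.q lam κ v x - lam * w x)‖ := congrArg norm this
      _ ≤ _ := norm_sub_le _ _
  have h6 : C₁ * size κ v ≤ C₁ * size κ v / ε := by
    rw [le_div_iff₀ hε]
    exact mul_le_of_le_one_right (by positivity) hε1
  rw [div_mul_eq_mul_div, div_div, le_div_iff₀ (by positivity)]
  have h7 : lam * ‖w x‖ ≤ (C₁ * size κ v + C₂ * size κ v * Real.pi) / ε := by
    rw [add_div]
    calc _ ≤ _ := h5
      _ ≤ C₁ * size κ v / ε + C₂ * size κ v / ε * Real.pi := add_le_add (h4.trans h6) h3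
      _ = _ := by ring
  rw [le_div_iff₀ hε] at h7
  linarith

/-- To the left of the turning points the Jost function is bounded uniformly in `ε`. -/
theorem exists_bound_left {lam xm xp : ℝ} (ht : u.TurningPoints lam xm xp) {a : ℝ} (ha : a < xm) :
    ∃ C, 0 ≤ C ∧ ∀ (ε : ℝ) (κ : ℂ) (v : Fin P → ℂ) (w : ℂ → ℂ), 0 < ε →
      u.IsJost ε lam κ v w → ∀ x ≤ a, ‖w x‖ ≤ C * size κ v := by
  obtain ⟨d, hd, haw⟩ := u.exists_away_real
  obtain ⟨C₁, hC₁, h₁⟩ := u.exists_bound_q hd lam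
  obtain ⟨C₂, hC₂, h₂⟩ := u.exists_bound_uC' hd
  set m := lam + u.u₀ a with hm
  have hm0 : 0 < m := ht.pos_left a ha
  have hH : ∀ x ≤ a, m ≤ lam + u.u₀ x := fun x hx => by linarith [ht.anti_left a ha x hx]
  have hHc : ∀ x : ℝ, (lam : ℂ) + u.uC x = ((lam + u.u₀ x : ℝ) : ℂ) := fun x => by
    rw [uC_ofReal]; push_cast; rfl
  have hHn : ∀ x ≤ a, m ≤ ‖(lam : ℂ) + u.uC x‖ := fun x hx => by
    rw [hHc, Complex.norm_real, Real.norm_of_nonneg (hm0.le.trans (hH x hx))]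
    exact hH x hx
  have hH0 : ∀ x ≤ a, (lam : ℂ) + u.uC x ≠ 0 := fun x hx =>
    norm_pos_iff.1 (hm0.trans_le (hHn x hx))
  set D := C₁ / m + C₁ * C₂ / m ^ 2 with hD
  have hD0 : 0 ≤ D := by positivity
  refine ⟨D * Real.pi + C₁ / m, by positivity, fun ε κ v w hε hw x hx => ?_⟩
  have hN := size_nonneg κ v
  have hε' : (ε : ℂ) ≠ 0 := by exact_mod_cast hε.ne'
  -- To the left of a the quotient q/(λ + u₀) is an approximate solution. Subtracting it leaves the
  -- right-hand side −iε(q/(λ + u₀))', whose factor ε cancels the 1/ε lost in the integration.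
  have key := norm_le_of_tendsto_atBot (b := x) (D := D * size κ v) (by positivity)
    (E := fun x : ℝ => u.osc ε lam x * (w x - u.q lam κ v x / (lam + u.uC x)))
    (E' := fun x : ℝ => u.osc ε lam x * (-(Complex.I * ε) * ((u.q' v x * (lam + u.uC x) -
      u.q lam κ v x * u.uC' x) / (lam + u.uC x) ^ 2) / (Complex.I * ε))) ?_ ?_ ?_
  · rw [norm_mul, norm_osc, one_mul] at key
    have h4 := (h₁ κ v x fun p => (haw x p).1).1
    have h5 : ‖u.q lam κ v x / (lam + u.uC x)‖ ≤ C₁ / m * size κ v := by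
      rw [norm_div, div_mul_eq_mul_div]
      gcongr
      exact hHn x hx
    calc ‖w x‖ = ‖(w x - u.q lam κ v x / (lam + u.uC x)) + u.q lam κ v x / (lam + u.uC x)‖ := by
          congr 1; ring
      _ ≤ _ := norm_add_le _ _
      _ ≤ D * size κ v * Real.pi + C₁ / m * size κ v := add_le_add key h5
      _ = _ := by ring
  · intro y hy
    have hya := hy.trans hx
    have hq := (u.hasDerivAt_q lam κ v fun p => (u.ofReal_ne y p).1).comp_ofReal
    have hu := ((u.hasDerivAt_uC fun p => u.ofReal_ne y p).const_add (lam : ℂ)).comp_ofReal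
    refine u.hasDerivAt_osc_mul hε.ne' ((hw.hasDerivAt_ofReal y).sub (hq.div hu (hH0 y hya))) ?_
    have h0 := hH0 y hya
    have e := hw.ode_ofReal y
    have : (lam + u.uC y) * (u.q lam κ v y / (lam + u.uC y)) = u.q lam κ v y := by
      field_simp
    linear_combination e - this
  · intro y hy
    have hya := hy.trans hx
    have A := h₁ κ v y fun p => (haw y p).1
    have B := h₂ y (haw y)
    have hx2 : ‖(y : ℂ)‖ ^ 2 = y ^ 2 := by rw [Complex.norm_real, Real.norm_eq_abs, sq_abs]
    rw [hx2] at A B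
    have h0 := hH0 y hya
    have e : (-(Complex.I * ε) * ((u.q' v y * (lam + u.uC y) -
      u.q lam κ v y * u.uC' y) / (lam + u.uC y) ^ 2) / (Complex.I * ε) : ℂ) =
      -(u.q' v y / (lam + u.uC y)) + u.q lam κ v y * u.uC' y / (lam + u.uC y) ^ 2 := by
      field_simp
      ring
    rw [norm_mul, norm_osc, one_mul, e]
    refine (norm_add_le _ _).trans ?_
    rw [norm_neg, norm_div, norm_div, norm_mul, norm_pow]
    calc _ ≤ C₁ * size κ v / (1 + y ^ 2) / m +
          C₁ * size κ v * (C₂ / (1 + y ^ 2)) / m ^ 2 := by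
          gcongr
          · exact A.2
          · exact hHn y hya
          · exact A.1
          · exact hHn y hya
      _ = _ := by rw [hD]; field_simp
  · refine tendsto_zero_iff_norm_tendsto_zero.2 ?_
    simp only [norm_mul, norm_osc, one_mul]
    have hu : Tendsto (fun x : ℝ => (lam : ℂ) + u.uC x) atBot (𝓝 lam) := by
      simp only [hHc]
      have := (u.tendsto_u₀_atBot.const_add lam)
      rw [add_zero] at this
      exact (Complex.continuous_ofReal.tendsto lam).comp this
    have hl : (lam : ℂ) ≠ 0 := by exact_mod_cast ht.lam_pos.ne'
    have := (hw.lim.sub ((u.tendsto_q_atBot lam κ v).div hu hl)).norm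
    rwa [mul_div_cancel_right₀ _ hl, sub_self, norm_zero] at this

end RationalPotential


/-! ### Bounds for Jost functions in the upper half-plane -/

namespace RationalPotential

variable {P : ℕ} (u : RationalPotential P)

theorem exists_radius : ∃ R : ℝ, 0 < R ∧ ∀ z : ℂ, R ≤ ‖z‖ → u.Away 1 z := by
  refine ⟨1 + ∑ p, ‖u.z p‖, by positivity, fun z hz p => ?_⟩
  have h : ‖u.z p‖ ≤ ∑ p, ‖u.z p‖ :=
    Finset.single_le_sum (f := fun p => ‖u.z p‖) (fun _ _ => norm_nonneg _) (Finset.mem_univ p)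
  have h1 := norm_sub_norm_le z (u.z p)
  have h2 := norm_sub_norm_le z (star (u.z p))
  rw [norm_star] at h2
  constructor <;> linarith

variable {u}

namespace IsJost

variable {ε lam : ℝ} {κ : ℂ} {v : Fin P → ℂ} {w : ℂ → ℂ}

theorem deriv_eq (hε : 0 < ε) (hw : u.IsJost ε lam κ v w) {z : ℂ} (hz : 0 ≤ z.im)
    (hp : ∀ p, z ≠ u.z p) :
    deriv w z = (u.q lam κ v z - (lam + u.uC z) * w z) / (Complex.I * ε) := by
  have hε' : (ε : ℂ) ≠ 0 := by exact_mod_cast hε.ne'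
  rw [← hw.ode z hz hp]
  field_simp
  ring

theorem norm_deriv_le (hε : 0 < ε) (hw : u.IsJost ε lam κ v w) {z : ℂ} (hz : 0 ≤ z.im)
    (hp : ∀ p, z ≠ u.z p) :
    ‖deriv w z‖ ≤ (‖u.q lam κ v z‖ + (|lam| + ‖u.uC z‖) * ‖w z‖) / ε := by
  rw [hw.deriv_eq hε hz hp, norm_div, norm_mul, Complex.norm_I, one_mul, Complex.norm_real,
    Real.norm_of_nonneg hε.le]
  gcongr
  refine (norm_sub_le _ _).trans ?_
  rw [norm_mul]
  gcongr
  refine (norm_add_le _ _).trans ?_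
  rw [Complex.norm_real, Real.norm_eq_abs]

/-- Outside a large disc the equation gives |w'| ≤ K(|w| + 1), and Grönwall along rays gives growth
of exponential type. The constants depend on ε and w, which is harmless since Phragmén–Lindelöf uses
the growth only qualitatively. -/
theorem exists_growth (hε : 0 < ε) (hw : u.IsJost ε lam κ v w) : ∃ A B R : ℝ, ∀ z : ℂ,
    0 ≤ z.im → R ≤ ‖z‖ → ‖w z‖ ≤ A * Real.exp (B * ‖z‖) := by
  obtain ⟨R, hR, haw⟩ := u.exists_radius
  obtain ⟨C₁, hC₁, h₁⟩ := u.exists_bound_q one_pos lam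
  obtain ⟨C₂, hC₂, h₂⟩ := u.exists_bound_uC one_pos
  have hN := size_nonneg κ v
  set K : ℝ := (C₁ * size κ v + |lam| + C₂ + 1) / ε with hK
  have hK0 : 0 < K := by positivity
  have hder : ∀ z : ℂ, 0 ≤ z.im → R ≤ ‖z‖ → ‖deriv w z‖ ≤ K * (‖w z‖ + 1) := by
    intro z hz hRz
    have ha := haw z hRz
    refine (hw.norm_deriv_le hε hz fun p => (ha.ne one_pos p).1).trans ?_
    have b1 := (h₁ κ v z fun p => (ha p).1).1
    have b2 : ‖u.uC z‖ ≤ C₂ := (h₂ z ha).trans (div_le_self hC₂ (by nlinarith [sq_nonneg ‖z‖]))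
    rw [hK, div_mul_eq_mul_div]
    gcongr
    have := norm_nonneg (w z)
    nlinarith [mul_le_mul_of_nonneg_right b2 this, abs_nonneg lam,
      mul_nonneg (mul_nonneg hC₁ hN) this]
  have hcomp : IsCompact {z : ℂ | 0 ≤ z.im ∧ ‖z‖ = R} := by
    have : {z : ℂ | 0 ≤ z.im ∧ ‖z‖ = R} = {z : ℂ | 0 ≤ z.im} ∩ Metric.sphere 0 R := by
      ext z; simp
    rw [this]
    exact (isCompact_sphere (0 : ℂ) R).inter_left
      (isClosed_le continuous_const Complex.continuous_im)
  obtain ⟨δ, hδ⟩ := hcomp.exists_bound_of_continuousOn (f := w)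
    fun z hz => (hw.diff z hz.1).continuousAt.continuousWithinAt
  refine ⟨|δ| + 1, K, R, fun z hz hRz => ?_⟩
  have hz0 : 0 < ‖z‖ := hR.trans_le hRz
  set ζ : ℂ := z / ‖z‖ with hζ
  have hζn : ‖ζ‖ = 1 := by
    rw [hζ, norm_div, Complex.norm_real, norm_norm, div_self hz0.ne']
  have hζi : 0 ≤ ζ.im := by
    rw [hζ, Complex.div_ofReal_im]; positivity
  have hn : ∀ t : ℝ, 0 ≤ t → ‖(R * ζ + t * ζ : ℂ)‖ = R + t := fun t ht => by
    rw [← add_mul, norm_mul, hζn, mul_one, ← Complex.ofReal_add, Complex.norm_real,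
      Real.norm_of_nonneg (by linarith)]
  have hi : ∀ t : ℝ, 0 ≤ t → 0 ≤ (R * ζ + t * ζ : ℂ).im := fun t ht => by
    rw [← add_mul, ← Complex.ofReal_add, Complex.im_ofReal_mul]
    have := hR.le
    positivity
  have := norm_le_of_norm_deriv_le (g := fun t : ℝ => w (R * ζ + t * ζ))
    (g' := fun t : ℝ => ζ * deriv w (R * ζ + t * ζ)) (T := ‖z‖ - R) (δ := |δ|) hK0
    (fun t ht => hasDerivAt_comp_line (hw.diff _ (hi t ht.1)).hasDerivAt)
    ((hδ _ ⟨by simpa using hi 0 le_rfl, by simpa using hn 0 le_rfl⟩).trans (le_abs_self δ))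
    (fun t ht => by
      rw [norm_mul, hζn, one_mul]
      exact hder _ (hi t ht.1) (by rw [hn t ht.1]; linarith [ht.1]))
    (t := ‖z‖ - R) ⟨by linarith, le_rfl⟩
  have e : (R * ζ + (‖z‖ - R : ℝ) * ζ : ℂ) = z := by
    rw [← add_mul, hζ]
    have : (‖z‖ : ℂ) ≠ 0 := by exact_mod_cast hz0.ne'
    push_cast
    field_simp
    ring
  simp only [e] at this
  refine this.trans ?_
  gcongr
  linarith

/-- Upwards along the imaginary axis the equation reads ε dw/dy = q − (λ + u₀)w, and λ > 0 makes it
dissipative: |w|² cannot cross a level at which λ|w|² dominates the other terms. -/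
theorem exists_bound_imag (hε : 0 < ε) (hlam : 0 < lam) (hw : u.IsJost ε lam κ v w) :
    ∃ D R : ℝ, ∀ y : ℝ, R ≤ y → ‖w (y * Complex.I)‖ ≤ D := by
  obtain ⟨R, hR, haw⟩ := u.exists_radius
  obtain ⟨C₁, hC₁, h₁⟩ := u.exists_bound_q one_pos lam
  obtain ⟨C₂, hC₂, h₂⟩ := u.exists_bound_mul_uC one_pos
  have hN := size_nonneg κ v
  -- Above height R' one has |u₀| ≤ λ/2. The level m exceeds both the initial modulus and twice the
  -- bound of q divided by λ, and the summand 1 makes this strict.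
  set R' : ℝ := R + 2 * C₂ / lam with hR'
  have hR'0 : 0 < R' := by positivity
  set m : ℝ := ‖w (R' * Complex.I)‖ + 2 * (C₁ * size κ v) / lam + 1 with hm
  have hm0 : 0 < m := by positivity
  refine ⟨m, R', fun y hy => ?_⟩
  have him : ∀ t : ℝ, R' ≤ t → 0 ≤ (0 + (t : ℂ) * Complex.I).im := fun t ht => by
    simpa using hR'0.le.trans ht
  have hnorm : ∀ t : ℝ, R' ≤ t → ‖(0 + (t : ℂ) * Complex.I)‖ = t := fun t ht => by
    simp [abs_of_nonneg (hR'0.le.trans ht)]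
  have hd : ∀ t : ℝ, R' ≤ t → HasDerivAt (fun t : ℝ => w (0 + t * Complex.I))
      (Complex.I * deriv w (0 + t * Complex.I)) t := fun t ht =>
    hasDerivAt_comp_line (hw.diff _ (him t ht)).hasDerivAt
  have key := image_le_of_deriv_right_lt_deriv_boundary (a := R') (b := y)
    (f := fun t : ℝ => ‖w (0 + t * Complex.I)‖ ^ 2)
    (f' := fun t : ℝ => 2 * inner ℝ (w (0 + t * Complex.I))
      (Complex.I * deriv w (0 + t * Complex.I)))
    (B := fun _ => m ^ 2) (B' := fun _ => 0)
    (fun t ht => (hd t ht.1).norm_sq.continuousAt.continuousWithinAt)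
    (fun t ht => (hd t ht.1).norm_sq.hasDerivWithinAt)
    (by
      rw [zero_add]
      have : ‖w (R' * Complex.I)‖ ≤ m := by
        rw [hm]
        have : 0 ≤ 2 * (C₁ * size κ v) / lam := by positivity
        linarith
      gcongr)
    (fun t => hasDerivAt_const t _) ?_ ⟨hy, le_rfl⟩
  · rw [zero_add] at key
    exact (sq_le_sq₀ (norm_nonneg _) hm0.le).1 key
  · intro t ht heq
    set z : ℂ := 0 + t * Complex.I
    have hzn : ‖z‖ = t := hnorm t ht.1
    have hzi : 0 ≤ z.im := him t ht.1
    clear_value z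
    have hRt : R ≤ ‖z‖ := by
      rw [hzn]
      have : 0 ≤ 2 * C₂ / lam := by positivity
      linarith [ht.1]
    have ha := haw z hRt
    have hwm : ‖w z‖ = m := by
      have := (sq_eq_sq₀ (norm_nonneg _) hm0.le).1 heq
      exact this
    have b1 := (h₁ κ v z fun p => (ha p).1).1
    have b2 : ‖u.uC z‖ ≤ lam / 2 := by
      refine (h₂ z ha).1.trans ?_
      rw [hzn, div_le_iff₀ (by linarith [ht.1])]
      have : 2 * C₂ / lam ≤ t := by linarith [ht.1]
      rw [div_le_iff₀ hlam] at this
      nlinarith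
    have e1 : Complex.I * deriv w z = ((1 / ε : ℝ) : ℂ) * (u.q lam κ v z - (lam + u.uC z) * w z) := by
      rw [hw.deriv_eq hε hzi fun p => (ha.ne one_pos p).1]
      have hε' : (ε : ℂ) ≠ 0 := by exact_mod_cast hε.ne'
      push_cast
      field_simp
    have e2 : inner ℝ (w z) (Complex.I * deriv w z) =
        1 / ε * ((starRingEnd ℂ (w z) * u.q lam κ v z).re - lam * m ^ 2 -
          (starRingEnd ℂ (w z) * (u.uC z * w z)).re) := by
      rw [e1, Complex.inner, ← hwm, ← Complex.normSq_eq_norm_sq]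
      simp only [Complex.normSq_apply, Complex.mul_re, Complex.mul_im, Complex.sub_re,
        Complex.sub_im, Complex.add_re, Complex.add_im, Complex.ofReal_re, Complex.ofReal_im,
        Complex.conj_re, Complex.conj_im]
      ring
    have b3 : (starRingEnd ℂ (w z) * u.q lam κ v z).re ≤ m * (C₁ * size κ v) := by
      refine (Complex.re_le_norm _).trans ?_
      rw [norm_mul, RCLike.norm_conj, hwm]
      gcongr
    have b4 : -(starRingEnd ℂ (w z) * (u.uC z * w z)).re ≤ m * (lam / 2 * m) := by
      refine (neg_le_abs _).trans ((Complex.abs_re_le_norm _).trans ?_)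
      rw [norm_mul, norm_mul, RCLike.norm_conj, hwm]
      gcongr
    rw [e2]
    have b5 : C₁ * size κ v < lam / 2 * m := by
      have : 2 * (C₁ * size κ v) / lam < m := by
        rw [hm]; linarith [norm_nonneg (w (R' * Complex.I))]
      rw [div_lt_iff₀ hlam] at this
      linarith
    have : (starRingEnd ℂ (w z) * u.q lam κ v z).re - lam * m ^ 2 -
          (starRingEnd ℂ (w z) * (u.uC z * w z)).re < 0 := by nlinarith
    have h6 : 0 < 1 / ε := by positivity
    nlinarith

end IsJost

variable (u)

/-- The `O(1/ε)` bound for the Jost function in the closed upper half-plane. -/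
theorem exists_bound_upper {lam : ℝ} (hlam : 0 < lam) : ∃ C, 0 ≤ C ∧
    ∀ (ε : ℝ) (κ : ℂ) (v : Fin P → ℂ) (w : ℂ → ℂ), 0 < ε → ε ≤ 1 → u.IsJost ε lam κ v w →
    ∀ z : ℂ, 0 ≤ z.im → ‖w z‖ ≤ C * size κ v / ε := by
  obtain ⟨C, hC, h⟩ := u.exists_bound_real hlam
  refine ⟨C, hC, fun ε κ v w hε hε1 hw z hz => ?_⟩
  obtain ⟨A, B, R, hg⟩ := hw.exists_growth hε
  obtain ⟨D, R', hi⟩ := hw.exists_bound_imag hε hlam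
  have hA : ∀ z : ℂ, 0 ≤ z.im → max R R' ≤ ‖z‖ → ‖w z‖ ≤ A * Real.exp (B * ‖z‖) :=
    fun z hz hR => hg z hz ((le_max_left _ _).trans hR)
  exact norm_le_of_upper_half_plane hw.diff hA
    (fun y hy => hi y ((le_max_right _ _).trans hy)) (h ε κ v w hε hε1 hw) hz

end RationalPotential


/-! ### Phase integrals along valley rays -/

/-- The contribution of the `l`-th power to the phase integral along the ray in direction `t`. -/
def rayInt (G a : ℂ → ℂ) (M : ℕ) (δ ε : ℝ) (t : ℂ) (l : ℕ) : ℂ :=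
  ∫ r in (0 : ℝ)..δ, Complex.exp (-Complex.I * ((r * t) ^ M * G (r * t)) / ε) *
    ((r * t) ^ l * a (r * t) * t)

/-- The moments `∫₀^∞ r^l e^{-b r^M} dr`. -/
def rayMoment (b : ℝ) (M l : ℕ) : ℝ := ∫ r in Set.Ioi (0 : ℝ), r ^ l * Real.exp (-b * r ^ M)

theorem integrableOn_pow_mul_exp_neg_mul_pow {b : ℝ} (hb : 0 < b) {M : ℕ} (hM : M ≠ 0) (l : ℕ) :
    IntegrableOn (fun r : ℝ => r ^ l * Real.exp (-b * r ^ M)) (Set.Ioi 0) := by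
  have := integrableOn_rpow_mul_exp_neg_mul_rpow (p := M) (s := l) (b := b)
    (by linarith [(Nat.cast_nonneg l : (0 : ℝ) ≤ l)])
    (by exact_mod_cast Nat.one_le_iff_ne_zero.2 hM) hb
  simpa only [Real.rpow_natCast] using this

theorem rayMoment_pos {b : ℝ} (hb : 0 < b) {M : ℕ} (hM : M ≠ 0) (l : ℕ) : 0 < rayMoment b M l := by
  have h := integrableOn_pow_mul_exp_neg_mul_pow hb hM l
  refine (setIntegral_pos_iff_support_of_nonneg_ae ?_ h).2 ?_
  · refine (ae_restrict_iff' measurableSet_Ioi).2 (Eventually.of_forall fun r hr => ?_)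
    have : (0 : ℝ) < r := hr
    simp only [Pi.zero_apply]
    positivity
  · refine lt_of_lt_of_le ?_ (measure_mono (s := Set.Ioi (0 : ℝ)) fun r hr => ⟨?_, hr⟩)
    · simp
    · have : (0 : ℝ) < r := hr
      simp only [Function.mem_support]
      positivity

section

variable {G a : ℂ → ℂ} {M : ℕ} {δ : ℝ}

/-- Put ε = s^M and substitute r → sr: the phase becomes r^M G(srt), and the power s^{l+1} comes
out. As s → 0 only G(0) and a(0) survive, and in the valley direction t the exponential is
e^{-|G(0)| r^M}. -/
theorem tendsto_rayInt (hδ : 0 < δ) (hM : M ≠ 0) (hG : ContinuousOn G (Metric.closedBall 0 δ))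
    (ha : ContinuousOn a (Metric.closedBall 0 δ)) (hG0 : G 0 ≠ 0) {t : ℂ} (htn : ‖t‖ = 1)
    (ht : -Complex.I * t ^ M * G 0 = -(‖G 0‖ : ℂ))
    (hre : ∀ r ∈ Set.Icc 0 δ, (-Complex.I * t ^ M * G (r * t)).re ≤ -(‖G 0‖ / 2)) (l : ℕ) :
    Tendsto (fun s : ℝ => (s : ℂ)⁻¹ ^ (l + 1) * rayInt G a M δ (s ^ M) t l) (𝓝[>] 0)
      (𝓝 (rayMoment ‖G 0‖ M l * t ^ (l + 1) * a 0)) := by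
  set b : ℝ := ‖G 0‖ with hb
  have hb0 : 0 < b := norm_pos_iff.2 hG0
  obtain ⟨A, hA⟩ := (isCompact_closedBall (0 : ℂ) δ).exists_bound_of_continuousOn ha
  have hA0 : 0 ≤ A := (norm_nonneg _).trans (hA 0 (by simp [hδ.le]))
  have hmem : ∀ r : ℝ, r ∈ Set.Icc 0 δ → (r * t : ℂ) ∈ Metric.closedBall 0 δ := fun r hr => by
    rw [mem_closedBall_zero_iff, norm_mul, htn, mul_one, Complex.norm_real,
      Real.norm_of_nonneg hr.1]
    exact hr.2
  -- The indicator keeps the domain (0, ∞) fixed while the rescaled interval (0, δ/s] grows. The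
  -- majorant has half the limiting decay rate, as `hre` allows.
  set k : ℝ → ℝ → ℂ := fun s r => (Set.Ioc 0 (δ / s)).indicator (fun r : ℝ =>
    Complex.exp ((r : ℂ) ^ M * (-Complex.I * t ^ M * G ((s * r : ℝ) * t))) *
      (r ^ l * t ^ (l + 1) * a ((s * r : ℝ) * t))) r with hk
  have hsr : ∀ s r : ℝ, 0 < s → r ∈ Set.Ioc 0 (δ / s) → s * r ∈ Set.Icc 0 δ := by
    intro s r hs hr
    have h1 := hr.2
    rw [le_div_iff₀ hs] at h1
    exact ⟨mul_nonneg hs.le hr.1.le, by linarith⟩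
  have heq : ∀ s : ℝ, 0 < s → (s : ℂ)⁻¹ ^ (l + 1) * rayInt G a M δ (s ^ M) t l =
      ∫ r in Set.Ioi (0 : ℝ), k s r := by
    intro s hs
    have hs' : (s : ℂ) ≠ 0 := by exact_mod_cast hs.ne'
    rw [hk]
    simp only
    rw [setIntegral_indicator measurableSet_Ioc,
      Set.inter_eq_self_of_subset_right Set.Ioc_subset_Ioi_self,
      ← intervalIntegral.integral_of_le (by positivity), rayInt]
    have hsub := intervalIntegral.integral_comp_mul_left (a := 0) (b := δ / s) (c := s)
      (fun r : ℝ => Complex.exp (-Complex.I * ((r * t) ^ M * G (r * t)) / ((s ^ M : ℝ) : ℂ)) *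
        ((r * t) ^ l * a (r * t) * t)) hs.ne'
    rw [mul_zero, mul_div_cancel₀ _ hs.ne'] at hsub
    have hsub' : ∫ r in (0 : ℝ)..δ, (Complex.exp (-Complex.I * ((r * t) ^ M * G (r * t)) /
        ((s ^ M : ℝ) : ℂ)) * ((r * t) ^ l * a (r * t) * t)) = (s : ℂ) *
        ∫ r in (0 : ℝ)..(δ / s), (Complex.exp (-Complex.I * (((s * r : ℝ) * t) ^ M *
          G ((s * r : ℝ) * t)) / ((s ^ M : ℝ) : ℂ)) *
          (((s * r : ℝ) * t) ^ l * a ((s * r : ℝ) * t) * t)) := by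
      rw [hsub, Complex.real_smul, Complex.ofReal_inv, ← mul_assoc, mul_inv_cancel₀ hs', one_mul]
    rw [hsub', ← mul_assoc, ← intervalIntegral.integral_const_mul]
    refine intervalIntegral.integral_congr fun r _ => ?_
    have e : -Complex.I * (((s * r : ℝ) * t) ^ M * G ((s * r : ℝ) * t)) / ((s ^ M : ℝ) : ℂ) =
        (r : ℂ) ^ M * (-Complex.I * t ^ M * G ((s * r : ℝ) * t)) := by
      generalize G ((s * r : ℝ) * t) = g
      push_cast
      field_simp
      ring
    rw [e]
    generalize a ((s * r : ℝ) * t) = g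
    push_cast
    rw [inv_pow]
    field_simp
    ring
  have hlim : (rayMoment b M l * t ^ (l + 1) * a 0 : ℂ) = ∫ r in Set.Ioi (0 : ℝ),
      Complex.exp ((r : ℂ) ^ M * (-Complex.I * t ^ M * G 0)) * (r ^ l * t ^ (l + 1) * a 0) := by
    rw [rayMoment, ← integral_complex_ofReal, mul_assoc, ← integral_mul_const]
    refine integral_congr_ae (Eventually.of_forall fun r => ?_)
    simp only [ht]
    push_cast
    rw [show -(b : ℂ) * (r : ℂ) ^ M = (r : ℂ) ^ M * -b by ring]
    ring
  rw [hlim]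
  refine Tendsto.congr' (f₁ := fun s => ∫ r in Set.Ioi (0 : ℝ), k s r) ?_ ?_
  · filter_upwards [self_mem_nhdsWithin] with s hs using (heq s hs).symm
  refine tendsto_integral_filter_of_dominated_convergence
    (fun r : ℝ => A * (r ^ l * Real.exp (-(b / 2) * r ^ M))) ?_ ?_
    ((integrableOn_pow_mul_exp_neg_mul_pow (by linarith) hM l).const_mul A) ?_
  · filter_upwards [self_mem_nhdsWithin] with s hs
    have hs : 0 < s := hs
    rw [hk]
    simp only
    rw [aestronglyMeasurable_indicator_iff measurableSet_Ioc,
      Measure.restrict_restrict measurableSet_Ioc,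
      Set.inter_eq_self_of_subset_left Set.Ioc_subset_Ioi_self]
    refine ContinuousOn.aestronglyMeasurable ?_ measurableSet_Ioc
    have hc : ContinuousOn (fun r : ℝ => ((s * r : ℝ) * t : ℂ)) (Set.Ioc 0 (δ / s)) := by fun_prop
    have hm : Set.MapsTo (fun r : ℝ => ((s * r : ℝ) * t : ℂ)) (Set.Ioc 0 (δ / s))
        (Metric.closedBall 0 δ) := fun r hr => hmem _ (hsr s r hs hr)
    have h1 := hG.comp hc hm
    have h2 := ha.comp hc hm
    simp only [Function.comp_def] at h1 h2
    fun_prop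
  · filter_upwards [self_mem_nhdsWithin] with s hs
    refine (ae_restrict_iff' measurableSet_Ioi).2 (Eventually.of_forall fun r hr => ?_)
    have hr : 0 < r := hr
    rw [hk]
    simp only
    by_cases hrm : r ∈ Set.Ioc 0 (δ / s)
    · rw [Set.indicator_of_mem hrm, norm_mul, Complex.norm_exp, norm_mul, norm_mul, norm_pow,
        norm_pow, htn, one_pow, mul_one, Complex.norm_real, Real.norm_of_nonneg hr.le]
      have h1 := hre _ (hsr s r hs hrm)
      have h2 := hA _ (hmem _ (hsr s r hs hrm))
      have h3 : ((r : ℂ) ^ M * (-Complex.I * t ^ M * G ((s * r : ℝ) * t))).re ≤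
          -(b / 2) * r ^ M := by
        rw [← Complex.ofReal_pow, Complex.re_ofReal_mul]
        have : 0 ≤ r ^ M := by positivity
        nlinarith
      calc _ ≤ Real.exp (-(b / 2) * r ^ M) * (r ^ l * A) := by gcongr
        _ = _ := by ring
    · rw [Set.indicator_of_notMem hrm, norm_zero]
      positivity
  · refine (ae_restrict_iff' measurableSet_Ioi).2 (Eventually.of_forall fun r hr => ?_)
    have hr : 0 < r := hr
    have hz : Tendsto (fun s : ℝ => ((s * r : ℝ) * t : ℂ)) (𝓝[>] 0) (𝓝 0) := by
      have : Continuous (fun s : ℝ => ((s * r : ℝ) * t : ℂ)) := by fun_prop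
      have h := this.tendsto 0
      simp only [zero_mul, Complex.ofReal_zero] at h
      exact h.mono_left nhdsWithin_le_nhds
    have hnb : Metric.closedBall (0 : ℂ) δ ∈ 𝓝 0 := Metric.closedBall_mem_nhds 0 hδ
    have h1 := (hG.continuousAt hnb).tendsto.comp hz
    have h2 := (ha.continuousAt hnb).tendsto.comp hz
    have h3 := ((((h1.const_mul (-Complex.I * t ^ M)).const_mul ((r : ℂ) ^ M)).cexp)).mul
      (h2.const_mul ((r : ℂ) ^ l * t ^ (l + 1)))
    refine h3.congr' ?_
    have hsmall : Set.Iio (δ / r) ∈ 𝓝 (0 : ℝ) := Iio_mem_nhds (by positivity)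
    filter_upwards [self_mem_nhdsWithin, mem_nhdsWithin_of_mem_nhds hsmall] with s hs hs'
    have hs : 0 < s := hs
    have hrm : r ∈ Set.Ioc 0 (δ / s) := by
      refine ⟨hr, ?_⟩
      have hs' : s < δ / r := hs'
      rw [lt_div_iff₀ hr] at hs'
      rw [le_div_iff₀ hs]
      linarith
    rw [hk]
    simp only [Set.indicator_of_mem hrm, Function.comp_apply]

theorem exists_common_bound {ι κ : Type*} [Finite ι] [Finite κ] (g : ι → κ → ℝ) :
    ∃ E : ℝ, 0 ≤ E ∧ ∀ i j, g i j ≤ E := by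
  obtain ⟨E, hE⟩ := (Set.finite_range fun x : ι × κ => g x.1 x.2).bddAbove
  exact ⟨max E 0, le_max_right _ _, fun i j => (hE ⟨(i, j), rfl⟩).trans (le_max_left _ _)⟩

/-- A kernel vector is the coefficient list of a polynomial of degree at most n without constant
term that takes one and the same value at n + 1 distinct points. Such a polynomial is constant,
hence all its coefficients vanish. -/
theorem det_rayMatrix_ne_zero {n : ℕ} {γ : Fin n → ℂ} (hγ : ∀ l, γ l ≠ 0)
    {t : Fin (n + 1) → ℂ} (ht : Function.Injective t) :
    (Matrix.of fun i l : Fin n => γ l * (t i.succ ^ ((l : ℕ) + 1) - t 0 ^ ((l : ℕ) + 1))).det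
      ≠ 0 := by
  intro h0
  obtain ⟨y, hy, hy0⟩ := Matrix.exists_mulVec_eq_zero_iff.2 h0
  apply hy
  set Q : Polynomial ℂ := ∑ l : Fin n, Polynomial.C (y l * γ l) * Polynomial.X ^ ((l : ℕ) + 1)
    with hQ
  have heval : ∀ x, Q.eval x = ∑ l : Fin n, y l * γ l * x ^ ((l : ℕ) + 1) := fun x => by
    simp [hQ, Polynomial.eval_finsetSum]
  have hdeg : (Q - Polynomial.C (Q.eval (t 0))).degree < (n + 1 : ℕ) := by
    rw [← Polynomial.mem_degreeLT]
    refine Submodule.sub_mem _ (Submodule.sum_mem _ fun l _ => ?_) ?_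
    · rw [Polynomial.mem_degreeLT]
      exact (Polynomial.degree_C_mul_X_pow_le _ _).trans_lt (by exact_mod_cast by omega)
    · rw [Polynomial.mem_degreeLT]
      exact Polynomial.degree_C_le.trans_lt (by exact_mod_cast by omega)
  have hz : Q - Polynomial.C (Q.eval (t 0)) = 0 := by
    refine Polynomial.eq_zero_of_degree_lt_of_eval_finset_eq_zero (Finset.univ.image t) ?_ ?_
    · rw [Finset.card_image_of_injective _ ht, Finset.card_univ, Fintype.card_fin]
      exact hdeg
    · intro x hx
      obtain ⟨i, -, rfl⟩ := Finset.mem_image.1 hx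
      rw [Polynomial.eval_sub, Polynomial.eval_C]
      refine Fin.cases (by simp) (fun i => ?_) i
      have := congrFun hy0 i
      simp only [Matrix.mulVec, dotProduct, Matrix.of_apply, Pi.zero_apply] at this
      rw [heval, heval, ← Finset.sum_sub_distrib, ← this]
      exact Finset.sum_congr rfl fun l _ => by ring
  funext l
  have hc : (Q - Polynomial.C (Q.eval (t 0))).coeff ((l : ℕ) + 1) = 0 := by rw [hz]; simp
  rw [Polynomial.coeff_sub, Polynomial.coeff_C_succ, sub_zero, hQ, Polynomial.finsetSum_coeff]
    at hc
  simp only [Polynomial.coeff_C_mul, Polynomial.coeff_X_pow, mul_ite, mul_one, mul_zero,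
    add_left_inj] at hc
  rw [Finset.sum_eq_single l (fun b _ hb => if_neg fun h => hb (Fin.ext h.symm)) (by simp)] at hc
  simp only [if_true] at hc
  exact (mul_eq_zero.1 hc).resolve_right (hγ l)

/-- If the phase integrals along `n + 1` valley directions agree up to `O(ε)`, the first `n`
coefficients of the amplitude are small. -/
theorem coeff_small_of_rayInt {n L : ℕ} (hδ : 0 < δ) (hn : n + 1 ≤ M) (hnL : n ≤ L)
    (hG : ContinuousOn G (Metric.closedBall 0 δ))
    (ha : ContinuousOn a (Metric.closedBall 0 δ)) (hG0 : G 0 ≠ 0) (ha0 : a 0 ≠ 0)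
    {t : Fin (n + 1) → ℂ} (hti : Function.Injective t) (htn : ∀ j, ‖t j‖ = 1)
    (ht : ∀ j, -Complex.I * t j ^ M * G 0 = -(‖G 0‖ : ℂ))
    (hre : ∀ j, ∀ r ∈ Set.Icc 0 δ, (-Complex.I * t j ^ M * G (r * t j)).re ≤ -(‖G 0‖ / 2)) :
    ∃ C s₀ : ℝ, 0 < s₀ ∧ ∀ s, 0 < s → s < s₀ → ∀ (ν : ℕ → ℂ) (N : ℝ), (∀ l, ‖ν l‖ ≤ N) →
      (∀ i j, ‖∑ l ∈ Finset.range L, ν l * rayInt G a M δ (s ^ M) (t i) l -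
        ∑ l ∈ Finset.range L, ν l * rayInt G a M δ (s ^ M) (t j) l‖ ≤ s ^ M * N) →
      ∀ l < n, ‖ν l‖ ≤ C * s * N := by
  have hM : M ≠ 0 := by omega
  set W : ℝ → Fin (n + 1) → ℕ → ℂ := fun s j l =>
    (s : ℂ)⁻¹ ^ (l + 1) * rayInt G a M δ (s ^ M) (t j) l with hW
  set γ : ℕ → ℂ := fun l => rayMoment ‖G 0‖ M l * a 0 with hγ
  have hγ0 : ∀ l, γ l ≠ 0 := fun l => mul_ne_zero
    (by exact_mod_cast (rayMoment_pos (norm_pos_iff.2 hG0) hM l).ne') ha0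
  have hWt : ∀ j l, Tendsto (fun s => W s j l) (𝓝[>] 0) (𝓝 (γ l * t j ^ (l + 1))) := fun j l => by
    have := tendsto_rayInt hδ hM hG ha hG0 (htn j) (ht j) (hre j) l
    rwa [show (γ l * t j ^ (l + 1)) = (rayMoment ‖G 0‖ M l * t j ^ (l + 1) * a 0) by
      rw [hγ]; ring]
  -- Subtracting the ray with index 0 removes the unknown common value of the integrals. The matrix
  -- converges to an invertible one, so its inverse, written with the adjugate, stays bounded.
  set B : ℝ → Matrix (Fin n) (Fin n) ℂ := fun s =>
    Matrix.of fun i l : Fin n => W s i.succ l - W s 0 l with hB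
  set B₀ : Matrix (Fin n) (Fin n) ℂ :=
    Matrix.of fun i l : Fin n => γ l * (t i.succ ^ ((l : ℕ) + 1) - t 0 ^ ((l : ℕ) + 1)) with hB₀
  have hdet0 : B₀.det ≠ 0 := det_rayMatrix_ne_zero (γ := fun l : Fin n => γ l) (fun l => hγ0 l) hti
  have hBt : Tendsto B (𝓝[>] 0) (𝓝 B₀) := by
    refine tendsto_pi_nhds.2 fun i => tendsto_pi_nhds.2 fun l => ?_
    have := (hWt i.succ l).sub (hWt 0 l)
    rw [← mul_sub] at this
    exact this
  have hdet : Tendsto (fun s => (B s).det) (𝓝[>] 0) (𝓝 B₀.det) :=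
    ((Continuous.matrix_det continuous_id).tendsto B₀).comp hBt
  have hadj : Tendsto (fun s => (B s).adjugate) (𝓝[>] 0) (𝓝 B₀.adjugate) :=
    ((Continuous.matrix_adjugate continuous_id).tendsto B₀).comp hBt
  have hadj' : ∀ i j, Tendsto (fun s => (B s).adjugate i j) (𝓝[>] 0) (𝓝 (B₀.adjugate i j)) :=
    fun i j => (tendsto_pi_nhds.1 (tendsto_pi_nhds.1 hadj i)) j
  have hinv : ∀ i j, Tendsto (fun s => ((B s).det)⁻¹ * (B s).adjugate i j) (𝓝[>] 0)
      (𝓝 (B₀.det⁻¹ * B₀.adjugate i j)) := fun i j => (hdet.inv₀ hdet0).mul (hadj' i j)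
  obtain ⟨E, hEn, hE0⟩ : ∃ E : ℝ, 0 ≤ E ∧ ∀ i j, ‖B₀.det⁻¹ * B₀.adjugate i j‖ + 1 ≤ E :=
    exists_common_bound fun i j => ‖B₀.det⁻¹ * B₀.adjugate i j‖ + 1
  obtain ⟨F, hFn, hF0⟩ : ∃ F : ℝ, 0 ≤ F ∧ ∀ (j : Fin (n + 1)) (l : Fin L),
      ‖γ l * t j ^ ((l : ℕ) + 1)‖ + 1 ≤ F :=
    exists_common_bound fun j (l : Fin L) => ‖γ l * t j ^ ((l : ℕ) + 1)‖ + 1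
  have hev1 : ∀ᶠ s in 𝓝[>] (0 : ℝ), ∀ i j, ‖((B s).det)⁻¹ * (B s).adjugate i j‖ ≤
      ‖B₀.det⁻¹ * B₀.adjugate i j‖ + 1 := by
    rw [eventually_all]; intro i
    rw [eventually_all]; intro j
    exact ((hinv i j).norm.eventually_lt_const (lt_add_one _)).mono fun _ h => h.le
  have hev2 : ∀ᶠ s in 𝓝[>] (0 : ℝ), ∀ j, ∀ l ∈ Finset.range L, ‖W s j l‖ ≤
      ‖γ l * t j ^ (l + 1)‖ + 1 := by
    rw [eventually_all]; intro j
    rw [Filter.eventually_all_finset]; intro l _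
    exact ((hWt j l).norm.eventually_lt_const (lt_add_one _)).mono fun _ h => h.le
  have hev3 : ∀ᶠ s in 𝓝[>] (0 : ℝ), (B s).det ≠ 0 := hdet.eventually_ne hdet0
  obtain ⟨s₁, hs₁, hs₁'⟩ := (mem_nhdsGT_iff_exists_Ioo_subset).1 (hev1.and (hev2.and hev3))
  refine ⟨n * E * (1 + 2 * L * F), min s₁ 1, lt_min hs₁ one_pos, ?_⟩
  intro s hs hss ν N hν hΦ l hl
  obtain ⟨h1, h2, h3⟩ := hs₁' ⟨hs, hss.trans_le (min_le_left _ _)⟩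
  have hs1 : s ≤ 1 := hss.le.trans (min_le_right _ _)
  have hs' : (s : ℂ) ≠ 0 := by exact_mod_cast hs.ne'
  have hN : 0 ≤ N := (norm_nonneg _).trans (hν 0)
  have hray : ∀ j l, rayInt G a M δ (s ^ M) (t j) l = (s : ℂ) ^ (l + 1) * W s j l := fun j l => by
    rw [hW]; simp only
    rw [← mul_assoc, ← mul_pow, mul_inv_cancel₀ hs', one_pow, one_mul]
  -- In the unknowns y_l = ν_l s^{l+1} the right-hand side is O(s^{n+1}): the discrepancy is s^M ≤
  -- s^{n+1}, and the powers l ≥ n carry at least s^{n+1}. Dividing y_l by s^{l+1} with l < n gains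
  -- a factor s.
  set y : Fin n → ℂ := fun l => ν l * (s : ℂ) ^ ((l : ℕ) + 1) with hy
  have hrhs : ∀ i, ‖(B s).mulVec y i‖ ≤ s ^ (n + 1) * ((1 + 2 * L * F) * N) := by
    intro i
    have hsplit : ∀ j, ∑ l ∈ Finset.range L, ν l * rayInt G a M δ (s ^ M) (t j) l =
        ∑ l : Fin n, y l * W s j l +
          ∑ l ∈ Finset.Ico n L, ν l * ((s : ℂ) ^ (l + 1) * W s j l) := by
      intro j
      rw [← Finset.sum_range_add_sum_Ico _ hnL, Finset.sum_range]
      simp only [hray, hy, mul_assoc]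
    have e : (B s).mulVec y i = (∑ l ∈ Finset.range L, ν l * rayInt G a M δ (s ^ M) (t i.succ) l -
        ∑ l ∈ Finset.range L, ν l * rayInt G a M δ (s ^ M) (t 0) l) -
        (∑ l ∈ Finset.Ico n L, ν l * ((s : ℂ) ^ (l + 1) * W s i.succ l) -
        ∑ l ∈ Finset.Ico n L, ν l * ((s : ℂ) ^ (l + 1) * W s 0 l)) := by
      rw [hsplit, hsplit]
      simp only [Matrix.mulVec, dotProduct, hB, Matrix.of_apply, sub_mul, Finset.sum_sub_distrib,
        mul_comm (y _)]
      ring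
    have hb : ∀ j, ‖∑ l ∈ Finset.Ico n L, ν l * ((s : ℂ) ^ (l + 1) * W s j l)‖ ≤
        s ^ (n + 1) * (L * F * N) := by
      intro j
      have : ∀ l ∈ Finset.Ico n L, ‖ν l * ((s : ℂ) ^ (l + 1) * W s j l)‖ ≤
          N * (s ^ (n + 1) * F) := by
        intro l hl
        have hlL : l ∈ Finset.range L := Finset.mem_range.2 (Finset.mem_Ico.1 hl).2
        rw [norm_mul, norm_mul, norm_pow, Complex.norm_real, Real.norm_of_nonneg hs.le]
        have p1 : s ^ (l + 1) ≤ s ^ (n + 1) :=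
          pow_le_pow_of_le_one hs.le hs1 (by have := (Finset.mem_Ico.1 hl).1; omega)
        have p2 := (h2 j l hlL).trans (hF0 j ⟨l, (Finset.mem_Ico.1 hl).2⟩)
        gcongr
        exact hν l
      refine (norm_sum_le_of_le _ this).trans ?_
      rw [Finset.sum_const, nsmul_eq_mul, Nat.card_Ico]
      have hc : ((L - n : ℕ) : ℝ) ≤ L := by exact_mod_cast Nat.sub_le _ _
      calc ((L - n : ℕ) : ℝ) * (N * (s ^ (n + 1) * F)) ≤ L * (N * (s ^ (n + 1) * F)) := by gcongr
        _ = _ := by ring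
    rw [e]
    have hsM : s ^ M ≤ s ^ (n + 1) := pow_le_pow_of_le_one hs.le hs1 hn
    calc _ ≤ _ := norm_sub_le _ _
      _ ≤ s ^ M * N + (s ^ (n + 1) * (L * F * N) + s ^ (n + 1) * (L * F * N)) :=
        add_le_add (hΦ _ _) ((norm_sub_le _ _).trans (add_le_add (hb _) (hb _)))
      _ ≤ s ^ (n + 1) * N + (s ^ (n + 1) * (L * F * N) + s ^ (n + 1) * (L * F * N)) := by gcongr
      _ = _ := by ring
  have hyl : ∀ l, ‖y l‖ ≤ n * E * (s ^ (n + 1) * ((1 + 2 * L * F) * N)) := by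
    intro l
    have e1 : (B s).adjugate.mulVec ((B s).mulVec y) = (B s).det • y := by
      rw [Matrix.mulVec_mulVec, Matrix.adjugate_mul, Matrix.smul_mulVec, Matrix.one_mulVec]
    have e2 : y l = ∑ j, ((B s).det⁻¹ * (B s).adjugate l j) * (B s).mulVec y j := by
      have := congrFun e1 l
      simp only [Matrix.mulVec, dotProduct, Pi.smul_apply, smul_eq_mul] at this ⊢
      simp only [mul_assoc, ← Finset.mul_sum]
      rw [this]
      field_simp
    rw [e2]
    have : ∀ j ∈ Finset.univ, ‖((B s).det⁻¹ * (B s).adjugate l j) * (B s).mulVec y j‖ ≤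
        E * (s ^ (n + 1) * ((1 + 2 * L * F) * N)) := fun j _ => by
      rw [norm_mul]
      exact mul_le_mul ((h1 l j).trans (hE0 l j)) (hrhs j) (norm_nonneg _) hEn
    refine (norm_sum_le_of_le _ this).trans ?_
    simp [mul_assoc]
  have := hyl ⟨l, hl⟩
  rw [hy] at this
  simp only [norm_mul, norm_pow, Complex.norm_real, Real.norm_of_nonneg hs.le] at this
  have hp : 0 < s ^ (l + 1) := by positivity
  have hsp : s ^ (n + 1) ≤ s ^ (l + 1) * s := by
    rw [← pow_succ]
    exact pow_le_pow_of_le_one hs.le hs1 (by omega)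
  have h5 : ‖ν l‖ * s ^ (l + 1) ≤ (n * E * (1 + 2 * L * F) * s * N) * s ^ (l + 1) := by
    calc _ ≤ _ := this
      _ ≤ n * E * (s ^ (l + 1) * s * ((1 + 2 * L * F) * N)) := by gcongr
      _ = _ := by ring
  exact le_of_mul_le_mul_right h5 hp

end


/-! ### Numerators, denominators and the local form of the phase -/

namespace RationalPotential

open Polynomial

variable {P : ℕ} (u : RationalPotential P)

/-- `∏ₚ (X - zₚ)`. -/
def den : ℂ[X] := ∏ p, (X - C (u.z p))

/-- `∏ₚ (X - conj zₚ)`. -/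
def denBar : ℂ[X] := ∏ p, (X - C (star (u.z p)))

/-- `∏_{r ≠ p} (X - zᵣ)`. -/
def denErase (p : Fin P) : ℂ[X] := ∏ r ∈ Finset.univ.erase p, (X - C (u.z r))

/-- `∏_{r ≠ p} (X - conj zᵣ)`. -/
def denBarErase (p : Fin P) : ℂ[X] := ∏ r ∈ Finset.univ.erase p, (X - C (star (u.z r)))

/-- The numerator of `q`. -/
def num (lam : ℝ) (κ : ℂ) (v : Fin P → ℂ) : ℂ[X] :=
  C (κ * lam) * u.den + ∑ p, C (v p) * u.denErase p

/-- The numerator of `λ + u₀`. -/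
def hnum (lam : ℝ) : ℂ[X] :=
  C (lam : ℂ) * (u.den * u.denBar) +
    ∑ p, (C (u.c p) * (u.denErase p * u.denBar) + C (star (u.c p)) * (u.den * u.denBarErase p))

theorem den_eq (p : Fin P) : u.den = (X - C (u.z p)) * u.denErase p :=
  (Finset.mul_prod_erase Finset.univ (fun r => X - C (u.z r)) (Finset.mem_univ p)).symm

theorem denBar_eq (p : Fin P) : u.denBar = (X - C (star (u.z p))) * u.denBarErase p :=
  (Finset.mul_prod_erase Finset.univ (fun r => X - C (star (u.z r))) (Finset.mem_univ p)).symm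

theorem eval_den_ne_zero {z : ℂ} (hz : ∀ p, z ≠ u.z p) : u.den.eval z ≠ 0 := by
  rw [den, eval_prod]
  refine Finset.prod_ne_zero_iff.2 fun p _ => ?_
  simpa [sub_eq_zero] using hz p

theorem eval_denBar_ne_zero {z : ℂ} (hz : ∀ p, z ≠ star (u.z p)) : u.denBar.eval z ≠ 0 := by
  rw [denBar, eval_prod]
  refine Finset.prod_ne_zero_iff.2 fun p _ => ?_
  have := sub_ne_zero.2 (hz p)
  simpa using this

theorem q_eq_div (lam : ℝ) (κ : ℂ) (v : Fin P → ℂ) {z : ℂ} (hz : ∀ p, z ≠ u.z p) :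
    u.q lam κ v z = (u.num lam κ v).eval z / u.den.eval z := by
  have h0 := u.eval_den_ne_zero hz
  rw [q, num, eval_add, eval_mul, eval_C, eval_finsetSum, add_div, mul_div_cancel_right₀ _ h0,
    Finset.sum_div]
  congr 1
  refine Finset.sum_congr rfl fun p _ => ?_
  have h1 : u.den.eval z = (z - u.z p) * (u.denErase p).eval z := by
    rw [u.den_eq p, eval_mul]; simp
  have h2 := sub_ne_zero.2 (hz p)
  have h3 : (u.denErase p).eval z ≠ 0 := fun h => h0 (by rw [h1, h, mul_zero])
  rw [h1, eval_mul, eval_C]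
  field_simp

theorem add_uC_eq_div (lam : ℝ) {z : ℂ} (hz : ∀ p, z ≠ u.z p ∧ z ≠ star (u.z p)) :
    lam + u.uC z = (u.hnum lam).eval z / (u.den.eval z * u.denBar.eval z) := by
  have h0 := u.eval_den_ne_zero fun p => (hz p).1
  have h0' := u.eval_denBar_ne_zero fun p => (hz p).2
  rw [uC, hnum, eval_add, eval_mul, eval_C, eval_mul, eval_finsetSum, add_div,
    mul_div_cancel_right₀ _ (mul_ne_zero h0 h0'), Finset.sum_div]
  congr 1
  refine Finset.sum_congr rfl fun p _ => ?_
  have h1 : u.den.eval z = (z - u.z p) * (u.denErase p).eval z := by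
    rw [u.den_eq p, eval_mul]; simp
  have h1' : u.denBar.eval z = (z - star (u.z p)) * (u.denBarErase p).eval z := by
    rw [u.denBar_eq p, eval_mul]; simp
  have h2 := sub_ne_zero.2 (hz p).1
  have h2' := sub_ne_zero.2 (hz p).2
  have h3 : (u.denErase p).eval z ≠ 0 := fun h => h0 (by rw [h1, h, mul_zero])
  have h3' : (u.denBarErase p).eval z ≠ 0 := fun h => h0' (by rw [h1', h, mul_zero])
  simp only [eval_add, eval_mul, eval_C]
  rw [h1, h1']
  field_simp

theorem z_injective : Function.Injective u.z := fun _ _ h =>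
  u.z_re_strictMono.injective (congrArg Complex.re h)

theorem z_ne_star (p r : Fin P) : u.z p ≠ star (u.z r) := fun h => by
  have := congrArg Complex.im h
  simp only [Complex.star_def, Complex.conj_im] at this
  linarith [u.z_im_pos p, u.z_im_pos r]

/-- At z_p only the summand with coefficient c_p survives, so the zeros of the numerator of λ + u₀
avoid the poles. -/
theorem eval_hnum_z (lam : ℝ) (p : Fin P) : (u.hnum lam).eval (u.z p) ≠ 0 := by
  have hd : u.den.eval (u.z p) = 0 := by rw [u.den_eq p, eval_mul]; simp
  have he : ∀ r, r ≠ p → (u.denErase r).eval (u.z p) = 0 := fun r hr => by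
    rw [denErase, eval_prod]
    exact Finset.prod_eq_zero (Finset.mem_erase.2 ⟨hr.symm, Finset.mem_univ p⟩) (by simp)
  rw [hnum, eval_add, eval_mul, eval_mul, hd, zero_mul, mul_zero, zero_add, eval_finsetSum,
    Finset.sum_eq_single p]
  · simp only [eval_add, eval_mul, eval_C, hd, zero_mul, mul_zero, add_zero]
    refine mul_ne_zero (u.c_ne_zero p) (mul_ne_zero ?_ (u.eval_denBar_ne_zero (u.z_ne_star p)))
    rw [denErase, eval_prod]
    refine Finset.prod_ne_zero_iff.2 fun r hr => ?_
    have : u.z p ≠ u.z r := fun h => (Finset.mem_erase.1 hr).1 (u.z_injective h).symm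
    simpa [sub_eq_zero] using this
  · intro r _ hr
    simp only [eval_add, eval_mul, eval_C, hd, he r hr, zero_mul, mul_zero, add_zero]
  · simp

theorem natDegree_den : u.den.natDegree = P := by
  rw [den, natDegree_prod_of_monic _ _ fun p _ => monic_X_sub_C _]
  simp

theorem natDegree_denErase_lt (p : Fin P) : (u.denErase p).natDegree < P := by
  rw [denErase, natDegree_prod_of_monic _ _ fun p _ => monic_X_sub_C _]
  simpa using p.pos

theorem natDegree_num_le (lam : ℝ) (κ : ℂ) (v : Fin P → ℂ) : (u.num lam κ v).natDegree ≤ P := by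
  refine natDegree_add_le_of_degree_le ?_ ?_
  · exact (natDegree_C_mul_le _ _).trans u.natDegree_den.le
  · refine natDegree_sum_le_of_forall_le _ _ fun p _ => ?_
    exact (natDegree_C_mul_le _ _).trans (u.natDegree_denErase_lt p).le

/-- Taylor coefficients of the numerator of `q`. -/
def nu (lam : ℝ) (ζ : ℂ) (κ : ℂ) (v : Fin P → ℂ) (l : ℕ) : ℂ :=
  (taylor ζ (u.num lam κ v)).coeff l

theorem eval_num_add (lam : ℝ) (ζ τ : ℂ) (κ : ℂ) (v : Fin P → ℂ) {L : ℕ} (hL : P < L) :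
    (u.num lam κ v).eval (ζ + τ) = ∑ l ∈ Finset.range L, u.nu lam ζ κ v l * τ ^ l := by
  rw [add_comm, ← taylor_eval, eval_eq_sum_range' (n := L)]
  · rfl
  · rw [natDegree_taylor]
    exact (u.natDegree_num_le lam κ v).trans_lt hL

theorem exists_bound_nu (lam : ℝ) (ζ : ℂ) : ∃ C, 0 ≤ C ∧ ∀ (κ : ℂ) (v : Fin P → ℂ) l,
    ‖u.nu lam ζ κ v l‖ ≤ C * size κ v := by
  set K : ℕ → ℝ := fun l => |lam| * ‖(taylor ζ u.den).coeff l‖ +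
    ∑ p, ‖(taylor ζ (u.denErase p)).coeff l‖ with hK
  have hK0 : ∀ l, 0 ≤ K l := fun l => by positivity
  refine ⟨∑ l ∈ Finset.range (P + 1), K l, Finset.sum_nonneg fun l _ => hK0 l, fun κ v l => ?_⟩
  have hN := size_nonneg κ v
  rcases Nat.lt_or_ge l (P + 1) with hl | hl
  · have h1 : ‖u.nu lam ζ κ v l‖ ≤ K l * size κ v := by
      rw [nu, num]
      simp only [map_add, taylor_mul, taylor_C, coeff_add, coeff_C_mul, map_sum, finsetSum_coeff]
      refine (norm_add_le _ _).trans ?_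
      rw [hK, add_mul]
      refine add_le_add ?_ ?_
      · rw [norm_mul, norm_mul, Complex.norm_real, Real.norm_eq_abs]
        have := norm_le_size κ v
        calc ‖κ‖ * |lam| * ‖(taylor ζ u.den).coeff l‖
            ≤ size κ v * |lam| * ‖(taylor ζ u.den).coeff l‖ := by gcongr
          _ = _ := by ring
      · rw [Finset.sum_mul]
        refine norm_sum_le_of_le _ fun p _ => ?_
        rw [norm_mul, mul_comm]
        have := norm_apply_le_size κ v p
        gcongr
    refine h1.trans ?_
    gcongr
    exact Finset.single_le_sum (f := K) (fun l _ => hK0 l) (Finset.mem_range.2 hl)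
  · rw [nu, coeff_eq_zero_of_natDegree_lt, norm_zero]
    · have := Finset.sum_nonneg fun l (_ : l ∈ Finset.range (P + 1)) => hK0 l
      positivity
    · rw [natDegree_taylor]
      exact (u.natDegree_num_le lam κ v).trans_lt (by omega)

/-- A local phase function at a zero `ζ` of `λ + u₀`. -/
structure LocalPhase (lam : ℝ) (ζ : ℂ) (M : ℕ) (δ ρ : ℝ) (θ G : ℂ → ℂ) : Prop where
  δ_pos : 0 < δ
  δ_lt : δ < ρ
  away : ∀ τ ∈ Metric.ball (0 : ℂ) ρ, ∀ p, ζ + τ ≠ u.z p ∧ ζ + τ ≠ star (u.z p)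
  deriv : ∀ τ ∈ Metric.ball (0 : ℂ) ρ, HasDerivAt θ (lam + u.uC (ζ + τ)) τ
  eq : ∀ τ ∈ Metric.ball (0 : ℂ) ρ, θ τ = τ ^ M * G τ
  cont : ContinuousOn G (Metric.closedBall 0 δ)
  ne : G 0 ≠ 0
  near : ∀ τ ∈ Metric.closedBall (0 : ℂ) δ, ‖G τ - G 0‖ ≤ ‖G 0‖ / 2

theorem hnum_ne_zero (hP : 0 < P) (lam : ℝ) : u.hnum lam ≠ 0 := fun h =>
  u.eval_hnum_z lam ⟨0, hP⟩ (by rw [h, eval_zero])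

/-- Factorisation of `λ + u₀` at a point of the closed upper half-plane off the poles. -/
theorem exists_factor (hP : 0 < P) (lam : ℝ) {ζ : ℂ}
    (hζ : ∀ p, ζ ≠ u.z p ∧ ζ ≠ star (u.z p)) : ∃ (ρ : ℝ) (g : ℂ → ℂ), 0 < ρ ∧
      (∀ τ ∈ Metric.ball (0 : ℂ) ρ, ∀ p, ζ + τ ≠ u.z p ∧ ζ + τ ≠ star (u.z p)) ∧
      DifferentiableOn ℂ g (Metric.ball 0 ρ) ∧ g 0 ≠ 0 ∧
      ∀ τ ∈ Metric.ball (0 : ℂ) ρ,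
        lam + u.uC (ζ + τ) = τ ^ (u.hnum lam).rootMultiplicity ζ * g τ := by
  obtain ⟨R, hR, hRd⟩ := exists_eq_pow_rootMultiplicity_mul_and_not_dvd (u.hnum lam)
    (u.hnum_ne_zero hP lam) ζ
  have hR0 : R.eval ζ ≠ 0 := fun h => hRd (dvd_iff_isRoot.2 h)
  have hopen : IsOpen {τ : ℂ | ∀ p, ζ + τ ≠ u.z p ∧ ζ + τ ≠ star (u.z p)} := by
    simp only [Set.ofPred_forall]
    refine isOpen_iInter_of_finite fun p => ?_
    have hc : Continuous fun τ : ℂ => ζ + τ := by fun_prop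
    exact (isOpen_ne.preimage hc).inter (isOpen_ne.preimage hc)
  obtain ⟨ρ, hρ, hball⟩ := Metric.isOpen_iff.1 hopen 0 (by simpa using hζ)
  have hne : ∀ τ ∈ Metric.ball (0 : ℂ) ρ, u.den.eval (ζ + τ) * u.denBar.eval (ζ + τ) ≠ 0 :=
    fun τ hτ => mul_ne_zero (u.eval_den_ne_zero fun p => (hball hτ p).1)
      (u.eval_denBar_ne_zero fun p => (hball hτ p).2)
  have hpd : ∀ p : ℂ[X], Differentiable ℂ fun τ : ℂ => p.eval (ζ + τ) := fun p =>
    p.differentiable.comp (by fun_prop)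
  refine ⟨ρ, fun τ => R.eval (ζ + τ) / (u.den.eval (ζ + τ) * u.denBar.eval (ζ + τ)), hρ, hball,
    ?_, ?_, fun τ hτ => ?_⟩
  · exact (hpd R).differentiableOn.div ((hpd _).mul (hpd _)).differentiableOn hne
  · have := hne 0 (Metric.mem_ball_self hρ)
    simp only [add_zero] at this ⊢
    exact div_ne_zero hR0 this
  · rw [u.add_uC_eq_div lam (hball hτ)]
    conv_lhs => rw [hR]
    rw [eval_mul, eval_pow]
    simp [mul_div_assoc]

/-- The primitive of τ^m g vanishing at 0 has a zero of order m + 1 there, and its leading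
coefficient is g(0)/(m + 1). The radius ρ is fixed first so that δ can still be shrunk afterwards.
-/
theorem exists_localPhase (hP : 0 < P) (lam : ℝ) {ζ : ℂ}
    (hζ : ∀ p, ζ ≠ u.z p ∧ ζ ≠ star (u.z p)) : ∃ θ G g : ℂ → ℂ, ∃ ρ : ℝ,
      ContinuousAt g 0 ∧ ((u.hnum lam).rootMultiplicity ζ + 1) * G 0 = g 0 ∧ 0 < ρ ∧
      (∀ τ ∈ Metric.ball (0 : ℂ) ρ,
        lam + u.uC (ζ + τ) = τ ^ (u.hnum lam).rootMultiplicity ζ * g τ) ∧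
      ∀ δ, 0 < δ → δ < ρ →
        u.LocalPhase lam ζ ((u.hnum lam).rootMultiplicity ζ + 1) δ ρ θ G := by
  obtain ⟨ρ₀, g, hρ₀, haw, hgd, hg0, hfac⟩ := u.exists_factor hP lam hζ
  set m := (u.hnum lam).rootMultiplicity ζ
  have hd : DifferentiableOn ℂ (fun τ => τ ^ m * g τ) (Metric.ball 0 ρ₀) := by fun_prop
  obtain ⟨θ₁, hθ₁⟩ := exists_primitive_of_convex (convex_ball (0 : ℂ) ρ₀) Metric.isOpen_ball hd
  set θ : ℂ → ℂ := fun τ => θ₁ τ - θ₁ 0 with hθdef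
  have hθ : ∀ τ ∈ Metric.ball (0 : ℂ) ρ₀, HasDerivAt θ (τ ^ m * g τ) τ := fun τ hτ =>
    (hθ₁ τ hτ).sub_const _
  have hθ0 : θ 0 = 0 := sub_self _
  have h0 : (0 : ℂ) ∈ Metric.ball (0 : ℂ) ρ₀ := Metric.mem_ball_self hρ₀
  have hnb : Metric.ball (0 : ℂ) ρ₀ ∈ 𝓝 (0 : ℂ) := Metric.ball_mem_nhds _ hρ₀
  have hθa : AnalyticAt ℂ θ 0 := DifferentiableOn.analyticAt
    (fun τ hτ => (hθ τ hτ).differentiableAt.differentiableWithinAt) hnb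
  have hga : AnalyticAt ℂ g 0 := hgd.analyticAt hnb
  -- A primitive vanishing identically near 0 would force τ^m g = 0, although g(0) ≠ 0.
  have hfin : analyticOrderAt θ 0 ≠ ⊤ := by
    intro htop
    have hz := analyticOrderAt_eq_top.1 htop
    have hd0 : ∀ᶠ τ in 𝓝 (0 : ℂ), τ ^ m * g τ = 0 := by
      filter_upwards [hz.eventually_nhds, hnb] with τ hτ hτb
      have h1 : HasDerivAt θ 0 τ := (hasDerivAt_const τ (0 : ℂ)).congr_of_eventuallyEq hτ
      exact (hθ τ hτb).unique h1
    have hgne : ∀ᶠ τ in 𝓝[≠] (0 : ℂ), g τ ≠ 0 :=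
      (hga.continuousAt.eventually_ne hg0).filter_mono nhdsWithin_le_nhds
    obtain ⟨τ, hτ1, hτ2, hτ3⟩ := ((hd0.filter_mono nhdsWithin_le_nhds).and
      (hgne.and self_mem_nhdsWithin)).exists
    exact (mul_ne_zero (pow_ne_zero _ hτ3) hτ2) hτ1
  obtain ⟨n, hn⟩ := ENat.ne_top_iff_exists.1 hfin
  obtain ⟨G, hGa, hG0, hGeq⟩ := (hθa.analyticOrderAt_eq_natCast).1 hn.symm
  simp only [sub_zero, smul_eq_mul] at hGeq
  have hn0 : n ≠ 0 := by
    rintro rfl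
    have := hGeq.self_of_nhds
    rw [hθ0, pow_zero, one_mul] at this
    exact hG0 this.symm
  obtain ⟨k, rfl⟩ := Nat.exists_eq_succ_of_ne_zero hn0
  -- Differentiating θ = τ^{k+1}G gives a second factorisation of θ'. Comparing orders yields k = m,
  -- and comparing the cofactors at 0 gives (m + 1)G(0) = g(0).
  have hder : ∀ᶠ τ in 𝓝 (0 : ℂ), τ ^ m * g τ = τ ^ k * ((k + 1) * G τ + τ * deriv G τ) := by
    filter_upwards [hGeq.eventually_nhds, hnb, hGa.eventually_analyticAt] with τ hτ hτb hGτ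
    have h1 := ((hasDerivAt_pow (k + 1) τ).mul hGτ.differentiableAt.hasDerivAt)
    have h2 := (hθ τ hτb).unique (h1.congr_of_eventuallyEq hτ)
    rw [h2]
    simp only [Nat.add_sub_cancel]
    push_cast
    ring
  have hG1 : AnalyticAt ℂ (fun τ => (k + 1) * G τ + τ * deriv G τ) 0 := by
    have := hGa.deriv
    fun_prop
  have hk1 : ((k : ℂ) + 1) ≠ 0 := by exact_mod_cast Nat.succ_ne_zero k
  have hmk : m = k := by
    have ha : AnalyticAt ℂ (fun τ => τ ^ m * g τ) 0 := by fun_prop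
    have e1 : analyticOrderAt (fun τ => τ ^ m * g τ) 0 = m :=
      ha.analyticOrderAt_eq_natCast.2 ⟨g, hga, hg0, by simp⟩
    have e2 : analyticOrderAt (fun τ => τ ^ m * g τ) 0 = k :=
      ha.analyticOrderAt_eq_natCast.2 ⟨_, hG1, by simpa using ⟨hk1, hG0⟩, by simpa using hder⟩
    exact_mod_cast e1.symm.trans e2
  obtain rfl : m = k := hmk
  have hG0eq : ((m : ℂ) + 1) * G 0 = g 0 := by
    have hev : ∀ᶠ τ in 𝓝[≠] (0 : ℂ), g τ = (m + 1) * G τ + τ * deriv G τ := by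
      filter_upwards [hder.filter_mono nhdsWithin_le_nhds, self_mem_nhdsWithin] with τ h1 h2
      exact mul_left_cancel₀ (pow_ne_zero m h2) h1
    have t1 := (hga.continuousAt.tendsto).mono_left (nhdsWithin_le_nhds (s := {0}ᶜ))
    have t2 := (hG1.continuousAt.tendsto).mono_left (nhdsWithin_le_nhds (s := {0}ᶜ))
    have := tendsto_nhds_unique (t1.congr' hev) t2
    simpa using this.symm
  have hnear : ∀ᶠ τ in 𝓝 (0 : ℂ), ‖G τ - G 0‖ ≤ ‖G 0‖ / 2 := by
    have : Tendsto (fun τ => ‖G τ - G 0‖) (𝓝 0) (𝓝 0) := by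
      have := (hGa.continuousAt.tendsto.sub_const (G 0)).norm
      simpa using this
    exact (this.eventually_lt_const (half_pos (norm_pos_iff.2 hG0))).mono fun _ h => h.le
  obtain ⟨ρ, hρ, hball⟩ := Metric.eventually_nhds_iff_ball.1
    (((hGeq.and hGa.eventually_analyticAt).and hnear).and hnb)
  refine ⟨θ, G, g, ρ, hga.continuousAt, hG0eq, hρ, fun τ hτ => hfac τ (hball τ hτ).2,
    fun δ hδ hδρ => ?_⟩
  have hsub : Metric.closedBall (0 : ℂ) δ ⊆ Metric.ball 0 ρ :=
    Metric.closedBall_subset_ball hδρ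
  exact {
    δ_pos := hδ
    δ_lt := hδρ
    away := fun τ hτ => haw τ (hball τ hτ).2
    deriv := fun τ hτ => by rw [hfac τ (hball τ hτ).2]; exact hθ τ (hball τ hτ).2
    eq := fun τ hτ => (hball τ hτ).1.1.1
    cont := fun τ hτ => (hball τ (hsub hτ)).1.1.2.continuousAt.continuousWithinAt
    ne := hG0
    near := fun τ hτ => (hball τ (hsub hτ)).1.2 }

end RationalPotential


/-- From 1 + x ≤ e^x at x = b/ε. At the far end of a valley this absorbs the 1/ε in the bound for
the Jost function. -/
theorem exp_neg_div_div_le {b ε : ℝ} (hb : 0 < b) (hε : 0 < ε) :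
    Real.exp (-(b / ε)) / ε ≤ 1 / b := by
  rw [div_le_div_iff₀ hε hb, one_mul, Real.exp_neg, inv_mul_le_iff₀ (Real.exp_pos _)]
  have := Real.add_one_le_exp (b / ε)
  have h2 : b = b / ε * ε := by field_simp
  nlinarith

/-! ### Valleys in the upper half-plane, and small Taylor coefficients -/

namespace RationalPotential

open Polynomial

variable {P : ℕ} (u : RationalPotential P)

/-- The amplitude `1 / ∏ₚ (X - zₚ)` centred at `ζ`. -/
def amp (ζ : ℂ) (τ : ℂ) : ℂ := (u.den.eval (ζ + τ))⁻¹

variable {u}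
variable {lam : ℝ} {ζ : ℂ} {M : ℕ} {δ ρ : ℝ} {θ G : ℂ → ℂ}

namespace LocalPhase

theorem mem_ball (h : u.LocalPhase lam ζ M δ ρ θ G) {τ : ℂ} (hτ : ‖τ‖ ≤ δ) :
    τ ∈ Metric.ball (0 : ℂ) ρ := by
  rw [mem_ball_zero_iff]; exact hτ.trans_lt h.δ_lt

theorem differentiableAt_amp (h : u.LocalPhase lam ζ M δ ρ θ G) {τ : ℂ}
    (hτ : τ ∈ Metric.ball (0 : ℂ) ρ) : DifferentiableAt ℂ (u.amp ζ) τ := by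
  have hp : DifferentiableAt ℂ (fun τ : ℂ => u.den.eval (ζ + τ)) τ :=
    (u.den.differentiable.comp (by fun_prop : Differentiable ℂ fun τ : ℂ => ζ + τ)) τ
  exact hp.inv (u.eval_den_ne_zero fun p => (h.away τ hτ p).1)

theorem continuousOn_amp (h : u.LocalPhase lam ζ M δ ρ θ G) :
    ContinuousOn (u.amp ζ) (Metric.closedBall 0 δ) := fun _ hτ =>
  (h.differentiableAt_amp (h.mem_ball (mem_closedBall_zero_iff.1 hτ))).continuousAt.continuousWithinAt

theorem amp_zero_ne (h : u.LocalPhase lam ζ M δ ρ θ G) : u.amp ζ 0 ≠ 0 :=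
  inv_ne_zero (u.eval_den_ne_zero fun p =>
    (h.away 0 (Metric.mem_ball_self (h.δ_pos.trans h.δ_lt)) p).1)

/-- Within distance δ the function G varies by at most |G(0)|/2, so half of the decay at the centre
remains along the whole ray. -/
theorem re_le (h : u.LocalPhase lam ζ M δ ρ θ G) {t : ℂ} (htn : ‖t‖ = 1)
    (ht : -Complex.I * t ^ M * G 0 = -(‖G 0‖ : ℂ)) {r : ℝ} (hr : r ∈ Set.Icc 0 δ) :
    (-Complex.I * t ^ M * G (r * t)).re ≤ -(‖G 0‖ / 2) := by
  have hm : (r * t : ℂ) ∈ Metric.closedBall (0 : ℂ) δ := by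
    rw [mem_closedBall_zero_iff, norm_mul, htn, mul_one, Complex.norm_real,
      Real.norm_of_nonneg hr.1]
    exact hr.2
  have e : -Complex.I * t ^ M * G (r * t) =
      -(‖G 0‖ : ℂ) + -Complex.I * t ^ M * (G (r * t) - G 0) := by rw [← ht]; ring
  have h2 : (-Complex.I * t ^ M * (G (r * t) - G 0)).re ≤ ‖G 0‖ / 2 := by
    refine (Complex.re_le_norm _).trans ?_
    rw [norm_mul, norm_mul, norm_neg, Complex.norm_I, one_mul, norm_pow, htn, one_pow, one_mul]
    exact h.near _ hm
  rw [e, Complex.add_re, ← Complex.ofReal_neg, Complex.ofReal_re]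
  linarith

theorem θ_zero (h : u.LocalPhase lam ζ M δ ρ θ G) (hM : M ≠ 0) : θ 0 = 0 := by
  rw [h.eq 0 (Metric.mem_ball_self (h.δ_pos.trans h.δ_lt)), zero_pow hM, zero_mul]

variable {ε : ℝ} {κ : ℂ} {v : Fin P → ℂ} {w : ℂ → ℂ}

theorem q_eq_sum (h : u.LocalPhase lam ζ M δ ρ θ G) {τ : ℂ} (hτ : τ ∈ Metric.ball (0 : ℂ) ρ)
    {L : ℕ} (hL : P < L) : u.q lam κ v (ζ + τ) =
      ∑ l ∈ Finset.range L, u.nu lam ζ κ v l * (τ ^ l * u.amp ζ τ) := by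
  rw [u.q_eq_div lam κ v fun p => (h.away τ hτ p).1, u.eval_num_add lam ζ τ κ v hL, amp,
    div_eq_mul_inv, Finset.sum_mul]
  exact Finset.sum_congr rfl fun l _ => by ring

/-- The numerator of q is a polynomial of degree at most P, so its Taylor expansion at ζ is exact
once L > P: the monomial integrals add up to the phase integral of q with no remainder. -/
theorem sum_rayInt (h : u.LocalPhase lam ζ M δ ρ θ G) {t : ℂ} (htn : ‖t‖ = 1) {L : ℕ}
    (hL : P < L) : ∑ l ∈ Finset.range L, u.nu lam ζ κ v l * rayInt G (u.amp ζ) M δ ε t l =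
      ∫ r in (0 : ℝ)..δ, Complex.exp (-Complex.I * θ (0 + r * t) / ε) *
        (u.q lam κ v (ζ + (0 + r * t)) * t) := by
  have hm : ∀ r ∈ Set.uIcc 0 δ, ‖(r * t : ℂ)‖ ≤ δ := fun r hr => by
    rw [Set.uIcc_of_le h.δ_pos.le] at hr
    rw [norm_mul, htn, mul_one, Complex.norm_real, Real.norm_of_nonneg hr.1]
    exact hr.2
  have hmt : Set.MapsTo (fun r : ℝ => (r * t : ℂ)) (Set.uIcc 0 δ) (Metric.closedBall 0 δ) :=
    fun r hr => mem_closedBall_zero_iff.2 (hm r hr)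
  have hc : ContinuousOn (fun r : ℝ => (r * t : ℂ)) (Set.uIcc 0 δ) := by fun_prop
  have h1 := h.cont.comp hc hmt
  have h2 := h.continuousOn_amp.comp hc hmt
  simp only [Function.comp_def] at h1 h2
  simp only [rayInt, ← intervalIntegral.integral_const_mul]
  rw [← intervalIntegral.integral_finsetSum]
  · refine intervalIntegral.integral_congr fun r hr => ?_
    simp only [zero_add]
    rw [h.q_eq_sum (h.mem_ball (hm r hr)) hL, h.eq _ (h.mem_ball (hm r hr)), Finset.sum_mul,
      Finset.mul_sum]
    exact Finset.sum_congr rfl fun l _ => by ring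
  · intro l _
    refine ContinuousOn.intervalIntegrable ?_
    exact continuousOn_const.mul ((((continuousOn_const.mul ((hc.pow M).mul h1)).div_const _).cexp).mul
      (((hc.pow l).mul h2).mul continuousOn_const))

/-- The oscillating factor times the Jost function. -/
theorem hasDerivAt_exp_mul (h : u.LocalPhase lam ζ M δ ρ θ G) (hε : 0 < ε)
    (hw : u.IsJost ε lam κ v w) {a t : ℂ} {r : ℝ} (hr : a + r * t ∈ Metric.ball (0 : ℂ) ρ)
    (hi : 0 ≤ (ζ + (a + r * t)).im) :
    HasDerivAt (fun r : ℝ => Complex.I * ε *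
        (Complex.exp (-Complex.I * θ (a + r * t) / ε) * w (ζ + (a + r * t))))
      (Complex.exp (-Complex.I * θ (a + r * t) / ε) * (u.q lam κ v (ζ + (a + r * t)) * t)) r := by
  have hε' : (ε : ℂ) ≠ 0 := by exact_mod_cast hε.ne'
  have h1 : HasDerivAt (fun τ => Complex.exp (-Complex.I * θ τ / ε)) _ (a + r * t) :=
    ((((h.deriv _ hr).const_mul (-Complex.I)).div_const (ε : ℂ))).cexp
  have h2 : HasDerivAt (fun τ => w (ζ + τ)) _ (a + r * t) :=
    ((hw.diff _ hi).hasDerivAt).comp_const_add ζ (a + r * t)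
  have h3 := (hasDerivAt_comp_line ((h1.mul h2))).const_mul (Complex.I * (ε : ℂ))
  refine h3.congr_deriv ?_
  rw [← hw.ode _ hi fun p => (h.away _ hr p).1]
  generalize a + (r : ℂ) * t = b
  field_simp
  linear_combination (-t * w (ζ + b) * (lam + u.uC (ζ + b))) * Complex.I_sq

theorem continuousOn_exp_mul_q (h : u.LocalPhase lam ζ M δ ρ θ G) {a t : ℂ} {s : Set ℝ}
    (hs : ∀ r ∈ s, a + (r : ℂ) * t ∈ Metric.ball (0 : ℂ) ρ) :
    ContinuousOn (fun r : ℝ => Complex.exp (-Complex.I * θ (a + r * t) / ε) *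
      (u.q lam κ v (ζ + (a + r * t)) * t)) s := by
  intro r hr
  have hb := hs r hr
  have h1 : ContinuousAt (fun r : ℝ => θ (a + r * t)) r :=
    (hasDerivAt_comp_line (h.deriv _ hb)).continuousAt
  have h2 : ContinuousAt (fun r : ℝ => u.q lam κ v (ζ + (a + r * t))) r :=
    (hasDerivAt_comp_line (w := fun τ => u.q lam κ v (ζ + τ))
      ((u.hasDerivAt_q lam κ v fun p => (h.away _ hb p).1).comp_const_add ζ _)).continuousAt
  exact ((((continuousAt_const.mul h1).div_const _).cexp).mul
    (h2.mul continuousAt_const)).continuousWithinAt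

/-- By the Jost equation the integrand is the derivative of iε e^{-iθ/ε}w along the line. This is
available only where w is holomorphic, that is, on segments in the closed upper half-plane. -/
theorem integral_eq_of_upper (h : u.LocalPhase lam ζ M δ ρ θ G) (hε : 0 < ε)
    (hw : u.IsJost ε lam κ v w) {a t : ℂ} {b c : ℝ}
    (hb : ∀ r ∈ Set.uIcc b c, a + (r : ℂ) * t ∈ Metric.ball (0 : ℂ) ρ)
    (hi : ∀ r ∈ Set.uIcc b c, 0 ≤ (ζ + (a + (r : ℂ) * t)).im) :
    ∫ r in b..c, Complex.exp (-Complex.I * θ (a + r * t) / ε) *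
        (u.q lam κ v (ζ + (a + r * t)) * t) =
      Complex.I * ε * (Complex.exp (-Complex.I * θ (a + c * t) / ε) * w (ζ + (a + c * t))) -
      Complex.I * ε * (Complex.exp (-Complex.I * θ (a + b * t) / ε) * w (ζ + (a + b * t))) := by
  refine intervalIntegral.integral_eq_sub_of_hasDerivAt
    (fun r hr => h.hasDerivAt_exp_mul hε hw (hb r hr) (hi r hr)) ?_
  exact (h.continuousOn_exp_mul_q hb).intervalIntegrable

/-- At ζ the boundary term is −iεw(ζ), the same for all rays. At the far end w = O(1/ε) meets an
exponentially small factor. -/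
theorem exists_bound_upper_ray (h : u.LocalPhase lam ζ M δ ρ θ G) (hM : M ≠ 0) (hlam : 0 < lam)
    {t : ℂ} (htn : ‖t‖ = 1) (ht : -Complex.I * t ^ M * G 0 = -(‖G 0‖ : ℂ))
    (hti : ∀ r ∈ Set.Icc 0 δ, 0 ≤ (ζ + (r : ℂ) * t).im) {L : ℕ} (hL : P < L) :
    ∃ C, ∀ ε κ v w, 0 < ε → ε ≤ 1 → u.IsJost ε lam κ v w →
      ‖(∑ l ∈ Finset.range L, u.nu lam ζ κ v l * rayInt G (u.amp ζ) M δ ε t l) +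
        Complex.I * ε * w ζ‖ ≤ C * ε * size κ v := by
  obtain ⟨C, hC, hw⟩ := u.exists_bound_upper hlam
  set b : ℝ := ‖G 0‖ / 2 * δ ^ M with hb
  have hG0 : 0 < ‖G 0‖ := norm_pos_iff.2 h.ne
  have hδ := h.δ_pos
  have hb0 : 0 < b := by positivity
  refine ⟨C / b, fun ε κ v w hε hε1 hJ => ?_⟩
  have hN := size_nonneg κ v
  have hm : ∀ r ∈ Set.uIcc 0 δ, ‖(r * t : ℂ)‖ ≤ δ := fun r hr => by
    rw [Set.uIcc_of_le h.δ_pos.le] at hr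
    rw [norm_mul, htn, mul_one, Complex.norm_real, Real.norm_of_nonneg hr.1]
    exact hr.2
  rw [h.sum_rayInt htn hL, h.integral_eq_of_upper hε hJ
    (fun r hr => h.mem_ball (by simpa using hm r hr))
    (fun r hr => by rw [zero_add]; exact hti r (by rwa [Set.uIcc_of_le h.δ_pos.le] at hr))]
  simp only [zero_add, Complex.ofReal_zero, zero_mul, h.θ_zero hM, mul_zero, zero_div,
    Complex.exp_zero, one_mul, add_zero, sub_add_cancel]
  have hδm : δ ∈ Set.Icc 0 δ := ⟨h.δ_pos.le, le_rfl⟩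
  have hre : (-Complex.I * θ (δ * t) / ε).re ≤ -(b / ε) := by
    have e : -Complex.I * θ (δ * t) / ε =
        ((δ ^ M / ε : ℝ) : ℂ) * (-Complex.I * t ^ M * G (δ * t)) := by
      rw [h.eq _ (h.mem_ball (hm δ Set.right_mem_uIcc)), mul_pow]
      push_cast
      ring
    rw [e, Complex.re_ofReal_mul]
    have := h.re_le htn ht hδm
    have h2 : 0 ≤ δ ^ M / ε := by positivity
    calc _ ≤ δ ^ M / ε * -(‖G 0‖ / 2) := mul_le_mul_of_nonneg_left this h2
      _ = _ := by rw [hb]; ring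
  rw [norm_mul, norm_mul, norm_mul, Complex.norm_I, one_mul, Complex.norm_real,
    Real.norm_of_nonneg hε.le, Complex.norm_exp]
  have h1 := hw ε κ v w hε hε1 hJ _ (hti δ hδm)
  calc ε * (Real.exp (-Complex.I * θ (δ * t) / ε).re * ‖w (ζ + δ * t)‖)
      ≤ ε * (Real.exp (-(b / ε)) * (C * size κ v / ε)) := by gcongr
    _ = (Real.exp (-(b / ε)) / ε) * (C * ε * size κ v) := by ring
    _ ≤ 1 / b * (C * ε * size κ v) :=
      mul_le_mul_of_nonneg_right (exp_neg_div_div_le hb0 hε) (by positivity)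
    _ = _ := by ring

end LocalPhase

variable (u) in
/-- The first `n` Taylor coefficients at `ζ` of the numerator of the right-hand side of the Jost
equation tend to zero with `ε`, uniformly relative to the size of the data. -/
def CoeffSmall (lam : ℝ) (ζ : ℂ) (n : ℕ) : Prop :=
  ∀ l < n, ∀ η > 0, ∃ ε₀ > 0, ∀ (ε : ℝ) (κ : ℂ) (v : Fin P → ℂ) (w : ℂ → ℂ), 0 < ε → ε < ε₀ →
    u.IsJost ε lam κ v w → ‖u.nu lam ζ κ v l‖ ≤ η * size κ v

/-- The integrals along all n + 1 rays agree up to O(ε) because each is −iεw(ζ) + O(ε). The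
comparison lemma with s = ε^{1/M} then bounds the coefficients by O(s) times the size of the data.
-/
theorem LocalPhase.coeffSmall (h : u.LocalPhase lam ζ M δ ρ θ G) {n : ℕ} (hn : n + 1 ≤ M)
    {t : Fin (n + 1) → ℂ} (hti : Function.Injective t) (htn : ∀ j, ‖t j‖ = 1)
    (ht : ∀ j, -Complex.I * t j ^ M * G 0 = -(‖G 0‖ : ℂ))
    (hb : ∀ j, ∀ L, P < L → ∃ C, ∀ ε κ v w, 0 < ε → ε ≤ 1 → u.IsJost ε lam κ v w →
      ‖(∑ l ∈ Finset.range L, u.nu lam ζ κ v l * rayInt G (u.amp ζ) M δ ε (t j) l) +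
        Complex.I * ε * w ζ‖ ≤ C * ε * size κ v) : u.CoeffSmall lam ζ n := by
  have hL : P < P + 1 + n := by omega
  choose C hC using fun j => hb j (P + 1 + n) hL
  obtain ⟨B, hB, hν⟩ := u.exists_bound_nu lam ζ
  obtain ⟨E, hE⟩ := (Set.finite_range C).bddAbove
  have hEj : ∀ j, C j ≤ max E 0 := fun j => (hE ⟨j, rfl⟩).trans (le_max_left _ _)
  have hE0 : 0 ≤ max E 0 := le_max_right _ _
  set K := B + 2 * max E 0 with hK
  obtain ⟨A, s₀, hs₀, hA⟩ := coeff_small_of_rayInt (L := P + 1 + n) h.δ_pos hn (by omega) h.cont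
    h.continuousOn_amp h.ne h.amp_zero_ne hti htn ht
    (fun j r hr => h.re_le (htn j) (ht j) hr)
  intro l hl η hη
  have hM : M ≠ 0 := by omega
  have hMr : (0 : ℝ) < 1 / M := by
    have : (0 : ℝ) < M := by exact_mod_cast Nat.pos_of_ne_zero hM
    positivity
  have hlim : Tendsto (fun ε : ℝ => ε ^ (1 / (M : ℝ))) (𝓝[>] 0) (𝓝 0) := by
    have := (Real.continuousAt_rpow_const 0 (1 / (M : ℝ)) (Or.inr hMr.le)).tendsto
    rw [Real.zero_rpow hMr.ne'] at this
    exact this.mono_left nhdsWithin_le_nhds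
  have hlim2 : Tendsto (fun ε : ℝ => A * ε ^ (1 / (M : ℝ)) * K) (𝓝[>] 0) (𝓝 0) := by
    simpa using (hlim.const_mul A).mul_const K
  obtain ⟨ε₀, hε₀, hsub⟩ := mem_nhdsGT_iff_exists_Ioo_subset.1
    ((hlim.eventually_lt_const hs₀).and (hlim2.eventually_lt_const hη))
  refine ⟨min ε₀ 1, lt_min hε₀ one_pos, fun ε κ v w hε hεlt hJ => ?_⟩
  have hN := size_nonneg κ v
  obtain ⟨h1, h2⟩ := hsub ⟨hε, hεlt.trans_le (min_le_left _ _)⟩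
  have hε1 : ε ≤ 1 := hεlt.le.trans (min_le_right _ _)
  set s := ε ^ (1 / (M : ℝ)) with hs
  have hs0 : 0 < s := Real.rpow_pos_of_pos hε _
  have hsM : s ^ M = ε := by
    rw [hs, one_div, Real.rpow_inv_natCast_pow hε.le hM]
  have hle : B * size κ v ≤ K * size κ v := by
    gcongr; rw [hK]; linarith
  have := hA s hs0 h1 (u.nu lam ζ κ v) (K * size κ v) (fun l => (hν κ v l).trans hle) (by
    intro i j
    rw [hsM]
    have a := hC i ε κ v w hε hε1 hJ
    have b := hC j ε κ v w hε hε1 hJ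
    have e := norm_sub_le
      ((∑ l ∈ Finset.range (P + 1 + n), u.nu lam ζ κ v l * rayInt G (u.amp ζ) M δ ε (t i) l) +
        Complex.I * ε * w ζ)
      ((∑ l ∈ Finset.range (P + 1 + n), u.nu lam ζ κ v l * rayInt G (u.amp ζ) M δ ε (t j) l) +
        Complex.I * ε * w ζ)
    rw [add_sub_add_right_eq_sub] at e
    refine e.trans ((add_le_add a b).trans ?_)
    have hi := hEj i
    have hj := hEj j
    calc C i * ε * size κ v + C j * ε * size κ v
        ≤ max E 0 * ε * size κ v + max E 0 * ε * size κ v := by gcongr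
      _ ≤ ε * ((B + 2 * max E 0) * size κ v) := by
        have : 0 ≤ ε * (B * size κ v) := by positivity
        nlinarith) l hl
  refine this.trans ?_
  calc A * s * (K * size κ v) = A * s * K * size κ v := by ring
    _ ≤ η * size κ v := by gcongr

/-- Equally spaced unit directions. -/
def rayDir (α : ℝ) (M : ℕ) (j : ℕ) : ℂ :=
  Complex.exp (((α + 2 * Real.pi * j) / M : ℝ) * Complex.I)

theorem norm_rayDir (α : ℝ) (M j : ℕ) : ‖rayDir α M j‖ = 1 := Complex.norm_exp_ofReal_mul_I _

theorem rayDir_pow (α : ℝ) {M : ℕ} (hM : M ≠ 0) (j : ℕ) :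
    rayDir α M j ^ M = Complex.exp (α * Complex.I) := by
  rw [rayDir, ← Complex.exp_nat_mul, Complex.exp_eq_exp_iff_exists_int]
  have : (M : ℂ) ≠ 0 := by exact_mod_cast hM
  refine ⟨j, ?_⟩
  push_cast
  field_simp

/-- At most M consecutive indices are pairwise distinct modulo M. The offset `j₀` selects which
block of valleys is used. -/
theorem rayDir_injective (α : ℝ) {M n : ℕ} (hn : n + 1 ≤ M) (j₀ : ℕ) :
    Function.Injective fun j : Fin (n + 1) => rayDir α M (j + j₀) := by
  intro i j hij
  have hM : (M : ℂ) ≠ 0 := by exact_mod_cast (by omega : M ≠ 0)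
  obtain ⟨k, hk⟩ := Complex.exp_eq_exp_iff_exists_int.1 hij
  have hpi : (Real.pi : ℂ) ≠ 0 := by exact_mod_cast Real.pi_ne_zero
  push_cast at hk
  have e : ((i : ℕ) : ℂ) - ((j : ℕ) : ℂ) = k * M := by
    have h2 : (2 * Real.pi * Complex.I : ℂ) * (((i : ℕ) : ℂ) - ((j : ℕ) : ℂ)) =
        (2 * Real.pi * Complex.I) * (k * M) := by
      field_simp at hk
      linear_combination Complex.I * hk
    exact mul_left_cancel₀ Complex.two_pi_I_ne_zero h2
  have e' : ((i : ℕ) : ℤ) - ((j : ℕ) : ℤ) = k * M := by exact_mod_cast e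
  have hi := i.2
  have hj := j.2
  have hk0 : k = 0 := by
    by_contra hk0
    rcases lt_or_gt_of_ne hk0 with h | h
    · have : k * (M : ℤ) ≤ -1 * M := by gcongr; omega
      omega
    · have : 1 * (M : ℤ) ≤ k * M := by gcongr; omega
      omega
  rw [hk0, zero_mul] at e'
  exact Fin.ext (by omega)

theorem im_rayDir (α : ℝ) (M j : ℕ) :
    (rayDir α M j).im = Real.sin ((α + 2 * Real.pi * j) / M) := Complex.exp_ofReal_mul_I_im _

/-- Interior zeros. -/
theorem coeffSmall_interior (u : RationalPotential P) (hP : 0 < P) (hlam : 0 < lam)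
    (hζ : 0 < ζ.im) (hp : ∀ p, ζ ≠ u.z p) :
    u.CoeffSmall lam ζ ((u.hnum lam).rootMultiplicity ζ) := by
  have hζ' : ∀ p, ζ ≠ u.z p ∧ ζ ≠ star (u.z p) := fun p => ⟨hp p, fun h => by
    have := congrArg Complex.im h
    simp only [Complex.star_def, Complex.conj_im] at this
    linarith [u.z_im_pos p]⟩
  obtain ⟨θ, G, g, ρ, -, -, hρ, -, hphase⟩ := u.exists_localPhase hP lam hζ'
  set m := (u.hnum lam).rootMultiplicity ζ
  -- The disc of radius Im ζ around ζ lies in the closed upper half-plane, so all m + 1 valleys can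
  -- be used.
  set δ := min (ρ / 2) ζ.im with hδ
  have h := hphase δ (lt_min (by linarith) hζ) ((min_le_left _ _).trans_lt (by linarith))
  -- The valley directions are the solutions of t^{m+1} = ω, which makes −i t^{m+1} G(0) negative.
  set ω : ℂ := -(‖G 0‖ : ℂ) / (-Complex.I * G 0) with hω
  have hG0 : (‖G 0‖ : ℂ) ≠ 0 := by exact_mod_cast (norm_pos_iff.2 h.ne).ne'
  have hωn : ‖ω‖ = 1 := by
    rw [hω, norm_div, norm_neg, Complex.norm_real, norm_norm, norm_mul, norm_neg, Complex.norm_I,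
      one_mul, div_self (norm_pos_iff.2 h.ne).ne']
  have hωe : Complex.exp (ω.arg * Complex.I) = ω := by
    have := Complex.norm_mul_exp_arg_mul_I ω
    rwa [hωn, Complex.ofReal_one, one_mul] at this
  have hval : ∀ j : Fin (m + 1), -Complex.I * rayDir ω.arg (m + 1) (j + 0) ^ (m + 1) * G 0 =
      -(‖G 0‖ : ℂ) := fun j => by
    rw [rayDir_pow _ (Nat.succ_ne_zero m), hωe, hω]
    have := h.ne
    have := Complex.I_ne_zero
    field_simp
  refine h.coeffSmall le_rfl (rayDir_injective ω.arg le_rfl 0) (fun j => norm_rayDir _ _ _) hval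
    fun j L hL => h.exists_bound_upper_ray (Nat.succ_ne_zero m) hlam (norm_rayDir _ _ _) (hval j)
      (fun r hr => ?_) hL
  rw [Complex.add_im, Complex.im_ofReal_mul]
  have h1 := Complex.abs_im_le_norm (rayDir ω.arg (m + 1) (j + 0))
  rw [norm_rayDir] at h1
  have h2 := (abs_le.1 h1).1
  have h3 : r ≤ ζ.im := hr.2.trans (min_le_right _ _)
  nlinarith [hr.1]

end RationalPotential


/-- The argument of σ lies in [0, a], so that of σ^m lies in [0, ma], and there the cosine is at
least cos(ma). -/
theorem norm_pow_mul_cos_le_re_pow {σ : ℂ} {a : ℝ} {m : ℕ} (ha : 0 < a) (ha2 : a < Real.pi / 2)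
    (hma : m * a ≤ Real.pi / 2) (hr : 0 < σ.re) (hi : 0 ≤ σ.im) (h : σ.im ≤ σ.re * Real.tan a) :
    ‖σ‖ ^ m * Real.cos (m * a) ≤ (σ ^ m).re := by
  have h1 : 0 ≤ σ.arg := Complex.arg_nonneg_iff.2 hi
  have h2 : |σ.arg| < Real.pi / 2 := Complex.abs_arg_lt_pi_div_two_iff.2 (Or.inl hr)
  have h3 : σ.arg ≤ a := by
    by_contra! hlt
    have := Real.strictMonoOn_tan (show a ∈ Set.Ioo (-(Real.pi / 2)) (Real.pi / 2) from
      ⟨by linarith [Real.pi_pos], ha2⟩) (show σ.arg ∈ Set.Ioo _ _ from abs_lt.1 h2) hlt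
    rw [Complex.tan_arg, lt_div_iff₀ hr] at this
    linarith
  have e : σ ^ m = ((‖σ‖ ^ m : ℝ) : ℂ) * Complex.exp ((m * σ.arg : ℝ) * Complex.I) := by
    conv_lhs => rw [← Complex.norm_mul_exp_arg_mul_I σ]
    rw [mul_pow, ← Complex.exp_nat_mul]
    push_cast
    ring_nf
  rw [e, Complex.re_ofReal_mul, Complex.exp_ofReal_mul_I_re]
  refine mul_le_mul_of_nonneg_left ?_ (by positivity)
  refine Real.cos_le_cos_of_nonneg_of_le_pi (by positivity) (by linarith [Real.pi_pos]) ?_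
  gcongr

theorem integral_exp_neg_le {b ε Y : ℝ} (hb : 0 < b) (hε : 0 < ε) :
    ∫ y in (0 : ℝ)..Y, Real.exp (-(b * y / ε)) ≤ ε / b := by
  have hd : ∀ y ∈ Set.uIcc 0 Y, HasDerivAt (fun y => -(ε / b) * Real.exp (-(b * y / ε)))
      (Real.exp (-(b * y / ε))) y := by
    intro y _
    have h1 : HasDerivAt (fun y => -(b * y / ε)) (-(b / ε)) y := by
      have := (((hasDerivAt_id y).const_mul b).div_const ε).neg
      rw [mul_one] at this
      exact this
    refine (h1.exp.const_mul (-(ε / b))).congr_deriv ?_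
    field_simp
  rw [intervalIntegral.integral_eq_sub_of_hasDerivAt hd
    (Continuous.intervalIntegrable (by fun_prop) _ _)]
  simp only [mul_zero, zero_div, neg_zero, Real.exp_zero, mul_one]
  have : 0 < ε / b * Real.exp (-(b * Y / ε)) := by positivity
  linarith

/-! ### The two real turning points -/

namespace RationalPotential

open Polynomial

variable {P : ℕ} (u : RationalPotential P)
variable {lam : ℝ} {ζ : ℂ} {M : ℕ} {δ ρ : ℝ} {θ G : ℂ → ℂ}

variable {u} in
-- On the real axis the derivative λ + u₀ of the phase is real, and the phase starts from 0.
theorem LocalPhase.im_θ_ofReal {x₀ : ℝ} (h : u.LocalPhase lam x₀ M δ ρ θ G) (hM : M ≠ 0) {x : ℝ}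
    (hx : |x| < ρ) : (θ x).im = 0 := by
  have hs : Convex ℝ (Set.uIcc 0 x) := convex_uIcc 0 x
  have hd : ∀ y ∈ Set.uIcc 0 x, HasDerivWithinAt (fun y : ℝ => (θ y).im) 0 (Set.uIcc 0 x) y := by
    intro y hy
    have hy2 : |y| ≤ |x| := by
      rcases Set.mem_uIcc.1 hy with h | h
      · rw [abs_of_nonneg h.1, abs_of_nonneg (h.1.trans h.2)]; exact h.2
      · rw [abs_of_nonpos h.2, abs_of_nonpos (h.1.trans h.2)]; linarith
    have hb : (y : ℂ) ∈ Metric.ball (0 : ℂ) ρ := by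
      rw [mem_ball_zero_iff, Complex.norm_real]; exact hy2.trans_lt hx
    have h1 := h.deriv _ hb
    rw [← Complex.ofReal_add, u.uC_ofReal, ← Complex.ofReal_add] at h1
    have h2 := (Complex.imCLM.hasFDerivAt (x := θ y)).comp_hasDerivAt y h1.comp_ofReal
    rw [Complex.imCLM_apply, Complex.ofReal_im] at h2
    exact h2.hasDerivWithinAt
  have := hs.norm_image_sub_le_of_norm_hasDerivWithin_le (C := 0) hd (by simp) Set.left_mem_uIcc
    Set.right_mem_uIcc
  simpa [h.θ_zero hM, sub_eq_zero] using this

/-- The sign of `λ + u₀` near a real zero determines the sign of the leading coefficient and the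
parity of the order. -/
theorem leading_of_sign {x₀ r s ρ : ℝ} {m : ℕ} {g : ℂ → ℂ} (hr : 0 < r) (hρ : 0 < ρ)
    (hs : s = 1 ∨ s = -1)
    (hpos : ∀ x, 0 < x → x < r → 0 < s * (lam + u.u₀ (x₀ + x)))
    (hneg : ∀ x, -r < x → x < 0 → s * (lam + u.u₀ (x₀ + x)) < 0)
    (hg : ContinuousAt g 0) (hg0 : g 0 ≠ 0)
    (hfac : ∀ τ ∈ Metric.ball (0 : ℂ) ρ, lam + u.uC (x₀ + τ) = τ ^ m * g τ) :
    (∃ γ : ℝ, 0 < γ ∧ g 0 = s * γ) ∧ Odd m := by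
  have hreal : ∀ x : ℝ, |x| < ρ → x ≠ 0 →
      g x = ((lam + u.u₀ (x₀ + x)) / x ^ m : ℝ) := by
    intro x hx hx0
    have := hfac x (by rw [mem_ball_zero_iff, Complex.norm_real]; exact hx)
    rw [← Complex.ofReal_add, u.uC_ofReal] at this
    have hx' : (x : ℂ) ^ m ≠ 0 := pow_ne_zero _ (by exact_mod_cast hx0)
    push_cast
    rw [this]
    field_simp
  have hss : s * s = 1 := by rcases hs with h | h <;> rw [h] <;> norm_num
  have hc : Tendsto (fun x : ℝ => (s : ℂ) * g x) (𝓝 0) (𝓝 (s * g 0)) := by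
    have : Tendsto (fun x : ℝ => (x : ℂ)) (𝓝 0) (𝓝 0) := by
      simpa using Complex.continuous_ofReal.tendsto 0
    exact (hg.tendsto.comp this).const_mul _
  have hev : ∀ᶠ x : ℝ in 𝓝[>] 0, 0 ≤ ((s : ℂ) * g x).re ∧ ((s : ℂ) * g x).im = 0 := by
    filter_upwards [Ioo_mem_nhdsGT (lt_min hr hρ)] with x hx
    rw [hreal x (by rw [abs_of_pos hx.1]; exact hx.2.trans_le (min_le_right _ _)) hx.1.ne',
      ← Complex.ofReal_mul, Complex.ofReal_re, Complex.ofReal_im]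
    refine ⟨?_, rfl⟩
    rw [← mul_div_assoc]
    have := hpos x hx.1 (hx.2.trans_le (min_le_left _ _))
    have := hx.1
    positivity
  have hc' := hc.mono_left (nhdsWithin_le_nhds (s := Set.Ioi 0))
  have hre : 0 ≤ ((s : ℂ) * g 0).re :=
    ge_of_tendsto ((Complex.continuous_re.tendsto _).comp hc') (hev.mono fun _ h => h.1)
  have him : ((s : ℂ) * g 0).im = 0 :=
    (tendsto_nhds_unique (((Complex.continuous_im.tendsto _).comp hc').congr'
      (hev.mono fun _ h => h.2)) tendsto_const_nhds)
  have hs0 : (s : ℂ) ≠ 0 := by rcases hs with h | h <;> simp [h]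
  have hss' : (s : ℂ) * s = 1 := by exact_mod_cast hss
  have hγ : 0 < ((s : ℂ) * g 0).re := by
    refine lt_of_le_of_ne hre fun h => mul_ne_zero hs0 hg0 (Complex.ext ?_ ?_)
    · rw [← h]; rfl
    · rw [him]; rfl
  refine ⟨⟨_, hγ, ?_⟩, ?_⟩
  · have : (((s : ℂ) * g 0).re : ℂ) = s * g 0 := Complex.ext rfl (by rw [him]; rfl)
    rw [this, ← mul_assoc, hss', one_mul]
  -- For even m the quotient (λ + u₀)/x^m would keep the sign change of λ + u₀, so the limit from
  -- the left would contradict the sign found from the right.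
  · by_contra hodd
    rw [Nat.not_odd_iff_even] at hodd
    have hev2 : ∀ᶠ x : ℝ in 𝓝[<] 0, ((s : ℂ) * g x).re ≤ 0 := by
      filter_upwards [Ioo_mem_nhdsLT (neg_lt_zero.2 (lt_min hr hρ))] with x hx
      rw [hreal x (by rw [abs_of_neg hx.2]; linarith [hx.1, min_le_right r ρ]) hx.2.ne,
        ← Complex.ofReal_mul, Complex.ofReal_re, ← mul_div_assoc]
      exact div_nonpos_of_nonpos_of_nonneg
        (hneg x (by linarith [hx.1, min_le_left r ρ]) hx.2).le (hodd.pow_nonneg x)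
    have := le_of_tendsto ((Complex.continuous_re.tendsto _).comp
      (hc.mono_left (nhdsWithin_le_nhds (s := Set.Iio 0)))) hev2
    linarith

/-- Near the right turning point. -/
theorem coeffSmall_right (hP : 0 < P) {xm xp : ℝ} (ht : u.TurningPoints lam xm xp) :
    ∃ k, (u.hnum lam).rootMultiplicity (xp : ℂ) = 2 * k + 1 ∧ u.CoeffSmall lam xp k := by
  obtain ⟨θ, G, g, ρ, hgc, hgG, hρ, hfac, hphase⟩ := u.exists_localPhase hP lam (u.ofReal_ne xp)
  have h := hphase (ρ / 2) (by linarith) (by linarith)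
  set m := (u.hnum lam).rootMultiplicity (xp : ℂ) with hm
  have hm0 : (m + 1 : ℂ) ≠ 0 := by exact_mod_cast Nat.succ_ne_zero m
  have hg0 : g 0 ≠ 0 := by rw [← hgG]; exact mul_ne_zero hm0 h.ne
  obtain ⟨⟨γ, hγ, hg⟩, k, hk⟩ := u.leading_of_sign (lam := lam) (x₀ := xp) (s := 1)
    (sub_pos.2 ht.lt) hρ
    (Or.inl rfl) (fun x h0 _ => by rw [one_mul]; exact ht.pos_right _ (by linarith))
    (fun x h0 h1 => by rw [one_mul]; exact ht.neg_mid _ (by linarith) (by linarith)) hgc hg0 hfac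
  have hG : G 0 = (γ / (m + 1) : ℝ) := by
    rw [hg] at hgG
    push_cast
    rw [eq_div_iff hm0, mul_comm, hgG]
    simp
  -- Here G(0) > 0, so valleys satisfy t^{2k+2} = −i and have angles (−π/2 + 2πj)/(2k + 2). Exactly
  -- j = 1, …, k + 1 lie above the real axis, whence the shift by 1.
  have hval : ∀ j : Fin (k + 1), -Complex.I * rayDir (-(Real.pi / 2)) (m + 1) (j + 1) ^ (m + 1) *
      G 0 = -(‖G 0‖ : ℂ) := fun j => by
    rw [rayDir_pow _ (Nat.succ_ne_zero m), hG, Complex.norm_real,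
      Real.norm_of_nonneg (by positivity), Complex.ofReal_neg, neg_mul ((Real.pi / 2 : ℝ) : ℂ),
      Complex.exp_neg]
    push_cast
    rw [Complex.exp_pi_div_two_mul_I]
    simp
  refine ⟨k, hk, h.coeffSmall (by omega)
    (rayDir_injective (-(Real.pi / 2)) (by omega) 1) (fun j => norm_rayDir _ _ _) hval
    fun j L hL => h.exists_bound_upper_ray (Nat.succ_ne_zero m) ht.lam_pos (norm_rayDir _ _ _)
      (hval j) (fun r hr => ?_) hL⟩
  rw [Complex.add_im, Complex.im_ofReal_mul, Complex.ofReal_im, zero_add, im_rayDir]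
  refine mul_nonneg hr.1 (Real.sin_nonneg_of_nonneg_of_le_pi ?_ ?_)
  · push_cast
    have : (0 : ℝ) ≤ (j : ℕ) := Nat.cast_nonneg _
    refine div_nonneg ?_ (by positivity)
    nlinarith [Real.pi_pos]
  · have h1 : ((j : ℕ) : ℝ) ≤ k := by exact_mod_cast Nat.lt_succ_iff.1 j.2
    have h2 : (m : ℝ) = 2 * k + 1 := by exact_mod_cast hk
    rw [div_le_iff₀ (by positivity)]
    push_cast
    rw [h2]
    nlinarith [Real.pi_pos]

variable {u} in
/-- The ray slightly below the real axis to the left of the left turning point. -/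
theorem LocalPhase.exists_bound_lower_ray {xm xp : ℝ} (ht : u.TurningPoints lam xm xp)
    (h : u.LocalPhase lam xm M δ ρ θ G) (hM : M ≠ 0) {d : ℝ} (hd : 0 < d) (hδd : δ ≤ d / 2)
    (haw : ∀ x : ℝ, u.Away d x) {a : ℝ} (ha : 0 < a) (ha2 : a < Real.pi / 2) {c : ℝ} (hc : 0 < c)
    (hre : ∀ y, 0 ≤ y → y ≤ δ * Real.sin a →
      c ≤ (lam + u.uC (xm + (-(δ * Real.cos a : ℝ) - y * Complex.I))).re)
    {L : ℕ} (hL : P < L) :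
    ∃ C, ∀ ε κ v w, 0 < ε → ε ≤ 1 → u.IsJost ε lam κ v w →
      ‖(∑ l ∈ Finset.range L, u.nu lam xm κ v l * rayInt G (u.amp xm) M δ ε
        (-Complex.exp (a * Complex.I)) l) + Complex.I * ε * w xm‖ ≤ C * ε * size κ v := by
  have hδ := h.δ_pos
  have hcos : 0 < Real.cos a := Real.cos_pos_of_mem_Ioo ⟨by linarith, ha2⟩
  have hsin : 0 < Real.sin a := Real.sin_pos_of_pos_of_lt_pi ha (by linarith [Real.pi_pos])
  set X := δ * Real.cos a with hX
  set Y := δ * Real.sin a with hY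
  have hX0 : 0 < X := by positivity
  have hY0 : 0 < Y := by positivity
  have hXδ : X ≤ δ := mul_le_of_le_one_right hδ.le (Real.cos_le_one a)
  obtain ⟨C₁, hC₁, hw⟩ := u.exists_bound_left ht (a := xm - X) (by linarith)
  obtain ⟨C₂, hC₂, hq⟩ := u.exists_bound_q (half_pos hd) lam
  refine ⟨C₁ + C₂ / c, fun ε κ v w hε hε1 hJ => ?_⟩
  have hN := size_nonneg κ v
  set E : ℂ → ℂ := fun τ => Complex.exp (-Complex.I * θ τ / ε) with hE
  have hdiff : DifferentiableOn ℂ (fun τ => E τ * u.q lam κ v (xm + τ)) (Metric.ball 0 ρ) := by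
    intro τ hτ
    have h1 := (h.deriv τ hτ).differentiableAt
    have h2 : DifferentiableAt ℂ (fun τ => u.q lam κ v (xm + τ)) τ :=
      ((u.hasDerivAt_q lam κ v fun p => (h.away τ hτ p).1).comp_const_add (xm : ℂ) τ).differentiableAt
    exact ((((h1.const_mul _).div_const _).cexp).mul h2).differentiableWithinAt
  -- The integrand e^{-iθ/ε}q is holomorphic on both sides of the axis, whereas w is available only
  -- above it. The integral along the lower ray is moved to a real segment, where the equation and
  -- the bound to the left apply, followed by a vertical segment, where the exponential decays.
  obtain ⟨F, hF⟩ := exists_primitive_of_convex (convex_ball (0 : ℂ) ρ) Metric.isOpen_ball hdiff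
  have hline : ∀ (b t : ℂ) (r₁ : ℝ), (∀ r ∈ Set.uIcc 0 r₁, b + (r : ℂ) * t ∈ Metric.ball (0 : ℂ) ρ) →
      ∫ r in (0 : ℝ)..r₁, E (b + r * t) * (u.q lam κ v (xm + (b + r * t)) * t) =
        F (b + r₁ * t) - F b := by
    intro b t r₁ hb
    have := intervalIntegral.integral_eq_sub_of_hasDerivAt (f := fun r : ℝ => F (b + r * t))
      (fun r hr => (hasDerivAt_comp_line (hF _ (hb r hr))).congr_deriv
        (show _ = E (b + r * t) * (u.q lam κ v (xm + (b + r * t)) * t) by ring))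
      (h.continuousOn_exp_mul_q hb).intervalIntegrable
    rw [this]
    simp
  have hbd : ∀ x y : ℝ, |x| ≤ X → |y| ≤ Y → ‖(x + y * Complex.I : ℂ)‖ ≤ δ := by
    intro x y hx hy
    rw [← sq_le_sq₀ (norm_nonneg _) hδ.le, ← Complex.normSq_eq_norm_sq, Complex.normSq_apply]
    simp only [Complex.add_re, Complex.ofReal_re, Complex.mul_re, Complex.I_re, mul_zero,
      Complex.ofReal_im, Complex.I_im, mul_one, sub_self, add_zero, Complex.add_im, Complex.mul_im,
      zero_add]
    have h1 : x * x ≤ X * X := by rw [← abs_mul_abs_self x]; gcongr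
    have h2 : y * y ≤ Y * Y := by rw [← abs_mul_abs_self y]; gcongr
    have h3 := Real.sin_sq_add_cos_sq a
    have h4 : δ ^ 2 = X * X + Y * Y := by rw [hX, hY]; linear_combination (-δ ^ 2) * h3
    linarith
  have hball : ∀ x y : ℝ, |x| ≤ X → |y| ≤ Y → (x + y * Complex.I : ℂ) ∈ Metric.ball (0 : ℂ) ρ :=
    fun x y hx hy => h.mem_ball (hbd x y hx hy)
  -- the ray
  have e1 : (∑ l ∈ Finset.range L, u.nu lam xm κ v l * rayInt G (u.amp xm) M δ ε
      (-Complex.exp (a * Complex.I)) l) = F (-X - Y * Complex.I) - F 0 := by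
    have hn : ‖-Complex.exp (a * Complex.I)‖ = 1 := by
      rw [norm_neg, Complex.norm_exp_ofReal_mul_I]
    rw [h.sum_rayInt hn hL, hline 0 _ δ fun r hr => ?_]
    · congr 2
      rw [Complex.exp_mul_I, ← Complex.ofReal_cos, ← Complex.ofReal_sin, hX, hY]
      push_cast
      ring
    · rw [Set.uIcc_of_le hδ.le] at hr
      refine h.mem_ball ?_
      rw [zero_add, norm_mul, hn, mul_one, Complex.norm_real, Real.norm_of_nonneg hr.1]
      exact hr.2
  -- the real segment
  have hreal : ∀ r ∈ Set.uIcc 0 X, (0 : ℂ) + (r : ℂ) * (-1) ∈ Metric.ball (0 : ℂ) ρ := by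
    intro r hr
    rw [Set.uIcc_of_le hX0.le] at hr
    have := hball (-r) 0 (by rw [abs_neg, abs_of_nonneg hr.1]; exact hr.2) (by simpa using hY0.le)
    simpa using this
  have e2 : F (-X) - F 0 = Complex.I * ε * (E (-X) * w (xm - X)) - Complex.I * ε * w xm := by
    have := hline 0 (-1) X hreal
    rw [h.integral_eq_of_upper hε hJ hreal (fun r _ => by simp)] at this
    simp only [Complex.ofReal_zero, mul_neg, mul_one, neg_zero, h.θ_zero hM,
      mul_zero, zero_div, Complex.exp_zero, one_mul, add_zero, zero_sub, ← sub_eq_add_neg] at this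
    exact this.symm
  -- the vertical segment
  have hvert : ∀ y ∈ Set.uIcc 0 Y, (-X : ℂ) + (y : ℂ) * (-Complex.I) ∈ Metric.ball (0 : ℂ) ρ := by
    intro y hy
    rw [Set.uIcc_of_le hY0.le] at hy
    have := hball (-X) (-y) (by rw [abs_neg, abs_of_nonneg hX0.le])
      (by rw [abs_neg, abs_of_nonneg hy.1]; exact hy.2)
    simpa using this
  have e3 := hline (-X) (-Complex.I) Y hvert
  -- Downwards Im θ decreases at rate Re(λ + u₀) ≥ c, starting from 0 on the real axis. The vertical
  -- leg is therefore O(ε/c).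
  have him : ∀ y ∈ Set.Icc 0 Y, (θ (-X + y * -Complex.I)).im ≤ -(c * y) := by
    have hdv : ∀ y ∈ Set.Icc 0 Y, HasDerivAt (fun y : ℝ => (θ (-X + y * -Complex.I)).im + c * y)
        (-(lam + u.uC (xm + (-X + y * -Complex.I))).re + c) y := by
      intro y hy
      have h1 := hasDerivAt_comp_line (h.deriv _ (hvert y (by rwa [Set.uIcc_of_le hY0.le])))
      have h2 := (Complex.imCLM.hasFDerivAt (x := θ (-X + y * -Complex.I))).comp_hasDerivAt y h1
      refine (h2.add ((hasDerivAt_id y).const_mul c)).congr_deriv ?_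
      simp only [Complex.imCLM_apply, mul_one]
      congr 1
      rw [neg_mul, Complex.neg_im, Complex.I_mul_im]
    have hanti : AntitoneOn (fun y : ℝ => (θ (-X + y * -Complex.I)).im + c * y) (Set.Icc 0 Y) := by
      refine antitoneOn_of_deriv_nonpos (convex_Icc 0 Y)
        (fun y hy => (hdv y hy).continuousAt.continuousWithinAt)
        (fun y hy => (hdv y (interior_subset hy)).differentiableAt.differentiableWithinAt) ?_
      intro y hy
      have hy' := interior_subset hy
      rw [(hdv y hy').deriv]
      have := hre y hy'.1 hy'.2
      rw [show ((xm : ℂ) + (-(X : ℝ) - y * Complex.I)) = xm + (-X + y * -Complex.I) by ring] at this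
      linarith
    intro y hy
    have := hanti (Set.left_mem_Icc.2 hY0.le) hy hy.1
    have h0 : (θ (-X + (0 : ℝ) * -Complex.I)).im = 0 := by
      rw [Complex.ofReal_zero, zero_mul, add_zero, ← Complex.ofReal_neg]
      refine h.im_θ_ofReal hM ?_
      rw [abs_neg, abs_of_pos hX0]
      exact hXδ.trans_lt h.δ_lt
    simp only [h0, mul_zero, add_zero] at this
    linarith
  have hnE : ∀ τ, ‖E τ‖ = Real.exp ((θ τ).im / ε) := by
    intro τ
    rw [hE, Complex.norm_exp, Complex.div_ofReal_re]
    congr 2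
    simp
  have b3 : ‖F (-X - Y * Complex.I) - F (-X)‖ ≤ C₂ / c * ε * size κ v := by
    rw [show (-X - Y * Complex.I : ℂ) = -X + Y * -Complex.I by ring, ← e3]
    have := intervalIntegral.norm_integral_le_of_norm_le (a := 0) (b := Y) (μ := volume)
      (f := fun y : ℝ => E (-X + y * -Complex.I) *
        (u.q lam κ v (xm + (-X + y * -Complex.I)) * -Complex.I))
      (g := fun y => Real.exp (-(c * y / ε)) * (C₂ * size κ v)) hY0.le ?_
      (Continuous.intervalIntegrable (by fun_prop) _ _)
    · refine this.trans ?_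
      rw [intervalIntegral.integral_mul_const]
      calc _ ≤ ε / c * (C₂ * size κ v) :=
            mul_le_mul_of_nonneg_right (integral_exp_neg_le hc hε) (by positivity)
        _ = _ := by ring
    · refine Eventually.of_forall fun y hy => ?_
      have hy' : y ∈ Set.Icc 0 Y := ⟨hy.1.le, hy.2⟩
      rw [norm_mul, norm_mul, norm_neg, Complex.norm_I, mul_one, hnE]
      refine mul_le_mul ?_ ?_ (norm_nonneg _) (Real.exp_pos _).le
      · rw [Real.exp_le_exp, ← neg_div]
        gcongr
        exact him y hy'
      · refine (hq κ v _ ?_).1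
        have hτ : ‖(-X + y * -Complex.I : ℂ)‖ ≤ d / 2 := by
          have := hbd (-X) (-y) (by rw [abs_neg, abs_of_nonneg hX0.le])
            (by rw [abs_neg, abs_of_nonneg hy'.1]; exact hy'.2)
          refine le_trans (le_of_eq ?_) (this.trans hδd)
          congr 1
          push_cast
          ring
        intro p
        have key : ∀ b : ℂ, d ≤ ‖(xm : ℂ) - b‖ →
            d / 2 ≤ ‖(xm : ℂ) + (-X + y * -Complex.I) - b‖ := by
          intro b hb
          have := norm_sub_norm_le ((xm : ℂ) - b) (-(-X + y * -Complex.I))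
          rw [norm_neg, sub_neg_eq_add] at this
          rw [show (xm : ℂ) + (-X + y * -Complex.I) - b = xm - b + (-X + y * -Complex.I) by ring]
          linarith
        exact key _ (haw xm p).1
  have b2 : ‖Complex.I * ε * (E (-X) * w (xm - X))‖ ≤ C₁ * ε * size κ v := by
    rw [norm_mul, norm_mul, norm_mul, Complex.norm_I, one_mul, Complex.norm_real,
      Real.norm_of_nonneg hε.le, hnE]
    have h0 : (θ (-X)).im = 0 := by
      rw [← Complex.ofReal_neg]
      refine h.im_θ_ofReal hM ?_
      rw [abs_neg, abs_of_pos hX0]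
      exact hXδ.trans_lt h.δ_lt
    have := hw ε κ v w hε hJ (xm - X) le_rfl
    push_cast at this
    rw [h0, zero_div, Real.exp_zero, one_mul]
    calc _ ≤ ε * (C₁ * size κ v) := by gcongr
      _ = _ := by ring
  rw [e1]
  have e4 : F (-X - Y * Complex.I) - F 0 + Complex.I * ε * w xm =
      (F (-X - Y * Complex.I) - F (-X)) + Complex.I * ε * (E (-X) * w (xm - X)) := by
    linear_combination e2
  rw [e4]
  refine (norm_add_le _ _).trans ((add_le_add b3 b2).trans (le_of_eq ?_))
  ring

/-- Near the left turning point. -/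
theorem coeffSmall_left (hP : 0 < P) {xm xp : ℝ} (ht : u.TurningPoints lam xm xp) :
    ∃ k, (u.hnum lam).rootMultiplicity (xm : ℂ) = 2 * k + 1 ∧ u.CoeffSmall lam xm (k + 1) := by
  obtain ⟨θ, G, g, ρ, hgc, hgG, hρ, hfac, hphase⟩ := u.exists_localPhase hP lam (u.ofReal_ne xm)
  obtain ⟨d, hd, haw⟩ := u.exists_away_real
  set m := (u.hnum lam).rootMultiplicity (xm : ℂ) with hm
  have hm0 : (m + 1 : ℂ) ≠ 0 := by exact_mod_cast Nat.succ_ne_zero m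
  have hne := (hphase (ρ / 2) (by linarith) (by linarith)).ne
  have hg0 : g 0 ≠ 0 := by rw [← hgG]; exact mul_ne_zero hm0 hne
  obtain ⟨⟨γ, hγ, hg⟩, k, hk⟩ := u.leading_of_sign (lam := lam) (x₀ := xm) (s := -1)
    (sub_pos.2 ht.lt) hρ
    (Or.inr rfl) (fun x h0 h1 => by
      have := ht.neg_mid (xm + x) (by linarith) (by linarith); linarith)
    (fun x h0 h1 => by have := ht.pos_left (xm + x) (by linarith); linarith) hgc hg0 hfac
  have hG : G 0 = (-(γ / (m + 1)) : ℝ) := by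
    rw [hg] at hgG
    push_cast
    rw [← neg_div, eq_div_iff hm0, mul_comm, hgG]
    simp
  have hmr : (m : ℝ) = 2 * k + 1 := by exact_mod_cast hk
  have hpi := Real.pi_pos
  -- The angle by which the extra valley lies below the negative real direction. From (m + 1)a = π/2
  -- follows ma < π/2, so cos(ma) > 0.
  set a : ℝ := Real.pi / 2 / (m + 1) with ha
  have ha0 : 0 < a := by positivity
  have ham : (m + 1) * a = Real.pi / 2 := by rw [ha]; field_simp
  have ha2 : a < Real.pi / 2 := by
    rw [ha]
    refine div_lt_self (by positivity) ?_
    rw [hmr]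
    have : (0 : ℝ) ≤ k := Nat.cast_nonneg _
    linarith
  have hcm : 0 < Real.cos (m * a) := Real.cos_pos_of_mem_Ioo
    ⟨by have : 0 ≤ m * a := by positivity
        linarith, by linarith⟩
  have hcos : 0 < Real.cos a := Real.cos_pos_of_mem_Ioo ⟨by linarith, ha2⟩
  have hη : 0 < γ * Real.cos (m * a) / 2 := by positivity
  obtain ⟨r₀, hr₀, hr₀g⟩ := Metric.continuousAt_iff.1 hgc _ hη
  set δ := min (min (ρ / 2) (d / 2)) (r₀ / 2) with hδdef
  have hδ : 0 < δ := by positivity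
  have hδρ : δ < ρ := lt_of_le_of_lt ((min_le_left _ _).trans (min_le_left _ _)) (by linarith)
  have h := hphase δ hδ hδρ
  -- Here G(0) < 0, so valleys satisfy t^{2k+2} = i and have angles (π/2 + 2πj)/(2k + 2). The
  -- indices 0, …, k lie above the axis, and k + 1 is the valley at angle π + a.
  have hval : ∀ j : Fin (k + 2), -Complex.I * rayDir (Real.pi / 2) (m + 1) (j + 0) ^ (m + 1) *
      G 0 = -(‖G 0‖ : ℂ) := fun j => by
    rw [rayDir_pow _ (Nat.succ_ne_zero m), hG, Complex.norm_real, norm_neg,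
      Real.norm_of_nonneg (by positivity)]
    push_cast
    rw [Complex.exp_pi_div_two_mul_I]
    linear_combination (γ / (m + 1) : ℂ) * Complex.I_sq
  refine ⟨k, hk, h.coeffSmall (by omega)
    (rayDir_injective (Real.pi / 2) (by omega) 0) (fun j => norm_rayDir _ _ _) hval
    fun j L hL => ?_⟩
  rcases Nat.lt_or_ge j (k + 1) with hj | hj
  · refine h.exists_bound_upper_ray (Nat.succ_ne_zero m) ht.lam_pos (norm_rayDir _ _ _)
      (hval j) (fun r hr => ?_) hL
    rw [Complex.add_im, Complex.im_ofReal_mul, Complex.ofReal_im, zero_add, im_rayDir]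
    refine mul_nonneg hr.1 (Real.sin_nonneg_of_nonneg_of_le_pi (by positivity) ?_)
    have h1 : ((j : ℕ) : ℝ) ≤ k := by exact_mod_cast Nat.lt_succ_iff.1 hj
    rw [div_le_iff₀ (by positivity)]
    push_cast
    rw [hmr]
    nlinarith
  · have hjk : (j : ℕ) + 0 = k + 1 := by have := j.2; omega
    have hdir : rayDir (Real.pi / 2) (m + 1) (j + 0) = -Complex.exp (a * Complex.I) := by
      rw [hjk, rayDir]
      have : (Real.pi / 2 + 2 * Real.pi * ((k + 1 : ℕ) : ℝ)) / ((m + 1 : ℕ) : ℝ) = Real.pi + a := by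
        rw [ha]
        push_cast
        rw [hmr]
        field_simp
        ring
      rw [this]
      push_cast
      rw [add_mul, Complex.exp_add, Complex.exp_pi_mul_I]
      ring
    rw [hdir]
    refine h.exists_bound_lower_ray ht (Nat.succ_ne_zero m) hd
      ((min_le_left _ _).trans (min_le_right _ _)) haw ha0 ha2
      (c := (δ * Real.cos a) ^ m * (γ * Real.cos (m * a) / 2)) (by positivity)
      (fun y hy0 hy => ?_) hL
    -- The points of the vertical leg are −σ with 0 ≤ arg σ ≤ a. As m is odd and g(0) = −γ, the
    -- leading term of λ + u₀ is γσ^m, whose real part is at least γ|σ|^m cos(ma). The choice of δ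
    -- bounds the error by half of this.
    set σ : ℂ := (δ * Real.cos a : ℝ) + y * Complex.I with hσ
    have hσr : σ.re = δ * Real.cos a := by
      rw [hσ, Complex.add_re, Complex.ofReal_re, Complex.re_ofReal_mul, Complex.I_re, mul_zero,
        add_zero]
    have hσi : σ.im = y := by
      rw [hσ, Complex.add_im, Complex.ofReal_im, Complex.im_ofReal_mul, Complex.I_im, mul_one,
        zero_add]
    have hσn : ‖σ‖ ≤ δ := by
      rw [← sq_le_sq₀ (norm_nonneg _) hδ.le, ← Complex.normSq_eq_norm_sq, Complex.normSq_apply,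
        hσr, hσi]
      have h1 : y * y ≤ δ * Real.sin a * (δ * Real.sin a) := mul_self_le_mul_self hy0 hy
      nlinarith [Real.sin_sq_add_cos_sq a]
    have e : (-(δ * Real.cos a : ℝ) - y * Complex.I : ℂ) = -σ := by rw [hσ]; ring
    have hσb : -σ ∈ Metric.ball (0 : ℂ) ρ := by
      rw [mem_ball_zero_iff, norm_neg]; exact hσn.trans_lt hδρ
    rw [e, hfac _ hσb]
    have hodd : (-σ) ^ m = -σ ^ m := Odd.neg_pow ⟨k, hk⟩ σ
    have hgσ : ‖g (-σ) - g 0‖ ≤ γ * Real.cos (m * a) / 2 := by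
      rw [← dist_eq_norm]
      refine (hr₀g ?_).le
      rw [dist_zero_right, norm_neg]
      exact (hσn.trans (min_le_right _ _)).trans_lt (by linarith)
    have e2 : (-σ) ^ m * g (-σ) = (γ : ℂ) * σ ^ m - σ ^ m * (g (-σ) - g 0) := by
      rw [hodd, hg]
      push_cast
      ring
    rw [e2, Complex.sub_re, Complex.re_ofReal_mul]
    have h1 : ‖σ‖ ^ m * Real.cos (m * a) ≤ (σ ^ m).re := by
      refine norm_pow_mul_cos_le_re_pow ha0 ha2 (by linarith) (by rw [hσr]; positivity)
        (by rw [hσi]; exact hy0) ?_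
      rw [hσr, hσi, mul_assoc, Real.tan_eq_sin_div_cos, mul_div_cancel₀ _ hcos.ne']
      exact hy
    have h2 : (σ ^ m * (g (-σ) - g 0)).re ≤ ‖σ‖ ^ m * (γ * Real.cos (m * a) / 2) := by
      refine (Complex.re_le_norm _).trans ?_
      rw [norm_mul, norm_pow]
      gcongr
    have h3 : (δ * Real.cos a) ^ m ≤ ‖σ‖ ^ m := by
      gcongr
      rw [← hσr]
      exact Complex.re_le_norm σ
    have h4 : (δ * Real.cos a) ^ m * (γ * Real.cos (m * a) / 2) ≤
        ‖σ‖ ^ m * (γ * Real.cos (m * a) / 2) := by gcongr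
    have h5 : γ * (‖σ‖ ^ m * Real.cos (m * a)) ≤ γ * (σ ^ m).re := by gcongr
    linarith

end RationalPotential


/-! ### Counting zeros and identifying the limiting numerator -/

namespace RationalPotential

open Polynomial

variable {P : ℕ} (u : RationalPotential P)

theorem monic_den : u.den.Monic := monic_prod_of_monic _ _ fun _ _ => monic_X_sub_C _

theorem monic_denBar : u.denBar.Monic := monic_prod_of_monic _ _ fun _ _ => monic_X_sub_C _

theorem monic_denErase (p : Fin P) : (u.denErase p).Monic :=
  monic_prod_of_monic _ _ fun _ _ => monic_X_sub_C _

theorem monic_denBarErase (p : Fin P) : (u.denBarErase p).Monic :=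
  monic_prod_of_monic _ _ fun _ _ => monic_X_sub_C _

theorem natDegree_denBar : u.denBar.natDegree = P := by
  rw [denBar, natDegree_prod_of_monic _ _ fun p _ => monic_X_sub_C _]
  simp

theorem natDegree_denErase (p : Fin P) : (u.denErase p).natDegree = P - 1 := by
  rw [denErase, natDegree_prod_of_monic _ _ fun p _ => monic_X_sub_C _]
  simp

theorem natDegree_denBarErase (p : Fin P) : (u.denBarErase p).natDegree = P - 1 := by
  rw [denBarErase, natDegree_prod_of_monic _ _ fun p _ => monic_X_sub_C _]
  simp

theorem nextCoeff_den : u.den.nextCoeff = -∑ p, u.z p := prod_X_sub_C_nextCoeff _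

theorem nextCoeff_denBar : u.denBar.nextCoeff = -∑ p, star (u.z p) := prod_X_sub_C_nextCoeff _

theorem natDegree_den_mul_denBar : (u.den * u.denBar).natDegree = 2 * P := by
  rw [u.monic_den.natDegree_mul u.monic_denBar, natDegree_den, natDegree_denBar, two_mul]

theorem natDegree_denErase_mul (p : Fin P) : (u.denErase p * u.denBar).natDegree = 2 * P - 1 := by
  have := p.pos
  rw [(u.monic_denErase p).natDegree_mul u.monic_denBar, natDegree_denErase, natDegree_denBar]
  omega

theorem natDegree_mul_denBarErase (p : Fin P) :
    (u.den * u.denBarErase p).natDegree = 2 * P - 1 := by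
  have := p.pos
  rw [u.monic_den.natDegree_mul (u.monic_denBarErase p), natDegree_denBarErase, natDegree_den]
  omega

theorem natDegree_hnum_le (lam : ℝ) : (u.hnum lam).natDegree ≤ 2 * P := by
  refine natDegree_add_le_of_degree_le ?_ ?_
  · exact (natDegree_C_mul_le _ _).trans u.natDegree_den_mul_denBar.le
  · refine natDegree_sum_le_of_forall_le _ _ fun p _ => natDegree_add_le_of_degree_le ?_ ?_
    · refine (natDegree_C_mul_le _ _).trans ?_
      rw [natDegree_denErase_mul]; omega
    · refine (natDegree_C_mul_le _ _).trans ?_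
      rw [natDegree_mul_denBarErase]; omega

theorem coeff_hnum (hP : 0 < P) (lam : ℝ) : (u.hnum lam).coeff (2 * P) = lam := by
  have h0 : (u.den * u.denBar).coeff (2 * P) = 1 := by
    rw [← u.natDegree_den_mul_denBar]
    exact (u.monic_den.mul u.monic_denBar).coeff_natDegree
  rw [hnum, coeff_add, coeff_C_mul, h0, mul_one, finsetSum_coeff, Finset.sum_eq_zero, add_zero]
  intro p _
  rw [coeff_add, coeff_C_mul, coeff_C_mul,
    coeff_eq_zero_of_natDegree_lt (by rw [natDegree_denErase_mul]; omega),
    coeff_eq_zero_of_natDegree_lt (by rw [natDegree_mul_denBarErase]; omega)]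
  simp

/-- The summands coming from u₀ contribute Σ(c_p + c̄_p) = 0 by integrability, so only the poles
remain and the coefficient is that of λ times the denominator. -/
theorem coeff_hnum_pred (hP : 0 < P) (lam : ℝ) :
    (u.hnum lam).coeff (2 * P - 1) = -(lam * ((∑ p, 2 * (u.z p).re : ℝ) : ℂ)) := by
  have h0 : (u.den * u.denBar).coeff (2 * P - 1) = -∑ p, u.z p + -∑ p, star (u.z p) := by
    rw [← u.natDegree_den_mul_denBar, ← nextCoeff_of_natDegree_pos
      (by rw [natDegree_den_mul_denBar]; omega), u.monic_den.nextCoeff_mul u.monic_denBar,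
      nextCoeff_den, nextCoeff_denBar]
  have h1 : ∀ p, (u.denErase p * u.denBar).coeff (2 * P - 1) = 1 := fun p => by
    rw [← u.natDegree_denErase_mul p]
    exact ((u.monic_denErase p).mul u.monic_denBar).coeff_natDegree
  have h2 : ∀ p, (u.den * u.denBarErase p).coeff (2 * P - 1) = 1 := fun p => by
    rw [← u.natDegree_mul_denBarErase p]
    exact (u.monic_den.mul (u.monic_denBarErase p)).coeff_natDegree
  rw [hnum, coeff_add, coeff_C_mul, h0, finsetSum_coeff]
  simp only [coeff_add, coeff_C_mul, h1, h2, mul_one]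
  have h3 : ∑ p, (u.c p + star (u.c p)) = 0 := by
    have := u.re_sum_c
    have e : ∀ p, u.c p + star (u.c p) = ((2 * (u.c p).re : ℝ) : ℂ) := fun p => Complex.add_conj _
    simp only [e]
    rw [← Complex.ofReal_sum, ← Finset.mul_sum, ← Complex.re_sum, this]
    simp
  rw [h3, add_zero, ← neg_add, ← Finset.sum_add_distrib]
  have e : ∀ p, u.z p + star (u.z p) = ((2 * (u.z p).re : ℝ) : ℂ) := fun p => Complex.add_conj _
  simp only [e, mul_neg, Complex.ofReal_sum]

theorem natDegree_hnum (hP : 0 < P) {lam : ℝ} (hlam : lam ≠ 0) :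
    (u.hnum lam).natDegree = 2 * P := by
  refine le_antisymm (u.natDegree_hnum_le lam) (le_natDegree_of_ne_zero ?_)
  rw [u.coeff_hnum hP]
  exact_mod_cast hlam

theorem map_hnum (lam : ℝ) : (u.hnum lam).map (starRingEnd ℂ) = u.hnum lam := by
  have h1 : u.den.map (starRingEnd ℂ) = u.denBar := by
    simp [den, denBar, Polynomial.map_prod]
  have h2 : u.denBar.map (starRingEnd ℂ) = u.den := by
    simp [den, denBar, Polynomial.map_prod]
  have h3 : ∀ p, (u.denErase p).map (starRingEnd ℂ) = u.denBarErase p := fun p => by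
    simp [denErase, denBarErase, Polynomial.map_prod]
  have h4 : ∀ p, (u.denBarErase p).map (starRingEnd ℂ) = u.denErase p := fun p => by
    simp [denErase, denBarErase, Polynomial.map_prod]
  simp only [hnum, Polynomial.map_add, Polynomial.map_mul, Polynomial.map_sum, map_C, h1, h2, h3,
    h4, Complex.conj_ofReal, Complex.star_def, Complex.conj_conj]
  rw [mul_comm u.denBar u.den]
  refine congrArg (_ + ·) (Finset.sum_congr rfl fun p _ => ?_)
  rw [add_comm, mul_comm u.denBar, mul_comm (u.denBarErase p)]

theorem rootMultiplicity_conj (lam : ℝ) (ζ : ℂ) :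
    (u.hnum lam).rootMultiplicity (starRingEnd ℂ ζ) = (u.hnum lam).rootMultiplicity ζ := by
  have := eq_rootMultiplicity_map (p := u.hnum lam) (f := starRingEnd ℂ)
    (starRingEnd ℂ).injective ζ
  rw [u.map_hnum] at this
  exact this.symm

/-- Vieta for the two leading coefficients: the zeros of λ + u₀ have the same sum as the poles z_p
and their conjugates. -/
theorem roots_sum_hnum (hP : 0 < P) {lam : ℝ} (hlam : lam ≠ 0) :
    ((u.hnum lam).roots.map Complex.re).sum = ∑ p, 2 * (u.z p).re := by
  have hl : (lam : ℂ) ≠ 0 := by exact_mod_cast hlam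
  have hcard : (u.hnum lam).roots.card = (u.hnum lam).natDegree :=
    (IsAlgClosed.card_roots_eq_natDegree)
  have h1 := C_leadingCoeff_mul_prod_multiset_X_sub_C hcard
  have h2 := u.coeff_hnum_pred hP lam
  have hlc : (u.hnum lam).leadingCoeff = lam := by
    rw [leadingCoeff, u.natDegree_hnum hP hlam, u.coeff_hnum hP]
  have hc2 : (u.hnum lam).roots.card = 2 * P := by rw [hcard, u.natDegree_hnum hP hlam]
  rw [← h1, hlc, coeff_C_mul, ← hc2, multiset_prod_X_sub_C_coeff_card_pred _ (by omega),
    mul_neg, neg_inj] at h2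
  have h3 := mul_left_cancel₀ hl h2
  have h4 := congrArg Complex.re h3
  rw [Complex.ofReal_re] at h4
  rw [← h4]
  exact (map_multiset_sum Complex.reLm _).symm

theorem isRoot_hnum_iff (lam : ℝ) (x : ℝ) :
    (u.hnum lam).IsRoot (x : ℂ) ↔ lam + u.u₀ x = 0 := by
  have hz := u.ofReal_ne x
  have h := u.add_uC_eq_div lam hz
  have h0 := u.eval_den_ne_zero fun p => (hz p).1
  have h0' := u.eval_denBar_ne_zero fun p => (hz p).2
  rw [u.uC_ofReal, eq_div_iff (mul_ne_zero h0 h0')] at h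
  rw [IsRoot, ← h, mul_eq_zero, or_iff_left (mul_ne_zero h0 h0')]
  exact_mod_cast Iff.rfl

/-- The order to which limiting data vanish at the zeros of `λ + u₀`. -/
def vanishOrder (lam xm xp : ℝ) (ζ : ℂ) : ℕ :=
  if ζ.im < 0 then 0 else
  if ζ = xm then ((u.hnum lam).rootMultiplicity ζ + 1) / 2 else
  if ζ = xp then ((u.hnum lam).rootMultiplicity ζ - 1) / 2 else
    (u.hnum lam).rootMultiplicity ζ

/-- Twice the sum over zeros in the upper half-plane counts every nonreal zero once, by conjugation
symmetry. At the real zeros twice the order is the multiplicity plus 1 on the left and minus 1 on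
the right; these two units produce the correction. The choice f = 1 counts degrees, and f = Re
produces the distance of the turning points. -/
theorem two_mul_sum_vanishOrder {lam xm xp : ℝ} (ht : u.TurningPoints lam xm xp)
    (hP : 0 < P) {km kp : ℕ} (hm : (u.hnum lam).rootMultiplicity (xm : ℂ) = 2 * km + 1)
    (hp : (u.hnum lam).rootMultiplicity (xp : ℂ) = 2 * kp + 1) {f : ℂ → ℝ}
    (hf : ∀ z, f (starRingEnd ℂ z) = f z) :
    2 * ∑ ζ ∈ (u.hnum lam).roots.toFinset, u.vanishOrder lam xm xp ζ * f ζ =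
      ((u.hnum lam).roots.map f).sum + f xm - f xp := by
  classical
  have h0 := u.hnum_ne_zero hP lam
  set Z := (u.hnum lam).roots.toFinset with hZ
  set r : ℂ → ℕ := fun ζ => (u.hnum lam).rootMultiplicity ζ with hr
  have hmem : ∀ ζ, ζ ∈ Z ↔ (u.hnum lam).IsRoot ζ := fun ζ => by
    rw [hZ, Multiset.mem_toFinset, mem_roots h0]
  have hconj : ∀ ζ, ζ ∈ Z → starRingEnd ℂ ζ ∈ Z := fun ζ hζ => by
    rw [hmem, ← rootMultiplicity_pos h0] at hζ ⊢
    rwa [u.rootMultiplicity_conj]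
  have hxm : (xm : ℂ) ∈ Z := (hmem _).2 ((u.isRoot_hnum_iff lam xm).2 ht.eq_left)
  have hxp : (xp : ℂ) ∈ Z := (hmem _).2 ((u.isRoot_hnum_iff lam xp).2 ht.eq_right)
  have hne : (xm : ℂ) ≠ xp := by exact_mod_cast ht.lt.ne
  have hreal : ∀ ζ ∈ Z, ζ.im = 0 → ζ = xm ∨ ζ = xp := fun ζ hζ him => by
    have e : ζ = (ζ.re : ℂ) := Complex.ext rfl (by simpa using him)
    rw [e, hmem, u.isRoot_hnum_iff] at hζ
    have : ζ.re ∈ ({xm, xp} : Set ℝ) := by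
      rw [← ht.setOf_eq, Set.mem_ofPred_eq]; linarith
    rw [e]
    rcases this with h | h
    · exact Or.inl (by rw [h])
    · exact Or.inr (by rw [Set.mem_singleton_iff.1 h])
  have hsplit : ∀ a : ℂ → ℝ, ∑ ζ ∈ Z, a ζ = ∑ ζ ∈ Z with 0 < ζ.im, a ζ +
      ∑ ζ ∈ Z with ζ.im < 0, a ζ + (a xm + a xp) := fun a => by
    have h1 := Finset.sum_filter_add_sum_filter_not Z (fun ζ : ℂ => 0 < ζ.im) a
    have h2 := Finset.sum_filter_add_sum_filter_not (Z.filter fun ζ : ℂ => ¬0 < ζ.im)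
      (fun ζ : ℂ => ζ.im < 0) a
    have e1 : (Z.filter fun ζ : ℂ => ¬0 < ζ.im).filter (fun ζ : ℂ => ζ.im < 0) =
        Z.filter fun ζ : ℂ => ζ.im < 0 := by
      ext ζ
      simp only [Finset.mem_filter]
      exact ⟨fun h => ⟨h.1.1, h.2⟩, fun h => ⟨⟨h.1, by linarith [h.2]⟩, h.2⟩⟩
    have e2 : (Z.filter fun ζ : ℂ => ¬0 < ζ.im).filter (fun ζ : ℂ => ¬ζ.im < 0) =
        {(xm : ℂ), (xp : ℂ)} := by
      ext ζ
      simp only [Finset.mem_filter, Finset.mem_insert, Finset.mem_singleton]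
      refine ⟨fun h => hreal ζ h.1.1 (by linarith [h.1.2, h.2]), ?_⟩
      rintro (h | h) <;> subst h <;> simp [hxm, hxp]
    rw [e1, e2, Finset.sum_pair hne] at h2
    linarith
  have hpair : ∀ a : ℂ → ℝ, (∀ z, a (starRingEnd ℂ z) = a z) →
      ∑ ζ ∈ Z with ζ.im < 0, a ζ = ∑ ζ ∈ Z with 0 < ζ.im, a ζ := fun a ha => by
    refine Finset.sum_nbij' (starRingEnd ℂ) (starRingEnd ℂ) ?_ ?_ ?_ ?_ ?_
    · intro ζ h
      rw [Finset.mem_filter] at h ⊢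
      exact ⟨hconj ζ h.1, by rw [Complex.conj_im]; linarith [h.2]⟩
    · intro ζ h
      rw [Finset.mem_filter] at h ⊢
      exact ⟨hconj ζ h.1, by rw [Complex.conj_im]; linarith [h.2]⟩
    · intro ζ _; exact Complex.conj_conj ζ
    · intro ζ _; exact Complex.conj_conj ζ
    · intro ζ _; exact (ha ζ).symm
  have hall : ((u.hnum lam).roots.map f).sum = ∑ ζ ∈ Z, r ζ * f ζ := by
    rw [Finset.sum_multiset_map_count]
    refine Finset.sum_congr rfl fun ζ _ => ?_
    rw [count_roots, nsmul_eq_mul]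
  have hS := hsplit fun ζ => u.vanishOrder lam xm xp ζ * f ζ
  have hR := hsplit fun ζ => r ζ * f ζ
  rw [hpair _ fun z => by rw [hf]; simp only [hr]; rw [u.rootMultiplicity_conj]] at hR
  have hup : ∑ ζ ∈ Z with 0 < ζ.im, (u.vanishOrder lam xm xp ζ : ℝ) * f ζ =
      ∑ ζ ∈ Z with 0 < ζ.im, r ζ * f ζ := Finset.sum_congr rfl fun ζ h => by
    rw [Finset.mem_filter] at h
    have n1 : ζ ≠ xm := fun e => by rw [e] at h; simp at h
    have n2 : ζ ≠ xp := fun e => by rw [e] at h; simp at h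
    rw [vanishOrder, if_neg (by linarith [h.2]), if_neg n1, if_neg n2]
  have hlow : ∑ ζ ∈ Z with ζ.im < 0, (u.vanishOrder lam xm xp ζ : ℝ) * f ζ = 0 :=
    Finset.sum_eq_zero fun ζ h => by
      rw [vanishOrder, if_pos (Finset.mem_filter.1 h).2, Nat.cast_zero, zero_mul]
  have e1 : u.vanishOrder lam xm xp xm = km + 1 := by
    rw [vanishOrder, if_neg (by simp), if_pos rfl, hm]; omega
  have e2 : u.vanishOrder lam xm xp xp = kp := by
    rw [vanishOrder, if_neg (by simp), if_neg hne.symm, if_pos rfl, hp]; omega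
  rw [hall, hS, hR, hup, hlow, e1, e2]
  simp only [hr, hm, hp]
  push_cast
  ring

theorem coeffSmall_vanishOrder (hP : 0 < P) {lam xm xp : ℝ} (ht : u.TurningPoints lam xm xp)
    {ζ : ℂ} (hζ : ζ ∈ (u.hnum lam).roots.toFinset) :
    u.CoeffSmall lam ζ (u.vanishOrder lam xm xp ζ) := by
  obtain ⟨km, hm, hcm⟩ := u.coeffSmall_left hP ht
  obtain ⟨kp, hp, hcp⟩ := u.coeffSmall_right hP ht
  have hroot : (u.hnum lam).IsRoot ζ := isRoot_of_mem_roots (Multiset.mem_toFinset.1 hζ)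
  rw [vanishOrder]
  split_ifs with h1 h2 h3
  · exact fun l hl => absurd hl (Nat.not_lt_zero l)
  · rw [h2, hm, show (2 * km + 1 + 1) / 2 = km + 1 by omega]
    exact hcm
  · rw [h3, hp, show (2 * kp + 1 - 1) / 2 = kp by omega]
    exact hcp
  · refine u.coeffSmall_interior hP ht.lam_pos ?_ ?_
    · refine lt_of_le_of_ne (not_lt.1 h1) fun him => ?_
      have e : ζ = (ζ.re : ℂ) := Complex.ext rfl (by simpa using him.symm)
      rw [e, u.isRoot_hnum_iff] at hroot
      have : ζ.re ∈ ({xm, xp} : Set ℝ) := by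
        rw [← ht.setOf_eq, Set.mem_ofPred_eq]; linarith
      rcases this with h | h
      · exact h2 (by rw [e, h])
      · exact h3 (by rw [e, Set.mem_singleton_iff.1 h])
    · rintro p rfl
      exact u.eval_hnum_z lam p hroot

/-- The numerator of limiting data is determined up to a factor. -/
theorem num_eq_of_nu_eq_zero (hP : 0 < P) {lam xm xp : ℝ} (ht : u.TurningPoints lam xm xp)
    {κ : ℂ} {v : Fin P → ℂ}
    (hν : ∀ ζ ∈ (u.hnum lam).roots.toFinset, ∀ l < u.vanishOrder lam xm xp ζ,
      u.nu lam ζ κ v l = 0) :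
    u.num lam κ v = C (κ * lam) *
      ∏ ζ ∈ (u.hnum lam).roots.toFinset, (X - C ζ) ^ u.vanishOrder lam xm xp ζ := by
  obtain ⟨km, hm, -⟩ := u.coeffSmall_left hP ht
  obtain ⟨kp, hp, -⟩ := u.coeffSmall_right hP ht
  set Z := (u.hnum lam).roots.toFinset
  set n := u.vanishOrder lam xm xp
  set S : ℂ[X] := ∏ ζ ∈ Z, (X - C ζ) ^ n ζ with hS
  have hSm : S.Monic := monic_prod_of_monic _ _ fun ζ _ => (monic_X_sub_C ζ).pow _
  -- With f = 1 the corrections cancel and half of the 2P zeros remain. So S has the maximal degree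
  -- of the numerator, which can only be a constant multiple of S.
  have hdeg : S.natDegree = P := by
    rw [hS, natDegree_prod_of_monic _ _ fun ζ _ => (monic_X_sub_C ζ).pow _]
    simp only [natDegree_pow, natDegree_X_sub_C, mul_one]
    have h2 := u.two_mul_sum_vanishOrder ht hP hm hp (f := fun _ => 1) (fun _ => rfl)
    simp only [mul_one, Multiset.map_const', Multiset.sum_replicate, nsmul_eq_mul,
      add_sub_cancel_right] at h2
    rw [IsAlgClosed.card_roots_eq_natDegree, u.natDegree_hnum hP ht.lam_pos.ne'] at h2
    have h3 : 2 * ∑ ζ ∈ Z, n ζ = 2 * P := by exact_mod_cast h2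
    omega
  have hdvd : S ∣ u.num lam κ v := by
    refine Finset.prod_dvd_of_coprime ?_ fun ζ hζ => ?_
    · intro a _ b _ hab
      exact (isCoprime_X_sub_C_of_isUnit_sub (sub_ne_zero.2 hab).isUnit).pow
    · rw [X_sub_C_pow_dvd_iff, X_pow_dvd_iff]
      exact fun d hd => hν ζ hζ d hd
  obtain ⟨T, hT⟩ := hdvd
  have hcP : (u.num lam κ v).coeff P = κ * lam := by
    have h0 : u.den.coeff P = 1 := by
      have := u.monic_den.coeff_natDegree
      rwa [u.natDegree_den] at this
    rw [num, coeff_add, coeff_C_mul, h0, mul_one, finsetSum_coeff, Finset.sum_eq_zero, add_zero]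
    intro p _
    rw [coeff_C_mul, coeff_eq_zero_of_natDegree_lt (u.natDegree_denErase_lt p), mul_zero]
  rcases eq_or_ne T 0 with h0 | h0
  · rw [h0, mul_zero] at hT
    rw [hT, coeff_zero] at hcP
    rw [hT, ← hcP, C_0, zero_mul]
  · have h1 := u.natDegree_num_le lam κ v
    rw [hT, hSm.natDegree_mul' h0, hdeg] at h1
    have h2 : T = C (T.coeff 0) := eq_C_of_natDegree_eq_zero (by omega)
    rw [h2] at hT
    have h3 : (S * C (T.coeff 0)).coeff P = T.coeff 0 := by
      rw [coeff_mul_C]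
      conv_lhs => rw [← hdeg]
      rw [hSm.coeff_natDegree, one_mul]
    rw [← hT, hcP] at h3
    rw [hT, ← h3, mul_comm]

theorem eq_zero_of_num_eq_zero {lam : ℝ} {v : Fin P → ℂ} (h : u.num lam 0 v = 0) : v = 0 := by
  funext p
  have h1 := congrArg (eval (u.z p)) h
  rw [num, eval_add, zero_mul, C_0, zero_mul, eval_zero, zero_add, eval_finsetSum,
    Finset.sum_eq_single p, eval_mul, eval_C, mul_eq_zero] at h1
  · refine h1.resolve_right ?_
    rw [denErase, eval_prod]
    refine Finset.prod_ne_zero_iff.2 fun r hr => ?_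
    have : u.z p ≠ u.z r := fun h => (Finset.mem_erase.1 hr).1 (u.z_injective h).symm
    simpa [sub_eq_zero] using this
  · intro r _ hr
    rw [eval_mul, denErase, eval_prod,
      Finset.prod_eq_zero (Finset.mem_erase.2 ⟨hr.symm, Finset.mem_univ p⟩) (by simp), mul_zero]
  · simp

/-- Comparison of the coefficients of X^{P−1} in the numerator and in λ∏(X − ζ)^n gives Σ v_p = λ(Σ
z_p − Σ nζ). In twice its real part the sum of all zeros cancels against the poles, leaving the
correction x₊ − x₋. -/
theorem re_sum_eq_of_nu_eq_zero (hP : 0 < P) {lam xm xp : ℝ} (ht : u.TurningPoints lam xm xp)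
    {v : Fin P → ℂ} (hν : ∀ ζ ∈ (u.hnum lam).roots.toFinset,
      ∀ l < u.vanishOrder lam xm xp ζ, u.nu lam ζ 1 v l = 0) :
    2 * (∑ p, v p).re = lam * (xp - xm) := by
  obtain ⟨km, hm, -⟩ := u.coeffSmall_left hP ht
  obtain ⟨kp, hp, -⟩ := u.coeffSmall_right hP ht
  have hnum := u.num_eq_of_nu_eq_zero hP ht hν
  have hlam := ht.lam_pos.ne'
  set Z := (u.hnum lam).roots.toFinset
  set n := u.vanishOrder lam xm xp
  have hcard : ∑ ζ ∈ Z, n ζ = P := by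
    have h2 := u.two_mul_sum_vanishOrder ht hP hm hp (f := fun _ => 1) (fun _ => rfl)
    simp only [mul_one, Multiset.map_const', Multiset.sum_replicate, nsmul_eq_mul,
      add_sub_cancel_right] at h2
    rw [IsAlgClosed.card_roots_eq_natDegree, u.natDegree_hnum hP hlam] at h2
    have h3 : 2 * ∑ ζ ∈ Z, n ζ = 2 * P := by exact_mod_cast h2
    omega
  -- The zeros repeated according to their orders, so that Vieta's formula for monic products
  -- applies.
  set R : Multiset ℂ := ∑ ζ ∈ Z, Multiset.replicate (n ζ) ζ with hR
  have hRc : R.card = P := by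
    rw [hR, Multiset.card_sum]
    simpa using hcard
  have hRS : ∏ ζ ∈ Z, (X - C ζ : ℂ[X]) ^ n ζ = (R.map fun t => X - C t).prod := by
    rw [hR, ← Multiset.coe_mapAddMonoidHom, map_sum, Multiset.prod_sum]
    simp
  have hRsum : R.sum = ∑ ζ ∈ Z, n ζ * ζ := by
    rw [hR, Multiset.sum_sum]
    simp
  have hc := congrArg (fun p => coeff p (P - 1)) hnum
  simp only [one_mul] at hc
  have hpred : (R.map fun t => X - C t).prod.coeff (P - 1) = -R.sum := by
    have := multiset_prod_X_sub_C_coeff_card_pred R (by omega)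
    rwa [hRc] at this
  rw [hRS, coeff_C_mul, hpred, hRsum, num, coeff_add, coeff_C_mul, finsetSum_coeff] at hc
  have h1 : u.den.coeff (P - 1) = -∑ p, u.z p := by
    rw [← u.nextCoeff_den, nextCoeff_of_natDegree_pos (by rw [natDegree_den]; exact hP),
      natDegree_den]
  have h2 : ∀ p, (C (v p) * u.denErase p).coeff (P - 1) = v p := fun p => by
    rw [coeff_C_mul]
    have := (u.monic_denErase p).coeff_natDegree
    rw [u.natDegree_denErase p] at this
    rw [this, mul_one]
  simp only [h1, h2, one_mul] at hc
  have h3 := congrArg Complex.re hc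
  have h4 := u.two_mul_sum_vanishOrder ht hP hm hp (f := Complex.re) Complex.conj_re
  rw [u.roots_sum_hnum hP hlam, ← Finset.mul_sum, Complex.ofReal_re, Complex.ofReal_re] at h4
  have h5 : (∑ ζ ∈ Z, (n ζ : ℂ) * ζ).re = ∑ ζ ∈ Z, n ζ * ζ.re := by
    rw [Complex.re_sum]
    refine Finset.sum_congr rfl fun ζ _ => ?_
    rw [← Complex.ofReal_natCast, Complex.re_ofReal_mul]
  rw [Complex.add_re, Complex.re_ofReal_mul, Complex.re_ofReal_mul, Complex.neg_re, Complex.neg_re,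
    h5, Complex.re_sum (f := u.z)] at h3
  linear_combination 2 * h3 + lam * (-1) * h4

end RationalPotential


/-! ### Compactness of normalised data -/

namespace RationalPotential

open Polynomial

variable {P : ℕ} (u : RationalPotential P)

theorem continuous_size : Continuous fun x : ℂ × (Fin P → ℂ) => size x.1 x.2 := by
  unfold size; fun_prop

theorem continuous_nu (lam : ℝ) (ζ : ℂ) (l : ℕ) :
    Continuous fun x : ℂ × (Fin P → ℂ) => u.nu lam ζ x.1 x.2 l := by
  simp only [nu, num, map_add, taylor_mul, taylor_C, coeff_add, coeff_C_mul, map_sum,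
    finsetSum_coeff]
  fun_prop

theorem size_smul (a κ : ℂ) (v : Fin P → ℂ) : size (a * κ) (a • v) = ‖a‖ * size κ v := by
  simp only [size, Pi.smul_apply, smul_eq_mul, norm_mul, mul_add, Finset.mul_sum]

theorem eq_zero_of_size {κ : ℂ} {v : Fin P → ℂ} (h : size κ v = 0) : κ = 0 ∧ v = 0 := by
  refine ⟨?_, funext fun p => ?_⟩
  · have := norm_le_size κ v
    rw [h] at this
    exact norm_le_zero_iff.1 this
  · have := norm_apply_le_size κ v p
    rw [h] at this
    exact norm_le_zero_iff.1 this

theorem isCompact_size_le (C : ℝ) : IsCompact {x : ℂ × (Fin P → ℂ) | size x.1 x.2 ≤ C} := by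
  refine Metric.isCompact_of_isClosed_isBounded (isClosed_le continuous_size continuous_const) ?_
  rw [Metric.isBounded_iff_subset_closedBall 0]
  refine ⟨max C 0, fun x hx => ?_⟩
  rw [mem_closedBall_zero_iff, norm_prod_le_iff]
  refine ⟨(norm_le_size x.1 x.2).trans (le_trans hx (le_max_left _ _)), ?_⟩
  rw [pi_norm_le_iff_of_nonneg (le_max_right _ _)]
  exact fun p => (norm_apply_le_size x.1 x.2 p).trans (le_trans hx (le_max_left _ _))

theorem IsJost.smul {u : RationalPotential P} {ε lam : ℝ} {κ : ℂ} {v : Fin P → ℂ} {w : ℂ → ℂ}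
    (hw : u.IsJost ε lam κ v w) (a : ℂ) : u.IsJost ε lam (a * κ) (a • v) fun z => a * w z where
  diff z hz := (hw.diff z hz).const_mul a
  ode z hz hp := by
    rw [deriv_const_mul _ (hw.diff z hz)]
    have e : u.q lam (a * κ) (a • v) z = a * u.q lam κ v z := by
      simp only [q, Pi.smul_apply, smul_eq_mul, mul_add, Finset.mul_sum, mul_div_assoc, mul_assoc]
    rw [e, ← hw.ode z hz hp]
    ring
  lim := hw.lim.const_mul a

/-- Data whose numerator vanishes to the orders forced in the limit `ε → 0`. -/
def IsLimiting (lam xm xp : ℝ) (x : ℂ × (Fin P → ℂ)) : Prop :=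
  ∀ ζ ∈ (u.hnum lam).roots.toFinset, ∀ l < u.vanishOrder lam xm xp ζ, u.nu lam ζ x.1 x.2 l = 0

variable {u} {lam xm xp : ℝ}

theorem isClosed_isLimiting : IsClosed {x | u.IsLimiting lam xm xp x} := by
  have : {x | u.IsLimiting lam xm xp x} = ⋂ ζ ∈ (u.hnum lam).roots.toFinset,
      ⋂ l, ⋂ (_ : l < u.vanishOrder lam xm xp ζ), {x | u.nu lam ζ x.1 x.2 l = 0} := by
    ext x; simp [IsLimiting]
  rw [this]
  exact isClosed_biInter fun ζ _ => isClosed_iInter fun l => isClosed_iInter fun _ =>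
    isClosed_eq (u.continuous_nu lam ζ l) continuous_const

/-- A compact set of data without limiting data carries no Jost functions for small `ε`. -/
theorem eventually_not_isJost (hP : 0 < P) (ht : u.TurningPoints lam xm xp)
    {K : Set (ℂ × (Fin P → ℂ))} (hK : IsCompact K) (hlim : ∀ x ∈ K, ¬u.IsLimiting lam xm xp x) :
    ∀ᶠ ε in 𝓝[>] (0 : ℝ), ∀ x ∈ K, ∀ w, ¬u.IsJost ε lam x.1 x.2 w := by
  set Z := (u.hnum lam).roots.toFinset
  set n := u.vanishOrder lam xm xp
  set N : ℂ × (Fin P → ℂ) → ℝ := fun x => ∑ ζ ∈ Z, ∑ l ∈ Finset.range (n ζ),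
    ‖u.nu lam ζ x.1 x.2 l‖ with hN
  have hNc : Continuous N := continuous_finsetSum _ fun ζ _ => continuous_finsetSum _ fun l _ =>
    (u.continuous_nu lam ζ l).norm
  have hNpos : ∀ x ∈ K, 0 < N x := by
    intro x hx
    refine lt_of_le_of_ne (by positivity) fun h0 => hlim x hx fun ζ hζ l hl => ?_
    have h1 := (Finset.sum_eq_zero_iff_of_nonneg fun ζ _ => by positivity).1 h0.symm ζ hζ
    have h2 := (Finset.sum_eq_zero_iff_of_nonneg fun l _ => by positivity).1 h1 l
      (Finset.mem_range.2 hl)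
    exact norm_eq_zero.1 h2
  obtain ⟨m, hm, hmK⟩ := hK.exists_forall_le' hNc.continuousOn hNpos
  obtain ⟨B, hB⟩ := hK.bddAbove_image continuous_size.continuousOn
  set c : ℝ := ∑ ζ ∈ Z, (n ζ : ℝ) with hc
  have hc0 : 0 ≤ c := by positivity
  -- A Jost function with data in K would make the sum N at most cη|B|, which this η places strictly
  -- below the minimum m of N on K.
  set η := m / ((c + 1) * (|B| + 1)) with hη
  have hη0 : 0 < η := by positivity
  have hev : ∀ᶠ ε in 𝓝[>] (0 : ℝ), ∀ ζ ∈ Z, ∀ l ∈ Finset.range (n ζ), ∀ κ v w,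
      u.IsJost ε lam κ v w → ‖u.nu lam ζ κ v l‖ ≤ η * size κ v := by
    rw [eventually_all_finset]
    intro ζ hζ
    rw [eventually_all_finset]
    intro l hl
    obtain ⟨ε₀, hε₀, h⟩ := u.coeffSmall_vanishOrder hP ht hζ l (Finset.mem_range.1 hl) η hη0
    filter_upwards [Ioo_mem_nhdsGT hε₀] with ε hε κ v w hw
    exact h ε κ v w hε.1 hε.2 hw
  filter_upwards [hev] with ε hε x hx w hw
  have h1 : size x.1 x.2 ≤ |B| := (hB ⟨x, hx, rfl⟩).trans (le_abs_self B)
  have h2 : N x ≤ c * (η * |B|) := by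
    rw [hN, hc, Finset.sum_mul]
    refine Finset.sum_le_sum fun ζ hζ => ?_
    calc ∑ l ∈ Finset.range (n ζ), ‖u.nu lam ζ x.1 x.2 l‖
        ≤ ∑ l ∈ Finset.range (n ζ), η * |B| := Finset.sum_le_sum fun l hl =>
          (hε ζ hζ l hl _ _ w hw).trans (by gcongr)
      _ = n ζ * (η * |B|) := by simp
  have h3 : η * ((c + 1) * (|B| + 1)) = m := by rw [hη]; field_simp
  have h4 := hmK x hx
  have hB0 := abs_nonneg B
  have : 0 < η * c + η * |B| + η := by positivity
  nlinarith

/-- For small `ε`, Jost data are controlled by their value at `-∞`. -/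
theorem exists_bound_size (hP : 0 < P) (ht : u.TurningPoints lam xm xp) : ∃ C : ℝ,
    ∀ᶠ ε in 𝓝[>] (0 : ℝ), ∀ κ v w, u.IsJost ε lam κ v w → size κ v ≤ C * ‖κ‖ := by
  -- Limiting data of size 1. With κ = 0 their numerator would vanish, hence also v, so |κ| has a
  -- positive lower bound r on L.
  set L : Set (ℂ × (Fin P → ℂ)) :=
    {x | size x.1 x.2 ≤ 1} ∩ ({x | 1 ≤ size x.1 x.2} ∩ {x | u.IsLimiting lam xm xp x}) with hL
  have hLc : IsCompact L := (isCompact_size_le 1).inter_right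
    ((isClosed_le continuous_const continuous_size).inter isClosed_isLimiting)
  obtain ⟨r, hr, hrL⟩ := hLc.exists_forall_le' (f := fun x => ‖x.1‖) (a := 0)
    continuous_fst.norm.continuousOn (by
      rintro ⟨κ, v⟩ ⟨-, h1, h2⟩
      rw [norm_pos_iff]
      rintro (rfl : κ = 0)
      have h3 := u.num_eq_of_nu_eq_zero hP ht h2
      rw [zero_mul, C_0, zero_mul] at h3
      have h4 := u.eq_zero_of_num_eq_zero h3
      subst h4
      simp [size] at h1
      linarith)
  refine ⟨2 / r, ?_⟩
  -- Data of size 1 with |κ| ≤ r/2, none of which is limiting. A violation of the claim, rescaled to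
  -- size 1, would fall into K.
  set K : Set (ℂ × (Fin P → ℂ)) :=
    {x | size x.1 x.2 ≤ 1} ∩ ({x | 1 ≤ size x.1 x.2} ∩ {x | ‖x.1‖ ≤ r / 2}) with hK
  have hKc : IsCompact K := (isCompact_size_le 1).inter_right
    ((isClosed_le continuous_const continuous_size).inter
      (isClosed_le continuous_fst.norm continuous_const))
  filter_upwards [eventually_not_isJost hP ht hKc (fun x hx hl => by
    have := hrL x ⟨hx.1, hx.2.1, hl⟩
    have h2 : ‖x.1‖ ≤ r / 2 := hx.2.2
    linarith)] with ε hε κ v w hw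
  by_contra! hlt
  have hs : 0 < size κ v := lt_of_le_of_lt (by positivity) hlt
  set a : ℂ := (((size κ v)⁻¹ : ℝ) : ℂ) with ha
  have hna : ‖a‖ = (size κ v)⁻¹ := by
    rw [ha, Complex.norm_real, Real.norm_of_nonneg (by positivity)]
  have h1 : size (a * κ) (a • v) = 1 := by
    rw [size_smul, hna, inv_mul_cancel₀ hs.ne']
  refine hε (a * κ, a • v) ⟨h1.le, h1.ge, ?_⟩ _ (hw.smul a)
  change ‖a * κ‖ ≤ r / 2
  rw [norm_mul, hna, inv_mul_le_iff₀ hs]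
  rw [div_mul_eq_mul_div, div_lt_iff₀ hr] at hlt
  linarith

/-- The limit of the sum of the normalised data. -/
theorem eventually_re_sum (hP : 0 < P) (ht : u.TurningPoints lam xm xp) {η : ℝ} (hη : 0 < η) :
    ∀ᶠ ε in 𝓝[>] (0 : ℝ), ∀ v w, u.IsJost ε lam 1 v w →
      |2 * (∑ p, v p).re - lam * (xp - xm)| < η := by
  obtain ⟨C, hC⟩ := exists_bound_size hP ht
  -- Bounded data with κ = 1 whose sum misses the predicted value by at least η. Limiting data
  -- attain it exactly, so K contains none.
  set K : Set (ℂ × (Fin P → ℂ)) := {x | size x.1 x.2 ≤ C} ∩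
    ({x | x.1 = 1} ∩ {x | η ≤ |2 * (∑ p, x.2 p).re - lam * (xp - xm)|}) with hK
  have hKc : IsCompact K := (isCompact_size_le C).inter_right
    ((isClosed_eq continuous_fst continuous_const).inter (isClosed_le continuous_const (by
      have : Continuous fun x : ℂ × (Fin P → ℂ) => (∑ p, x.2 p).re :=
        Complex.continuous_re.comp (by fun_prop)
      fun_prop)))
  filter_upwards [hC, eventually_not_isJost hP ht hKc (by
    rintro ⟨κ, v⟩ ⟨-, (rfl : κ = 1), h2⟩ hl
    have h2' : η ≤ |2 * (∑ p, v p).re - lam * (xp - xm)| := h2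
    rw [u.re_sum_eq_of_nu_eq_zero hP ht hl, sub_self, abs_zero] at h2'
    linarith)] with ε h1 h2 v w hw
  by_contra! hge
  refine h2 (1, v) ⟨?_, rfl, hge⟩ w hw
  have := h1 1 v w hw
  simpa using this

end RationalPotential


/-! ### The exact identity for the amplitude at +∞ -/

/-- The integral of twice the Poisson kernel. -/
theorem integral_inv_sub_sub_inv_sub_conj {a : ℂ} (ha : 0 < a.im) :
    Integrable (fun x : ℝ => ((x : ℂ) - a)⁻¹ - ((x : ℂ) - star a)⁻¹) ∧
    ∫ x : ℝ, (((x : ℂ) - a)⁻¹ - ((x : ℂ) - star a)⁻¹) = 2 * Real.pi * Complex.I := by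
  have e : ∀ x : ℝ, ((x : ℂ) - a)⁻¹ - ((x : ℂ) - star a)⁻¹ =
      ((2 * (a.im⁻¹ * (1 + ((x - a.re) / a.im) ^ 2)⁻¹) : ℝ) : ℂ) * Complex.I := by
    intro x
    have h1 : (x : ℂ) - a ≠ 0 := fun h => by
      have := congrArg Complex.im h; simp at this; linarith
    have h2 : (x : ℂ) - star a ≠ 0 := fun h => by
      have := congrArg Complex.im h; simp at this; linarith
    have h3 : ((x : ℂ) - a) * (x - star a) = (((x - a.re) ^ 2 + a.im ^ 2 : ℝ) : ℂ) := by
      have h31 : star a = (a.re : ℂ) - a.im * Complex.I := by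
        apply Complex.ext <;> simp
      have h32 : a = (a.re : ℂ) + a.im * Complex.I := (Complex.re_add_im a).symm
      rw [h31]
      conv_lhs => rw [h32]
      simp only [Complex.add_re, Complex.ofReal_re, Complex.re_ofReal_mul, Complex.I_re, mul_zero,
        add_zero, Complex.add_im, Complex.ofReal_im, Complex.im_ofReal_mul, Complex.I_im, mul_one,
        zero_add]
      push_cast
      linear_combination (-(a.im : ℂ) ^ 2) * Complex.I_sq
    have h4 : a - star a = ((2 * a.im : ℝ) : ℂ) * Complex.I := by
      rw [Complex.star_def, Complex.sub_conj]
    have h5 : (a.im⁻¹ * (1 + ((x - a.re) / a.im) ^ 2)⁻¹) = a.im / ((x - a.re) ^ 2 + a.im ^ 2) := by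
      field_simp
      ring
    rw [inv_sub_inv h1 h2, h3, h5, show (x : ℂ) - star a - (x - a) = a - star a by ring, h4]
    push_cast
    ring
  simp only [e]
  have hbase : Integrable fun x : ℝ => (1 + ((x - a.re) / a.im) ^ 2)⁻¹ :=
    ((integrable_inv_one_add_sq.comp_div ha.ne').comp_sub_right a.re)
  have hi : Integrable fun x : ℝ => (2 * (a.im⁻¹ * (1 + ((x - a.re) / a.im) ^ 2)⁻¹)) :=
    (hbase.const_mul _).const_mul _
  refine ⟨hi.ofReal.mul_const _, ?_⟩
  rw [integral_mul_const, integral_complex_ofReal, integral_const_mul, integral_const_mul]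
  have h6 : ∫ x : ℝ, (1 + ((x - a.re) / a.im) ^ 2)⁻¹ = a.im * Real.pi := by
    rw [integral_sub_right_eq_self (fun x : ℝ => (1 + (x / a.im) ^ 2)⁻¹) a.re,
      Measure.integral_comp_div (fun x : ℝ => (1 + x ^ 2)⁻¹) a.im, integral_univ_inv_one_add_sq,
      abs_of_pos ha, smul_eq_mul]
  rw [h6, ← mul_assoc a.im⁻¹, inv_mul_cancel₀ ha.ne']
  push_cast
  ring

namespace RationalPotential

variable {P : ℕ} (u : RationalPotential P)

/-- The reflection of `q` in the real axis. -/
def qs (lam : ℝ) (κ : ℂ) (v : Fin P → ℂ) (z : ℂ) : ℂ :=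
  star κ * lam + ∑ p, star (v p) / (z - star (u.z p))

/-- The derivative of `qs`. -/
def qs' (v : Fin P → ℂ) (z : ℂ) : ℂ := -∑ p, star (v p) / (z - star (u.z p)) ^ 2

theorem qs_eq (lam : ℝ) (κ : ℂ) (v : Fin P → ℂ) (z : ℂ) :
    u.qs lam κ v z = star (u.q lam κ v (star z)) := by
  simp [qs, q]

theorem qs'_eq (v : Fin P → ℂ) (z : ℂ) : u.qs' v z = star (u.q' v (star z)) := by
  simp [qs', q']

theorem ne_star_of_nonneg {z : ℂ} (hz : 0 ≤ z.im) (p : Fin P) : z - star (u.z p) ≠ 0 := by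
  intro h
  have := congrArg Complex.im h
  simp at this
  linarith [u.z_im_pos p]

variable {lam : ℝ} {κ : ℂ} {v : Fin P → ℂ}

theorem differentiableAt_qs {z : ℂ} (hz : 0 ≤ z.im) : DifferentiableAt ℂ (u.qs lam κ v) z := by
  refine (DifferentiableAt.fun_sum fun p _ => ?_).const_add _
  exact (differentiableAt_const _).div (by fun_prop) (u.ne_star_of_nonneg hz p)

theorem differentiableAt_qs' {z : ℂ} (hz : 0 ≤ z.im) : DifferentiableAt ℂ (u.qs' v) z := by
  refine (DifferentiableAt.fun_sum fun p _ => ?_).neg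
  exact (differentiableAt_const _).div (by fun_prop) (pow_ne_zero 2 (u.ne_star_of_nonneg hz p))

variable (lam κ v) in
/-- The residue sum `∑ₚ vₚ q#(zₚ)`. -/
def residueSum : ℂ := ∑ p, v p * u.qs lam κ v (u.z p)

/-- The double sum of v_p v̄_r/(z_p − z̄_r) is minus its own conjugate, as exchanging p and r shows.
It is purely imaginary, and only the constant term of q# contributes. -/
theorem re_residueSum : (u.residueSum lam κ v).re = lam * (star κ * ∑ p, v p).re := by
  set T : ℂ := ∑ p, ∑ r, v p * star (v r) / (u.z p - star (u.z r)) with hT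
  have h1 : u.residueSum lam κ v = lam * (star κ * ∑ p, v p) + T := by
    simp only [residueSum, qs, mul_add, Finset.sum_add_distrib, Finset.mul_sum, hT, mul_div_assoc]
    congr 1
    exact Finset.sum_congr rfl fun p _ => by ring
  have h2 : star T = -T := by
    rw [hT, star_sum, ← Finset.sum_neg_distrib]
    simp only [star_sum, ← Finset.sum_neg_distrib]
    rw [Finset.sum_comm]
    refine Finset.sum_congr rfl fun p _ => Finset.sum_congr rfl fun r _ => ?_
    simp only [star_div₀, star_mul', star_sub, star_star]
    rw [← div_neg, neg_sub, mul_comm]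
  have h3 : T.re = 0 := by
    have := congrArg Complex.re h2
    simp only [Complex.star_def, Complex.conj_re, Complex.neg_re] at this
    linarith
  rw [h1, Complex.add_re, h3, add_zero, Complex.re_ofReal_mul]

variable (lam κ v) in
/-- The kernel subtracted from the integrand in the contour integral. -/
def poissonSum (z : ℂ) : ℂ :=
  ∑ p, v p * u.qs lam κ v (u.z p) * ((z - u.z p)⁻¹ - (z - star (u.z p))⁻¹)

variable {u} in
-- The product u₀w is singular at the poles, but the equation replaces it by q − λw − iεw', whose
-- singular part is Σ v_p/(z − z_p). Subtracting the residues at z_p, paired with their mirror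
-- images so as to decay quadratically, removes all singularities.
theorem IsJost.exists_holomorphic {ε : ℝ} {w : ℂ → ℂ} (hw : u.IsJost ε lam κ v w) :
    ∃ G : ℂ → ℂ, (∀ z : ℂ, 0 ≤ z.im → DifferentiableAt ℂ G z) ∧
      ∀ z : ℂ, 0 ≤ z.im → (∀ p, z ≠ u.z p) → G z =
        w z * (-Complex.I * ε * u.qs' v z + u.uC z * u.qs lam κ v z) -
          u.poissonSum lam κ v z := by
  -- The divided difference (q#(z) − q#(z_p))/(z − z_p), written so that it makes sense at z = z_p.
  set E : Fin P → ℂ → ℂ := fun p z =>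
    -∑ r, star (v r) / ((z - star (u.z r)) * (u.z p - star (u.z r))) with hE
  set G₁ : ℂ → ℂ := fun z => w z * (-Complex.I * ε * u.qs' v z + u.uC z * u.qs lam κ v z) -
    u.poissonSum lam κ v z with hG₁
  set G₂ : ℂ → ℂ := fun z => -Complex.I * ε * w z * u.qs' v z +
    (κ * lam - lam * w z - Complex.I * ε * deriv w z) * u.qs lam κ v z +
    ∑ p, v p * (E p z + u.qs lam κ v (u.z p) * (z - star (u.z p))⁻¹) with hG₂
  have hEq : ∀ z : ℂ, 0 ≤ z.im → (∀ p, z ≠ u.z p) → G₂ z = G₁ z := by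
    intro z hz hp
    have hodd := hw.ode z hz hp
    have hEp : ∀ p, (z - u.z p)⁻¹ * (u.qs lam κ v z - u.qs lam κ v (u.z p)) = E p z := by
      intro p
      have hzp := sub_ne_zero.2 (hp p)
      rw [inv_mul_eq_iff_eq_mul₀ hzp, hE, qs, qs, add_sub_add_left_eq_sub,
        ← Finset.sum_sub_distrib, mul_neg, Finset.mul_sum, ← Finset.sum_neg_distrib]
      refine Finset.sum_congr rfl fun r _ => ?_
      have h1 := u.ne_star_of_nonneg hz r
      have h2 := u.ne_star_of_nonneg (u.z_im_pos p).le r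
      field_simp
      ring
    have hsum : ∑ p, v p * (E p z + u.qs lam κ v (u.z p) * (z - star (u.z p))⁻¹) =
        (∑ p, v p / (z - u.z p)) * u.qs lam κ v z - u.poissonSum lam κ v z := by
      rw [poissonSum, Finset.sum_mul, ← Finset.sum_sub_distrib]
      refine Finset.sum_congr rfl fun p _ => ?_
      rw [← hEp p]
      ring
    simp only [hG₂, hG₁]
    rw [hsum]
    rw [q] at hodd
    linear_combination (-u.qs lam κ v z) * hodd
  have hwd : ∀ z : ℂ, 0 < z.im → DifferentiableAt ℂ (deriv w) z := by
    intro z hz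
    have ho : IsOpen {z : ℂ | 0 < z.im} := isOpen_lt continuous_const Complex.continuous_im
    have hd : DifferentiableOn ℂ w {z : ℂ | 0 < z.im} := fun y hy =>
      (hw.diff y (le_of_lt hy)).differentiableWithinAt
    exact (hd.deriv ho).differentiableAt (ho.mem_nhds hz)
  -- The formula G₂ is regular at the poles but involves w', whose differentiability is at hand only
  -- in the open half-plane. Near real points G₁ is used instead.
  refine ⟨fun z => if 0 < z.im then G₂ z else G₁ z, fun z hz => ?_, fun z hz hp => ?_⟩
  · rcases hz.lt_or_eq with hz' | hz'
    · have ho : IsOpen {z : ℂ | 0 < z.im} := isOpen_lt continuous_const Complex.continuous_im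
      have hev : (fun z : ℂ => if 0 < z.im then G₂ z else G₁ z) =ᶠ[𝓝 z] G₂ := by
        filter_upwards [ho.mem_nhds hz'] with y hy
        rw [if_pos hy]
      refine DifferentiableAt.congr_of_eventuallyEq ?_ hev
      have h1 := hw.diff z hz
      have h2 := hwd z hz'
      have h3 := u.differentiableAt_qs (lam := lam) (κ := κ) (v := v) hz
      have h4 := u.differentiableAt_qs' (v := v) hz
      have h5 : DifferentiableAt ℂ
          (fun z => ∑ p, v p * (E p z + u.qs lam κ v (u.z p) * (z - star (u.z p))⁻¹)) z := by
        refine DifferentiableAt.fun_sum fun p _ => ((?_ : DifferentiableAt ℂ (E p) z).add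
          (DifferentiableAt.const_mul ?_ _)).const_mul _
        · refine (DifferentiableAt.fun_sum fun r _ => ?_).neg
          exact (differentiableAt_const _).div (by fun_prop)
            (mul_ne_zero (u.ne_star_of_nonneg hz r) (u.ne_star_of_nonneg (u.z_im_pos p).le r))
        · exact (by fun_prop : DifferentiableAt ℂ (fun z => z - star (u.z p)) z).inv
            (u.ne_star_of_nonneg hz p)
      exact ((((h1.const_mul _).mul h4).add
        ((((h1.const_mul _).const_sub _).sub (h2.const_mul _)).mul h3)).add h5)
    · have hreal : ∀ p, z ≠ u.z p := fun p h => by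
        have := u.z_im_pos p
        rw [← h, ← hz'] at this
        exact lt_irrefl _ this
      have hev : (fun z : ℂ => if 0 < z.im then G₂ z else G₁ z) =ᶠ[𝓝 z] G₁ := by
        have : ∀ᶠ y in 𝓝 z, ∀ p, y ≠ u.z p := by
          rw [eventually_all]
          exact fun p => isOpen_ne.mem_nhds (hreal p)
        filter_upwards [this] with y hy
        split_ifs with h
        · exact hEq y h.le hy
        · rfl
      refine DifferentiableAt.congr_of_eventuallyEq ?_ hev
      have h1 := hw.diff z hz
      have h3 := u.differentiableAt_qs (lam := lam) (κ := κ) (v := v) hz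
      have h4 := u.differentiableAt_qs' (v := v) hz
      have h6 : DifferentiableAt ℂ u.uC z := (u.hasDerivAt_uC fun p =>
        ⟨hreal p, sub_ne_zero.1 (u.ne_star_of_nonneg hz p)⟩).differentiableAt
      refine (h1.mul ((h4.const_mul _).add (h6.mul h3))).sub
        (DifferentiableAt.fun_sum fun p _ => DifferentiableAt.const_mul (DifferentiableAt.sub ?_ ?_) _)
      · exact (by fun_prop : DifferentiableAt ℂ (fun z => z - u.z p) z).inv
          (sub_ne_zero.2 (hreal p))
      · exact (by fun_prop : DifferentiableAt ℂ (fun z => z - star (u.z p)) z).inv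
          (u.ne_star_of_nonneg hz p)
  · change (if 0 < z.im then G₂ z else G₁ z) = G₁ z
    split_ifs with h
    · exact hEq z hz hp
    · rfl

/-- The difference of the reciprocals at z_p and its conjugate decays one order faster than each of
them. -/
theorem norm_poissonSum_le : ∃ C, ∀ z, u.Away 1 z →
    ‖u.poissonSum lam κ v z‖ ≤ C / (1 + ‖z‖ ^ 2) := by
  refine ⟨∑ p, ‖v p * u.qs lam κ v (u.z p)‖ * (‖u.z p - star (u.z p)‖ *
    (((1 + ‖u.z p‖) / 1 + 1) * ((1 + ‖star (u.z p)‖) / 1 + 1))), fun z hz => ?_⟩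
  rw [poissonSum, Finset.sum_div]
  refine norm_sum_le_of_le _ fun p _ => ?_
  rw [norm_mul, mul_div_assoc]
  refine mul_le_mul_of_nonneg_left ?_ (norm_nonneg _)
  have hne := hz.ne one_pos p
  rw [inv_sub_inv (sub_ne_zero.2 hne.1) (sub_ne_zero.2 hne.2),
    show z - star (u.z p) - (z - u.z p) = u.z p - star (u.z p) by ring, div_eq_mul_inv, mul_inv,
    norm_mul, norm_mul, mul_div_assoc]
  refine mul_le_mul_of_nonneg_left ?_ (norm_nonneg _)
  have h1 := norm_inv_sub_le one_pos (hz p).1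
  have h2 := norm_inv_sub_le one_pos (hz p).2
  calc _ ≤ ((1 + ‖u.z p‖) / 1 + 1) / (1 + ‖z‖) * (((1 + ‖star (u.z p)‖) / 1 + 1) / (1 + ‖z‖)) := by
        gcongr
    _ = ((1 + ‖u.z p‖) / 1 + 1) * ((1 + ‖star (u.z p)‖) / 1 + 1) / (1 + ‖z‖) ^ 2 := by
        rw [div_mul_div_comm, sq]
    _ ≤ _ := by
        gcongr
        nlinarith [norm_nonneg z]

variable {u} in
/-- The contour integral of the Jost function. -/
theorem IsJost.integral_mul {ε : ℝ} {w : ℂ → ℂ} (hw : u.IsJost ε lam κ v w) (hlam : 0 < lam)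
    (hε : 0 < ε) (hε1 : ε ≤ 1) :
    Integrable (fun x : ℝ => w x * (-Complex.I * ε * u.qs' v x + u.uC x * u.qs lam κ v x)) ∧
    ∫ x : ℝ, w x * (-Complex.I * ε * u.qs' v x + u.uC x * u.qs lam κ v x) =
      2 * Real.pi * Complex.I * u.residueSum lam κ v := by
  obtain ⟨G, hGd, hG⟩ := hw.exists_holomorphic
  obtain ⟨R, hR, hRaw⟩ := u.exists_radius
  obtain ⟨C₁, hC₁, h₁⟩ := u.exists_bound_q one_pos lam
  obtain ⟨C₂, hC₂, h₂⟩ := u.exists_bound_uC one_pos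
  obtain ⟨C₃, h₃⟩ := u.norm_poissonSum_le (lam := lam) (κ := κ) (v := v)
  obtain ⟨C₄, hC₄, h₄⟩ := u.exists_bound_upper hlam
  have hN := size_nonneg κ v
  set W := C₄ * size κ v / ε with hW
  have hW0 : 0 ≤ W := by positivity
  set D := W * (ε * (C₁ * size κ v) + C₂ * (C₁ * size κ v)) + C₃ with hD
  have hfar : ∀ z : ℂ, 0 ≤ z.im → R ≤ ‖z‖ → ‖G z‖ ≤ D / (1 + ‖z‖ ^ 2) := by
    intro z hz hzR
    have haw := hRaw z hzR
    rw [hG z hz fun p => (haw.ne one_pos p).1]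
    have hq := h₁ κ v (star z) fun p => by
      have := (haw p).2
      rwa [← norm_star, star_sub, star_star] at this
    have a1 : ‖u.qs lam κ v z‖ ≤ C₁ * size κ v := by
      rw [qs_eq, norm_star]; exact hq.1
    have a2 : ‖u.qs' v z‖ ≤ C₁ * size κ v / (1 + ‖z‖ ^ 2) := by
      rw [qs'_eq, norm_star]
      have := hq.2
      rwa [norm_star] at this
    have a3 := h₂ z haw
    have a4 := h₄ ε κ v w hε hε1 hw z hz
    have a5 := h₃ z haw
    have hden : 0 < 1 + ‖z‖ ^ 2 := by positivity
    refine (norm_sub_le _ _).trans ?_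
    rw [norm_mul, hD, add_div]
    refine add_le_add ?_ a5
    rw [mul_div_assoc]
    refine mul_le_mul a4 ?_ (norm_nonneg _) hW0
    refine (norm_add_le _ _).trans ?_
    rw [norm_mul, norm_mul, norm_mul, norm_neg, Complex.norm_I, one_mul, Complex.norm_real,
      Real.norm_of_nonneg hε.le]
    calc _ ≤ ε * (C₁ * size κ v / (1 + ‖z‖ ^ 2)) + C₂ / (1 + ‖z‖ ^ 2) * (C₁ * size κ v) := by gcongr
      _ = _ := by ring
  obtain ⟨B, hB⟩ : ∃ B, ∀ z ∈ Metric.closedBall (0 : ℂ) R ∩ {z | 0 ≤ z.im}, ‖G z‖ ≤ B := by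
    refine IsCompact.exists_bound_of_continuousOn ((isCompact_closedBall (0 : ℂ) R).inter_right
      (isClosed_le continuous_const Complex.continuous_im)) ?_
    exact fun z hz => (hGd z hz.2).continuousAt.continuousWithinAt
  have hB0 : 0 ≤ B := (norm_nonneg _).trans (hB 0 ⟨by simpa using hR.le, by simp⟩)
  have hzero : ∫ x : ℝ, G x = 0 := by
    refine integral_eq_zero_of_decay hGd (C := |D| + B * (1 + R ^ 2)) fun z hz => ?_
    have hden : 0 < 1 + ‖z‖ ^ 2 := by positivity
    rcases le_total R ‖z‖ with h | h
    · refine (hfar z hz h).trans ?_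
      gcongr
      have := le_abs_self D
      have : 0 ≤ B * (1 + R ^ 2) := by positivity
      linarith
    · rw [le_div_iff₀ hden]
      have h1 := hB z ⟨mem_closedBall_zero_iff.2 h, hz⟩
      have h2 : ‖G z‖ * (1 + ‖z‖ ^ 2) ≤ B * (1 + R ^ 2) := by gcongr
      have := abs_nonneg D
      linarith
  have hGr : ∀ x : ℝ, G x = w x * (-Complex.I * ε * u.qs' v x + u.uC x * u.qs lam κ v x) -
      u.poissonSum lam κ v x := fun x => hG x (by simp) fun p => (u.ofReal_ne x p).1
  have hp : ∀ p, Integrable fun x : ℝ => v p * u.qs lam κ v (u.z p) *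
      (((x : ℂ) - u.z p)⁻¹ - ((x : ℂ) - star (u.z p))⁻¹) := fun p =>
    (integral_inv_sub_sub_inv_sub_conj (u.z_im_pos p)).1.const_mul _
  have hpi : Integrable fun x : ℝ => u.poissonSum lam κ v x :=
    integrable_finsetSum _ fun p _ => hp p
  have hps : ∫ x : ℝ, u.poissonSum lam κ v x = 2 * Real.pi * Complex.I * u.residueSum lam κ v := by
    simp only [poissonSum]
    rw [integral_finsetSum _ fun p _ => hp p, residueSum, Finset.mul_sum]
    refine Finset.sum_congr rfl fun p _ => ?_
    rw [integral_const_mul, (integral_inv_sub_sub_inv_sub_conj (u.z_im_pos p)).2]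
    ring
  obtain ⟨d, hd, haw⟩ := u.exists_away_real
  have hwi : Integrable (fun x : ℝ => w x *
      (-Complex.I * ε * u.qs' v x + u.uC x * u.qs lam κ v x)) := by
    have hGi : Integrable fun x : ℝ => G x := by
      refine (integrable_inv_one_add_sq.const_mul (|D| + B * (1 + R ^ 2))).mono' ?_ ?_
      · refine (continuous_iff_continuousAt.2 fun x => ?_).aestronglyMeasurable
        exact ContinuousAt.comp (g := G) (hGd _ (by simp)).continuousAt (by fun_prop)
      · refine Eventually.of_forall fun x => ?_
        have hden : 0 < 1 + ‖(x : ℂ)‖ ^ 2 := by positivity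
        have hx : 1 + x ^ 2 = 1 + ‖(x : ℂ)‖ ^ 2 := by
          rw [Complex.norm_real, Real.norm_eq_abs, sq_abs]
        rw [hx, ← div_eq_mul_inv]
        rcases le_total R ‖(x : ℂ)‖ with h | h
        · refine (hfar x (by simp) h).trans ?_
          gcongr
          have := le_abs_self D
          have : 0 ≤ B * (1 + R ^ 2) := by positivity
          linarith
        · rw [le_div_iff₀ hden]
          have h1 := hB x ⟨mem_closedBall_zero_iff.2 h, by simp⟩
          have h2 : ‖G x‖ * (1 + ‖(x : ℂ)‖ ^ 2) ≤ B * (1 + R ^ 2) := by gcongr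
          have := abs_nonneg D
          linarith
    refine (hGi.add hpi).congr (Eventually.of_forall fun x => ?_)
    simp only [Pi.add_apply, hGr]
    ring
  refine ⟨hwi, ?_⟩
  simp only [hGr] at hzero
  rw [integral_sub hwi hpi, hps, sub_eq_zero] at hzero
  exact hzero

theorem tendsto_q_atTop (lam : ℝ) (κ : ℂ) (v : Fin P → ℂ) :
    Tendsto (fun x : ℝ => u.q lam κ v x) atTop (𝓝 (κ * lam)) := by
  have : Tendsto (fun x : ℝ => κ * lam + ∑ p, v p / ((x : ℂ) - u.z p)) atTop
      (𝓝 (κ * lam + ∑ _p : Fin P, 0)) := by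
    refine tendsto_const_nhds.add (tendsto_finsetSum _ fun p _ => ?_)
    have h : Tendsto (fun x : ℝ => ‖(x : ℂ) - u.z p‖) atTop atTop := by
      refine tendsto_atTop_mono (fun x => ?_)
        (tendsto_atTop_add_const_right _ (-‖u.z p‖) tendsto_abs_atTop_atTop)
      have := norm_sub_norm_le (x : ℂ) (u.z p)
      rw [Complex.norm_real, Real.norm_eq_abs] at this
      linarith
    refine tendsto_zero_iff_norm_tendsto_zero.2 ?_
    simp only [norm_div]
    exact tendsto_const_nhds.div_atTop h
  simpa [q] using this

variable {u} in
/-- The amplitude of the Jost function at `+∞`. -/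
theorem IsJost.exists_limit {ε : ℝ} {w : ℂ → ℂ} (hw : u.IsJost ε lam κ v w) (hlam : 0 < lam)
    (hε : 0 < ε) (hε1 : ε ≤ 1) : ∃ K : ℂ,
    Tendsto (fun x : ℝ => u.osc ε lam x * (u.q lam κ v x - lam * w x)) atTop (𝓝 K) ∧
    ε * ‖K‖ ^ 2 = 4 * Real.pi * lam ^ 2 * (star κ * ∑ p, v p).re := by
  obtain ⟨C₂, hC₂, h₂⟩ := u.exists_bound_deriv_k lam
  have hder := hw.hasDerivAt_osc_mul_k hε.ne'
  have hcont : Continuous fun x : ℝ => u.osc ε lam x * ((Complex.I * ε * u.q' v x +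
      u.uC x * u.q lam κ v x) / (Complex.I * ε)) := by
    refine continuous_iff_continuousAt.2 fun x => ?_
    have c1 : ContinuousAt (u.osc ε lam) x := (u.hasDerivAt_osc ε lam x).continuousAt
    have c2 : ContinuousAt (fun x : ℝ => u.q lam κ v x) x :=
      (u.hasDerivAt_q lam κ v fun p => (u.ofReal_ne x p).1).comp_ofReal.continuousAt
    have c3 : ContinuousAt (fun x : ℝ => u.uC x) x :=
      (u.hasDerivAt_uC (u.ofReal_ne x)).comp_ofReal.continuousAt
    have c4 : ContinuousAt (fun x : ℝ => u.q' v x) x := by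
      have : (fun x : ℝ => u.q' v x) = fun x : ℝ => star (u.qs' v x) := by
        funext y
        rw [qs'_eq, star_star]
        simp
      rw [this]
      exact (ContinuousAt.comp (g := u.qs' v)
        (u.differentiableAt_qs' (by simp)).continuousAt (by fun_prop)).star
    exact c1.mul (((continuousAt_const.mul c4).add (c3.mul c2)).div_const _)
  have hint : Integrable fun x : ℝ => u.osc ε lam x * ((Complex.I * ε * u.q' v x +
      u.uC x * u.q lam κ v x) / (Complex.I * ε)) :=
    (integrable_inv_one_add_sq.const_mul (C₂ * size κ v / ε)).mono' hcont.aestronglyMeasurable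
      (Eventually.of_forall fun x => h₂ ε κ v x hε hε1)
  have hK := tendsto_limUnder_of_hasDerivAt_of_integrableOn_Ioi (a := (0 : ℝ))
    (fun x _ => hder x) hint.integrableOn
  set K := limUnder atTop fun x : ℝ => u.osc ε lam x * (u.q lam κ v x - lam * w x)
  refine ⟨K, hK, ?_⟩
  set k : ℝ → ℂ := fun x => u.q lam κ v x - lam * w x with hk
  set Q : ℝ → ℂ := fun x => u.q lam κ v x with hQ
  -- At both ends |q|² tends to |κλ|², while |k|² goes from 0 to |K|². So |K|² is the integral of
  -- F', which the contour identity evaluates.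
  set F : ℝ → ℝ := fun x => Complex.normSq (k x) - Complex.normSq (Q x) with hF
  obtain ⟨hwi, hwint⟩ := hw.integral_mul hlam hε hε1
  have hns : ∀ {g : ℝ → ℂ} {g' : ℂ} {x : ℝ}, HasDerivAt g g' x →
      HasDerivAt (fun x => Complex.normSq (g x)) (2 * (star (g x) * g').re) x := by
    intro g g' x hg
    have h1 := Complex.reCLM.hasFDerivAt.comp_hasDerivAt x hg
    have h2 := Complex.imCLM.hasFDerivAt.comp_hasDerivAt x hg
    have h3 := (h1.mul h1).add (h2.mul h2)
    refine (h3.congr_deriv ?_)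
    simp [Complex.mul_re]
    ring
  have hFd : ∀ x : ℝ, HasDerivAt F (2 * lam / ε *
      (w x * (-Complex.I * ε * u.qs' v x + u.uC x * u.qs lam κ v x)).im) x := by
    intro x
    have hq : HasDerivAt Q (u.q' v x) x :=
      (u.hasDerivAt_q lam κ v fun p => (u.ofReal_ne x p).1).comp_ofReal
    have hk' : HasDerivAt k (u.q' v x - lam * deriv w x) x := hq.sub ((hw.hasDerivAt_ofReal x).const_mul (lam : ℂ))
    refine ((hns hk').sub (hns hq)).congr_deriv ?_
    have hode := hw.ode_ofReal x
    rw [u.uC_ofReal] at hode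
    have e1 : u.qs lam κ v x = star (u.q lam κ v x) := by
      rw [qs_eq]; simp
    have e2 : u.qs' v x = star (u.q' v x) := by
      rw [qs'_eq]; simp
    rw [e1, e2, u.uC_ofReal]
    simp only [hk, hQ]
    clear hk' hq e1 e2
    have hre := congrArg Complex.re hode
    have him := congrArg Complex.im hode
    generalize u.q lam κ v x = a at *
    generalize u.q' v x = a' at *
    generalize w x = b at *
    generalize deriv w x = b' at *
    generalize u.u₀ x = c at *
    simp only [Complex.star_def, Complex.add_re, Complex.add_im, Complex.mul_re, Complex.mul_im,
      Complex.sub_re, Complex.sub_im, Complex.conj_re, Complex.conj_im, Complex.ofReal_re,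
      Complex.ofReal_im, Complex.neg_re, Complex.neg_im, Complex.I_re, Complex.I_im] at *
    field_simp
    linear_combination (-lam * (a.re - lam * b.re)) * him + (lam * (a.im - lam * b.im)) * hre
  have hFi : Integrable fun x : ℝ => 2 * lam / ε *
      (w x * (-Complex.I * ε * u.qs' v x + u.uC x * u.qs lam κ v x)).im :=
    hwi.im.const_mul _
  have hnormk : ∀ x, Complex.normSq (k x) = ‖u.osc ε lam x * (u.q lam κ v x - lam * w x)‖ ^ 2 := by
    intro x
    rw [norm_mul, norm_osc, one_mul, Complex.normSq_eq_norm_sq]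
  have hbot : Tendsto F atBot (𝓝 (0 - Complex.normSq (κ * lam))) := by
    refine Tendsto.sub ?_ ((Complex.continuous_normSq.tendsto _).comp (u.tendsto_q_atBot lam κ v))
    simp only [hnormk]
    simpa using (hw.tendsto_osc_mul_k.norm.pow 2)
  have htop : Tendsto F atTop (𝓝 (‖K‖ ^ 2 - Complex.normSq (κ * lam))) := by
    refine Tendsto.sub ?_ ((Complex.continuous_normSq.tendsto _).comp (u.tendsto_q_atTop lam κ v))
    simp only [hnormk]
    exact hK.norm.pow 2
  have hfin := integral_of_hasDerivAt_of_tendsto hFd hFi hbot htop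
  rw [integral_const_mul] at hfin
  have him : ∫ x : ℝ, (w x * (-Complex.I * ε * u.qs' v x + u.uC x * u.qs lam κ v x)).im =
      (∫ x : ℝ, w x * (-Complex.I * ε * u.qs' v x + u.uC x * u.qs lam κ v x)).im := integral_im hwi
  have hres : (2 * Real.pi * Complex.I * u.residueSum lam κ v).im =
      2 * Real.pi * (u.residueSum lam κ v).re := by
    rw [show (2 * Real.pi * Complex.I * u.residueSum lam κ v : ℂ) =
      ((2 * Real.pi : ℝ) : ℂ) * (Complex.I * u.residueSum lam κ v) by push_cast; ring,
      Complex.im_ofReal_mul, Complex.I_mul_im]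
  rw [him, hwint, hres, re_residueSum] at hfin
  have hfin' : ‖K‖ ^ 2 = 2 * lam / ε * (2 * Real.pi * (lam * (star κ * ∑ p, v p).re)) := by
    linarith
  rw [hfin']
  field_simp
  ring

end RationalPotential


/-! ### Primitives on cut planes, and uniqueness of boundary values -/

/-- Primitives on an open set which is closed under vertical projection to a horizontal line. -/
theorem exists_primitive_vertical {Ω : Set ℂ} (hΩ : IsOpen Ω) {b : ℝ}
    (hv : ∀ z ∈ Ω, ∀ t ∈ Set.uIcc b z.im, (z.re + t * Complex.I : ℂ) ∈ Ω)
    (hbase : ∀ x : ℝ, (b * Complex.I + x : ℂ) ∈ Ω)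
    {Ψ : ℂ → ℂ} (hΨ : DifferentiableOn ℂ Ψ Ω) : ∃ J : ℂ → ℂ, ∀ z ∈ Ω, HasDerivAt J (Ψ z) z := by
  -- Integration along the horizontal base line, then vertically; the set need not be convex.
  set J : ℂ → ℂ := fun z => (∫ x in (0 : ℝ)..z.re, Ψ (b * Complex.I + x)) +
    ∫ t in b..z.im, Complex.I * Ψ (z.re + t * Complex.I) with hJ
  refine ⟨J, fun z₀ hz₀ => ?_⟩
  set s : Set ℂ := (fun t : ℝ => (z₀.re + t * Complex.I : ℂ)) '' Set.uIcc b z₀.im with hs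
  have hsc : IsCompact s := isCompact_uIcc.image (by fun_prop)
  have hscx : Convex ℝ s := by
    rintro _ ⟨t, ht, rfl⟩ _ ⟨r, hr, rfl⟩ α β hα hβ hαβ
    refine ⟨α * t + β * r, convex_uIcc b z₀.im ht hr hα hβ hαβ, ?_⟩
    have hc : (α : ℂ) + β = 1 := by exact_mod_cast hαβ
    simp only [Complex.real_smul]
    push_cast
    linear_combination (-(z₀.re : ℂ)) * hc
  have hsub : s ⊆ Ω := by
    rintro _ ⟨t, ht, rfl⟩
    exact hv z₀ hz₀ t ht
  obtain ⟨δ, hδ, hV⟩ := hsc.exists_thickening_subset_open hΩ hsub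
  set V := Metric.thickening δ s
  obtain ⟨F, hF⟩ := exists_primitive_of_convex (hscx.thickening δ) Metric.isOpen_thickening
    (hΨ.mono hV)
  have hz₀s : z₀ ∈ s := ⟨z₀.im, Set.right_mem_uIcc, Complex.re_add_im z₀⟩
  have hbs : (z₀.re + b * Complex.I : ℂ) ∈ s := ⟨b, Set.left_mem_uIcc, rfl⟩
  have hVs : s ⊆ V := Metric.self_subset_thickening hδ s
  have hVball : ∀ a ∈ s, ∀ y, dist y a < δ → y ∈ V := fun a ha y hy =>
    Metric.mem_thickening_iff.2 ⟨a, ha, hy⟩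
  have hcb : ∀ x : ℝ, ContinuousAt (fun x : ℝ => Ψ (b * Complex.I + x)) x := fun x =>
    ContinuousAt.comp (g := Ψ) ((hΨ.differentiableAt (hΩ.mem_nhds (hbase x))).continuousAt)
      (by fun_prop)
  have hcbc : Continuous fun x : ℝ => Ψ (b * Complex.I + x) := continuous_iff_continuousAt.2 hcb
  -- A thickening of the vertical segment below or above z₀ is convex and has a primitive F. Near z₀
  -- all parts of the path that vary with z stay in it, so J differs from F by a constant.
  have key : ∀ z ∈ Metric.ball z₀ δ, J z = F z +
      ((∫ x in (0 : ℝ)..z₀.re, Ψ (b * Complex.I + x)) - F (b * Complex.I + z₀.re)) := by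
    intro z hz
    have hre : |z.re - z₀.re| < δ := lt_of_le_of_lt
      (Complex.abs_re_le_norm (z - z₀)) (by rwa [← dist_eq_norm])
    have hhor : ∀ x ∈ Set.uIcc z₀.re z.re, (b * Complex.I + x : ℂ) ∈ V := by
      intro x hx
      refine hVball _ hbs _ ?_
      have : (b * Complex.I + x : ℂ) - (z₀.re + b * Complex.I) = ((x - z₀.re : ℝ) : ℂ) := by
        push_cast; ring
      rw [dist_eq_norm, this, Complex.norm_real, Real.norm_eq_abs]
      exact (Set.abs_sub_left_of_mem_uIcc hx).trans_lt hre
    have hver : ∀ t ∈ Set.uIcc b z.im, (z.re + t * Complex.I : ℂ) ∈ V := by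
      intro t ht
      by_cases htz : t ∈ Set.uIcc b z₀.im
      · refine hVball _ ⟨t, htz, rfl⟩ _ ?_
        have : (z.re + t * Complex.I : ℂ) - (z₀.re + t * Complex.I) = ((z.re - z₀.re : ℝ) : ℂ) := by
          push_cast; ring
        rw [dist_eq_norm, this, Complex.norm_real, Real.norm_eq_abs]
        exact hre
      · refine hVball _ hz₀s _ (lt_of_le_of_lt ?_ (Metric.mem_ball.1 hz))
        have him : |t - z₀.im| ≤ |z.im - z₀.im| := by
          rw [Set.mem_uIcc] at ht htz
          push Not at htz
          rcases ht with ⟨h1, h2⟩ | ⟨h1, h2⟩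
          · have := htz.1 h1
            rw [abs_of_pos (by linarith), abs_of_pos (by linarith)]; linarith
          · have h3 : t < z₀.im := by
              by_contra! h
              exact absurd h2 (not_le.2 (htz.2 h))
            rw [abs_of_neg (by linarith), abs_of_neg (by linarith)]; linarith
        rw [dist_eq_norm, dist_eq_norm, ← sq_le_sq₀ (norm_nonneg _) (norm_nonneg _),
          ← Complex.normSq_eq_norm_sq, ← Complex.normSq_eq_norm_sq, Complex.normSq_apply,
          Complex.normSq_apply]
        simp only [Complex.sub_re, Complex.add_re, Complex.ofReal_re, Complex.re_ofReal_mul,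
          Complex.I_re, mul_zero, add_zero, Complex.sub_im, Complex.add_im, Complex.ofReal_im,
          Complex.im_ofReal_mul, Complex.I_im, mul_one, zero_add]
        have := mul_self_le_mul_self (abs_nonneg _) him
        rw [abs_mul_abs_self, abs_mul_abs_self] at this
        linarith
    have i1 : ∫ x in z₀.re..z.re, Ψ (b * Complex.I + x) =
        F (b * Complex.I + z.re) - F (b * Complex.I + z₀.re) :=
      intervalIntegral.integral_eq_sub_of_hasDerivAt
        (fun x hx => ((hF _ (hhor x hx)).comp_const_add (b * Complex.I) (x : ℂ)).comp_ofReal)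
        (hcbc.intervalIntegrable _ _)
    have i2 : ∫ t in b..z.im, Complex.I * Ψ (z.re + t * Complex.I) =
        F (z.re + z.im * Complex.I) - F (z.re + b * Complex.I) := by
      refine intervalIntegral.integral_eq_sub_of_hasDerivAt
        (fun t ht => hasDerivAt_comp_line (hF _ (hver t ht))) (ContinuousOn.intervalIntegrable ?_)
      intro t ht
      have hc : ContinuousAt (fun t : ℝ => Ψ (z.re + t * Complex.I)) t :=
        ContinuousAt.comp (g := Ψ) (f := fun t : ℝ => (z.re + t * Complex.I : ℂ))
          (hΨ.differentiableAt (hΩ.mem_nhds (hV (hver t ht)))).continuousAt (by fun_prop)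
      exact (continuousAt_const.mul hc).continuousWithinAt
    rw [Complex.re_add_im, add_comm (z.re : ℂ)] at i2
    have i3 := intervalIntegral.integral_add_adjacent_intervals
      (hcbc.intervalIntegrable (μ := volume) 0 z₀.re) (hcbc.intervalIntegrable z₀.re z.re)
    simp only [hJ]
    rw [← i3, i1, i2]
    ring
  refine ((hF z₀ (hVs hz₀s)).add_const _).congr_of_eventuallyEq
    (Filter.eventually_of_mem (Metric.ball_mem_nhds z₀ hδ) key)

theorem isOpen_cutPlane : IsOpen {w : ℂ | w.im ≠ 0 ∨ w.re < 0} := by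
  refine (isOpen_ne_fun Complex.continuous_im continuous_const).union
    (isOpen_lt Complex.continuous_re continuous_const)

theorem neg_mem_slitPlane {w : ℂ} (hw : w.im ≠ 0 ∨ w.re < 0) : -w ∈ Complex.slitPlane := by
  rw [Complex.mem_slitPlane_iff]
  rcases hw with h | h
  · right; simpa using h
  · left; simpa using h

theorem isPreconnected_cutPlane : IsPreconnected {w : ℂ | w.im ≠ 0 ∨ w.re < 0} := by
  have h := (Complex.starConvex_one_slitPlane.isPathConnected
    Complex.one_mem_slitPlane).isConnected.isPreconnected.image (fun z => -z)
    continuous_neg.continuousOn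
  convert h using 1
  ext w
  refine ⟨fun hw => ⟨-w, neg_mem_slitPlane hw, neg_neg w⟩, ?_⟩
  rintro ⟨z, hz, rfl⟩
  rw [Complex.mem_slitPlane_iff] at hz
  rcases hz with h | h
  · right; simpa using h
  · left; simpa using h

theorem upperHalf_neBot (lam : ℝ) : (𝓝[{w : ℂ | 0 < w.im}] (lam : ℂ)).NeBot := by
  rw [← mem_closure_iff_nhdsWithin_neBot, Complex.closure_setOfPred_lt_im]
  simp

namespace IsUpperBoundaryValue

variable {F F' : ℝ → ℂ} {lam : ℝ} {a a' : ℂ}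

/-- Two continuations agree on the negative half-line, which accumulates at −1. The slit plane is
connected, so they agree everywhere and have the same boundary limit. -/
theorem unique (h : IsUpperBoundaryValue F lam a) (h' : IsUpperBoundaryValue F lam a') :
    a = a' := by
  obtain ⟨G, hd, hF, hl⟩ := h
  obtain ⟨G', hd', hF', hl'⟩ := h'
  have heq : Set.EqOn G G' {w : ℂ | w.im ≠ 0 ∨ w.re < 0} := by
    refine (hd.analyticOnNhd isOpen_cutPlane).eqOn_of_preconnected_of_frequently_eq
      (hd'.analyticOnNhd isOpen_cutPlane) isPreconnected_cutPlane (z₀ := -1) (by simp) ?_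
    have ht : Tendsto (fun n : ℕ => (((-1 - 1 / ((n : ℝ) + 1) : ℝ)) : ℂ)) atTop (𝓝[≠] (-1)) := by
      refine tendsto_nhdsWithin_iff.2 ⟨?_, Eventually.of_forall fun n h => ?_⟩
      · have := (tendsto_one_div_add_atTop_nhds_zero_nat (𝕜 := ℝ)).const_sub (-1)
        have h2 := (Complex.continuous_ofReal.tendsto _).comp this
        simpa [Function.comp_def] using h2
      · have h1 : (-1 - 1 / ((n : ℝ) + 1) : ℝ) = -1 := by
          have := congrArg Complex.re (Set.mem_singleton_iff.1 h)
          simpa only [Complex.ofReal_re, Complex.neg_re, Complex.one_re] using this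
        have : (0 : ℝ) < 1 / ((n : ℝ) + 1) := by positivity
        linarith
    refine ht.frequently (Eventually.of_forall fun n => ?_).frequently
    have hn : (-1 - 1 / ((n : ℝ) + 1) : ℝ) < 0 := by
      have : (0 : ℝ) < 1 / ((n : ℝ) + 1) := by positivity
      linarith
    rw [hF _ hn, hF' _ hn]
  have := upperHalf_neBot lam
  refine tendsto_nhds_unique hl (hl'.congr' ?_)
  filter_upwards [self_mem_nhdsWithin] with w hw
  exact (heq (Or.inl (ne_of_gt hw))).symm

theorem congr (h : IsUpperBoundaryValue F lam a) (hFF' : ∀ x < 0, F x = F' x) :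
    IsUpperBoundaryValue F' lam a := by
  obtain ⟨G, hd, hF, hl⟩ := h
  exact ⟨G, hd, fun x hx => (hF x hx).trans (hFF' x hx), hl⟩

theorem of_differentiable {G : ℂ → ℂ} (hG : Differentiable ℂ G) (lam : ℝ) :
    IsUpperBoundaryValue (fun x => G x) lam (G lam) :=
  ⟨G, hG.differentiableOn, fun _ _ => rfl,
    (hG.continuous.tendsto _).mono_left nhdsWithin_le_nhds⟩

theorem add (h : IsUpperBoundaryValue F lam a) (h' : IsUpperBoundaryValue F' lam a') :
    IsUpperBoundaryValue (fun x => F x + F' x) lam (a + a') := by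
  obtain ⟨G, hd, hF, hl⟩ := h
  obtain ⟨G', hd', hF', hl'⟩ := h'
  exact ⟨fun w => G w + G' w, hd.add hd', fun x hx => congrArg₂ (· + ·) (hF x hx) (hF' x hx), hl.add hl'⟩

theorem mul (h : IsUpperBoundaryValue F lam a) (h' : IsUpperBoundaryValue F' lam a') :
    IsUpperBoundaryValue (fun x => F x * F' x) lam (a * a') := by
  obtain ⟨G, hd, hF, hl⟩ := h
  obtain ⟨G', hd', hF', hl'⟩ := h'
  exact ⟨fun w => G w * G' w, hd.mul hd', fun x hx => congrArg₂ (· * ·) (hF x hx) (hF' x hx), hl.mul hl'⟩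

theorem const_mul (h : IsUpperBoundaryValue F lam a) (c : ℂ) :
    IsUpperBoundaryValue (fun x => c * F x) lam (c * a) :=
  (of_differentiable (differentiable_const c) lam).mul h

end IsUpperBoundaryValue

theorem integral_Ioi_shift (g : ℝ → ℂ) (Y : ℝ) :
    ∫ y in Set.Ioi Y, g y = ∫ t in Set.Ioi (0 : ℝ), g (Y + t) := by
  rw [← (measurePreserving_add_left volume Y).setIntegral_preimage_emb
    (measurableEmbedding_addLeft Y) g (Set.Ioi Y)]
  simp

/-- Since |t| = |s||z − z₀|, quadratic decay in z gives quadratic decay in t, uniformly for bounded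
s. -/
theorem one_add_sq_le_of_shift {z₀ s : ℂ} {t B : ℝ} (hs : s ≠ 0) (hB : ‖s‖ ≤ B) :
    1 + t ^ 2 ≤ (1 + 2 * B ^ 2 * (1 + ‖z₀‖ ^ 2)) * (1 + ‖z₀ + Complex.I * t / s‖ ^ 2) := by
  set z := z₀ + Complex.I * t / s with hz
  have h1 : Complex.I * t = s * (z - z₀) := by rw [hz]; field_simp; ring
  have h2 : |t| ≤ B * (‖z‖ + ‖z₀‖) := by
    have := congrArg norm h1
    rw [norm_mul, Complex.norm_I, one_mul, Complex.norm_real, Real.norm_eq_abs, norm_mul] at this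
    rw [this]
    have := norm_sub_le z z₀
    have := (norm_nonneg s).trans hB
    gcongr
  have h3 : t ^ 2 ≤ B ^ 2 * (2 * ‖z‖ ^ 2 + 2 * ‖z₀‖ ^ 2) := by
    have h4 : t ^ 2 ≤ (B * (‖z‖ + ‖z₀‖)) ^ 2 := by rw [← sq_abs t]; gcongr
    have h5 : (‖z‖ + ‖z₀‖) ^ 2 ≤ 2 * ‖z‖ ^ 2 + 2 * ‖z₀‖ ^ 2 := by nlinarith [sq_nonneg (‖z‖ - ‖z₀‖)]
    calc _ ≤ _ := h4
      _ = B ^ 2 * (‖z‖ + ‖z₀‖) ^ 2 := by ring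
      _ ≤ _ := by gcongr
  have h6 : 0 ≤ B ^ 2 * ‖z₀‖ ^ 2 * ‖z‖ ^ 2 := by positivity
  have h7 : 0 ≤ B ^ 2 := by positivity
  nlinarith [sq_nonneg ‖z‖]


/-! ### Continuation of half-line integrals by rotating the contour -/

/-- The integrand of the rotated half-line integral. -/
def rotInt (ε : ℝ) (φ' : ℂ → ℂ) (z₀ : ℂ) (s : ℂ) (t : ℝ) : ℂ :=
  Complex.exp (-s * t / ε) * φ' (z₀ + Complex.I * t / s)

/-- With s² = −μ the factor e^{-iμz/ε} on the ray z₀ + it/s becomes a constant times e^{-st/ε}. The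
single condition Re s ≥ 0 keeps the exponential bounded and the ray above the height of z₀. Rotating
by half the argument of −μ therefore serves the whole slit plane. -/
theorem im_rot {z₀ s : ℂ} {t : ℝ} :
    (z₀ + Complex.I * t / s).im = z₀.im + t * (s.re / Complex.normSq s) := by
  rw [Complex.add_im, show Complex.I * t / s = (t : ℂ) * (Complex.I * s⁻¹) by ring,
    Complex.im_ofReal_mul, Complex.I_mul_im, Complex.inv_re]

section

variable {ε C : ℝ} {φ' : ℂ → ℂ} {z₀ : ℂ}

theorem norm_rotInt_le (hε : 0 < ε) (hC : ∀ z : ℂ, z₀.im ≤ z.im → ‖φ' z‖ ≤ C / (1 + ‖z‖ ^ 2))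
    {s : ℂ} (hs : s ≠ 0) (hre : 0 ≤ s.re) {B : ℝ} (hB : ‖s‖ ≤ B) {t : ℝ} (ht : 0 ≤ t) :
    ‖rotInt ε φ' z₀ s t‖ ≤ C * (1 + 2 * B ^ 2 * (1 + ‖z₀‖ ^ 2)) * (1 + t ^ 2)⁻¹ := by
  have him : z₀.im ≤ (z₀ + Complex.I * t / s).im := by
    rw [im_rot]
    have : 0 ≤ t * (s.re / Complex.normSq s) :=
      mul_nonneg ht (div_nonneg hre (Complex.normSq_nonneg s))
    linarith
  have h1 := hC _ him
  have hC0 : 0 ≤ C := by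
    have := (norm_nonneg _).trans (hC z₀ le_rfl)
    rw [le_div_iff₀ (by positivity)] at this
    simpa using this
  have h2 := one_add_sq_le_of_shift (z₀ := z₀) (t := t) hs hB
  have h3 : ‖Complex.exp (-s * t / ε)‖ ≤ 1 := by
    rw [Complex.norm_exp, Real.exp_le_one_iff, show -s * t / ε = ((-(t / ε) : ℝ) : ℂ) * s by
      push_cast; ring, Complex.re_ofReal_mul]
    have : 0 ≤ t / ε * s.re := by positivity
    linarith
  rw [rotInt, norm_mul]
  calc _ ≤ 1 * (C / (1 + ‖z₀ + Complex.I * t / s‖ ^ 2)) := by gcongr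
    _ ≤ C * (1 + 2 * B ^ 2 * (1 + ‖z₀‖ ^ 2)) * (1 + t ^ 2)⁻¹ := by
      rw [one_mul, ← div_eq_mul_inv, div_le_div_iff₀ (by positivity) (by positivity), mul_assoc]
      gcongr

theorem continuousOn_rotInt (hd : ∀ z : ℂ, z₀.im ≤ z.im → DifferentiableAt ℂ φ' z) {s : ℂ}
    (hre : 0 ≤ s.re) : ContinuousOn (rotInt ε φ' z₀ s) (Set.Ioi 0) := by
  intro t ht
  have him : z₀.im ≤ (z₀ + Complex.I * t / s).im := by
    rw [im_rot]
    have : 0 ≤ t * (s.re / Complex.normSq s) :=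
      mul_nonneg (le_of_lt ht) (div_nonneg hre (Complex.normSq_nonneg s))
    linarith
  have h1 : ContinuousAt (fun t : ℝ => φ' (z₀ + Complex.I * t / s)) t :=
    ContinuousAt.comp (g := φ') (f := fun t : ℝ => z₀ + Complex.I * t / s)
      (hd _ him).continuousAt (by fun_prop)
  have h2 : ContinuousAt (fun t : ℝ => Complex.exp (-s * t / ε)) t := by fun_prop
  exact (h2.mul h1).continuousWithinAt

theorem differentiableAt_rotInt (hd : ∀ z : ℂ, z₀.im ≤ z.im → DifferentiableAt ℂ φ' z) {s : ℂ}
    (hs : s ≠ 0) (hre : 0 ≤ s.re) {t : ℝ} (ht : 0 ≤ t) :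
    DifferentiableAt ℂ (fun s => rotInt ε φ' z₀ s t) s := by
  have him : z₀.im ≤ (z₀ + Complex.I * t / s).im := by
    rw [im_rot]
    have : 0 ≤ t * (s.re / Complex.normSq s) :=
      mul_nonneg ht (div_nonneg hre (Complex.normSq_nonneg s))
    linarith
  have h0 : DifferentiableAt ℂ (fun s : ℂ => z₀ + Complex.I * t / s) s :=
    ((differentiableAt_const _).div differentiableAt_id hs).const_add _
  have h1 : DifferentiableAt ℂ (fun s : ℂ => φ' (z₀ + Complex.I * t / s)) s :=
    DifferentiableAt.comp (g := φ') s (hd _ him) h0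
  have h2 : DifferentiableAt ℂ (fun s : ℂ => Complex.exp (-s * t / ε)) s := by fun_prop
  exact h2.mul h1

theorem differentiableAt_integral_rotInt (hε : 0 < ε)
    (hd : ∀ z : ℂ, z₀.im ≤ z.im → DifferentiableAt ℂ φ' z)
    (hC : ∀ z : ℂ, z₀.im ≤ z.im → ‖φ' z‖ ≤ C / (1 + ‖z‖ ^ 2)) {s₀ : ℂ} (hs₀ : 0 < s₀.re) :
    DifferentiableAt ℂ (fun s => ∫ t in Set.Ioi (0 : ℝ), rotInt ε φ' z₀ s t) s₀ := by
  -- The radius Re s₀ keeps every s of the ball in the right half-plane.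
  have hball : ∀ s ∈ Metric.ball s₀ s₀.re, 0 < s.re ∧ ‖s‖ ≤ ‖s₀‖ + s₀.re := by
    intro s hs
    rw [Metric.mem_ball, dist_eq_norm] at hs
    have h1 := (abs_le.1 (Complex.abs_re_le_norm (s - s₀))).1
    rw [Complex.sub_re] at h1
    have h2 := norm_sub_norm_le s s₀
    exact ⟨by linarith, by linarith⟩
  have hne : ∀ s : ℂ, 0 < s.re → s ≠ 0 := fun s hs h => by rw [h] at hs; simp at hs
  refine differentiableAt_integral_of_dominated hs₀
    (bound := fun t => C * (1 + 2 * (‖s₀‖ + s₀.re) ^ 2 * (1 + ‖z₀‖ ^ 2)) * (1 + t ^ 2)⁻¹)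
    (integrable_inv_one_add_sq.const_mul _).integrableOn ?_ ?_ ?_
  · intro s hs
    exact (continuousOn_rotInt hd (hball s hs).1.le).aestronglyMeasurable measurableSet_Ioi
  · refine (ae_restrict_iff' measurableSet_Ioi).2 (Eventually.of_forall fun t ht s hs => ?_)
    exact (differentiableAt_rotInt hd (hne s (hball s hs).1) (hball s hs).1.le
      (le_of_lt ht)).differentiableWithinAt
  · refine (ae_restrict_iff' measurableSet_Ioi).2 (Eventually.of_forall fun t ht s hs => ?_)
    exact norm_rotInt_le hε hC (hne s (hball s hs).1) (hball s hs).1.le (hball s hs).2 (le_of_lt ht)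

theorem tendsto_integral_rotInt (hε : 0 < ε)
    (hd : ∀ z : ℂ, z₀.im ≤ z.im → DifferentiableAt ℂ φ' z)
    (hC : ∀ z : ℂ, z₀.im ≤ z.im → ‖φ' z‖ ≤ C / (1 + ‖z‖ ^ 2)) {s₀ : ℂ} (hs₀ : s₀ ≠ 0)
    (hre : 0 ≤ s₀.re) :
    Tendsto (fun s => ∫ t in Set.Ioi (0 : ℝ), rotInt ε φ' z₀ s t) (𝓝[{s : ℂ | 0 < s.re}] s₀)
      (𝓝 (∫ t in Set.Ioi (0 : ℝ), rotInt ε φ' z₀ s₀ t)) := by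
  have hne : ∀ s : ℂ, 0 < s.re → s ≠ 0 := fun s hs h => by rw [h] at hs; simp at hs
  have hev : ∀ᶠ s in 𝓝[{s : ℂ | 0 < s.re}] s₀, 0 < s.re ∧ ‖s‖ ≤ ‖s₀‖ + 1 := by
    have h1 : ∀ᶠ s in 𝓝 s₀, ‖s‖ < ‖s₀‖ + 1 :=
      continuous_norm.continuousAt.eventually_lt_const (by linarith)
    filter_upwards [self_mem_nhdsWithin, nhdsWithin_le_nhds h1] with s a b
    exact ⟨a, b.le⟩
  refine tendsto_integral_filter_of_dominated_convergence
    (fun t => C * (1 + 2 * (‖s₀‖ + 1) ^ 2 * (1 + ‖z₀‖ ^ 2)) * (1 + t ^ 2)⁻¹) ?_ ?_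
    (integrable_inv_one_add_sq.const_mul _).integrableOn ?_
  · filter_upwards [hev] with s hs
    exact (continuousOn_rotInt hd hs.1.le).aestronglyMeasurable measurableSet_Ioi
  · filter_upwards [hev] with s hs
    refine (ae_restrict_iff' measurableSet_Ioi).2 (Eventually.of_forall fun t ht => ?_)
    exact norm_rotInt_le hε hC (hne s hs.1) hs.1.le hs.2 (le_of_lt ht)
  · refine (ae_restrict_iff' measurableSet_Ioi).2 (Eventually.of_forall fun t ht => ?_)
    exact (differentiableAt_rotInt hd hs₀ hre (le_of_lt ht)).continuousAt.tendsto.mono_left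
      nhdsWithin_le_nhds

end

/-- The square root of `-μ` with positive real part. -/
def negSqrt (μ : ℂ) : ℂ := Complex.exp (Complex.log (-μ) / 2)

theorem ne_zero_of_mem_cutPlane {μ : ℂ} (hμ : μ.im ≠ 0 ∨ μ.re < 0) : μ ≠ 0 := by
  rintro rfl
  simp at hμ

theorem re_negSqrt_pos {μ : ℂ} (hμ : μ.im ≠ 0 ∨ μ.re < 0) : 0 < (negSqrt μ).re := by
  have h1 := Complex.mem_slitPlane_iff_arg.1 (neg_mem_slitPlane hμ)
  have h2 := Complex.arg_le_pi (-μ)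
  have h3 := Complex.neg_pi_lt_arg (-μ)
  have h4 : Complex.arg (-μ) < Real.pi := lt_of_le_of_ne h2 h1.1
  have h5 : (Complex.log (-μ) / 2).im = Complex.arg (-μ) / 2 := by
    rw [Complex.div_ofNat_im, Complex.log_im]
  rw [negSqrt, Complex.exp_re, h5]
  exact mul_pos (Real.exp_pos _) (Real.cos_pos_of_mem_Ioo ⟨by linarith, by linarith⟩)

theorem differentiableAt_negSqrt {μ : ℂ} (hμ : μ.im ≠ 0 ∨ μ.re < 0) :
    DifferentiableAt ℂ negSqrt μ :=
  (((differentiableAt_id.neg).clog (neg_mem_slitPlane hμ)).div_const 2).cexp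

theorem negSqrt_ofReal {x : ℝ} (hx : x < 0) : negSqrt x = (Real.sqrt (-x) : ℝ) := by
  have h : ((Real.log (-x) / 2 : ℝ) : ℂ) = Complex.log (-x) / 2 := by
    rw [← Complex.ofReal_neg, ← Complex.ofReal_log (by linarith)]
    push_cast
    rfl
  rw [negSqrt, ← h, ← Complex.ofReal_exp, Real.sqrt_eq_rpow, Real.rpow_def_of_pos (by linarith)]
  congr 2
  ring

/-- For μ → λ from above, −μ approaches the negative axis from below, where the logarithm has
imaginary part −π. The root therefore tends to −i√λ. -/
theorem tendsto_negSqrt {lam : ℝ} (hlam : 0 < lam) :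
    Tendsto negSqrt (𝓝[{w : ℂ | 0 < w.im}] (lam : ℂ))
      (𝓝[{s : ℂ | 0 < s.re}] (-Complex.I * (Real.sqrt lam : ℝ))) := by
  refine tendsto_nhdsWithin_iff.2 ⟨?_, ?_⟩
  · have h1 := Complex.tendsto_log_nhdsWithin_im_neg_of_re_neg_of_im_zero (z := -(lam : ℂ))
      (by simpa using hlam) (by simp)
    have h2 : Tendsto (fun w : ℂ => -w) (𝓝[{w : ℂ | 0 < w.im}] (lam : ℂ))
        (𝓝[{w : ℂ | w.im < 0}] (-(lam : ℂ))) := by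
      refine tendsto_nhdsWithin_iff.2 ⟨(continuous_neg.tendsto _).mono_left nhdsWithin_le_nhds, ?_⟩
      filter_upwards [self_mem_nhdsWithin] with w hw
      simpa using hw
    have h3 := (Complex.continuous_exp.tendsto _).comp ((h1.comp h2).div_const 2)
    have h4 : Complex.exp ((Real.log ‖-(lam : ℂ)‖ - Real.pi * Complex.I) / 2) =
        -Complex.I * (Real.sqrt lam : ℝ) := by
      rw [norm_neg, Complex.norm_real, Real.norm_of_nonneg hlam.le, sub_div, Complex.exp_sub,
        show (Real.pi * Complex.I / 2 : ℂ) = Real.pi / 2 * Complex.I by ring,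
        Complex.exp_pi_div_two_mul_I, Complex.div_I, Real.sqrt_eq_rpow, Real.rpow_def_of_pos hlam]
      push_cast
      ring_nf
    rw [h4] at h3
    exact h3
  · filter_upwards [self_mem_nhdsWithin] with w hw
    exact re_negSqrt_pos (Or.inl (ne_of_gt hw))

section

variable {ε B C x₀ Y : ℝ} {φ φ' : ℂ → ℂ}

theorem norm_exp_vertical (ε μ x₀ y : ℝ) :
    ‖Complex.exp (-Complex.I * (μ * (x₀ + y * Complex.I)) / ε)‖ = Real.exp (μ / ε * y) := by
  rw [Complex.norm_exp]
  congr 1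
  rw [show -Complex.I * (μ * (x₀ + y * Complex.I)) / ε =
    ((μ / ε * y : ℝ) : ℂ) + ((-(μ * x₀ / ε) : ℝ) : ℂ) * Complex.I by
      push_cast; linear_combination (-(μ : ℂ) * y / ε) * Complex.I_sq]
  rw [Complex.add_re, Complex.ofReal_re, Complex.re_ofReal_mul, Complex.I_re, mul_zero, add_zero]

theorem integrableOn_vertical {g : ℂ → ℂ} {B : ℝ} (hε : 0 < ε)
    (hg : ∀ z : ℂ, Y ≤ z.im → ContinuousAt g z) (hB : ∀ z : ℂ, Y ≤ z.im → ‖g z‖ ≤ B) {μ : ℝ}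
    (hμ : μ < 0) : IntegrableOn (fun y : ℝ =>
      Complex.exp (-Complex.I * (μ * (x₀ + y * Complex.I)) / ε) * g (x₀ + y * Complex.I))
        (Set.Ioi Y) := by
  have hneg : μ / ε < 0 := div_neg_of_neg_of_pos hμ hε
  have him : ∀ y : ℝ, (x₀ + y * Complex.I : ℂ).im = y := fun y => by simp
  have hexp : IntegrableOn (fun y : ℝ => Real.exp (μ / ε * y)) (Set.Ioi Y) := by
    have := integrableOn_exp_mul_Ioi hneg Y
    simpa using this
  refine Integrable.mono' (hexp.mul_const B) ?_ ?_
  · refine ContinuousOn.aestronglyMeasurable (fun y hy => ?_) measurableSet_Ioi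
    have h1 : ContinuousAt (fun y : ℝ => g (x₀ + y * Complex.I)) y :=
      ContinuousAt.comp (g := g) (f := fun y : ℝ => (x₀ + y * Complex.I : ℂ))
        (hg _ (by rw [him]; exact le_of_lt hy)) (by fun_prop)
    have h2 : ContinuousAt (fun y : ℝ =>
        Complex.exp (-Complex.I * (μ * (x₀ + y * Complex.I)) / ε)) y := by fun_prop
    exact (h2.mul h1).continuousWithinAt
  · refine (ae_restrict_iff' measurableSet_Ioi).2 (Eventually.of_forall fun y hy => ?_)
    rw [norm_mul, norm_exp_vertical]
    exact mul_le_mul_of_nonneg_left (hB _ (by rw [him]; exact le_of_lt hy)) (Real.exp_pos _).le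

/-- For `μ < 0` the half-line integral equals its rotated form. -/
theorem leg_eq (hε : 0 < ε) (hφ : ∀ z : ℂ, Y ≤ z.im → HasDerivAt φ (φ' z) z)
    (hd : ∀ z : ℂ, Y ≤ z.im → DifferentiableAt ℂ φ' z) (hB : ∀ z : ℂ, Y ≤ z.im → ‖φ z‖ ≤ B)
    (hC : ∀ z : ℂ, Y ≤ z.im → ‖φ' z‖ ≤ C / (1 + ‖z‖ ^ 2)) {μ : ℝ} (hμ : μ < 0) :
    Complex.I * ∫ y in Set.Ioi Y,
        Complex.exp (-Complex.I * (μ * (x₀ + y * Complex.I)) / ε) * φ (x₀ + y * Complex.I) =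
      -(Complex.I * ε / μ) * Complex.exp (-Complex.I * (μ * (x₀ + Y * Complex.I)) / ε) *
        (φ (x₀ + Y * Complex.I) + Complex.I / negSqrt μ *
          ∫ t in Set.Ioi (0 : ℝ), rotInt ε φ' (x₀ + Y * Complex.I) (negSqrt μ) t) := by
  have hε' : (ε : ℂ) ≠ 0 := by exact_mod_cast hε.ne'
  have hμ' : (μ : ℂ) ≠ 0 := by exact_mod_cast hμ.ne
  have hC0 : 0 ≤ C := by
    have := (norm_nonneg _).trans (hC (x₀ + Y * Complex.I) (by simp))
    rw [le_div_iff₀ (by positivity)] at this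
    simpa using this
  have him : ∀ y : ℝ, (x₀ + y * Complex.I : ℂ).im = y := fun y => by simp
  have hi1 := integrableOn_vertical (x₀ := x₀) hε (fun z hz => (hφ z hz).continuousAt) hB hμ
  have hi2 := integrableOn_vertical (x₀ := x₀) hε (fun z hz => (hd z hz).continuousAt)
    (B := C) (fun z hz => (hC z hz).trans (div_le_self hC0 (by nlinarith [sq_nonneg ‖z‖]))) hμ
  set e : ℝ → ℂ := fun y => Complex.exp (-Complex.I * (μ * (x₀ + y * Complex.I)) / ε) with he
  have hde : ∀ y : ℝ, HasDerivAt e (e y * (μ / ε)) y := by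
    intro y
    have h1 : HasDerivAt (fun z : ℂ => Complex.exp (-Complex.I * (μ * z) / ε))
        (Complex.exp (-Complex.I * (μ * (x₀ + y * Complex.I)) / ε) *
          (-Complex.I * (μ * 1) / ε)) (x₀ + y * Complex.I) :=
      ((((hasDerivAt_id (x₀ + y * Complex.I : ℂ)).const_mul (μ : ℂ)).const_mul
        (-Complex.I)).div_const (ε : ℂ)).cexp
    refine (hasDerivAt_comp_line h1).congr_deriv ?_
    simp only [he]
    linear_combination (-Complex.exp (-Complex.I * (μ * (x₀ + y * Complex.I)) / ε) * μ / ε) *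
      Complex.I_sq
  -- Integration by parts replaces the bounded φ by the quadratically decaying φ'. This is needed at
  -- the boundary λ > 0, where e^{-st/ε} no longer decays.
  have hpart := integral_Ioi_of_hasDerivAt_of_tendsto' (a := Y)
    (f := fun y : ℝ => (ε / μ : ℂ) * (e y * φ (x₀ + y * Complex.I)))
    (f' := fun y : ℝ => e y * φ (x₀ + y * Complex.I) +
      (Complex.I * ε / μ) * (e y * φ' (x₀ + y * Complex.I))) (m := 0)
    (fun y hy => by
      refine (((hde y).mul (hasDerivAt_comp_line (hφ _ (by rw [him]; exact hy)))).const_mul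
        (ε / μ : ℂ)).congr_deriv ?_
      field_simp)
    (hi1.add (hi2.const_mul _))
    (by
      have hlim : Tendsto (fun y : ℝ => Real.exp (μ / ε * y) * B) atTop (𝓝 0) := by
        have h1 : Tendsto (fun y : ℝ => μ / ε * y) atTop atBot :=
          tendsto_id.const_mul_atTop_of_neg (div_neg_of_neg_of_pos hμ hε)
        simpa using (Real.tendsto_exp_atBot.comp h1).mul_const B
      have h2 : Tendsto (fun y : ℝ => e y * φ (x₀ + y * Complex.I)) atTop (𝓝 0) := by
        refine squeeze_zero_norm' ?_ hlim
        filter_upwards [eventually_ge_atTop Y] with y hy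
        rw [norm_mul, norm_exp_vertical]
        exact mul_le_mul_of_nonneg_left (hB _ (by rw [him]; exact hy)) (Real.exp_pos _).le
      simpa using h2.const_mul (ε / μ : ℂ))
  rw [integral_add hi1 (hi2.const_mul _), integral_const_mul] at hpart
  have hs : 0 < Real.sqrt (-μ) := Real.sqrt_pos.2 (by linarith)
  set s := Real.sqrt (-μ) with hsdef
  have hss : s * s = -μ := Real.mul_self_sqrt (by linarith)
  have hssc : (s : ℂ) * s = -μ := by exact_mod_cast hss
  have hs' : (s : ℂ) ≠ 0 := by exact_mod_cast hs.ne'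
  have hrot : ∫ y in Set.Ioi Y, e y * φ' (x₀ + y * Complex.I) =
      Complex.exp (-Complex.I * (μ * (x₀ + Y * Complex.I)) / ε) / s *
        ∫ t in Set.Ioi (0 : ℝ), rotInt ε φ' (x₀ + Y * Complex.I) s t := by
    rw [integral_Ioi_shift]
    have h1 := integral_comp_mul_left_Ioi (fun t : ℝ =>
      e (Y + t) * φ' (x₀ + ((Y + t : ℝ) : ℂ) * Complex.I)) 0 (b := s⁻¹) (by positivity)
    rw [mul_zero, inv_inv, Complex.real_smul] at h1
    have h2 : ∫ t in Set.Ioi (0 : ℝ), e (Y + s⁻¹ * t) *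
        φ' (x₀ + ((Y + s⁻¹ * t : ℝ) : ℂ) * Complex.I) =
        Complex.exp (-Complex.I * (μ * (x₀ + Y * Complex.I)) / ε) *
          ∫ t in Set.Ioi (0 : ℝ), rotInt ε φ' (x₀ + Y * Complex.I) s t := by
      rw [← integral_const_mul]
      refine integral_congr_ae (Eventually.of_forall fun t => ?_)
      have e1 : Complex.exp (-Complex.I * (μ * (x₀ + ((Y + s⁻¹ * t : ℝ) : ℂ) * Complex.I)) / ε) =
          Complex.exp (-Complex.I * (μ * (x₀ + Y * Complex.I)) / ε) *
            Complex.exp (-s * t / ε) := by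
        rw [← Complex.exp_add]
        congr 1
        push_cast
        field_simp
        linear_combination (-(t : ℂ)) * μ * Complex.I_sq + (t : ℂ) * hssc
      have e2 : (x₀ + ((Y + s⁻¹ * t : ℝ) : ℂ) * Complex.I) =
          x₀ + Y * Complex.I + Complex.I * t / s := by
        push_cast
        field_simp
        ring
      simp only [he, rotInt]
      rw [e1, e2, mul_assoc]
    rw [h2] at h1
    rw [div_mul_eq_mul_div, eq_div_iff hs', h1]
    ring
  rw [hrot] at hpart
  rw [negSqrt_ofReal hμ, ← hsdef]
  linear_combination Complex.I * hpart

/-- The boundary value of the half-line integral. -/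
theorem isUpperBoundaryValue_leg (hε : 0 < ε) {lam : ℝ} (hlam : 0 < lam)
    (hφ : ∀ z : ℂ, Y ≤ z.im → HasDerivAt φ (φ' z) z)
    (hd : ∀ z : ℂ, Y ≤ z.im → DifferentiableAt ℂ φ' z) (hB : ∀ z : ℂ, Y ≤ z.im → ‖φ z‖ ≤ B)
    (hC : ∀ z : ℂ, Y ≤ z.im → ‖φ' z‖ ≤ C / (1 + ‖z‖ ^ 2)) {E : ℝ → ℂ}
    (hE : ∀ x : ℝ, HasDerivAt E (-(Complex.I * ε / lam) *
      (Complex.exp (-Complex.I * (lam * (x + Y * Complex.I)) / ε) * φ' (x + Y * Complex.I))) x)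
    (hElim : Tendsto E atBot (𝓝 0)) (x₀ : ℝ) :
    IsUpperBoundaryValue (fun μ => Complex.I * ∫ y in Set.Ioi Y,
        Complex.exp (-Complex.I * (μ * (x₀ + y * Complex.I)) / ε) * φ (x₀ + y * Complex.I)) lam
      (-(Complex.I * ε / lam * (Complex.exp (-Complex.I * (lam * (x₀ + Y * Complex.I)) / ε) *
        φ (x₀ + Y * Complex.I)) + E x₀)) := by
  set z₀ : ℂ := x₀ + Y * Complex.I with hz₀
  have hz₀i : z₀.im = Y := by simp [hz₀]
  have hd' : ∀ z : ℂ, z₀.im ≤ z.im → DifferentiableAt ℂ φ' z := fun z hz => hd z (hz₀i ▸ hz)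
  have hC' : ∀ z : ℂ, z₀.im ≤ z.im → ‖φ' z‖ ≤ C / (1 + ‖z‖ ^ 2) := fun z hz => hC z (hz₀i ▸ hz)
  have hε' : (ε : ℂ) ≠ 0 := by exact_mod_cast hε.ne'
  have hlam' : (lam : ℂ) ≠ 0 := by exact_mod_cast hlam.ne'
  set r := Real.sqrt lam with hr
  have hr0 : 0 < r := Real.sqrt_pos.2 hlam
  have hrr : (r : ℂ) * r = lam := by exact_mod_cast Real.mul_self_sqrt hlam.le
  have hr' : (r : ℂ) ≠ 0 := by exact_mod_cast hr0.ne'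
  set s₀ : ℂ := -Complex.I * r with hs₀
  have hs₀ne : s₀ ≠ 0 := mul_ne_zero (neg_ne_zero.2 Complex.I_ne_zero) hr'
  have hs₀re : s₀.re = 0 := by simp [hs₀]
  refine ⟨fun μ => -(Complex.I * ε / μ) * Complex.exp (-Complex.I * (μ * z₀) / ε) *
    (φ z₀ + Complex.I / negSqrt μ * ∫ t in Set.Ioi (0 : ℝ), rotInt ε φ' z₀ (negSqrt μ) t),
    ?_, ?_, ?_⟩
  · intro μ hμ
    have h0 : μ ≠ 0 := ne_zero_of_mem_cutPlane hμ
    have h1 := differentiableAt_negSqrt hμ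
    have h2 := re_negSqrt_pos hμ
    have h3 : negSqrt μ ≠ 0 := fun h => by rw [h] at h2; simp at h2
    have h4 : DifferentiableAt ℂ (fun μ => ∫ t in Set.Ioi (0 : ℝ), rotInt ε φ' z₀ (negSqrt μ) t) μ :=
      DifferentiableAt.comp (g := fun s => ∫ t in Set.Ioi (0 : ℝ), rotInt ε φ' z₀ s t) μ
        (differentiableAt_integral_rotInt hε hd' hC' h2) h1
    have h5 : DifferentiableAt ℂ (fun μ : ℂ => -(Complex.I * ε / μ)) μ :=
      ((differentiableAt_const _).div differentiableAt_id h0).neg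
    have h6 : DifferentiableAt ℂ (fun μ : ℂ => Complex.exp (-Complex.I * (μ * z₀) / ε)) μ := by
      fun_prop
    exact ((h5.mul h6).mul (((((differentiableAt_const Complex.I).div h1 h3).mul h4)).const_add
      (φ z₀))).differentiableWithinAt
  · intro μ hμ
    exact (leg_eq hε hφ hd hB hC hμ).symm
  -- At s₀ = −i√λ the direction i/s₀ is −1/√λ: the ray has become the horizontal half-line to −∞,
  -- along which E is a primitive vanishing at −∞.
  · have hint : ∫ t in Set.Ioi (0 : ℝ), rotInt ε φ' z₀ s₀ t =
        Complex.I * r * lam * E x₀ * Complex.exp (Complex.I * (lam * z₀) / ε) / ε := by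
      have hEd : ∀ t ∈ Set.Ici (0 : ℝ), HasDerivAt (fun t : ℝ => E (x₀ - t / r))
          (Complex.I * ε / (lam * r) * Complex.exp (-Complex.I * (lam * z₀) / ε) *
            rotInt ε φ' z₀ s₀ t) t := by
        intro t _
        have h1 : HasDerivAt (fun t : ℝ => x₀ - t / r) (-(1 / r)) t :=
          ((hasDerivAt_id t).div_const r).const_sub x₀
        refine (HasDerivAt.scomp t (hE (x₀ - t / r)) h1).congr_deriv ?_
        have e2 : (((x₀ - t / r : ℝ) : ℂ) + Y * Complex.I) = z₀ + Complex.I * t / s₀ := by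
          rw [hz₀, hs₀]
          push_cast
          have := Complex.I_ne_zero
          field_simp
          ring
        have e3 : Complex.exp (-Complex.I * (lam * (z₀ + Complex.I * t / s₀)) / ε) =
            Complex.exp (-Complex.I * (lam * z₀) / ε) * Complex.exp (-s₀ * t / ε) := by
          rw [← Complex.exp_add]
          congr 1
          rw [hs₀, ← hrr]
          have := Complex.I_ne_zero
          field_simp
          ring
        rw [e2, e3, rotInt, Complex.real_smul]
        push_cast
        field_simp
      have hlimE : Tendsto (fun t : ℝ => E (x₀ - t / r)) atTop (𝓝 0) := by
        refine hElim.comp ?_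
        have : Tendsto (fun t : ℝ => t / r) atTop atTop := tendsto_id.atTop_div_const hr0
        exact (tendsto_atBot_add_const_left _ x₀ (tendsto_neg_atTop_atBot.comp this)).congr
          fun t => by simp [sub_eq_add_neg]
      have hi : IntegrableOn (rotInt ε φ' z₀ s₀) (Set.Ioi 0) := by
        refine Integrable.mono' (integrable_inv_one_add_sq.const_mul
          (C * (1 + 2 * ‖s₀‖ ^ 2 * (1 + ‖z₀‖ ^ 2)))).integrableOn
          ((continuousOn_rotInt hd' hs₀re.ge).aestronglyMeasurable measurableSet_Ioi) ?_
        refine (ae_restrict_iff' measurableSet_Ioi).2 (Eventually.of_forall fun t ht => ?_)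
        exact norm_rotInt_le hε hC' hs₀ne hs₀re.ge le_rfl (le_of_lt ht)
      have h1 := integral_Ioi_of_hasDerivAt_of_tendsto' hEd (hi.const_mul _) hlimE
      rw [integral_const_mul] at h1
      have hx : Complex.exp (-Complex.I * (lam * z₀) / ε) * Complex.exp (Complex.I * (lam * z₀) / ε) =
          1 := by
        rw [← Complex.exp_add, ← Complex.exp_zero]
        congr 1
        ring
      simp only [zero_div, sub_zero, zero_sub] at h1
      have hI := Complex.I_sq
      set a := Complex.exp (-Complex.I * (lam * z₀) / ε)
      set b := Complex.exp (Complex.I * (lam * z₀) / ε)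
      set S := ∫ t in Set.Ioi (0 : ℝ), rotInt ε φ' z₀ s₀ t
      have h2 : Complex.I * ε * a * S = -E x₀ * (lam * r) := by
        rw [← h1]
        field_simp
      have h3 : S * (ε * a) = Complex.I * r * (lam * E x₀) := by
        linear_combination (-Complex.I) * h2 + (ε * a * S) * hI
      have h4 : S * ε = Complex.I * r * lam * E x₀ * b := by
        linear_combination b * h3 - S * ε * hx
      rw [← h4, mul_div_cancel_right₀ _ hε']
    have hst := tendsto_negSqrt hlam
    have hst' := hst.mono_right nhdsWithin_le_nhds
    have hK := (tendsto_integral_rotInt hε hd' hC' hs₀ne hs₀re.ge).comp hst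
    have hμ : Tendsto (fun μ : ℂ => μ) (𝓝[{w : ℂ | 0 < w.im}] (lam : ℂ)) (𝓝 (lam : ℂ)) :=
      tendsto_id.mono_left nhdsWithin_le_nhds
    have h1 : Tendsto (fun μ : ℂ => -(Complex.I * ε / μ)) (𝓝[{w : ℂ | 0 < w.im}] (lam : ℂ))
        (𝓝 (-(Complex.I * ε / lam))) := (tendsto_const_nhds.div hμ hlam').neg
    have h2 : Tendsto (fun μ : ℂ => Complex.exp (-Complex.I * (μ * z₀) / ε))
        (𝓝[{w : ℂ | 0 < w.im}] (lam : ℂ)) (𝓝 (Complex.exp (-Complex.I * (lam * z₀) / ε))) := by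
      have : Continuous fun μ : ℂ => Complex.exp (-Complex.I * (μ * z₀) / ε) := by fun_prop
      exact (this.tendsto _).comp hμ
    have h3 := (h1.mul h2).mul (((((tendsto_const_nhds (x := Complex.I)).div hst' hs₀ne)).mul hK).const_add (φ z₀))
    have hx : Complex.exp (-Complex.I * (lam * z₀) / ε) *
        Complex.exp (Complex.I * (lam * z₀) / ε) = 1 := by
      rw [← Complex.exp_add, ← Complex.exp_zero]
      congr 1
      ring
    refine Tendsto.mono_right (Tendsto.congr (fun _ => rfl) h3) (le_of_eq (congrArg 𝓝 ?_))
    rw [hint, ← hr, ← hrr]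
    rw [← hrr] at hx
    set a := Complex.exp (-Complex.I * (r * r * z₀) / ε)
    set b := Complex.exp (Complex.I * (r * r * z₀) / ε)
    have hI := Complex.I_ne_zero
    field_simp
    linear_combination (-E x₀ * r ^ 2) * hx + (E x₀ * r ^ 2 * a * b) * Complex.I_sq

end


/-! ### The two cut planes and the branch of f adapted to the left -/

theorem norm_sub_le_arctan_Icc {E E' : ℝ → ℂ} {a b D : ℝ} (hab : a ≤ b)
    (hE : ∀ x ∈ Set.Icc a b, HasDerivAt E (E' x) x)
    (hD : ∀ x ∈ Set.Icc a b, ‖E' x‖ ≤ D * (1 + x ^ 2)⁻¹) :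
    ‖E b - E a‖ ≤ D * (Real.arctan b - Real.arctan a) := by
  have := image_norm_le_of_norm_deriv_right_le_deriv_boundary (a := a) (b := b)
    (f := fun x => E x - E a) (f' := E') (B := fun x => D * (Real.arctan x - Real.arctan a))
    (B' := fun x => D * (1 + x ^ 2)⁻¹)
    (fun x hx => ((hE x hx).sub_const _).continuousAt.continuousWithinAt)
    (fun x hx => ((hE x ⟨hx.1, hx.2.le⟩).sub_const _).hasDerivWithinAt) (by simp)
    (fun x => (((Real.hasDerivAt_arctan x).sub_const _).const_mul D).congr_deriv (by simp))
    (fun x hx => hD x ⟨hx.1, hx.2.le⟩)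
  exact this (Set.right_mem_Icc.2 hab)

/-- Constancy along a segment. -/
theorem eq_of_deriv_zero_segment {f : ℂ → ℂ} {a b : ℂ}
    (hf : ∀ z ∈ segment ℝ a b, HasDerivAt f 0 z) : f a = f b :=
  eqOn_of_deriv_zero (convex_segment a b) hf (left_mem_segment ℝ a b) (right_mem_segment ℝ a b)

theorem re_mem_uIcc_of_mem_segment {a b z : ℂ} (hz : z ∈ segment ℝ a b) :
    z.re ∈ Set.uIcc a.re b.re := by
  obtain ⟨s, t, hs, ht, hst, rfl⟩ := hz
  have := convex_uIcc a.re b.re Set.left_mem_uIcc Set.right_mem_uIcc hs ht hst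
  simpa using this

theorem im_mem_uIcc_of_mem_segment {a b z : ℂ} (hz : z ∈ segment ℝ a b) :
    z.im ∈ Set.uIcc a.im b.im := by
  obtain ⟨s, t, hs, ht, hst, rfl⟩ := hz
  have := convex_uIcc a.im b.im Set.left_mem_uIcc Set.right_mem_uIcc hs ht hst
  simpa using this

namespace RationalPotential

variable {P : ℕ} (u : RationalPotential P)

/-- The domain of analyticity of `f`: the plane cut vertically upwards from the poles and
downwards from their conjugates. -/
def cutUp : Set ℂ := {z | ∀ p, z.re ≠ (u.z p).re ∨ (-(u.z p).im < z.im ∧ z.im < (u.z p).im)}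

/-- The plane cut vertically downwards from the poles. -/
def cutDown : Set ℂ := {z | ∀ p, z.re ≠ (u.z p).re ∨ (u.z p).im < z.im}

variable {u}

theorem isOpen_cutUp : IsOpen u.cutUp := by
  rw [show u.cutUp = ⋂ p, {z | z.re ≠ (u.z p).re ∨ (-(u.z p).im < z.im ∧ z.im < (u.z p).im)} by
    ext z; simp [cutUp]]
  exact isOpen_iInter_of_finite fun p => (isOpen_ne_fun Complex.continuous_re continuous_const).union
    ((isOpen_lt continuous_const Complex.continuous_im).inter
      (isOpen_lt Complex.continuous_im continuous_const))

theorem isOpen_cutDown : IsOpen u.cutDown := by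
  rw [show u.cutDown = ⋂ p, {z | z.re ≠ (u.z p).re ∨ (u.z p).im < z.im} by
    ext z; simp [cutDown]]
  exact isOpen_iInter_of_finite fun p => (isOpen_ne_fun Complex.continuous_re continuous_const).union
    (isOpen_lt continuous_const Complex.continuous_im)

theorem ne_of_mem_cutUp {z : ℂ} (hz : z ∈ u.cutUp) (p : Fin P) :
    z ≠ u.z p ∧ z ≠ star (u.z p) := by
  refine ⟨fun h => ?_, fun h => ?_⟩ <;> have := hz p <;> rw [h] at this <;> simp at this

theorem ne_of_mem_cutDown {z : ℂ} (hz : z ∈ u.cutDown) (p : Fin P) :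
    z ≠ u.z p ∧ z ≠ star (u.z p) := by
  have h0 := u.z_im_pos p
  refine ⟨fun h => ?_, fun h => ?_⟩ <;> have := hz p <;> rw [h] at this <;> simp at this
  linarith

theorem ofReal_mem_cutUp (x : ℝ) : (x : ℂ) ∈ u.cutUp := fun p => by
  right; simpa using u.z_im_pos p

theorem mem_cutUp_of_re {z : ℂ} (h : ∀ p, z.re ≠ (u.z p).re) : z ∈ u.cutUp := fun p => Or.inl (h p)

theorem mem_cutDown_of_re {z : ℂ} (h : ∀ p, z.re ≠ (u.z p).re) : z ∈ u.cutDown :=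
  fun p => Or.inl (h p)

theorem mem_cutUp_vertical {z : ℂ} (hz : z ∈ u.cutUp) {t : ℝ} (ht : t ∈ Set.uIcc 0 z.im) :
    (z.re + t * Complex.I : ℂ) ∈ u.cutUp := by
  intro p
  have h0 := u.z_im_pos p
  rcases hz p with h | ⟨h1, h2⟩
  · left; simpa using h
  · right
    have : (z.re + t * Complex.I : ℂ).im = t := by simp
    rw [this]
    rcases Set.mem_uIcc.1 ht with ⟨h3, h4⟩ | ⟨h3, h4⟩ <;> constructor <;> linarith

theorem mem_cutDown_vertical {Y : ℝ} (hY : ∀ p, (u.z p).im + 1 ≤ Y) {z : ℂ} (hz : z ∈ u.cutDown)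
    {t : ℝ} (ht : t ∈ Set.uIcc Y z.im) : (z.re + t * Complex.I : ℂ) ∈ u.cutDown := by
  intro p
  have h0 := hY p
  rcases hz p with h | h1
  · left; simpa using h
  · right
    have : (z.re + t * Complex.I : ℂ).im = t := by simp
    rw [this]
    rcases Set.mem_uIcc.1 ht with ⟨h3, h4⟩ | ⟨h3, h4⟩ <;> linarith

theorem mem_cutDown_of_im {Y : ℝ} (hY : ∀ p, (u.z p).im + 1 ≤ Y) {z : ℂ} (hz : Y ≤ z.im) :
    z ∈ u.cutDown := fun p => Or.inr (by linarith [hY p])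

theorem mem_slitPlane_of_mem_cutUp {z : ℂ} (hz : z ∈ u.cutUp) (p : Fin P) :
    Complex.I * (z - u.z p) ∈ Complex.slitPlane ∧
      -Complex.I * (z - star (u.z p)) ∈ Complex.slitPlane := by
  rw [Complex.mem_slitPlane_iff, Complex.mem_slitPlane_iff]
  rcases hz p with h | ⟨h1, h2⟩
  · have : z.re - (u.z p).re ≠ 0 := sub_ne_zero.2 h
    refine ⟨Or.inr (by simpa using this), Or.inr ?_⟩
    simp only [Complex.mul_im, Complex.neg_re, Complex.neg_im, Complex.I_re, Complex.I_im,
      Complex.sub_re, Complex.sub_im, RCLike.star_def, Complex.conj_re]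
    intro h'
    apply this
    linarith
  · refine ⟨Or.inl ?_, Or.inl ?_⟩ <;> simp <;> linarith

theorem hasDerivAt_f {z : ℂ} (hz : z ∈ u.cutUp) : HasDerivAt u.f (u.uC z) z := by
  have h : ∀ p, HasDerivAt (fun x : ℂ =>
      u.c p * (Complex.log (Complex.I * (x - u.z p)) + Real.pi * Complex.I / 2) +
      star (u.c p) * (Complex.log (-Complex.I * (x - star (u.z p))) - Real.pi * Complex.I / 2))
      (u.c p / (z - u.z p) + star (u.c p) / (z - star (u.z p))) z := by
    intro p
    obtain ⟨h1, h2⟩ := mem_slitPlane_of_mem_cutUp hz p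
    obtain ⟨h3, h4⟩ := ne_of_mem_cutUp hz p
    have d1 := ((((hasDerivAt_id z).sub_const (u.z p)).const_mul Complex.I).clog h1).add_const
      (Real.pi * Complex.I / 2 : ℂ)
    have d2 := ((((hasDerivAt_id z).sub_const (star (u.z p))).const_mul
      (-Complex.I)).clog h2).sub_const (Real.pi * Complex.I / 2 : ℂ)
    refine ((d1.const_mul (u.c p)).add (d2.const_mul (star (u.c p)))).congr_deriv ?_
    have h3' := sub_ne_zero.2 h3
    have h4' := sub_ne_zero.2 h4
    have := Complex.I_ne_zero
    simp only [id]
    field_simp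
  exact HasDerivAt.fun_sum fun p _ => h p

/-- `e^{-ih(z;λ)/ε}`. -/
def wave (u : RationalPotential P) (ε lam : ℝ) (z : ℂ) : ℂ :=
  Complex.exp (-Complex.I * u.h lam z / ε)

/-- `e^{-i(λz + f₀(z))/ε}`. -/
def waveOf (f₀ : ℂ → ℂ) (ε lam : ℝ) (z : ℂ) : ℂ :=
  Complex.exp (-Complex.I * (lam * z + f₀ z) / ε)

theorem hasDerivAt_waveOf {f₀ : ℂ → ℂ} {z : ℂ} (h : HasDerivAt f₀ (u.uC z) z) (ε lam : ℝ) :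
    HasDerivAt (waveOf f₀ ε lam) (-(Complex.I / ε) * (lam + u.uC z) * waveOf f₀ ε lam z) z := by
  refine ((((((hasDerivAt_id z).const_mul (lam : ℂ)).add h).const_mul
    (-Complex.I)).div_const (ε : ℂ)).cexp).congr_deriv ?_
  simp only [waveOf, id, Pi.add_apply]
  ring

theorem hasDerivAt_wave {z : ℂ} (hz : z ∈ u.cutUp) (ε lam : ℝ) :
    HasDerivAt (u.wave ε lam) (-(Complex.I / ε) * (lam + u.uC z) * u.wave ε lam z) z :=
  hasDerivAt_waveOf (hasDerivAt_f hz) ε lam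

theorem waveOf_ne_zero (f₀ : ℂ → ℂ) (ε lam : ℝ) (z : ℂ) : waveOf f₀ ε lam z ≠ 0 :=
  Complex.exp_ne_zero _

theorem wave_ne_zero (ε lam : ℝ) (z : ℂ) : u.wave ε lam z ≠ 0 := Complex.exp_ne_zero _

/-- `f₀` is the branch of `f` on the plane cut downwards which agrees with `f` on the left. -/
structure IsBranch (u : RationalPotential P) (l Y : ℝ) (f₀ : ℂ → ℂ) : Prop where
  left : ∀ p, l + 1 ≤ (u.z p).re
  above : ∀ p, (u.z p).im + 1 ≤ Y
  pos : 0 < Y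
  hasDerivAt : ∀ z ∈ u.cutDown, HasDerivAt f₀ (u.uC z) z
  eq : f₀ (l + Y * Complex.I) = u.f (l + Y * Complex.I)

theorem exists_isBranch {l Y : ℝ} (hl : ∀ p, l + 1 ≤ (u.z p).re) (hY : ∀ p, (u.z p).im + 1 ≤ Y)
    (h0 : 0 < Y) : ∃ f₀, u.IsBranch l Y f₀ := by
  obtain ⟨J, hJ⟩ := exists_primitive_vertical (isOpen_cutDown (u := u)) (b := Y)
    (fun z hz t ht => mem_cutDown_vertical hY hz ht)
    (fun x => mem_cutDown_of_im hY (by simp))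
    (Ψ := u.uC) fun z hz =>
      (u.hasDerivAt_uC (ne_of_mem_cutDown hz)).differentiableAt.differentiableWithinAt
  refine ⟨fun z => J z + (u.f (l + Y * Complex.I) - J (l + Y * Complex.I)), hl, hY, h0,
    fun z hz => (hJ z hz).add_const _, by simp⟩

namespace IsBranch

variable {l Y : ℝ} {f₀ : ℂ → ℂ}

theorem away (hf : u.IsBranch l Y f₀) {z : ℂ} (hz : Y ≤ z.im ∨ z.re ≤ l) : u.Away 1 z := by
  intro p
  have h0 := u.z_im_pos p
  rcases hz with hz | hz
  · have h1 := hf.above p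
    refine ⟨le_trans ?_ (Complex.abs_im_le_norm _), le_trans ?_ (Complex.abs_im_le_norm _)⟩ <;>
    · refine le_trans ?_ (le_abs_self _)
      simp
      linarith
  · have h1 := hf.left p
    refine ⟨le_trans ?_ (Complex.abs_re_le_norm _), le_trans ?_ (Complex.abs_re_le_norm _)⟩ <;>
    · refine le_trans ?_ (neg_le_abs _)
      simp
      linarith

theorem mem_cutDown (hf : u.IsBranch l Y f₀) {z : ℂ} (hz : Y ≤ z.im ∨ z.re ≤ l) :
    z ∈ u.cutDown := by
  rcases hz with hz | hz
  · exact mem_cutDown_of_im hf.above hz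
  · exact mem_cutDown_of_re fun p => ne_of_lt (by linarith [hf.left p])

/-- The derivative u₀ decays quadratically, so a vertical path to height Y followed by a horizontal
path at that height changes f₀ by at most Cπ each. Both paths stay away from the poles. -/
theorem exists_bound (hf : u.IsBranch l Y f₀) : ∃ B, ∀ z : ℂ,
    (Y ≤ z.im ∨ (0 ≤ z.im ∧ z.re ≤ l)) → ‖f₀ z‖ ≤ B := by
  obtain ⟨C, hC, hb⟩ := u.exists_bound_uC one_pos
  have hb' : ∀ (z : ℂ) (t : ℝ), (Y ≤ z.im ∨ z.re ≤ l) → |t| ≤ ‖z‖ →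
      ‖u.uC z‖ ≤ C * (1 + t ^ 2)⁻¹ := by
    intro z t hz ht
    refine (hb z (hf.away hz)).trans ?_
    rw [div_eq_mul_inv]
    have : t ^ 2 ≤ ‖z‖ ^ 2 := by rw [← sq_abs]; gcongr
    gcongr
  have hline : ∀ a b : ℝ, a ≤ b → Real.arctan b - Real.arctan a ≤ Real.pi := fun a b _ => by
    linarith [Real.arctan_lt_pi_div_two b, Real.neg_pi_div_two_lt_arctan a]
  have hup : ∀ (x : ℝ) (a b : ℝ), a ≤ b → (Y ≤ a ∨ x ≤ l) →
      ‖f₀ (x + b * Complex.I) - f₀ (x + a * Complex.I)‖ ≤ C * Real.pi := by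
    intro x a b hab hx
    have hmem : ∀ t ∈ Set.Icc a b, Y ≤ (x + t * Complex.I : ℂ).im ∨ (x + t * Complex.I : ℂ).re ≤ l := by
      intro t ht
      rcases hx with hx | hx
      · left; simpa using hx.trans ht.1
      · right; simpa using hx
    refine (norm_sub_le_arctan_Icc hab (E := fun t : ℝ => f₀ (x + t * Complex.I)) (D := C)
      (fun t ht => hasDerivAt_comp_line (hf.hasDerivAt _ (hf.mem_cutDown (hmem t ht))))
      (fun t ht => ?_)).trans (mul_le_mul_of_nonneg_left (hline a b hab) hC)
    rw [norm_mul, Complex.norm_I, one_mul]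
    refine hb' _ _ (hmem t ht) ?_
    have := Complex.abs_im_le_norm (x + t * Complex.I)
    simpa using this
  have hhor : ∀ a b : ℝ, a ≤ b →
      ‖f₀ (Y * Complex.I + b) - f₀ (Y * Complex.I + a)‖ ≤ C * Real.pi := by
    intro a b hab
    have hmem : ∀ t : ℝ, Y ≤ (Y * Complex.I + t * 1 : ℂ).im := fun t => by simp
    have := (norm_sub_le_arctan_Icc hab (E := fun t : ℝ => f₀ (Y * Complex.I + t * 1)) (D := C)
      (fun t _ => hasDerivAt_comp_line (hf.hasDerivAt _ (hf.mem_cutDown (Or.inl (hmem t)))))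
      (fun t ht => ?_)).trans (mul_le_mul_of_nonneg_left (hline a b hab) hC)
    · simpa using this
    · rw [one_mul]
      refine hb' _ _ (Or.inl (hmem t)) ?_
      have := Complex.abs_re_le_norm (Y * Complex.I + t * 1)
      simpa using this
  refine ⟨C * Real.pi + C * Real.pi + ‖f₀ (Y * Complex.I)‖, fun z hz => ?_⟩
  have h1 : ‖f₀ z - f₀ (z.re + Y * Complex.I)‖ ≤ C * Real.pi := by
    rcases le_total Y z.im with h | h
    · have := hup z.re Y z.im h (Or.inl le_rfl)
      rwa [Complex.re_add_im] at this
    · rcases hz with hz | hz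
      · have := hup z.re Y z.im hz (Or.inl le_rfl)
        rwa [Complex.re_add_im] at this
      · have := hup z.re z.im Y h (Or.inr hz.2)
        rwa [Complex.re_add_im, norm_sub_rev] at this
  have h2 : ‖f₀ (z.re + Y * Complex.I) - f₀ (Y * Complex.I)‖ ≤ C * Real.pi := by
    rcases le_total 0 z.re with h | h
    · have := hhor 0 z.re h
      rwa [Complex.ofReal_zero, add_zero, add_comm] at this
    · have := hhor z.re 0 h
      rwa [Complex.ofReal_zero, add_zero, norm_sub_rev, add_comm] at this
  calc ‖f₀ z‖ = ‖(f₀ z - f₀ (z.re + Y * Complex.I)) + (f₀ (z.re + Y * Complex.I) -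
        f₀ (Y * Complex.I)) + f₀ (Y * Complex.I)‖ := by congr 1; ring
    _ ≤ _ := (norm_add_le _ _).trans (add_le_add_left ((norm_add_le _ _).trans
        (add_le_add h1 h2)) _)

/-- The amplitude `e^{-if₀/ε} q` and its derivative. -/
def amp (u : RationalPotential P) (f₀ : ℂ → ℂ) (ε : ℝ) (κ : ℂ) (v : Fin P → ℂ) (z : ℂ) : ℂ :=
  Complex.exp (-Complex.I * f₀ z / ε) * u.q 1 κ v z

/-- The parameter of `q` is set to 1, so its constant term is κ itself and the amplitude is
independent of the spectral variable μ. -/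
def amp' (u : RationalPotential P) (f₀ : ℂ → ℂ) (ε : ℝ) (κ : ℂ) (v : Fin P → ℂ) (z : ℂ) : ℂ :=
  Complex.exp (-Complex.I * f₀ z / ε) * (u.q' v z - Complex.I / ε * u.uC z * u.q 1 κ v z)

theorem hasDerivAt_amp (hf : u.IsBranch l Y f₀) (ε : ℝ) (κ : ℂ) (v : Fin P → ℂ) {z : ℂ}
    (hz : z ∈ u.cutDown) : HasDerivAt (amp u f₀ ε κ v) (amp' u f₀ ε κ v z) z := by
  refine (((((hf.hasDerivAt z hz).const_mul (-Complex.I)).div_const (ε : ℂ)).cexp).mul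
    (u.hasDerivAt_q 1 κ v fun p => (ne_of_mem_cutDown hz p).1)).congr_deriv ?_
  rw [amp']
  ring

theorem differentiableAt_amp' (hf : u.IsBranch l Y f₀) (ε : ℝ) (κ : ℂ) (v : Fin P → ℂ) {z : ℂ}
    (hz : z ∈ u.cutDown) : DifferentiableAt ℂ (amp' u f₀ ε κ v) z := by
  have hne := ne_of_mem_cutDown hz
  have h1 := (((hf.hasDerivAt z hz).const_mul (-Complex.I)).div_const (ε : ℂ)).cexp
  have h2 := (u.hasDerivAt_q 1 κ v fun p => (hne p).1).differentiableAt
  have h3 := (u.hasDerivAt_uC hne).differentiableAt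
  have h4 : DifferentiableAt ℂ (u.q' v) z := by
    unfold q'
    refine (DifferentiableAt.fun_sum fun p _ => ?_).neg
    exact (differentiableAt_const _).div ((differentiableAt_id.sub_const _).pow 2)
      (pow_ne_zero 2 (sub_ne_zero.2 (hne p).1))
  exact h1.differentiableAt.mul (h4.sub ((h3.const_mul _).mul h2))

theorem exists_bound_amp (hf : u.IsBranch l Y f₀) (ε : ℝ) (κ : ℂ) (v : Fin P → ℂ) :
    ∃ B, 0 ≤ B ∧ ∀ z : ℂ, (Y ≤ z.im ∨ (0 ≤ z.im ∧ z.re ≤ l)) →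
      ‖Complex.exp (-Complex.I * f₀ z / ε)‖ ≤ B ∧ ‖Complex.exp (-Complex.I * f₀ z / ε)‖⁻¹ ≤ B ∧
      ‖amp u f₀ ε κ v z‖ ≤ B ∧ ‖amp' u f₀ ε κ v z‖ ≤ B / (1 + ‖z‖ ^ 2) := by
  obtain ⟨B, hB⟩ := hf.exists_bound
  obtain ⟨C₁, hC₁, h₁⟩ := u.exists_bound_q one_pos 1
  obtain ⟨C₂, hC₂, h₂⟩ := u.exists_bound_uC one_pos
  have hN := size_nonneg κ v
  set N := size κ v
  set K := Real.exp (B / |ε|) with hK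
  have hK0 : 0 < K := Real.exp_pos _
  have hε := abs_nonneg ε
  refine ⟨K + K * (C₁ * N) + K * (C₁ * N + |ε|⁻¹ * C₂ * (C₁ * N)), by positivity, fun z hz => ?_⟩
  have haw : u.Away 1 z := hf.away (hz.imp_right And.right)
  have hb := hB z hz
  have hw : ‖-Complex.I * f₀ z / ε‖ ≤ B / |ε| := by
    rw [norm_div, norm_mul, norm_neg, Complex.norm_I, one_mul, Complex.norm_real, Real.norm_eq_abs]
    gcongr
  have he : ‖Complex.exp (-Complex.I * f₀ z / ε)‖ ≤ K := by
    rw [Complex.norm_exp]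
    exact Real.exp_le_exp.2 ((Complex.re_le_norm _).trans hw)
  have he' : ‖Complex.exp (-Complex.I * f₀ z / ε)‖⁻¹ ≤ K := by
    rw [Complex.norm_exp, ← Real.exp_neg]
    exact Real.exp_le_exp.2 (((neg_le_abs _).trans (Complex.abs_re_le_norm _)).trans hw)
  obtain ⟨hq, hq'⟩ := h₁ κ v z fun p => (haw p).1
  have hu := h₂ z haw
  have p1 : 0 ≤ K * (C₁ * N) := by positivity
  have p2 : 0 ≤ K * (C₁ * N + |ε|⁻¹ * C₂ * (C₁ * N)) := by positivity
  refine ⟨by linarith, by linarith, ?_, ?_⟩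
  · have : ‖amp u f₀ ε κ v z‖ ≤ K * (C₁ * N) := by
      rw [amp, norm_mul]
      gcongr
    linarith
  · have : ‖amp' u f₀ ε κ v z‖ ≤ K * ((C₁ * N + |ε|⁻¹ * C₂ * (C₁ * N)) / (1 + ‖z‖ ^ 2)) := by
      rw [amp', norm_mul]
      gcongr
      refine (norm_sub_le _ _).trans ?_
      rw [add_div]
      refine add_le_add hq' ?_
      rw [norm_mul, norm_mul, norm_div, Complex.norm_I, Complex.norm_real, Real.norm_eq_abs,
        one_div]
      calc |ε|⁻¹ * ‖u.uC z‖ * ‖u.q 1 κ v z‖ ≤ |ε|⁻¹ * (C₂ / (1 + ‖z‖ ^ 2)) * (C₁ * N) := by gcongr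
        _ = _ := by ring
    rw [← mul_div_assoc] at this
    refine this.trans ?_
    gcongr
    linarith

end IsBranch
end RationalPotential

/-- On bounded parts of a contour the integral is entire in μ, so its boundary value is just its
value. Only the half-lines need the rotation. -/
theorem differentiable_integral_exp {ζ g : ℝ → ℂ} (hζ : Continuous ζ) {a b : ℝ}
    (hg : IntervalIntegrable g volume a b) (ε : ℝ) :
    Differentiable ℂ fun μ : ℂ => ∫ t in a..b, Complex.exp (-Complex.I * (μ * ζ t) / ε) * g t := by
  intro s₀
  obtain ⟨Z, hZ⟩ := isCompact_uIcc.exists_bound_of_continuousOn (s := Set.uIcc a b)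
    hζ.continuousOn
  simp only [intervalIntegral.intervalIntegral_eq_integral_uIoc]
  refine DifferentiableAt.const_smul ?_ _
  have hgi : IntegrableOn g (Set.uIoc a b) := intervalIntegrable_iff.1 hg
  refine differentiableAt_integral_of_dominated (r := 1) one_pos
    (bound := fun t => Real.exp ((‖s₀‖ + 1) * Z / |ε|) * ‖g t‖) (hgi.norm.const_mul _) ?_ ?_ ?_
  · intro s _
    exact (Continuous.aestronglyMeasurable (by fun_prop)).mul hgi.aestronglyMeasurable
  · refine Eventually.of_forall fun t => Differentiable.differentiableOn ?_
    exact (by fun_prop : Differentiable ℂ fun s : ℂ =>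
      Complex.exp (-Complex.I * (s * ζ t) / ε)).mul_const (g t)
  · refine (ae_restrict_iff' measurableSet_uIoc).2 (Eventually.of_forall fun t ht s hs => ?_)
    rw [norm_mul]
    refine mul_le_mul_of_nonneg_right ?_ (norm_nonneg _)
    rw [Complex.norm_exp]
    refine Real.exp_le_exp.2 ((Complex.re_le_norm _).trans ?_)
    rw [norm_div, norm_mul, norm_neg, Complex.norm_I, one_mul, norm_mul, Complex.norm_real,
      Real.norm_eq_abs]
    have h1 := hZ t (Set.uIoc_subset_uIcc ht)
    have h2 : ‖s‖ ≤ ‖s₀‖ + 1 := by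
      have := norm_sub_norm_le s s₀
      rw [mem_ball_iff_norm] at hs
      linarith
    gcongr

/-! ### Boundary values of the contour integrals as values of primitives -/

namespace RationalPotential

variable {P : ℕ} {u : RationalPotential P} {l Y : ℝ} {f₀ : ℂ → ℂ}

theorem waveOf_eq (f₀ : ℂ → ℂ) (ε lam : ℝ) (z : ℂ) : waveOf f₀ ε lam z =
    Complex.exp (-Complex.I * (lam * z) / ε) * Complex.exp (-Complex.I * f₀ z / ε) := by
  rw [waveOf, ← Complex.exp_add]
  congr 1
  ring

theorem norm_exp_im (ε lam : ℝ) (z : ℂ) :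
    ‖Complex.exp (-Complex.I * (lam * z) / ε)‖ = Real.exp (lam / ε * z.im) := by
  rw [← norm_exp_vertical ε lam z.re z.im, Complex.re_add_im]

/-- A primitive of `e^{-i(λz + f₀)/ε} q` on the plane cut downwards, small at `-∞`, gives the boundary values of
the half-line integrals. -/
theorem IsBranch.exists_primitive (hf : u.IsBranch l Y f₀) {ε lam : ℝ} (hε : 0 < ε)
    (hlam : 0 < lam) (κ : ℂ) (v : Fin P → ℂ) : ∃ J : ℂ → ℂ,
      (∀ z ∈ u.cutDown, HasDerivAt J (waveOf f₀ ε lam z * u.q 1 κ v z) z) ∧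
      Tendsto (fun x : ℝ => J x / waveOf f₀ ε lam x) atBot (𝓝 (Complex.I * ε / lam * κ)) ∧
      ∀ x₀ : ℝ, IsUpperBoundaryValue (fun μ => Complex.I * ∫ y in Set.Ioi Y,
        Complex.exp (-Complex.I * (μ * (x₀ + y * Complex.I)) / ε) *
          IsBranch.amp u f₀ ε κ v (x₀ + y * Complex.I)) lam (-J (x₀ + Y * Complex.I)) := by
  have hε' : (ε : ℂ) ≠ 0 := by exact_mod_cast hε.ne'
  have hlam' : (lam : ℂ) ≠ 0 := by exact_mod_cast hlam.ne'
  -- The part of the integrand left after integration by parts; unlike the integrand itself it is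
  -- integrable towards −∞, so its primitive can be normalised there.
  set Θ : ℂ → ℂ := fun z => -(Complex.I * ε / lam) *
    (Complex.exp (-Complex.I * (lam * z) / ε) * IsBranch.amp' u f₀ ε κ v z) with hΘ
  have hΘd : ∀ z ∈ u.cutDown, DifferentiableAt ℂ Θ z := fun z hz =>
    DifferentiableAt.const_mul (DifferentiableAt.mul (by fun_prop)
      (hf.differentiableAt_amp' ε κ v hz)) _
  obtain ⟨B, hB0, hB⟩ := hf.exists_bound_amp ε κ v
  set D : ℝ := ε / lam * (Real.exp (lam / ε * Y) * B) with hD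
  have hD0 : 0 ≤ D := by positivity
  have hΘb : ∀ z : ℂ, 0 ≤ z.im → z.im ≤ Y → (z.im = Y ∨ z.re ≤ l) →
      ‖Θ z‖ ≤ D * (1 + z.re ^ 2)⁻¹ := by
    intro z h0 h1 h2
    have h3 := (hB z (h2.imp ge_of_eq fun h => ⟨h0, h⟩)).2.2.2
    have h4 : z.re ^ 2 ≤ ‖z‖ ^ 2 := by
      rw [← sq_abs z.re]
      gcongr
      exact Complex.abs_re_le_norm z
    rw [hΘ]
    simp only
    rw [norm_mul, norm_mul, norm_exp_im, norm_neg, norm_div, norm_mul, Complex.norm_I, one_mul,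
      Complex.norm_real, Complex.norm_real, Real.norm_of_nonneg hε.le, Real.norm_of_nonneg hlam.le,
      hD, mul_assoc, mul_assoc]
    refine mul_le_mul_of_nonneg_left (mul_le_mul ?_ (h3.trans ?_) (norm_nonneg _)
      (Real.exp_pos _).le) (by positivity)
    · exact Real.exp_le_exp.2 (mul_le_mul_of_nonneg_left h1 (by positivity))
    · rw [div_eq_mul_inv]
      gcongr
  obtain ⟨E₀, hE₀⟩ := exists_primitive_vertical (isOpen_cutDown (u := u)) (b := Y)
    (fun z hz t ht => mem_cutDown_vertical hf.above hz ht)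
    (fun x => mem_cutDown_of_im hf.above (by simp)) (Ψ := Θ)
    fun z hz => (hΘd z hz).differentiableWithinAt
  have hline : ∀ x : ℝ, (Y ≤ (x + Y * Complex.I : ℂ).im) := fun x => by simp
  have hcut : ∀ x : ℝ, (x + Y * Complex.I : ℂ) ∈ u.cutDown := fun x =>
    mem_cutDown_of_im hf.above (hline x)
  have hderiv : ∀ x : ℝ, HasDerivAt (fun x : ℝ => E₀ (x + Y * Complex.I))
      (Θ (x + Y * Complex.I)) x := fun x => by
    have h1 : HasDerivAt (fun z : ℂ => E₀ (z + Y * Complex.I)) (Θ (x + Y * Complex.I)) (x : ℂ) :=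
      HasDerivAt.comp_add_const (x : ℂ) (Y * Complex.I) (hE₀ _ (hcut x))
    exact h1.comp_ofReal
  have hint : IntegrableOn (fun x : ℝ => Θ (x + Y * Complex.I)) (Set.Iic 0) := by
    refine (Integrable.mono' (integrable_inv_one_add_sq.const_mul D) ?_ ?_).integrableOn
    · refine Continuous.aestronglyMeasurable (continuous_iff_continuousAt.2 fun x => ?_)
      exact ContinuousAt.comp (g := Θ) (f := fun x : ℝ => (x + Y * Complex.I : ℂ))
        (hΘd _ (hcut x)).continuousAt (by fun_prop)
    · refine Eventually.of_forall fun x => ?_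
      have := hΘb (x + Y * Complex.I) (by simpa using hf.pos.le) (by simp) (by simp)
      simpa using this
  have hlim := tendsto_limUnder_of_hasDerivAt_of_integrableOn_Iic (a := 0)
    (fun x _ => hderiv x) hint
  set L := limUnder atBot fun x : ℝ => E₀ (x + Y * Complex.I)
  set E : ℂ → ℂ := fun z => E₀ z - L with hE
  have hEd : ∀ z ∈ u.cutDown, HasDerivAt E (Θ z) z := fun z hz => (hE₀ z hz).sub_const L
  have hElim : Tendsto (fun x : ℝ => E (x + Y * Complex.I)) atBot (𝓝 0) := by
    simpa using hlim.sub_const L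
  -- Restoring the boundary term of the integration by parts gives a primitive of the original
  -- integrand. Since E tends to 0, this term alone determines the limit of J/e^{-i(λz + f₀)/ε}.
  set J : ℂ → ℂ := fun z => E z + Complex.I * ε / lam * (waveOf f₀ ε lam z * u.q 1 κ v z) with hJ
  have hJeq : ∀ z, J z = Complex.I * ε / lam * (Complex.exp (-Complex.I * (lam * z) / ε) *
      IsBranch.amp u f₀ ε κ v z) + E z := fun z => by
    rw [hJ]
    simp only
    rw [waveOf_eq, IsBranch.amp]
    ring
  refine ⟨J, fun z hz => ?_, ?_, fun x₀ => ?_⟩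
  · have h1 := hasDerivAt_waveOf (hf.hasDerivAt z hz) ε lam
    have h2 := u.hasDerivAt_q 1 κ v fun p => (ne_of_mem_cutDown hz p).1
    refine ((hEd z hz).add ((h1.mul h2).const_mul (Complex.I * ε / lam : ℂ))).congr_deriv ?_
    simp only [hΘ, IsBranch.amp']
    rw [waveOf_eq]
    set a := Complex.exp (-Complex.I * (lam * z) / ε)
    set b := Complex.exp (-Complex.I * f₀ z / ε)
    field_simp
    linear_combination (-(a * b * lam * u.q 1 κ v z)) * Complex.I_sq
  -- From height Y down to the real axis E changes by at most Y times O(1/x²), so the limit at −∞ is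
  -- the same on both lines.
  · have hE0 : Tendsto (fun x : ℝ => E x) atBot (𝓝 0) := by
      have h1 : Tendsto (fun x : ℝ => D * (1 + x ^ 2)⁻¹ * Y) atBot (𝓝 0) := by
        have : Tendsto (fun x : ℝ => 1 + x ^ 2) atBot atTop :=
          tendsto_atTop_add_const_left _ _ <| ((tendsto_pow_atTop
            two_ne_zero).comp tendsto_abs_atBot_atTop).congr fun x => sq_abs x
        simpa using ((tendsto_inv_atTop_zero.comp this).const_mul D).mul_const Y
      have h2 : Tendsto (fun x : ℝ => E (x + Y * Complex.I) - E x) atBot (𝓝 0) := by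
        refine squeeze_zero_norm' ?_ h1
        filter_upwards [eventually_le_atBot l] with x hx
        have h3 : ∀ t ∈ Set.Icc 0 Y, HasDerivWithinAt (fun t : ℝ => E (x + t * Complex.I))
            (Complex.I * Θ (x + t * Complex.I)) (Set.Icc 0 Y) t := fun t ht =>
          (hasDerivAt_comp_line (hEd _ (hf.mem_cutDown (Or.inr (by simpa using hx))))).hasDerivWithinAt
        have h4 := norm_image_sub_le_of_norm_deriv_le_segment' h3 (C := D * (1 + x ^ 2)⁻¹)
          (fun t ht => by
            have := hΘb (x + t * Complex.I) (by simpa using ht.1) (by simpa using ht.2.le)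
              (Or.inr (by simpa using hx))
            rw [norm_mul, Complex.norm_I, one_mul]
            simpa using this) Y ⟨hf.pos.le, le_rfl⟩
        simpa using h4
      have h3 := hElim.sub h2
      simpa using h3
    have hb : ∀ᶠ x : ℝ in atBot, ‖(waveOf f₀ ε lam x)⁻¹‖ ≤ B := by
      filter_upwards [eventually_le_atBot l] with x hx
      rw [waveOf_eq, norm_inv, norm_mul, norm_exp_im]
      simp only [Complex.ofReal_im, mul_zero, Real.exp_zero, one_mul]
      exact (hB x (Or.inr (by simpa using hx))).2.1
    have h1 : Tendsto (fun x : ℝ => E x * (waveOf f₀ ε lam x)⁻¹) atBot (𝓝 0) := by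
      refine squeeze_zero_norm' (a := fun x : ℝ => ‖E x‖ * B) ?_ (by simpa using hE0.norm.mul_const B)
      filter_upwards [hb] with x hx
      rw [norm_mul]
      gcongr
    have h2 := h1.add ((u.tendsto_q_atBot 1 κ v).const_mul (Complex.I * ε / lam : ℂ))
    simp only [Complex.ofReal_one, mul_one, zero_add] at h2
    refine h2.congr fun x => ?_
    have := waveOf_ne_zero f₀ ε lam x
    simp only [hJ]
    field_simp
  · rw [hJeq]
    refine isUpperBoundaryValue_leg (B := B) (C := B) hε hlam
      (fun z hz => hf.hasDerivAt_amp ε κ v (mem_cutDown_of_im hf.above hz))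
      (fun z hz => hf.differentiableAt_amp' ε κ v (mem_cutDown_of_im hf.above hz))
      (fun z hz => (hB z (Or.inl hz)).2.2.1) (fun z hz => (hB z (Or.inl hz)).2.2.2)
      (E := fun x => E (x + Y * Complex.I)) (fun x => ?_) hElim x₀
    exact (hderiv x).sub_const L

/-- The entries of the linear system, for a general numerator. -/
def row (u : RationalPotential P) (ε : ℝ) (m : Fin P) (κ : ℂ) (v : Fin P → ℂ) (μ : ℝ) : ℂ :=
  u.contourIntegral ε m fun z => u.wave ε μ z * u.q 1 κ v z

theorem wave_eq_mul (ε lam : ℝ) (z : ℂ) : u.wave ε lam z =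
    Complex.exp (-Complex.I * (lam * z) / ε) * Complex.exp (-Complex.I * u.f z / ε) :=
  waveOf_eq u.f ε lam z

theorem continuousAt_exp_f_mul_q {ε : ℝ} {κ : ℂ} {v : Fin P → ℂ} {z : ℂ} (hz : z ∈ u.cutUp) :
    ContinuousAt (fun z => Complex.exp (-Complex.I * u.f z / ε) * u.q 1 κ v z) z :=
  ((((hasDerivAt_f hz).const_mul (-Complex.I)).div_const (ε : ℂ)).cexp).continuousAt.mul
    (u.hasDerivAt_q 1 κ v fun p => (ne_of_mem_cutUp hz p).1).continuousAt

/-- The part of a contour integral over a segment has an entire continuation. -/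
theorem isUpperBoundaryValue_segment {ε lam : ℝ} {κ : ℂ} {v : Fin P → ℂ} {JS : ℂ → ℂ}
    (hJS : ∀ z ∈ u.cutUp, HasDerivAt JS (u.wave ε lam z * u.q 1 κ v z) z) {a b : ℂ} {s t : ℝ}
    (h : ∀ r ∈ Set.uIcc s t, a + r * b ∈ u.cutUp) :
    IsUpperBoundaryValue (fun μ => b * ∫ r in s..t, u.wave ε μ (a + r * b) * u.q 1 κ v (a + r * b))
      lam (JS (a + t * b) - JS (a + s * b)) := by
  have hc : ContinuousOn (fun r : ℝ => Complex.exp (-Complex.I * u.f (a + r * b) / ε) *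
      u.q 1 κ v (a + r * b)) (Set.uIcc s t) := fun r hr =>
    (ContinuousAt.comp (f := fun r : ℝ => a + r * b) (continuousAt_exp_f_mul_q (h r hr))
      (by fun_prop)).continuousWithinAt
  have h1 := differentiable_integral_exp (ζ := fun r : ℝ => a + r * b) (by fun_prop)
    hc.intervalIntegrable ε
  have h2 : ∀ μ : ℝ, ∫ r in s..t, Complex.exp (-Complex.I * (μ * (a + r * b)) / ε) *
      (Complex.exp (-Complex.I * u.f (a + r * b) / ε) * u.q 1 κ v (a + r * b)) =
      ∫ r in s..t, u.wave ε μ (a + r * b) * u.q 1 κ v (a + r * b) := fun μ => by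
    simp only [wave_eq_mul, mul_assoc]
  have h3 := (IsUpperBoundaryValue.of_differentiable h1 lam).const_mul b
  have h4 : b * ∫ r in s..t, u.wave ε lam (a + r * b) * u.q 1 κ v (a + r * b) =
      JS (a + t * b) - JS (a + s * b) := by
    rw [← intervalIntegral.integral_const_mul]
    refine intervalIntegral.integral_eq_sub_of_hasDerivAt
      (fun r hr => hasDerivAt_comp_line (hJS _ (h r hr))) (ContinuousOn.intervalIntegrable
      fun r hr => ?_)
    have hw := (hasDerivAt_wave (h r hr) ε lam).continuousAt
    have hq := (u.hasDerivAt_q 1 κ v fun p => (ne_of_mem_cutUp (h r hr) p).1).continuousAt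
    exact (continuousAt_const.mul (ContinuousAt.comp (f := fun r : ℝ => a + r * b) (hw.mul hq)
      (by fun_prop))).continuousWithinAt
  rw [h2, h4] at h3
  exact h3.congr fun μ _ => by rw [h2]

/-- The boundary value of the integral over a whole vertical half-line. -/
theorem IsBranch.isUpperBoundaryValue_vertical (hf : u.IsBranch l Y f₀) {ε lam : ℝ} (hε : 0 < ε)
    {κ : ℂ} {v : Fin P → ℂ} {JS JT : ℂ → ℂ}
    (hJS : ∀ z ∈ u.cutUp, HasDerivAt JS (u.wave ε lam z * u.q 1 κ v z) z) {x₀ : ℝ}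
    (hx₀ : ∀ p, x₀ ≠ (u.z p).re)
    (hJT : IsUpperBoundaryValue (fun μ => Complex.I * ∫ y in Set.Ioi Y,
        Complex.exp (-Complex.I * (μ * (x₀ + y * Complex.I)) / ε) *
          IsBranch.amp u f₀ ε κ v (x₀ + y * Complex.I)) lam (-JT (x₀ + Y * Complex.I))) :
    IsUpperBoundaryValue (fun μ => Complex.I * ∫ y in Set.Ioi (0 : ℝ),
        u.wave ε μ (x₀ + y * Complex.I) * u.q 1 κ v (x₀ + y * Complex.I)) lam
      (JS (x₀ + Y * Complex.I) - JS x₀ - u.wave ε lam (x₀ + Y * Complex.I) *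
        (JT (x₀ + Y * Complex.I) / waveOf f₀ ε lam (x₀ + Y * Complex.I))) := by
  have hre : ∀ t : ℝ, (x₀ + t * Complex.I : ℂ).re = x₀ := fun t => by simp
  have hS : ∀ t : ℝ, (x₀ + t * Complex.I : ℂ) ∈ u.cutUp := fun t =>
    mem_cutUp_of_re fun p => by rw [hre]; exact hx₀ p
  have hT : ∀ t : ℝ, (x₀ + t * Complex.I : ℂ) ∈ u.cutDown := fun t =>
    mem_cutDown_of_re fun p => by rw [hre]; exact hx₀ p
  -- On a vertical line that misses the poles f − f₀ is constant. The two integrands differ there by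
  -- the constant factor ρ, through which the boundary value obtained for f₀ is transferred to f.
  set d : ℂ := u.f (x₀ + Y * Complex.I) - f₀ (x₀ + Y * Complex.I) with hd
  have hdc : ∀ t : ℝ, u.f (x₀ + t * Complex.I) = f₀ (x₀ + t * Complex.I) + d := by
    intro t
    have h1 : ∀ z ∈ segment ℝ (x₀ + t * Complex.I : ℂ) (x₀ + Y * Complex.I),
        HasDerivAt (fun z => u.f z - f₀ z) 0 z := by
      intro z hz
      have h2 := re_mem_uIcc_of_mem_segment hz
      rw [hre, hre, Set.uIcc_self, Set.mem_singleton_iff] at h2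
      have h3 : ∀ p, z.re ≠ (u.z p).re := fun p => by rw [h2]; exact hx₀ p
      exact ((hasDerivAt_f (mem_cutUp_of_re h3)).sub
        (hf.hasDerivAt z (mem_cutDown_of_re h3))).congr_deriv (sub_self _)
    have h2 := eq_of_deriv_zero_segment h1
    rw [hd, ← h2]
    ring
  set ρ : ℂ := Complex.exp (-Complex.I * d / ε) with hρ
  have hamp : ∀ (μ t : ℝ), u.wave ε μ (x₀ + t * Complex.I) * u.q 1 κ v (x₀ + t * Complex.I) =
      ρ * (Complex.exp (-Complex.I * (μ * (x₀ + t * Complex.I)) / ε) *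
        IsBranch.amp u f₀ ε κ v (x₀ + t * Complex.I)) := by
    intro μ t
    rw [wave_eq_mul, hdc, IsBranch.amp, hρ,
      show -Complex.I * (f₀ (x₀ + t * Complex.I) + d) / ε =
        -Complex.I * f₀ (x₀ + t * Complex.I) / ε + -Complex.I * d / ε by ring, Complex.exp_add]
    ring
  obtain ⟨B, hB0, hB⟩ := hf.exists_bound_amp ε κ v
  have hint : ∀ μ : ℝ, μ < 0 → IntegrableOn (fun y : ℝ => u.wave ε μ (x₀ + y * Complex.I) *
      u.q 1 κ v (x₀ + y * Complex.I)) (Set.Ioi Y) := by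
    intro μ hμ
    simp only [hamp]
    exact (integrableOn_vertical (x₀ := x₀) hε (fun z hz => (hf.hasDerivAt_amp ε κ v
      (mem_cutDown_of_im hf.above hz)).continuousAt) (fun z hz => (hB z (Or.inl hz)).2.2.1)
      hμ).const_mul ρ
  have hsum := (isUpperBoundaryValue_segment hJS (a := x₀) (b := Complex.I) (s := 0) (t := Y)
    fun r _ => hS r).add (hJT.const_mul ρ)
  have hval : JS (x₀ + Y * Complex.I) - JS (x₀ + (0 : ℝ) * Complex.I) +
      ρ * -JT (x₀ + Y * Complex.I) = JS (x₀ + Y * Complex.I) - JS x₀ -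
        u.wave ε lam (x₀ + Y * Complex.I) *
        (JT (x₀ + Y * Complex.I) / waveOf f₀ ε lam (x₀ + Y * Complex.I)) := by
    have h1 : u.wave ε lam (x₀ + Y * Complex.I) = ρ * waveOf f₀ ε lam (x₀ + Y * Complex.I) := by
      rw [wave, h, waveOf, hρ, ← Complex.exp_add, hdc]
      congr 1
      ring
    have h2 := waveOf_ne_zero f₀ ε lam (x₀ + Y * Complex.I)
    rw [h1, Complex.ofReal_zero, zero_mul, add_zero]
    field_simp
    ring
  rw [hval] at hsum
  refine hsum.congr fun μ hμ => ?_
  have hi : IntervalIntegrable (fun y : ℝ => u.wave ε μ (x₀ + y * Complex.I) *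
      u.q 1 κ v (x₀ + y * Complex.I)) volume 0 Y := by
    refine ContinuousOn.intervalIntegrable fun r _ => ?_
    have hw := (hasDerivAt_wave (hS r) ε μ).continuousAt
    have hq := (u.hasDerivAt_q 1 κ v fun p => (ne_of_mem_cutUp (hS r) p).1).continuousAt
    exact (ContinuousAt.comp (f := fun r : ℝ => (x₀ + r * Complex.I : ℂ)) (hw.mul hq)
      (by fun_prop)).continuousWithinAt
  rw [← intervalIntegral.integral_interval_add_Ioi' hi (hint μ hμ), mul_add]
  have hI : ∫ y in Set.Ioi Y, u.wave ε μ (x₀ + y * Complex.I) * u.q 1 κ v (x₀ + y * Complex.I) =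
      ρ * ∫ y in Set.Ioi Y, Complex.exp (-Complex.I * (μ * (x₀ + y * Complex.I)) / ε) *
        IsBranch.amp u f₀ ε κ v (x₀ + y * Complex.I) := by
    rw [← integral_const_mul]
    simp only [hamp]
  rw [hI]
  ring

end RationalPotential

/-! ### Exceptional poles, and pairs of primitives -/

namespace RationalPotential

variable {P : ℕ} {u : RationalPotential P} {l Y : ℝ} {f₀ : ℂ → ℂ}

theorem re_le_of_le {p m : Fin P} (h : p ≤ m) : (u.z p).re ≤ (u.z m).re :=
  u.z_re_strictMono.monotone h

theorem leftAbscissa_add_one_le (m p : Fin P) : u.leftAbscissa m + 1 ≤ (u.z p).re := by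
  have : (u.z ⟨0, m.pos⟩).re ≤ (u.z p).re := re_le_of_le (Fin.mk_le_of_le_val (Nat.zero_le _))
  rw [leftAbscissa]
  linarith

theorem lt_rightAbscissa (m : Fin P) : (u.z m).re < u.rightAbscissa m := by
  unfold rightAbscissa
  split_ifs with h
  · have : (u.z m).re < (u.z ⟨m + 1, h⟩).re := u.z_re_strictMono (Fin.lt_def.2 (Nat.lt_succ_self _))
    linarith
  · linarith

theorem rightAbscissa_lt {m p : Fin P} (h : m < p) : u.rightAbscissa m < (u.z p).re := by
  have hp : (m : ℕ) + 1 < P := lt_of_le_of_lt (Nat.succ_le_of_lt h) p.2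
  rw [rightAbscissa, dif_pos hp]
  have h1 : (u.z m).re < (u.z ⟨m + 1, hp⟩).re := u.z_re_strictMono (Fin.lt_def.2 (Nat.lt_succ_self _))
  have h2 : (u.z ⟨m + 1, hp⟩).re ≤ (u.z p).re := re_le_of_le (Nat.succ_le_of_lt h)
  linarith

theorem rightAbscissa_ne (m p : Fin P) : u.rightAbscissa m ≠ (u.z p).re := by
  rcases lt_or_ge m p with h | h
  · exact (rightAbscissa_lt h).ne
  · exact ((re_le_of_le h).trans_lt (lt_rightAbscissa m)).ne'

/-- A neighbourhood of the vertical cut above the pole `zₘ`. -/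
def strip (u : RationalPotential P) (m : Fin P) (δ : ℝ) : Set ℂ :=
  {z | |z.re - (u.z m).re| < δ ∧ -(u.z m).im < z.im}

theorem isOpen_strip (m : Fin P) (δ : ℝ) : IsOpen (u.strip m δ) :=
  IsOpen.inter (s := {z : ℂ | |z.re - (u.z m).re| < δ}) (t := {z : ℂ | -(u.z m).im < z.im})
    (isOpen_lt (by fun_prop) continuous_const) (isOpen_lt continuous_const (by fun_prop))

theorem convex_strip (m : Fin P) (δ : ℝ) : Convex ℝ (u.strip m δ) := by
  have : u.strip m δ = ({z : ℂ | (u.z m).re - δ < z.re} ∩ {z : ℂ | z.re < (u.z m).re + δ}) ∩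
      {z : ℂ | -(u.z m).im < z.im} := by
    ext z
    simp only [strip, Set.mem_ofPred_eq, Set.mem_inter_iff, abs_lt]
    constructor
    · rintro ⟨⟨h1, h2⟩, h3⟩
      exact ⟨⟨by linarith, by linarith⟩, h3⟩
    · rintro ⟨⟨h1, h2⟩, h3⟩
      exact ⟨⟨by linarith, by linarith⟩, h3⟩
  rw [this]
  exact ((convex_halfSpace_re_gt _).inter (convex_halfSpace_re_lt _)).inter
    (convex_halfSpace_im_gt _)

theorem exists_separation (m : Fin P) : ∃ δ > 0, ∀ p, p ≠ m → δ ≤ |(u.z p).re - (u.z m).re| := by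
  classical
  have hpos : ∀ p, p ≠ m → 0 < |(u.z p).re - (u.z m).re| := fun p hp =>
    abs_pos.2 (sub_ne_zero.2 fun h => hp (u.z_re_strictMono.injective h))
  rcases (Finset.univ.erase m).eq_empty_or_nonempty with he | he
  · refine ⟨1, one_pos, fun p hp => ?_⟩
    have : p ∈ Finset.univ.erase m := by simp [hp]
    rw [he] at this
    simp at this
  · obtain ⟨p, hp, hmin⟩ := (Finset.univ.erase m).exists_min_image
      (fun p => |(u.z p).re - (u.z m).re|) he
    exact ⟨_, hpos p (by simpa using hp), fun p hp => hmin p (by simp [hp])⟩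

/-- Near the pole `zₘ` of an exceptional index, `e^{-if/ε}` is `(z - zₘ)ⁿ` up to a nonvanishing factor. -/
theorem IsExceptional.exists_regular {ε : ℝ} {m : Fin P} (h : u.IsExceptional ε m) (hε : 0 < ε)
    {δ : ℝ} (hδ : ∀ p, p ≠ m → δ ≤ |(u.z p).re - (u.z m).re|) :
    ∃ (n : ℕ) (g : ℂ → ℂ), DifferentiableOn ℂ g (u.strip m δ) ∧
      (∀ z ∈ u.strip m δ, z ≠ u.z m → HasDerivAt (fun z => (z - u.z m) ^ (n + 1) *
        Complex.exp (-Complex.I * g z / ε)) (-(Complex.I / ε) * u.uC z * ((z - u.z m) ^ (n + 1) *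
        Complex.exp (-Complex.I * g z / ε))) z) ∧
      ∀ z ∈ u.strip m δ, z ∈ u.cutUp → Complex.exp (-Complex.I * u.f z / ε) =
        (z - u.z m) ^ (n + 1) * Complex.exp (-Complex.I * g z / ε) := by
  classical
  obtain ⟨n', hn', hn⟩ := h
  obtain ⟨n, rfl⟩ := Nat.exists_eq_succ_of_ne_zero hn'.ne'
  have hε' : (ε : ℂ) ≠ 0 := by exact_mod_cast hε.ne'
  set a : Fin P → ℂ → ℂ := fun p x =>
    u.c p * (Complex.log (Complex.I * (x - u.z p)) + Real.pi * Complex.I / 2) with ha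
  set b : Fin P → ℂ → ℂ := fun p x =>
    star (u.c p) * (Complex.log (-Complex.I * (x - star (u.z p))) - Real.pi * Complex.I / 2) with hb
  -- Since −ic_m/ε = n + 1, the logarithm at z_m exponentiates to a power. The two factors i^{n+1},
  -- from the argument of the logarithm and from πi/2, give the sign (−1)^{n+1}, which the constant
  -- (n + 1)πε cancels.
  set g : ℂ → ℂ := fun z => ∑ p ∈ Finset.univ.erase m, a p z + ∑ p, b p z -
    (n + 1) * Real.pi * ε with hg
  have hI := Complex.I_ne_zero
  have had : ∀ z ∈ u.strip m δ, ∀ p ∈ Finset.univ.erase m,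
      HasDerivAt (a p) (u.c p / (z - u.z p)) z := by
    intro z hz p hp
    have hre : z.re - (u.z p).re ≠ 0 := by
      intro h0
      have := hδ p (Finset.ne_of_mem_erase hp)
      rw [← sub_eq_zero.1 h0] at this
      exact absurd hz.1 (not_lt.2 this)
    have hs : Complex.I * (z - u.z p) ∈ Complex.slitPlane :=
      Complex.mem_slitPlane_iff.2 (Or.inr (by simpa using hre))
    have hne : z - u.z p ≠ 0 := fun h0 => Complex.zero_notMem_slitPlane (by simpa only [h0, mul_zero] using hs)
    refine (((((((hasDerivAt_id z).sub_const (u.z p)).const_mul Complex.I).clog hs).add_const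
      (Real.pi * Complex.I / 2 : ℂ))).const_mul (u.c p)).congr_deriv ?_
    simp only [id]
    field_simp
  have hbd : ∀ z ∈ u.strip m δ, ∀ p ∈ Finset.univ,
      HasDerivAt (b p) (star (u.c p) / (z - star (u.z p))) z := by
    intro z hz p _
    have hs : -Complex.I * (z - star (u.z p)) ∈ Complex.slitPlane := by
      rw [Complex.mem_slitPlane_iff]
      by_cases hp : p = m
      · left
        subst hp
        have := hz.2
        simp
        linarith
      · right
        have := hδ p hp
        simp only [Complex.mul_im, Complex.neg_re, Complex.neg_im, Complex.I_re, Complex.I_im,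
          Complex.sub_re, Complex.sub_im, RCLike.star_def, Complex.conj_re]
        intro h'
        have h0 : z.re = (u.z p).re := by linarith
        rw [← h0] at this
        exact absurd hz.1 (not_lt.2 this)
    have hne : z - star (u.z p) ≠ 0 := fun h0 => Complex.zero_notMem_slitPlane (by simpa only [h0, mul_zero] using hs)
    refine (((((((hasDerivAt_id z).sub_const (star (u.z p))).const_mul (-Complex.I)).clog
      hs).sub_const (Real.pi * Complex.I / 2 : ℂ))).const_mul (star (u.c p))).congr_deriv ?_
    simp only [id]
    field_simp
  have hgd : ∀ z ∈ u.strip m δ, HasDerivAt g (∑ p ∈ Finset.univ.erase m, u.c p / (z - u.z p) +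
      ∑ p, star (u.c p) / (z - star (u.z p))) z := fun z hz =>
    ((HasDerivAt.fun_sum fun p hp => had z hz p hp).add
      (HasDerivAt.fun_sum fun p hp => hbd z hz p hp)).sub_const _
  refine ⟨n, g, fun z hz => (hgd z hz).differentiableAt.differentiableWithinAt, fun z hz hne => ?_,
    fun z hz hcut => ?_⟩
  · have hne' := sub_ne_zero.2 hne
    have hu : ∑ p ∈ Finset.univ.erase m, u.c p / (z - u.z p) +
        ∑ p, star (u.c p) / (z - star (u.z p)) = u.uC z - u.c m / (z - u.z m) := by
      rw [uC, Finset.sum_add_distrib,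
        ← Finset.add_sum_erase _ (fun p => u.c p / (z - u.z p)) (Finset.mem_univ m)]
      ring
    have h1 := (((hgd z hz).const_mul (-Complex.I)).div_const (ε : ℂ)).cexp
    have h2 := ((hasDerivAt_id z).sub_const (u.z m)).pow (n + 1)
    refine (h2.mul h1).congr_deriv ?_
    rw [hu]
    have h3 : Complex.I * u.c m = -((n + 1 : ℕ) : ℂ) * ε := by
      rw [← hn]; field_simp
    simp only [id, Pi.pow_apply, Nat.add_sub_cancel, mul_one]
    push_cast at h3 ⊢
    field_simp
    linear_combination (z - u.z m) ^ (n + 1) * h3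
  · have hne' := sub_ne_zero.2 (ne_of_mem_cutUp hcut m).1
    have hf : u.f z = a m z + (g z + (n + 1) * Real.pi * ε) := by
      simp only [f, hg, Finset.sum_add_distrib]
      rw [← Finset.add_sum_erase _ (fun p => a p z) (Finset.mem_univ m)]
      ring
    have h3 : -Complex.I * u.c m / ε = (n + 1 : ℕ) := by
      rw [neg_mul, neg_div, hn, neg_neg]
    have h4 : Complex.exp (-Complex.I * u.f z / ε) =
        Complex.exp ((n + 1 : ℕ) * Complex.log (Complex.I * (z - u.z m))) *
        Complex.exp ((n + 1 : ℕ) * (Real.pi / 2 * Complex.I)) *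
        Complex.exp ((n + 1 : ℕ) * (-(Real.pi * Complex.I))) *
        Complex.exp (-Complex.I * g z / ε) := by
      rw [← Complex.exp_add, ← Complex.exp_add, ← Complex.exp_add, hf, ha, ← h3]
      congr 1
      have h5 : ((n : ℂ) + 1) * ε = -Complex.I * u.c m := by
        push_cast at h3; rw [← h3]; field_simp
      field_simp
      linear_combination (-(2 * Real.pi)) * h5
    rw [h4, Complex.exp_nat_mul, Complex.exp_nat_mul, Complex.exp_nat_mul,
      Complex.exp_log (mul_ne_zero hI hne'), Complex.exp_pi_div_two_mul_I, Complex.exp_neg,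
      Complex.exp_pi_mul_I]
    congr 1
    rw [← mul_pow, ← mul_pow]
    congr 1
    linear_combination (-(z - u.z m)) * Complex.I_sq

end RationalPotential

namespace RationalPotential

variable {P : ℕ} {u : RationalPotential P} {l Y : ℝ} {f₀ : ℂ → ℂ}

theorem exists_mul_q (m : Fin P) {δ : ℝ} (hδ : ∀ p, p ≠ m → δ ≤ |(u.z p).re - (u.z m).re|)
    (κ : ℂ) (v : Fin P → ℂ) : ∃ Q : ℂ → ℂ, DifferentiableOn ℂ Q (u.strip m δ) ∧
      Q (u.z m) = v m ∧ ∀ z, z ≠ u.z m → Q z = (z - u.z m) * u.q 1 κ v z := by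
  classical
  refine ⟨fun z => (z - u.z m) * (κ + ∑ p ∈ Finset.univ.erase m, v p / (z - u.z p)) + v m,
    fun z hz => ?_, by simp, fun z hz => ?_⟩
  · have h : DifferentiableAt ℂ (fun z => ∑ p ∈ Finset.univ.erase m, v p / (z - u.z p)) z := by
      refine DifferentiableAt.fun_sum fun p hp => ?_
      refine (differentiableAt_const _).div (differentiableAt_id.sub_const _) (sub_ne_zero.2 ?_)
      rintro rfl
      exact absurd hz.1 (not_lt.2 (hδ p (Finset.ne_of_mem_erase hp)))
    exact (((differentiableAt_id.sub_const _).mul (h.const_add κ)).add_const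
      _).differentiableWithinAt
  · rw [q, ← Finset.add_sum_erase _ (fun p => v p / (z - u.z p)) (Finset.mem_univ m)]
    have := sub_ne_zero.2 hz
    push_cast
    field_simp
    ring

theorem pole_mem_strip (m : Fin P) {δ : ℝ} (hδ : 0 < δ) : u.z m ∈ u.strip m δ :=
  ⟨by simpa using hδ, by linarith [u.z_im_pos m]⟩

/-- The integrand near the pole `zₘ` of an exceptional index. -/
theorem IsExceptional.exists_local {ε : ℝ} {m : Fin P} (h : u.IsExceptional ε m) (hε : 0 < ε)
    (κ : ℂ) (v : Fin P → ℂ) : ∃ δ > 0, ∃ Z G : ℂ → ℂ,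
      (∀ p, p ≠ m → δ ≤ |(u.z p).re - (u.z m).re|) ∧ DifferentiableOn ℂ G (u.strip m δ) ∧
      (∀ z ∈ u.strip m δ, z ≠ u.z m → Z z ≠ 0 ∧ HasDerivAt Z (-(Complex.I / ε) * u.uC z * Z z) z ∧
        Z z * u.q 1 κ v z = G z) ∧
      (∀ z ∈ u.strip m δ, z ∈ u.cutUp → Complex.exp (-Complex.I * u.f z / ε) = Z z) ∧
      ∃ B, ∀ᶠ z in 𝓝 (u.z m), ∀ w, ‖w - u.z m‖ ≤ ‖z - u.z m‖ →
        ‖G w‖ * ‖z - u.z m‖ ≤ B * ‖Z z‖ := by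
  obtain ⟨δ, hδ0, hδ⟩ := u.exists_separation m
  obtain ⟨n, g, hg, hgd, hgc⟩ := h.exists_regular hε hδ
  obtain ⟨Q, hQ, -, hQq⟩ := u.exists_mul_q m hδ κ v
  have hmem := u.pole_mem_strip m hδ0
  have hnhds := (u.isOpen_strip m δ).mem_nhds hmem
  have hE : DifferentiableOn ℂ (fun z => Complex.exp (-Complex.I * g z / ε)) (u.strip m δ) :=
    ((hg.const_mul _).div_const _).cexp
  refine ⟨δ, hδ0, fun z => (z - u.z m) ^ (n + 1) * Complex.exp (-Complex.I * g z / ε),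
    fun z => (z - u.z m) ^ n * (Complex.exp (-Complex.I * g z / ε) * Q z), hδ, ?_,
    fun z hz hne => ⟨?_, hgd z hz hne, ?_⟩, hgc, ?_⟩
  · exact ((differentiableOn_id.sub_const _).pow n).mul (hE.mul hQ)
  · exact mul_ne_zero (pow_ne_zero _ (sub_ne_zero.2 hne)) (Complex.exp_ne_zero _)
  · simp only [hQq z hne]
    ring
  -- Z vanishes to order n + 1 at z_m, while G = Zq is divisible by the n-th power. This one order
  -- makes J/Z bounded later, for J the primitive vanishing at z_m.
  · have hEc := (hE.differentiableAt hnhds).continuousAt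
    have hQc := (hQ.differentiableAt hnhds).continuousAt
    set e : ℝ := ‖Complex.exp (-Complex.I * g (u.z m) / ε)‖ with he
    have he0 : 0 < e := norm_pos_iff.2 (Complex.exp_ne_zero _)
    have h1 := (hEc.norm).eventually (lt_mem_nhds (half_lt_self he0))
    have h2 := ((hEc.mul hQc).norm).eventually (gt_mem_nhds (lt_add_one _))
    set M : ℝ := ‖Complex.exp (-Complex.I * g (u.z m) / ε) * Q (u.z m)‖ + 1
    have hM : 0 ≤ M := by positivity
    obtain ⟨r, hr, hr2⟩ := Metric.eventually_nhds_iff.1 h2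
    refine ⟨M * (e / 2)⁻¹, ?_⟩
    filter_upwards [h1, Metric.ball_mem_nhds _ hr] with z hz hzr w hw
    have h3 : ‖Complex.exp (-Complex.I * g w / ε) * Q w‖ ≤ M :=
      (hr2 (y := w) (by
        rw [dist_eq_norm]
        exact hw.trans_lt (mem_ball_iff_norm.1 hzr))).le
    rw [norm_mul, norm_pow, norm_mul (_ ^ _), norm_pow]
    calc ‖w - u.z m‖ ^ n * ‖Complex.exp (-Complex.I * g w / ε) * Q w‖ * ‖z - u.z m‖
        ≤ ‖z - u.z m‖ ^ n * M * ‖z - u.z m‖ := by gcongr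
      _ = M * (e / 2)⁻¹ * (‖z - u.z m‖ ^ (n + 1) * (e / 2)) := by
        field_simp
        ring
      _ ≤ _ := by
        gcongr

/-- Primitives of the integrand on the two cut planes, together with the boundary values of the
contour integrals. -/
structure IsPair (u : RationalPotential P) (ε lam l Y : ℝ) (f₀ : ℂ → ℂ) (κ : ℂ) (v : Fin P → ℂ)
    (JS JT : ℂ → ℂ) (R : Fin P → ℂ) : Prop where
  up : ∀ z ∈ u.cutUp, HasDerivAt JS (u.wave ε lam z * u.q 1 κ v z) z
  down : ∀ z ∈ u.cutDown, HasDerivAt JT (waveOf f₀ ε lam z * u.q 1 κ v z) z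
  left : JS (l + Y * Complex.I) = JT (l + Y * Complex.I)
  lim : Tendsto (fun x : ℝ => JT x / waveOf f₀ ε lam x) atBot (𝓝 (Complex.I * ε / lam * κ))
  row_of_not : ∀ m, ¬ u.IsExceptional ε m → R m = JS (u.rightAbscissa m + Y * Complex.I) -
    u.wave ε lam (u.rightAbscissa m + Y * Complex.I) *
      (JT (u.rightAbscissa m + Y * Complex.I) /
        waveOf f₀ ε lam (u.rightAbscissa m + Y * Complex.I))
  row_of_exceptional : ∀ m, u.IsExceptional ε m →
    Tendsto (fun y : ℝ => JS ((u.z m).re + y * Complex.I)) (𝓝[<] (u.z m).im) (𝓝 (R m))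

theorem vertical_mem {m : Fin P} {δ : ℝ} (hδ : 0 < δ) {y : ℝ} (hy : 0 ≤ y) :
    ((u.z m).re + y * Complex.I : ℂ) ∈ u.strip m δ :=
  ⟨by simpa using hδ, by simpa using (neg_lt_zero.2 (u.z_im_pos m)).trans_le hy⟩

theorem vertical_mem_cutUp {m : Fin P} {y : ℝ} (hy : 0 ≤ y) (hy' : y < (u.z m).im) :
    ((u.z m).re + y * Complex.I : ℂ) ∈ u.cutUp := by
  intro p
  by_cases hp : p = m
  · right
    have := u.z_im_pos p
    subst hp
    simp
    exact ⟨by linarith, hy'⟩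
  · left
    have : (u.z m).re ≠ (u.z p).re := fun h => hp (u.z_re_strictMono.injective h.symm)
    simpa using this

/-- Boundary value of the last part of an exceptional contour. -/
theorem IsExceptional.exists_isUpperBoundaryValue {ε lam : ℝ} {m : Fin P}
    (h : u.IsExceptional ε m) (hε : 0 < ε) {κ : ℂ} {v : Fin P → ℂ} {JS : ℂ → ℂ}
    (hJS : ∀ z ∈ u.cutUp, HasDerivAt JS (u.wave ε lam z * u.q 1 κ v z) z) :
    ∃ r, IsUpperBoundaryValue (fun μ => Complex.I * ∫ y in (0 : ℝ)..(u.z m).im,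
        u.wave ε μ ((u.z m).re + y * Complex.I) * u.q 1 κ v ((u.z m).re + y * Complex.I)) lam
        (r - JS (u.z m).re) ∧
      Tendsto (fun y : ℝ => JS ((u.z m).re + y * Complex.I)) (𝓝[<] (u.z m).im) (𝓝 r) := by
  obtain ⟨δ, hδ0, Z, G, hδ, hG, hZ, hZc, -⟩ := h.exists_local hε κ v
  have hm := u.z_im_pos m
  set γ : ℝ → ℂ := fun y => (u.z m).re + y * Complex.I with hγ
  have hγc : Continuous γ := by fun_prop
  have hγm : γ (u.z m).im = u.z m := Complex.re_add_im _
  have hmem : ∀ y, 0 ≤ y → γ y ∈ u.strip m δ := fun y hy => vertical_mem hδ0 hy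
  have hcut : ∀ y, 0 ≤ y → y < (u.z m).im → γ y ∈ u.cutUp := fun y hy hy' =>
    vertical_mem_cutUp hy hy'
  -- Below the pole the integrand equals an exponential times G, which is holomorphic across z_m.
  -- The contour may therefore end at the pole.
  have hint : ∀ y, 0 ≤ y → y < (u.z m).im → ∀ μ : ℝ, u.wave ε μ (γ y) * u.q 1 κ v (γ y) =
      Complex.exp (-Complex.I * (μ * γ y) / ε) * G (γ y) := by
    intro y hy hy' μ
    have hc := hcut y hy hy'
    rw [wave_eq_mul, hZc _ (hmem y hy) hc, mul_assoc,
      (hZ _ (hmem y hy) (ne_of_mem_cutUp hc m).1).2.2]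
  have hint' : ∀ μ : ℝ, ∫ y in (0 : ℝ)..(u.z m).im, u.wave ε μ (γ y) * u.q 1 κ v (γ y) =
      ∫ y in (0 : ℝ)..(u.z m).im, Complex.exp (-Complex.I * (μ * γ y) / ε) * G (γ y) := by
    intro μ
    rw [intervalIntegral.integral_of_le hm.le, intervalIntegral.integral_of_le hm.le,
      integral_Ioc_eq_integral_Ioo, integral_Ioc_eq_integral_Ioo]
    exact setIntegral_congr_fun measurableSet_Ioo fun y hy => hint y hy.1.le hy.2 μ
  have hGc : ContinuousOn (fun y => G (γ y)) (Set.uIcc 0 (u.z m).im) := by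
    intro y hy
    rw [Set.uIcc_of_le hm.le] at hy
    exact (ContinuousAt.comp (f := γ) (hG.differentiableAt
      ((u.isOpen_strip m δ).mem_nhds (hmem y hy.1))).continuousAt
      hγc.continuousAt).continuousWithinAt
  have hΨ : DifferentiableOn ℂ (fun z => Complex.exp (-Complex.I * (lam * z) / ε) * G z)
      (u.strip m δ) := DifferentiableOn.mul (by fun_prop) hG
  obtain ⟨J, hJ⟩ := exists_primitive_of_convex (u.convex_strip m δ) (u.isOpen_strip m δ) hΨ
  have hd := differentiable_integral_exp hγc hGc.intervalIntegrable ε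
  have hb := (IsUpperBoundaryValue.of_differentiable hd lam).const_mul Complex.I
  have hval : Complex.I * ∫ y in (0 : ℝ)..(u.z m).im,
      Complex.exp (-Complex.I * (lam * γ y) / ε) * G (γ y) = J (u.z m) - J (u.z m).re := by
    rw [← intervalIntegral.integral_const_mul]
    have := intervalIntegral.integral_eq_sub_of_hasDerivAt (a := 0) (b := (u.z m).im)
      (f := fun y : ℝ => J (γ y))
      (f' := fun y => Complex.I * (Complex.exp (-Complex.I * (lam * γ y) / ε) * G (γ y)))
      (fun y hy => by
        rw [Set.uIcc_of_le hm.le] at hy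
        exact hasDerivAt_comp_line (hJ _ (hmem y hy.1)))
      (ContinuousOn.intervalIntegrable (continuousOn_const.mul
        (ContinuousOn.mul (by fun_prop) hGc)))
    rw [this, hγm]
    simp [hγ]
  have hconst : ∀ y, 0 ≤ y → y < (u.z m).im →
      JS (γ y) = J (γ y) + (JS (u.z m).re - J (u.z m).re) := by
    intro y hy hy'
    have h1 : ∀ z ∈ segment ℝ (γ 0) (γ y), HasDerivAt (fun z => JS z - J z) 0 z := by
      intro z hz
      have hre := re_mem_uIcc_of_mem_segment hz
      have him := im_mem_uIcc_of_mem_segment hz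
      simp only [hγ, Complex.add_re, Complex.ofReal_re, Complex.re_ofReal_mul, Complex.I_re,
        mul_zero, add_zero, Set.uIcc_self, Set.mem_singleton_iff, Complex.add_im,
        Complex.ofReal_im, Complex.im_ofReal_mul, Complex.I_im, mul_one, zero_add] at hre him
      rw [Set.uIcc_of_le hy] at him
      have hz : z = γ z.im := by rw [hγ]; simp only; rw [← hre, Complex.re_add_im]
      rw [hz]
      have h2 := hJS _ (hcut z.im him.1 (him.2.trans_lt hy'))
      rw [hint z.im him.1 (him.2.trans_lt hy')] at h2
      exact (h2.sub (hJ _ (hmem z.im him.1))).congr_deriv (sub_self _)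
    have h2 := eq_of_deriv_zero_segment h1
    have h3 : γ 0 = (u.z m).re := by simp [hγ]
    simp only [h3] at h2
    linear_combination -h2
  refine ⟨J (u.z m) + (JS (u.z m).re - J (u.z m).re), ?_, ?_⟩
  · rw [hval] at hb
    rw [show J (u.z m) + (JS (u.z m).re - J (u.z m).re) - JS (u.z m).re =
      J (u.z m) - J (u.z m).re by ring]
    exact hb.congr fun μ _ => by rw [hint' μ]
  · have h1 : Tendsto (fun y : ℝ => J (γ y)) (𝓝[<] (u.z m).im) (𝓝 (J (u.z m))) := by
      have h2 : ContinuousAt (fun y => J (γ y)) (u.z m).im :=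
        ContinuousAt.comp (f := γ) (hJ _ (hmem _ hm.le)).continuousAt hγc.continuousAt
      have h3 := h2.tendsto
      rw [hγm] at h3
      exact h3.mono_left nhdsWithin_le_nhds
    refine (h1.add_const _).congr' ?_
    filter_upwards [Ioo_mem_nhdsLT hm] with y hy
    exact (hconst y hy.1.le hy.2).symm

/-- The upward primitive is normalised to agree with the downward one at l + iY. Then the left leg
has boundary value −JS(l), and the contributions of the legs telescope. -/
theorem IsBranch.exists_isPair (hf : u.IsBranch l Y f₀) {ε lam : ℝ} (hε : 0 < ε)
    (hlam : 0 < lam) (hl : ∀ m, u.leftAbscissa m = l) (κ : ℂ) (v : Fin P → ℂ) :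
    ∃ (JS JT : ℂ → ℂ) (R : Fin P → ℂ), u.IsPair ε lam l Y f₀ κ v JS JT R ∧
      ∀ m, IsUpperBoundaryValue (u.row ε m κ v) lam (R m) := by
  obtain ⟨JT, hJT, hlim, hleg⟩ := hf.exists_primitive hε hlam κ v
  obtain ⟨JS₀, hJS₀⟩ := exists_primitive_vertical (isOpen_cutUp (u := u)) (b := 0)
    (fun z hz t ht => mem_cutUp_vertical hz ht)
    (fun x => by simpa using ofReal_mem_cutUp (u := u) x)
    (Ψ := fun z => u.wave ε lam z * u.q 1 κ v z) fun z hz =>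
      ((hasDerivAt_wave hz ε lam).differentiableAt.mul
        (u.hasDerivAt_q 1 κ v fun p => (ne_of_mem_cutUp hz p).1).differentiableAt).differentiableWithinAt
  set JS : ℂ → ℂ := fun z => JS₀ z + (JT (l + Y * Complex.I) - JS₀ (l + Y * Complex.I)) with hJSdef
  have hJS : ∀ z ∈ u.cutUp, HasDerivAt JS (u.wave ε lam z * u.q 1 κ v z) z := fun z hz =>
    (hJS₀ z hz).add_const _
  have hleft : JS (l + Y * Complex.I) = JT (l + Y * Complex.I) := by simp [hJSdef]
  have hbl := hf.isUpperBoundaryValue_vertical hε hJS (x₀ := l)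
    (fun p => ne_of_lt (by linarith [hf.left p])) (hleg l)
  have hw : u.wave ε lam (l + Y * Complex.I) = waveOf f₀ ε lam (l + Y * Complex.I) := by
    rw [wave, waveOf, h, hf.eq]
  rw [hw, mul_div_cancel₀ _ (waveOf_ne_zero _ _ _ _), hleft, sub_right_comm, sub_self,
    zero_sub] at hbl
  have hseg : ∀ r : ℝ, IsUpperBoundaryValue (fun μ => ∫ x in l..r, u.wave ε μ x * u.q 1 κ v x)
      lam (JS r - JS l) := by
    intro r
    have := isUpperBoundaryValue_segment hJS (a := 0) (b := 1) (s := l) (t := r) fun x _ => by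
      simpa using ofReal_mem_cutUp (u := u) x
    simpa using this
  have hR : ∀ m, ∃ R, IsUpperBoundaryValue (u.row ε m κ v) lam R ∧
      (¬ u.IsExceptional ε m → R = JS (u.rightAbscissa m + Y * Complex.I) -
        u.wave ε lam (u.rightAbscissa m + Y * Complex.I) *
        (JT (u.rightAbscissa m + Y * Complex.I) /
          waveOf f₀ ε lam (u.rightAbscissa m + Y * Complex.I))) ∧
      (u.IsExceptional ε m →
        Tendsto (fun y : ℝ => JS ((u.z m).re + y * Complex.I)) (𝓝[<] (u.z m).im) (𝓝 R)) := by
    intro m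
    by_cases hm : u.IsExceptional ε m
    · obtain ⟨r, hr1, hr2⟩ := hm.exists_isUpperBoundaryValue hε hJS
      refine ⟨r, ?_, fun h => absurd hm h, fun _ => hr2⟩
      have := (((hbl.const_mul (-1)).add (hseg (u.z m).re)).add hr1)
      rw [show -1 * -JS l + (JS (u.z m).re - JS l) + (r - JS (u.z m).re) = r by ring] at this
      refine this.congr fun μ _ => ?_
      rw [row, contourIntegral, if_pos hm, hl m]
      ring
    · have hbr := hf.isUpperBoundaryValue_vertical hε hJS (x₀ := u.rightAbscissa m)
        (fun p => rightAbscissa_ne m p) (hleg _)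
      refine ⟨_, ?_, fun _ => rfl, fun h => absurd h hm⟩
      have := (((hbl.const_mul (-1)).add (hseg (u.rightAbscissa m))).add hbr)
      refine cast (congrArg _ ?_) (this.congr (F' := u.row ε m κ v) fun μ _ => ?_)
      · ring
      · rw [row, contourIntegral, if_neg hm, hl m]
        ring
  choose R hR1 hR2 hR3 using hR
  exact ⟨JS, JT, R, ⟨hJS, hJT, hleft, hlim, hR2, hR3⟩, hR1⟩

namespace IsPair

variable {ε lam : ℝ}

theorem const_mul {κ : ℂ} {v : Fin P → ℂ} {JS JT : ℂ → ℂ} {R : Fin P → ℂ}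
    (h : u.IsPair ε lam l Y f₀ κ v JS JT R) (a : ℂ) :
    u.IsPair ε lam l Y f₀ (a * κ) (fun p => a * v p) (fun z => a * JS z) (fun z => a * JT z)
      (fun m => a * R m) := by
  have hq : ∀ z, u.q 1 (a * κ) (fun p => a * v p) z = a * u.q 1 κ v z := fun z => by
    simp only [q, mul_add, Finset.mul_sum, mul_div_assoc]
    ring
  refine ⟨fun z hz => ((h.up z hz).const_mul a).congr_deriv (by rw [hq]; ring),
    fun z hz => ((h.down z hz).const_mul a).congr_deriv (by rw [hq]; ring),
    congrArg (a * ·) h.left, ?_, fun m hm => ?_, fun m hm => (h.row_of_exceptional m hm).const_mul a⟩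
  · convert h.lim.const_mul a using 2
    · ring
    · ring_nf
  · rw [h.row_of_not m hm]
    ring

/-- All conditions are linear. Pairs for the individual columns of the system can thus be superposed
into the pair for a solution vector. -/
theorem sum {ι : Type*} {s : Finset ι} {κ : ι → ℂ} {v : ι → Fin P → ℂ} {JS JT : ι → ℂ → ℂ}
    {R : ι → Fin P → ℂ} (h : ∀ i ∈ s, u.IsPair ε lam l Y f₀ (κ i) (v i) (JS i) (JT i) (R i)) :
    u.IsPair ε lam l Y f₀ (∑ i ∈ s, κ i) (fun p => ∑ i ∈ s, v i p) (fun z => ∑ i ∈ s, JS i z)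
      (fun z => ∑ i ∈ s, JT i z) (fun m => ∑ i ∈ s, R i m) := by
  have hq : ∀ z, u.q 1 (∑ i ∈ s, κ i) (fun p => ∑ i ∈ s, v i p) z =
      ∑ i ∈ s, u.q 1 (κ i) (v i) z := fun z => by
    simp only [q, Finset.sum_add_distrib, Finset.sum_mul, Finset.sum_div]
    rw [Finset.sum_comm]
  refine ⟨fun z hz => (HasDerivAt.fun_sum fun i hi => (h i hi).up z hz).congr_deriv
      (by rw [hq, Finset.mul_sum]),
    fun z hz => (HasDerivAt.fun_sum fun i hi => (h i hi).down z hz).congr_deriv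
      (by rw [hq, Finset.mul_sum]),
    Finset.sum_congr rfl fun i hi => (h i hi).left, ?_, fun m hm => ?_,
    fun m hm => tendsto_finsetSum _ fun i hi => (h i hi).row_of_exceptional m hm⟩
  · rw [Finset.mul_sum]
    simp only [Finset.sum_div]
    exact tendsto_finsetSum _ fun i hi => (h i hi).lim
  · rw [Finset.sum_congr rfl fun i hi => (h i hi).row_of_not m hm, Finset.sum_sub_distrib,
      Finset.sum_div, Finset.mul_sum]

end IsPair

end RationalPotential

/-! ### Regular singular points -/

/-- Polynomial growth at a regular singular point. -/
theorem exists_pow_mul_le {W W' : ℂ → ℂ} {a : ℂ} {C r : ℝ} (hr : 0 < r)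
    (hW : ∀ z, z ≠ a → ‖z - a‖ ≤ r → HasDerivAt W (W' z) z)
    (hb : ∀ z, z ≠ a → ‖z - a‖ ≤ r → ‖W' z‖ * ‖z - a‖ ≤ C * (‖W z‖ + 1)) :
    ∃ (N : ℕ) (K : ℝ), ∀ z, z ≠ a → ‖z - a‖ ≤ r → ‖z - a‖ ^ N * ‖W z‖ ≤ K := by
  obtain ⟨N, hN⟩ := exists_nat_ge (max C 1)
  have hN1 : (1 : ℝ) ≤ N := (le_max_right _ _).trans hN
  have hCN : C ≤ N := (le_max_left _ _).trans hN
  obtain ⟨δ, hδ⟩ := (isCompact_sphere a r).exists_bound_of_continuousOn (f := W) fun z hz => by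
    have h1 : ‖z - a‖ = r := by simpa using hz
    have h2 : z ≠ a := fun h => by rw [h, sub_self, norm_zero] at h1; exact hr.ne h1
    exact (hW z h2 h1.le).continuousAt.continuousWithinAt
  refine ⟨N, (δ + 1) * r ^ N, fun z hz hzr => ?_⟩
  have hz0 : 0 < ‖z - a‖ := norm_pos_iff.2 (sub_ne_zero.2 hz)
  set d : ℂ := (r / ‖z - a‖ : ℝ) * (z - a) with hd
  have hdn : ‖d‖ = r := by
    rw [hd, norm_mul, Complex.norm_real, Real.norm_of_nonneg (by positivity)]
    field_simp
  have hd0 : d ≠ 0 := norm_pos_iff.1 (hdn ▸ hr)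
  set T : ℝ := Real.log (r / ‖z - a‖) with hT
  have hT0 : 0 ≤ T := Real.log_nonneg ((one_le_div hz0).2 hzr)
  have hexpT : Real.exp T = r / ‖z - a‖ := Real.exp_log (by positivity)
  -- In the logarithmic radial variable s the bound on (z − a)W' becomes a Grönwall inequality, and
  -- e^{NT} = (r/|z − a|)^N is the polynomial growth.
  set γ : ℝ → ℂ := fun s => a + (Real.exp (-s) : ℝ) * d with hγ
  have hγn : ∀ s, ‖γ s - a‖ = Real.exp (-s) * r := fun s => by
    rw [hγ]
    simp only [add_sub_cancel_left, norm_mul, Complex.norm_real, hdn]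
    rw [Real.norm_of_nonneg (Real.exp_pos _).le]
  have hγa : ∀ s, γ s ≠ a := fun s h => by
    have := hγn s
    rw [h, sub_self, norm_zero] at this
    exact (mul_pos (Real.exp_pos _) hr).ne this
  have hγr : ∀ s ∈ Set.Icc 0 T, ‖γ s - a‖ ≤ r := fun s hs => by
    rw [hγn]
    exact mul_le_of_le_one_left hr.le (Real.exp_le_one_iff.2 (by linarith [hs.1]))
  have hγd : ∀ s, HasDerivAt γ (-(γ s - a)) s := fun s => by
    have h1 := (((hasDerivAt_neg s).exp).ofReal_comp.mul_const d).const_add a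
    refine h1.congr_deriv ?_
    simp only [hγ]
    push_cast
    ring
  have hγT : γ T = z := by
    simp only [hγ, hd]
    rw [Real.exp_neg, hexpT, ← mul_assoc, ← Complex.ofReal_mul,
      inv_mul_cancel₀ (by positivity)]
    simp
  have hg : ∀ s ∈ Set.Icc 0 T, HasDerivAt (fun s => W (γ s)) (-(γ s - a) * W' (γ s)) s :=
    fun s hs => ((hW (γ s) (hγa s) (hγr s hs)).comp_of_eq s (hγd s) rfl).congr_deriv (mul_comm _ _)
  have hγ0 : γ 0 = a + d := by simp [hγ]
  have h := norm_le_of_norm_deriv_le (g := fun s => W (γ s)) (K := N) (T := T) (δ := δ)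
    (by linarith) hg (hδ _ (by simp [hγ0, hdn])) (fun s hs => by
      rw [norm_mul, norm_neg, mul_comm]
      refine (hb _ (hγa s) (hγr s hs)).trans ?_
      gcongr) ⟨hT0, le_rfl⟩
  simp only [hγT] at h
  rw [Real.exp_nat_mul, hexpT] at h
  calc ‖z - a‖ ^ N * ‖W z‖ ≤ ‖z - a‖ ^ N * ((δ + 1) * (r / ‖z - a‖) ^ N) := by gcongr
    _ = (δ + 1) * r ^ N := by
      rw [div_pow]
      field_simp

/-- Downward induction on the pole order. If g = (z − a)^{k+1}W is analytic, the equation gives (z −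
a)g' → (k + 1 + t(a))g(a), while the left side tends to 0. The excluded exponents force g(a) = 0, so
one power can be divided out. -/
theorem exists_bound_of_pow_mul {W s t : ℂ → ℂ} {a : ℂ} (hs : ContinuousAt s a)
    (ht : ContinuousAt t a) (hta : ∀ n : ℕ, t a ≠ -((n + 1 : ℕ) : ℂ))
    (hW : ∀ᶠ z in 𝓝[≠] a, HasDerivAt W ((s z + t z * W z) / (z - a)) z) (k : ℕ) :
    ∀ g : ℂ → ℂ, AnalyticAt ℂ g a → (∀ᶠ z in 𝓝[≠] a, g z = (z - a) ^ k * W z) →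
      ∃ B, ∀ᶠ z in 𝓝[≠] a, ‖W z‖ ≤ B := by
  induction k with
  | zero =>
    intro g hg hgW
    refine ⟨‖g a‖ + 1, ?_⟩
    filter_upwards [hgW, nhdsWithin_le_nhds
      ((hg.continuousAt.norm).eventually (gt_mem_nhds (lt_add_one _)))] with z h1 h2
    rw [pow_zero, one_mul] at h1
    rw [← h1]
    exact le_of_lt h2
  | succ k ih =>
    intro g hg hgW
    have hlim1 : Tendsto (fun z => (z - a) * deriv g z) (𝓝[≠] a) (𝓝 0) := by
      have : ContinuousAt (fun z => (z - a) * deriv g z) a :=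
        (continuousAt_id.sub continuousAt_const).mul hg.deriv.continuousAt
      simpa using this.tendsto.mono_left nhdsWithin_le_nhds
    have hlim2 : Tendsto (fun z => ((k : ℂ) + 1) * g z + (z - a) ^ (k + 1) * s z + t z * g z)
        (𝓝[≠] a) (𝓝 (((k : ℂ) + 1 + t a) * g a)) := by
      have : ContinuousAt (fun z => ((k : ℂ) + 1) * g z + (z - a) ^ (k + 1) * s z + t z * g z) a :=
        ((continuousAt_const.mul hg.continuousAt).add
          (((continuousAt_id.sub continuousAt_const).pow _).mul hs)).add (ht.mul hg.continuousAt)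
      have h1 := this.tendsto.mono_left (nhdsWithin_le_nhds (s := {a}ᶜ))
      convert h1 using 2
      rw [sub_self, zero_pow (Nat.succ_ne_zero k)]
      ring
    have heq : (fun z => (z - a) * deriv g z) =ᶠ[𝓝[≠] a]
        fun z => ((k : ℂ) + 1) * g z + (z - a) ^ (k + 1) * s z + t z * g z := by
      have h1 : ∀ᶠ z in 𝓝[≠] a, ∀ᶠ y in 𝓝 z, g y = (y - a) ^ (k + 1) * W y := by
        have := eventually_eventually_nhdsWithin.2 hgW
        filter_upwards [this, self_mem_nhdsWithin] with z hz hza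
        rwa [(isOpen_compl_singleton).nhdsWithin_eq hza] at hz
      filter_upwards [h1, hW, self_mem_nhdsWithin] with z hz hWz hza
      have hza' : z - a ≠ 0 := sub_ne_zero.2 hza
      have h2 : HasDerivAt g _ z :=
        ((((hasDerivAt_id z).sub_const a).pow (k + 1)).mul hWz).congr_of_eventuallyEq hz
      rw [h2.deriv, hz.self_of_nhds]
      simp only [id, Pi.pow_apply, Nat.add_sub_cancel, mul_one]
      push_cast
      field_simp
      ring
    have h0 := tendsto_nhds_unique (hlim1.congr' heq) hlim2
    have hga : g a = 0 := by
      rcases mul_eq_zero.1 h0.symm with h | h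
      · exact absurd (by push_cast; linear_combination h) (hta k)
      · exact h
    obtain ⟨p, hp⟩ := hg
    refine ih (dslope g a) hp.has_fpower_series_dslope_fslope.analyticAt ?_
    filter_upwards [hgW, self_mem_nhdsWithin] with z hz hza
    have hza' : z - a ≠ 0 := sub_ne_zero.2 hza
    rw [dslope_of_ne g hza, slope_def_field, hga, hz]
    field_simp
    ring

/-- At a regular singular point without negative integral exponents solutions are bounded. -/
theorem exists_bound_of_regular_singular {W s t : ℂ → ℂ} {a : ℂ} (hs : ContinuousAt s a)
    (ht : ContinuousAt t a) (hta : ∀ n : ℕ, t a ≠ -((n + 1 : ℕ) : ℂ))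
    (hW : ∀ᶠ z in 𝓝[≠] a, HasDerivAt W ((s z + t z * W z) / (z - a)) z) :
    ∃ B, ∀ᶠ z in 𝓝[≠] a, ‖W z‖ ≤ B := by
  have h1 : ∀ᶠ z in 𝓝[≠] a, ‖s z‖ < ‖s a‖ + 1 := nhdsWithin_le_nhds
    ((hs.norm).eventually (gt_mem_nhds (lt_add_one _)))
  have h2 : ∀ᶠ z in 𝓝[≠] a, ‖t z‖ < ‖t a‖ + 1 := nhdsWithin_le_nhds
    ((ht.norm).eventually (gt_mem_nhds (lt_add_one _)))
  set S := ‖s a‖ + 1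
  set T := ‖t a‖ + 1
  obtain ⟨r, hr, hball⟩ := Metric.mem_nhdsWithin_iff.1 (hW.and (h1.and h2))
  have hmem : ∀ z, z ≠ a → ‖z - a‖ ≤ r / 2 → HasDerivAt W ((s z + t z * W z) / (z - a)) z ∧
      ‖s z‖ < S ∧ ‖t z‖ < T := fun z hz hzr =>
    hball ⟨mem_ball_iff_norm.2 (by linarith), hz⟩
  obtain ⟨N, K, hK⟩ := exists_pow_mul_le (W := W) (C := S + T) (a := a) (r := r / 2) (by linarith)
    (fun z hz hzr => (hmem z hz hzr).1) (fun z hz hzr => by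
      obtain ⟨-, h3, h4⟩ := hmem z hz hzr
      have hz0 : ‖z - a‖ ≠ 0 := norm_ne_zero_iff.2 (sub_ne_zero.2 hz)
      rw [norm_div, div_mul_cancel₀ _ hz0]
      refine (norm_add_le _ _).trans ?_
      rw [norm_mul]
      have hS : 0 ≤ S := by positivity
      have hT : 0 ≤ T := by positivity
      have := norm_nonneg (W z)
      have : ‖t z‖ * ‖W z‖ ≤ T * ‖W z‖ := by gcongr
      nlinarith)
  have hev : ∀ᶠ z in 𝓝[≠] a, z ≠ a ∧ ‖z - a‖ ≤ r / 2 := by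
    filter_upwards [self_mem_nhdsWithin, nhdsWithin_le_nhds
      (Metric.ball_mem_nhds a (half_pos hr))] with z hz hzr
    exact ⟨hz, (mem_ball_iff_norm.1 hzr).le⟩
  -- By the polynomial growth one further power makes the product tend to 0 at a, and 0 is also its
  -- value there, so the singularity is removable.
  refine exists_bound_of_pow_mul hs ht hta hW (N + 1) (fun z => (z - a) ^ (N + 1) * W z) ?_
    (Eventually.of_forall fun _ => rfl)
  refine Complex.analyticAt_of_differentiable_on_punctured_nhds_of_continuousAt ?_ ?_
  · filter_upwards [hW] with z hz
    exact ((differentiableAt_id.sub_const a).pow _).mul hz.differentiableAt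
  · have h0 : Tendsto (fun z => (z - a) ^ (N + 1) * W z) (𝓝[≠] a) (𝓝 0) := by
      refine squeeze_zero_norm' (a := fun z => ‖z - a‖ * K) ?_ ?_
      · filter_upwards [hev] with z hz
        rw [norm_mul, norm_pow, pow_succ', mul_assoc]
        exact mul_le_mul_of_nonneg_left (hK z hz.1 hz.2) (norm_nonneg _)
      · have : Continuous fun z : ℂ => ‖z - a‖ * K := by fun_prop
        simpa using (this.tendsto a).mono_left nhdsWithin_le_nhds
    rw [continuousAt_iff_punctured_nhds]
    simpa using h0


/-! ### Gluing the two solutions across the poles -/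

namespace RationalPotential

variable {P : ℕ} {u : RationalPotential P} {l Y ε lam : ℝ} {f₀ : ℂ → ℂ} {κ : ℂ} {v : Fin P → ℂ}

/-- The equation `iε (W/iε)' + (λ + u₀) (W/iε) = q`, solved for `W'`. -/
def SolvesAt (u : RationalPotential P) (ε lam : ℝ) (κ : ℂ) (v : Fin P → ℂ) (W : ℂ → ℂ) (z : ℂ) :
    Prop :=
  HasDerivAt W (u.q 1 κ v z + Complex.I / ε * (lam + u.uC z) * W z) z

theorem solvesAt_div {Z J : ℂ → ℂ} {z : ℂ}
    (hZ : HasDerivAt Z (-(Complex.I / ε) * (lam + u.uC z) * Z z) z)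
    (hJ : HasDerivAt J (Z z * u.q 1 κ v z) z) (h0 : Z z ≠ 0) :
    u.SolvesAt ε lam κ v (fun z => J z / Z z) z := by
  refine (hJ.div hZ h0).congr_deriv ?_
  field_simp
  ring

/-- Z(W₁ − W₂) has derivative zero, so two solutions that agree at one end agree at the other. -/
theorem eq_of_solvesAt_segment {W₁ W₂ Z : ℂ → ℂ} {a b : ℂ}
    (hZ : ∀ z ∈ segment ℝ a b, HasDerivAt Z (-(Complex.I / ε) * (lam + u.uC z) * Z z) z)
    (hb : Z b ≠ 0) (h₁ : ∀ z ∈ segment ℝ a b, u.SolvesAt ε lam κ v W₁ z)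
    (h₂ : ∀ z ∈ segment ℝ a b, u.SolvesAt ε lam κ v W₂ z) (hab : W₁ a = W₂ a) : W₁ b = W₂ b := by
  have h := eq_of_deriv_zero_segment (f := fun z => Z z * (W₁ z - W₂ z)) (a := a) (b := b)
    fun z hz => by
      refine ((hZ z hz).mul ((h₁ z hz).sub (h₂ z hz))).congr_deriv ?_
      simp only [Pi.sub_apply]
      ring
  simp only [hab, sub_self, mul_zero] at h
  exact sub_eq_zero.1 ((mul_eq_zero.1 h.symm).resolve_left hb)

theorem segment_vertical_mem {Ω : Set ℂ} {b : ℝ} {z : ℂ}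
    (h : ∀ t ∈ Set.uIcc b z.im, (z.re + t * Complex.I : ℂ) ∈ Ω) {x : ℂ}
    (hx : x ∈ segment ℝ (z.re + b * Complex.I : ℂ) z) : x ∈ Ω := by
  have hre := re_mem_uIcc_of_mem_segment hx
  have him := im_mem_uIcc_of_mem_segment hx
  simp only [Complex.add_re, Complex.ofReal_re, Complex.re_ofReal_mul, Complex.I_re,
    mul_zero, add_zero, Set.uIcc_self, Set.mem_singleton_iff, Complex.add_im,
    Complex.ofReal_im, Complex.im_ofReal_mul, Complex.I_im, mul_one, zero_add] at hre him
  have := h x.im him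
  rwa [← hre, Complex.re_add_im] at this

namespace IsPair

variable {JS JT : ℂ → ℂ} {R : Fin P → ℂ}

theorem solvesAt_up (h : u.IsPair ε lam l Y f₀ κ v JS JT R) {z : ℂ} (hz : z ∈ u.cutUp) :
    u.SolvesAt ε lam κ v (fun z => JS z / u.wave ε lam z) z :=
  solvesAt_div (hasDerivAt_wave hz ε lam) (h.up z hz) (wave_ne_zero _ _ _)

theorem solvesAt_down (hf : u.IsBranch l Y f₀) (h : u.IsPair ε lam l Y f₀ κ v JS JT R) {z : ℂ}
    (hz : z ∈ u.cutDown) : u.SolvesAt ε lam κ v (fun z => JT z / waveOf f₀ ε lam z) z :=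
  solvesAt_div (hasDerivAt_waveOf (hf.hasDerivAt z hz) ε lam) (h.down z hz) (waveOf_ne_zero _ _ _ _)

theorem glue_segment (hf : u.IsBranch l Y f₀) (h : u.IsPair ε lam l Y f₀ κ v JS JT R) {a b : ℂ}
    (hab : ∀ p, (u.z p).re ∉ Set.uIcc a.re b.re)
    (ha : JS a / u.wave ε lam a = JT a / waveOf f₀ ε lam a) :
    JS b / u.wave ε lam b = JT b / waveOf f₀ ε lam b := by
  have hre : ∀ z ∈ segment ℝ a b, ∀ p, z.re ≠ (u.z p).re := fun z hz p hp =>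
    hab p (hp ▸ re_mem_uIcc_of_mem_segment hz)
  exact eq_of_solvesAt_segment (W₁ := fun z => JS z / u.wave ε lam z)
    (W₂ := fun z => JT z / waveOf f₀ ε lam z)
    (fun z hz => hasDerivAt_wave (mem_cutUp_of_re (hre z hz)) ε lam) (wave_ne_zero _ _ _)
    (fun z hz => h.solvesAt_up (mem_cutUp_of_re (hre z hz)))
    (fun z hz => h.solvesAt_down hf (mem_cutDown_of_re (hre z hz))) ha

/-- Across an exceptional pole there is a bounded single-valued solution. -/
theorem exists_transfer (hf : u.IsBranch l Y f₀) (h : u.IsPair ε lam l Y f₀ κ v JS JT R)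
    (hε : 0 < ε) {m : Fin P} (hm : u.IsExceptional ε m) (hR : R m = 0) :
    ∃ δ > 0, ∃ W : ℂ → ℂ, (∀ p, p ≠ m → δ ≤ |(u.z p).re - (u.z m).re|) ∧
      (∀ z ∈ u.strip m δ, z ∈ u.cutUp → JS z / u.wave ε lam z = W z) ∧
      (∀ a ∈ u.strip m δ, a ∈ u.cutUp → a ∈ u.cutDown →
        JS a / u.wave ε lam a = JT a / waveOf f₀ ε lam a →
        ∀ z ∈ u.strip m δ, z ∈ u.cutDown → W z = JT z / waveOf f₀ ε lam z) ∧
      ∃ B, ∀ᶠ z in 𝓝[≠] (u.z m), ‖W z‖ ≤ B := by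
  obtain ⟨δ, hδ0, Z, G, hδ, hG, hZ, hZc, B, hB⟩ := hm.exists_local hε κ v
  have hym := u.z_im_pos m
  have hmem := u.pole_mem_strip m hδ0
  set e : ℂ → ℂ := fun z => Complex.exp (-Complex.I * (lam * z) / ε) with he
  have hed : ∀ z, HasDerivAt e (-(Complex.I / ε) * lam * e z) z := fun z => by
    refine (((((hasDerivAt_id z).const_mul (lam : ℂ)).const_mul
      (-Complex.I)).div_const (ε : ℂ)).cexp).congr_deriv ?_
    simp only [he, id]
    ring
  have he0 : ∀ z, e z ≠ 0 := fun z => Complex.exp_ne_zero _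
  have hΨ : DifferentiableOn ℂ (fun z => e z * G z) (u.strip m δ) :=
    DifferentiableOn.mul (fun z _ => (hed z).differentiableAt.differentiableWithinAt) hG
  obtain ⟨J, hJ⟩ := exists_primitive_of_convex (u.convex_strip m δ) (u.isOpen_strip m δ) hΨ
  have hEd : ∀ z ∈ u.strip m δ, z ∈ u.cutUp → HasDerivAt (fun z => JS z - J z) 0 z := by
    intro z hz hc
    have h1 := (hZ z hz (ne_of_mem_cutUp hc m).1).2.2
    refine ((h.up z hc).sub (hJ z hz)).congr_deriv ?_
    rw [wave_eq_mul, hZc z hz hc, ← h1, he]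
    ring
  have hbase : ∀ x : ℝ, |x - (u.z m).re| < δ → (x : ℂ) ∈ u.strip m δ := fun x hx =>
    ⟨by simpa using hx, by simpa using hym⟩
  have hvert : ∀ z ∈ u.strip m δ, z ∈ u.cutUp → JS z - J z = JS (z.re : ℂ) - J (z.re : ℂ) := by
    intro z hz hc
    have h1 := eq_of_deriv_zero_segment (f := fun z => JS z - J z) (a := (z.re + (0 : ℝ) * Complex.I))
      (b := z) fun x hx => by
        refine hEd x ((u.convex_strip m δ).segment_subset ?_ hz hx)
          (segment_vertical_mem (fun t ht => mem_cutUp_vertical hc ht) hx)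
        simpa using hbase z.re hz.1
    simpa using h1.symm
  have hhor : ∀ x : ℝ, |x - (u.z m).re| < δ →
      JS (x : ℂ) - J (x : ℂ) = JS ((u.z m).re : ℂ) - J ((u.z m).re : ℂ) := by
    intro x hx
    have hmr : ((u.z m).re : ℂ) ∈ u.strip m δ := hbase _ (by simpa using hδ0)
    refine eq_of_deriv_zero_segment (f := fun z => JS z - J z) fun y hy =>
      hEd y ((u.convex_strip m δ).segment_subset (hbase x hx) hmr hy) ?_
    have him := im_mem_uIcc_of_mem_segment hy
    simp only [Complex.ofReal_im, Set.uIcc_self, Set.mem_singleton_iff] at him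
    rw [show y = (y.re : ℂ) from Complex.ext (by simp) (by simpa using him)]
    exact ofReal_mem_cutUp _
  -- The parts of the strip on both sides of the cut above z_m communicate below the pole: down to
  -- the real axis, then across.
  have hconst : ∀ z ∈ u.strip m δ, z ∈ u.cutUp →
      JS z - J z = JS ((u.z m).re : ℂ) - J ((u.z m).re : ℂ) := fun z hz hc =>
    (hvert z hz hc).trans (hhor z.re hz.1)
  -- The vanishing row says that JS tends to 0 at the pole. This fixes the constant, so JS is the
  -- primitive that vanishes at z_m.
  have hJm : JS ((u.z m).re : ℂ) - J ((u.z m).re : ℂ) = -J (u.z m) := by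
    have h1 := h.row_of_exceptional m hm
    rw [hR] at h1
    have h2 : Tendsto (fun y : ℝ => J ((u.z m).re + y * Complex.I)) (𝓝[<] (u.z m).im)
        (𝓝 (J (u.z m))) := by
      have h3 : ContinuousAt (fun y : ℝ => J ((u.z m).re + y * Complex.I)) (u.z m).im :=
        ContinuousAt.comp (f := fun y : ℝ => ((u.z m).re + y * Complex.I : ℂ))
          (by rw [Complex.re_add_im]; exact (hJ _ hmem).continuousAt) (by fun_prop)
      have h4 := h3.tendsto
      rw [Complex.re_add_im] at h4
      exact h4.mono_left nhdsWithin_le_nhds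
    have h3 := h1.sub h2
    rw [zero_sub] at h3
    refine tendsto_nhds_unique (tendsto_const_nhds.congr' ?_) h3
    filter_upwards [Ioo_mem_nhdsLT hym] with y hy
    exact (hconst _ (vertical_mem hδ0 hy.1.le) (vertical_mem_cutUp hy.1.le hy.2)).symm
  have hJS : ∀ z ∈ u.strip m δ, z ∈ u.cutUp → JS z = J z - J (u.z m) := fun z hz hc => by
    have := hconst z hz hc
    rw [hJm] at this
    linear_combination this
  set W : ℂ → ℂ := fun z => (J z - J (u.z m)) / (e z * Z z) with hW
  have hWS : ∀ z ∈ u.strip m δ, z ∈ u.cutUp → JS z / u.wave ε lam z = W z := fun z hz hc => by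
    rw [hJS z hz hc, wave_eq_mul, hZc z hz hc]
  have hZd : ∀ z ∈ u.strip m δ, z ≠ u.z m → HasDerivAt (fun z => e z * Z z)
      (-(Complex.I / ε) * (lam + u.uC z) * (e z * Z z)) z := fun z hz hne => by
    refine ((hed z).mul (hZ z hz hne).2.1).congr_deriv ?_
    ring
  have hWsolve : ∀ z ∈ u.strip m δ, z ≠ u.z m → u.SolvesAt ε lam κ v W z := fun z hz hne => by
    refine solvesAt_div (hZd z hz hne) (((hJ z hz).sub_const _).congr_deriv ?_)
      (mul_ne_zero (he0 z) (hZ z hz hne).1)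
    rw [← (hZ z hz hne).2.2]
    ring
  refine ⟨δ, hδ0, W, hδ, hWS, fun a ha hau had hab z hz hzd => ?_, ?_⟩
  · have hstep : ∀ a b : ℂ, a ∈ u.strip m δ → b ∈ u.strip m δ →
        (∀ x ∈ segment ℝ a b, x ∈ u.cutDown) → W a = JT a / waveOf f₀ ε lam a →
        W b = JT b / waveOf f₀ ε lam b := by
      intro a b ha hb hseg hab
      exact eq_of_solvesAt_segment (W₁ := W) (W₂ := fun z => JT z / waveOf f₀ ε lam z)
        (fun x hx => hasDerivAt_waveOf (hf.hasDerivAt x (hseg x hx)) ε lam)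
        (waveOf_ne_zero _ _ _ _)
        (fun x hx => hWsolve x ((u.convex_strip m δ).segment_subset ha hb hx)
          (ne_of_mem_cutDown (hseg x hx) m).1)
        (fun x hx => h.solvesAt_down hf (hseg x hx)) hab
    have htop : ∀ z ∈ u.strip m δ, (z.re + Y * Complex.I : ℂ) ∈ u.strip m δ := fun z hz =>
      ⟨by simpa using hz.1, by simpa using (neg_lt_zero.2 hym).trans hf.pos⟩
    have h1 : W (a.re + Y * Complex.I) = JT (a.re + Y * Complex.I) /
        waveOf f₀ ε lam (a.re + Y * Complex.I) := by
      refine hstep a _ ha (htop a ha) (fun x hx => ?_) ((hWS a ha hau).symm.trans hab)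
      rw [segment_symm] at hx
      exact segment_vertical_mem (fun t ht => mem_cutDown_vertical hf.above had ht) hx
    have h2 := hstep _ _ (htop a ha) (htop z hz) (fun x hx => by
      refine mem_cutDown_of_im hf.above ?_
      have him := im_mem_uIcc_of_mem_segment hx
      simp only [Complex.add_im, Complex.ofReal_im, Complex.im_ofReal_mul, Complex.I_im, mul_one,
        zero_add, Set.uIcc_self, Set.mem_singleton_iff] at him
      exact him.ge) h1
    exact hstep _ z (htop z hz) hz (fun x hx =>
      segment_vertical_mem (fun t ht => mem_cutDown_vertical hf.above hzd ht) hx) h2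
  · have hec : ContinuousAt e (u.z m) := (hed _).continuousAt
    have h1 := (hec.norm).eventually (gt_mem_nhds (lt_add_one _))
    have h2 := (hec.norm).eventually (lt_mem_nhds (half_lt_self (norm_pos_iff.2 (he0 (u.z m)))))
    simp only at h1 h2
    obtain ⟨r, hr, hball⟩ := Metric.eventually_nhds_iff.1
      ((h1.and h2).and (hB.and ((u.isOpen_strip m δ).mem_nhds hmem)))
    set M := ‖e (u.z m)‖ + 1
    set M' := ‖e (u.z m)‖ / 2
    have hM' : 0 < M' := half_pos (norm_pos_iff.2 (he0 _))
    have hM : 0 ≤ M := by positivity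
    refine ⟨M * B / M', ?_⟩
    filter_upwards [self_mem_nhdsWithin, nhdsWithin_le_nhds (Metric.ball_mem_nhds (u.z m) hr)]
      with z hza hzr
    obtain ⟨⟨-, h3⟩, h4, h5⟩ := hball hzr
    have hZ0 : 0 < ‖Z z‖ := norm_pos_iff.2 (hZ z h5 hza).1
    have hd0 : 0 < ‖z - u.z m‖ := norm_pos_iff.2 (sub_ne_zero.2 hza)
    have hmv : ‖J z - J (u.z m)‖ ≤ M * (B * ‖Z z‖ / ‖z - u.z m‖) * ‖z - u.z m‖ := by
      refine (convex_segment (u.z m) z).norm_image_sub_le_of_norm_hasDerivWithin_le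
        (f' := fun x => e x * G x) (fun x hx => (hJ x ((u.convex_strip m δ).segment_subset hmem h5
          hx)).hasDerivWithinAt) (fun x hx => ?_) (left_mem_segment ℝ _ _) (right_mem_segment ℝ _ _)
      have hxz : ‖x - u.z m‖ ≤ ‖z - u.z m‖ := norm_sub_le_of_mem_segment hx
      have hxr : dist x (u.z m) < r := by
        rw [dist_eq_norm]
        exact hxz.trans_lt (by rwa [← dist_eq_norm])
      rw [norm_mul]
      refine mul_le_mul (hball hxr).1.1.le ?_ (norm_nonneg _) hM
      rw [le_div_iff₀ hd0]
      exact h4 x hxz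
    rw [hW]
    simp only
    rw [norm_div, norm_mul]
    rw [mul_assoc, div_mul_cancel₀ _ hd0.ne'] at hmv
    have hBZ : 0 ≤ B * ‖Z z‖ := le_trans (by positivity) (h4 z le_rfl)
    calc ‖J z - J (u.z m)‖ / (‖e z‖ * ‖Z z‖) ≤ M * (B * ‖Z z‖) / (M' * ‖Z z‖) := by gcongr
      _ = M * B / M' := by field_simp

end IsPair

end RationalPotential

namespace RationalPotential

variable {P : ℕ} {u : RationalPotential P} {l Y ε lam : ℝ} {f₀ : ℂ → ℂ} {κ : ℂ} {v : Fin P → ℂ}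

/-- Such a point lies strictly above some pole on its upward cut; since the real parts are distinct,
it is on no downward cut. -/
theorem mem_cutDown_of_notMem_cutUp {z : ℂ} (hz : ∀ p, -(u.z p).im < z.im) (hp : ∀ p, z ≠ u.z p)
    (h : z ∉ u.cutUp) : z ∈ u.cutDown := by
  have h' : ∃ p, ¬(z.re ≠ (u.z p).re ∨ (-(u.z p).im < z.im ∧ z.im < (u.z p).im)) := by
    by_contra! h0
    exact h fun p => h0 p
  obtain ⟨p, hp'⟩ := h'
  push Not at hp'
  obtain ⟨hre, him⟩ := hp'
  have h1 : (u.z p).im ≤ z.im := him (hz p)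
  have h2 : (u.z p).im < z.im := lt_of_le_of_ne h1 fun h0 => hp p (Complex.ext hre h0.symm)
  intro r
  by_cases hr : r = p
  · right; rw [hr]; exact h2
  · left
    rw [hre]
    exact fun h0 => hr (u.z_re_strictMono.injective h0).symm

theorem re_ne_of_mem_cutUp_cutDown {z : ℂ} (h : z ∈ u.cutUp) (h' : z ∈ u.cutDown) (p : Fin P) :
    z.re ≠ (u.z p).re := by
  rcases h p with h1 | h1
  · exact h1
  · rcases h' p with h2 | h2
    · exact h2
    · linarith [h1.2]

theorem eventually_ne_poles (u : RationalPotential P) (m : Fin P) :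
    ∀ᶠ z in 𝓝[≠] (u.z m), ∀ p, z ≠ u.z p := by
  refine eventually_all.2 fun p => ?_
  by_cases hpm : p = m
  · rw [hpm]
    exact self_mem_nhdsWithin
  · exact nhdsWithin_le_nhds (eventually_ne_nhds fun h0 => hpm
      (u.z_re_strictMono.injective (congrArg Complex.re h0)).symm)

theorem eventually_im_gt {z : ℂ} (hz : 0 ≤ z.im) : ∀ᶠ y in 𝓝 z, ∀ p, -(u.z p).im < y.im :=
  eventually_all.2 fun p => Complex.continuous_im.continuousAt.eventually
    (lt_mem_nhds ((neg_lt_zero.2 (u.z_im_pos p)).trans_le hz))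

namespace IsPair

variable {JS JT : ℂ → ℂ} {R : Fin P → ℂ}

/-- Induction over the poles from left to right. Left of all poles the solutions agree by
normalisation. At a non-exceptional pole the vanishing row is literally their equality at one point
to its right. At an exceptional one it yields a single-valued solution around the pole that carries
the equality across. -/
theorem glue (hf : u.IsBranch l Y f₀) (h : u.IsPair ε lam l Y f₀ κ v JS JT R)
    (hε : 0 < ε) (hR : ∀ m, R m = 0) (k : ℕ) : ∀ z : ℂ, (∀ p, z.re ≠ (u.z p).re) →
      (∀ p : Fin P, k ≤ p → z.re < (u.z p).re) →
      JS z / u.wave ε lam z = JT z / waveOf f₀ ε lam z := by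
  induction k with
  | zero =>
    intro z _ hz
    refine h.glue_segment hf (a := l + Y * Complex.I) (fun p hp => ?_) ?_
    · have h1 : (l + Y * Complex.I : ℂ).re = l := by simp
      rw [h1, Set.mem_uIcc] at hp
      have := hz p (Nat.zero_le _)
      have := hf.left p
      rcases hp with hp | hp <;> linarith [hp.1, hp.2]
    · rw [h.left, wave, waveOf, RationalPotential.h, hf.eq]
  | succ k ih =>
    intro z hz hzk
    by_cases hk : k < P
    swap
    · exact ih z hz fun p hp => absurd (lt_of_le_of_lt hp p.2) hk
    set m : Fin P := ⟨k, hk⟩ with hm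
    rcases lt_or_gt_of_ne (hz m) with hlt | hgt
    · refine ih z hz fun p hp => ?_
      rcases Nat.eq_or_lt_of_le hp with he | he
      · rwa [show p = m from Fin.ext he.symm]
      · exact hzk p he
    have key : ∀ a : ℂ, (u.z m).re < a.re → (∀ p, m < p → a.re < (u.z p).re) →
        JS a / u.wave ε lam a = JT a / waveOf f₀ ε lam a →
        JS z / u.wave ε lam z = JT z / waveOf f₀ ε lam z := by
      intro a ha ha' hab
      refine h.glue_segment hf (a := a) (fun p hp => ?_) hab
      rw [Set.mem_uIcc] at hp
      rcases le_or_gt p m with hpm | hpm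
      · have := re_le_of_le (u := u) hpm
        rcases hp with hp | hp <;> linarith [hp.1, hp.2]
      · have h1 := ha' p hpm
        have h2 := hzk p (Nat.succ_le_of_lt hpm)
        rcases hp with hp | hp <;> linarith [hp.1, hp.2]
    by_cases hexc : u.IsExceptional ε m
    · obtain ⟨δ, hδ0, W, hδ, hWS, hWT, -⟩ := h.exists_transfer hf hε hexc (hR m)
      have hmem : ∀ s : ℝ, |s| < δ → (((u.z m).re + s : ℝ) : ℂ) ∈ u.strip m δ := fun s hs =>
        ⟨by simpa using hs, by simpa using u.z_im_pos m⟩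
      have hne : ∀ s : ℝ, |s| < δ → s ≠ 0 → ∀ p,
          (((u.z m).re + s : ℝ) : ℂ).re ≠ (u.z p).re := by
        intro s hs hs0 p hp
        rw [Complex.ofReal_re] at hp
        by_cases hpm : p = m
        · rw [hpm] at hp
          exact hs0 (by linarith)
        · have := hδ p hpm
          rw [← hp, add_sub_cancel_left] at this
          linarith
      have habs : |δ / 2| < δ := by rw [abs_of_pos (by linarith)]; linarith
      have habs' : |-(δ / 2)| < δ := by rwa [abs_neg]
      have hL := hne _ habs' (by linarith)
      have hRt := hne _ habs (by linarith)
      have hglueL := ih _ hL fun p hp => by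
        have : (u.z m).re ≤ (u.z p).re := re_le_of_le hp
        rw [Complex.ofReal_re]
        linarith
      have h1 := hWT _ (hmem _ habs') (mem_cutUp_of_re hL) (mem_cutDown_of_re hL) hglueL _
        (hmem _ habs) (mem_cutDown_of_re hRt)
      refine key _ ?_ (fun p hp => ?_) ((hWS _ (hmem _ habs) (mem_cutUp_of_re hRt)).trans h1)
      · rw [Complex.ofReal_re]
        linarith
      · have h2 := hδ p hp.ne'
        have h3 : (u.z m).re < (u.z p).re := u.z_re_strictMono hp
        rw [abs_of_pos (by linarith)] at h2
        rw [Complex.ofReal_re]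
        linarith
    · have hre : (u.rightAbscissa m + Y * Complex.I : ℂ).re = u.rightAbscissa m := by simp
      refine key (u.rightAbscissa m + Y * Complex.I) ?_ (fun p hp => ?_) ?_
      · rw [hre]; exact lt_rightAbscissa m
      · rw [hre]; exact rightAbscissa_lt hp
      · have h1 := h.row_of_not m hexc
        rw [hR m] at h1
        rw [sub_eq_zero.1 h1.symm, mul_div_cancel_left₀ _ (wave_ne_zero _ _ _)]

/-- If all contour conditions hold, the two solutions glue to a solution off the poles. -/
theorem exists_solution (hf : u.IsBranch l Y f₀) (h : u.IsPair ε lam l Y f₀ κ v JS JT R)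
    (hε : 0 < ε) (hR : ∀ m, R m = 0) : ∃ W : ℂ → ℂ,
      (∀ z : ℂ, (∀ p, -(u.z p).im < z.im) → (∀ p, z ≠ u.z p) → u.SolvesAt ε lam κ v W z) ∧
      Tendsto (fun x : ℝ => W x) atBot (𝓝 (Complex.I * ε / lam * κ)) ∧
      ∀ m, ∃ B, ∀ᶠ z in 𝓝[≠] (u.z m), ‖W z‖ ≤ B := by
  classical
  have hglue : ∀ z : ℂ, (∀ p, z.re ≠ (u.z p).re) →
      JS z / u.wave ε lam z = JT z / waveOf f₀ ε lam z := fun z hz =>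
    h.glue hf hε hR P z hz fun p hp => absurd p.2 (not_lt.2 hp)
  set W : ℂ → ℂ := fun z => if z ∈ u.cutUp then JS z / u.wave ε lam z else
    JT z / waveOf f₀ ε lam z with hW
  have hWup : ∀ z ∈ u.cutUp, W z = JS z / u.wave ε lam z := fun z hz => if_pos hz
  have hWdown : ∀ z ∈ u.cutDown, W z = JT z / waveOf f₀ ε lam z := fun z hz => by
    by_cases hc : z ∈ u.cutUp
    · rw [hWup z hc]
      exact hglue z (re_ne_of_mem_cutUp_cutDown hc hz)
    · exact if_neg hc
  have hsolve : ∀ z : ℂ, (∀ p, -(u.z p).im < z.im) → (∀ p, z ≠ u.z p) → u.SolvesAt ε lam κ v W z := by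
    intro z hz hp
    by_cases hc : z ∈ u.cutUp
    · have h1 := h.solvesAt_up hc
      unfold SolvesAt at h1 ⊢
      rw [hWup z hc]
      exact h1.congr_of_eventuallyEq (Filter.eventually_of_mem (isOpen_cutUp.mem_nhds hc) hWup)
    · have hd := mem_cutDown_of_notMem_cutUp hz hp hc
      have h1 := h.solvesAt_down hf hd
      unfold SolvesAt at h1 ⊢
      rw [hWdown z hd]
      exact h1.congr_of_eventuallyEq (Filter.eventually_of_mem (isOpen_cutDown.mem_nhds hd) hWdown)
  refine ⟨W, hsolve, ?_, fun m => ?_⟩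
  · refine h.lim.congr' ?_
    filter_upwards [eventually_le_atBot l] with x hx
    exact (hWdown x (hf.mem_cutDown (Or.inr (by simpa using hx)))).symm
  · have hym := u.z_im_pos m
    have hupper : ∀ᶠ z in 𝓝[≠] (u.z m), ∀ p, -(u.z p).im < z.im :=
      nhdsWithin_le_nhds ((eventually_im_gt (by simpa using hym.le)))
    obtain ⟨δ, hδ0, hδ⟩ := u.exists_separation m
    have hsep := u.eventually_ne_poles m
    by_cases hexc : u.IsExceptional ε m
    · obtain ⟨δ', hδ0', V, hδ', hVS, hVT, B, hB⟩ := h.exists_transfer hf hε hexc (hR m)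
      refine ⟨B, ?_⟩
      have hre : ∀ p, (((u.z m).re + δ' / 2 : ℝ) : ℂ).re ≠ (u.z p).re := by
        intro p hp
        rw [Complex.ofReal_re] at hp
        by_cases hpm : p = m
        · rw [hpm] at hp
          linarith
        · have := hδ' p hpm
          rw [← hp, add_sub_cancel_left, abs_of_pos (by linarith)] at this
          linarith
      have hV := hVT (((u.z m).re + δ' / 2 : ℝ) : ℂ)
        ⟨by
          rw [Complex.ofReal_re, add_sub_cancel_left, abs_of_pos (by linarith)]
          linarith, by simpa using hym⟩
        (mem_cutUp_of_re hre) (mem_cutDown_of_re hre) (hglue _ hre)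
      filter_upwards [hB, hupper, hsep, nhdsWithin_le_nhds
        ((u.isOpen_strip m δ').mem_nhds (u.pole_mem_strip m hδ0'))] with z h1 h2 h3 h4
      by_cases hc : z ∈ u.cutUp
      · rwa [hWup z hc, hVS z h4 hc]
      · have hd := mem_cutDown_of_notMem_cutUp h2 h3 hc
        rwa [hWdown z hd, ← hV z h4 hd]
    · obtain ⟨Q, hQ, hQm, hQq⟩ := u.exists_mul_q m hδ κ v
      obtain ⟨Q', hQ', hQm', hQq'⟩ := u.exists_mul_q m hδ lam u.c
      have hnhds := (u.isOpen_strip m δ).mem_nhds (u.pole_mem_strip m hδ0)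
      set S : ℂ → ℂ := fun z => ∑ p, star (u.c p) / (z - star (u.z p)) with hS
      have hSc : ContinuousAt S (u.z m) := by
        refine tendsto_finsetSum _ fun p _ => ?_
        refine ContinuousAt.div (f := fun _ => star (u.c p)) (g := fun z => z - star (u.z p))
          continuousAt_const (by fun_prop) ?_
        intro h0
        have := congrArg Complex.im h0
        simp at this
        linarith [u.z_im_pos p]
      -- Multiplied by z − z_m the equation has a regular singular point with exponent ic_m/ε, which
      -- is not a negative integer precisely because the index is not exceptional.
      refine exists_bound_of_regular_singular (s := Q)
        (t := fun z => Complex.I / ε * (Q' z + (z - u.z m) * S z))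
        (hQ.differentiableAt hnhds).continuousAt
        (continuousAt_const.mul ((hQ'.differentiableAt hnhds).continuousAt.add
          ((by fun_prop : ContinuousAt (fun z => z - u.z m) (u.z m)).mul hSc))) (fun n hn => ?_) ?_
      · refine hexc ⟨n + 1, Nat.succ_pos n, ?_⟩
        rw [hQm', sub_self, zero_mul, add_zero] at hn
        rw [← hn]
        ring
      · filter_upwards [hupper, hsep] with z h1 h2
        refine (hsolve z h1 h2).congr_deriv ?_
        have hne := sub_ne_zero.2 (h2 m)
        have hu : (lam + u.uC z) = u.q 1 lam u.c z + S z := by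
          rw [uC, q, Finset.sum_add_distrib]
          push_cast
          ring
        rw [hQq z (h2 m), hQq' z (h2 m), hu]
        field_simp

end IsPair

theorem limUnder_eq_of_continuousAt {W : ℂ → ℂ} {z : ℂ} (h : ContinuousAt W z) :
    limUnder (𝓝[≠] z) W = W z :=
  (h.tendsto.mono_left nhdsWithin_le_nhds).limUnder_eq

/-- Riemann's removable singularity theorem. The punctured limit equals W at every point of
continuity, so this one formula repairs all poles at once. -/
theorem differentiableAt_limUnder {W : ℂ → ℂ} {a : ℂ} {B : ℝ}
    (hd : ∀ᶠ z in 𝓝[≠] a, DifferentiableAt ℂ W z) (hB : ∀ᶠ z in 𝓝[≠] a, ‖W z‖ ≤ B) :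
    DifferentiableAt ℂ (fun z => limUnder (𝓝[≠] z) W) a := by
  obtain ⟨r, hr, hball⟩ := Metric.mem_nhdsWithin_iff.1 (hd.and hB)
  have h1 := Complex.differentiableOn_update_limUnder_of_bddAbove (f := W)
    (Metric.ball_mem_nhds a hr) (fun z hz => (hball ⟨hz.1, hz.2⟩).1.differentiableWithinAt)
    ⟨B, by
      rintro _ ⟨z, hz, rfl⟩
      exact (hball ⟨hz.1, hz.2⟩).2⟩
  refine (h1.differentiableAt (Metric.ball_mem_nhds a hr)).congr_of_eventuallyEq ?_
  filter_upwards [Metric.ball_mem_nhds a hr] with z hz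
  by_cases hza : z = a
  · rw [hza, Function.update_self]
  · rw [Function.update_of_ne hza]
    exact limUnder_eq_of_continuousAt (hball ⟨hz, hza⟩).1.continuousAt

/-- Division by iε passes from W to w. The constant κλ compensates for the parameter 1 in `q`, and
the limit iεκ of W at −∞ becomes κ. -/
theorem IsPair.exists_isJost {JS JT : ℂ → ℂ} {R : Fin P → ℂ} (hf : u.IsBranch l Y f₀)
    (h : u.IsPair ε lam l Y f₀ (κ * lam) v JS JT R) (hε : 0 < ε) (hlam : 0 < lam)
    (hR : ∀ m, R m = 0) : ∃ w, u.IsJost ε lam κ v w := by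
  have hε' : (ε : ℂ) ≠ 0 := by exact_mod_cast hε.ne'
  have hlam' : (lam : ℂ) ≠ 0 := by exact_mod_cast hlam.ne'
  obtain ⟨W, hW, hlim, hB⟩ := h.exists_solution hf hε hR
  have hq : ∀ z, u.q 1 (κ * lam) v z = u.q lam κ v z := fun z => by simp [q]
  have hL : ∀ z : ℂ, (∀ p, -(u.z p).im < z.im) → (∀ p, z ≠ u.z p) →
      limUnder (𝓝[≠] z) W = W z := fun z hz hp =>
    limUnder_eq_of_continuousAt (hW z hz hp).continuousAt
  have hreg : ∀ z : ℂ, 0 ≤ z.im → (∀ p, z ≠ u.z p) →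
      (fun z => limUnder (𝓝[≠] z) W) =ᶠ[𝓝 z] W := by
    intro z hz hp
    filter_upwards [eventually_im_gt (u := u) hz,
      eventually_all.2 fun p => eventually_ne_nhds (hp p)] with y h1 h2
    exact hL y h1 h2
  have him : ∀ z : ℂ, 0 ≤ z.im → ∀ p, -(u.z p).im < z.im := fun z hz =>
    (eventually_im_gt (u := u) hz).self_of_nhds
  have hI := Complex.I_ne_zero
  refine ⟨fun z => limUnder (𝓝[≠] z) W / (Complex.I * ε), fun z hz => ?_, fun z hz hp => ?_, ?_⟩
  · refine DifferentiableAt.div_const ?_ _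
    by_cases hp : ∀ p, z ≠ u.z p
    · exact (hW z (him z hz) hp).differentiableAt.congr_of_eventuallyEq (hreg z hz hp)
    · push Not at hp
      obtain ⟨p, rfl⟩ := hp
      obtain ⟨B, hB⟩ := hB p
      refine differentiableAt_limUnder ?_ hB
      filter_upwards [nhdsWithin_le_nhds (eventually_im_gt (u := u) hz), u.eventually_ne_poles p]
        with y h1 h2
      exact (hW y h1 h2).differentiableAt
  · have h1 : HasDerivAt (fun z => limUnder (𝓝[≠] z) W / (Complex.I * ε)) _ z :=
      ((hW z (him z hz) hp).congr_of_eventuallyEq (hreg z hz hp)).div_const (Complex.I * ε)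
    rw [h1.deriv, hL z (him z hz) hp, hq]
    field_simp
    linear_combination ((lam + u.uC z) * W z) * Complex.I_sq
  · have h1 := hlim.div_const (Complex.I * ε)
    have h2 : Complex.I * ε / lam * (κ * lam) / (Complex.I * ε) = κ := by field_simp
    rw [h2] at h1
    refine h1.congr fun x => ?_
    rw [hL x (him x (by simp)) fun p => (u.ofReal_ne x p).1]

end RationalPotential

/-! ### The linear system and the reflection coefficient -/

namespace RationalPotential

variable {P : ℕ} {u : RationalPotential P} {ε lam : ℝ}

theorem entryA_eq_row (ε : ℝ) (m p : Fin P) : u.entryA ε m p = u.row ε m 0 (Pi.single p 1) := by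
  have : ∀ z, u.q 1 0 (Pi.single p 1) z = 1 / (z - u.z p) := fun z => by
    simp only [q, zero_mul, zero_add]
    rw [Finset.sum_eq_single p (fun r _ hr => by simp [Pi.single_eq_of_ne hr])
      (fun h => absurd (Finset.mem_univ p) h), Pi.single_eq_same]
  funext μ
  simp only [entryA, row, this, wave, mul_one_div]

theorem entryB_eq_row (ε : ℝ) (m : Fin P) (μ : ℝ) : u.entryB ε m μ = -μ * u.row ε m 1 0 μ := by
  have : ∀ z, u.q 1 1 0 z = 1 := fun z => by simp [q]
  simp only [entryB, row, this, wave, mul_one]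

/-- The boundary values exist, and solutions of the linear system give Jost functions. -/
theorem exists_system (u : RationalPotential P) (hP : 0 < P) (hε : 0 < ε) (hlam : 0 < lam) :
    ∃ (A : Matrix (Fin P) (Fin P) ℂ) (b : Fin P → ℂ),
      (∀ m p, IsUpperBoundaryValue (u.entryA ε m p) lam (A m p)) ∧
      (∀ m, IsUpperBoundaryValue (u.entryB ε m) lam (b m)) ∧
      ∀ (κ : ℂ) (v : Fin P → ℂ), A.mulVec v = κ • b → ∃ w, u.IsJost ε lam κ v w := by
  classical
  set m₀ : Fin P := ⟨0, hP⟩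
  have hl : ∀ m, u.leftAbscissa m = u.leftAbscissa m₀ := fun _ => rfl
  obtain ⟨f₀, hf⟩ := exists_isBranch (u := u) (l := u.leftAbscissa m₀)
    (Y := 1 + ∑ p, (u.z p).im) (fun p => leftAbscissa_add_one_le m₀ p)
    (fun p => by
      have := Finset.single_le_sum (f := fun p => (u.z p).im) (fun p _ => (u.z_im_pos p).le)
        (Finset.mem_univ p)
      linarith)
    (by
      have := Finset.sum_nonneg fun p (_ : p ∈ Finset.univ) => (u.z_im_pos p).le
      linarith)
  obtain ⟨S₀, T₀, R₀, h₀, hb₀⟩ := hf.exists_isPair hε hlam hl 1 0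
  choose S T R h hb using fun p : Fin P => hf.exists_isPair hε hlam hl 0 (Pi.single p 1)
  refine ⟨fun m p => R p m, fun m => -lam * R₀ m, fun m p => ?_, fun m => ?_, fun κ v hv => ?_⟩
  · rw [entryA_eq_row]
    exact hb p m
  · have h1 := IsUpperBoundaryValue.of_differentiable (G := fun μ : ℂ => -μ) differentiable_neg lam
    exact (h1.mul (hb₀ m)).congr fun μ _ => (entryB_eq_row ε m μ).symm
  · have hsum := IsPair.sum (s := Finset.univ) (u := u) (ι := Option (Fin P))
      (κ := fun i => i.elim (κ * lam * 1) fun p => v p * 0)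
      (v := fun i => i.elim (fun r => κ * lam * (0 : Fin P → ℂ) r)
        fun p r => v p * (Pi.single p 1 : Fin P → ℂ) r)
      (JS := fun i => i.elim (fun z => κ * lam * S₀ z) fun p z => v p * S p z)
      (JT := fun i => i.elim (fun z => κ * lam * T₀ z) fun p z => v p * T p z)
      (R := fun i => i.elim (fun m => κ * lam * R₀ m) fun p m => v p * R p m) (fun i _ => by
        cases i with
        | none => exact h₀.const_mul (κ * lam)
        | some p => exact (h p).const_mul (v p))
    simp only [Fintype.sum_option, Option.elim_none, Option.elim_some, mul_one, mul_zero,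
      Finset.sum_const_zero, add_zero, Pi.zero_apply, zero_add] at hsum
    have hsv : (fun r => ∑ p, v p * (Pi.single p 1 : Fin P → ℂ) r) = v := by
      funext r
      rw [Finset.sum_eq_single r (fun p _ hp => by simp [Pi.single_eq_of_ne hp.symm])
        (fun h => absurd (Finset.mem_univ r) h), Pi.single_eq_same, mul_one]
    rw [hsv] at hsum
    refine hsum.exists_isJost hf hε hlam fun m => ?_
    have h1 := congrFun hv m
    simp only [Matrix.mulVec, dotProduct, Pi.smul_apply, smul_eq_mul] at h1
    have h2 : ∑ p, v p * R p m = ∑ p, R p m * v p := Finset.sum_congr rfl fun p _ => mul_comm _ _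
    rw [h2, h1]
    ring

/-- On the real line the two logarithms of each summand are conjugate to each other, so the phase is
real and the wave unimodular. -/
theorem f_ofReal_im (u : RationalPotential P) (x : ℝ) : (u.f x).im = 0 := by
  rw [f, Complex.im_sum]
  refine Finset.sum_eq_zero fun p _ => ?_
  obtain ⟨h1, -⟩ := mem_slitPlane_of_mem_cutUp (ofReal_mem_cutUp (u := u) x) p
  have h2 : -Complex.I * ((x : ℂ) - star (u.z p)) =
      (starRingEnd ℂ) (Complex.I * (x - u.z p)) := by simp
  have h3 : star (u.c p) * (Complex.log (-Complex.I * ((x : ℂ) - star (u.z p))) -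
      Real.pi * Complex.I / 2) = (starRingEnd ℂ) (u.c p *
        (Complex.log (Complex.I * (x - u.z p)) + Real.pi * Complex.I / 2)) := by
    rw [h2, Complex.log_conj _ (Complex.mem_slitPlane_iff_arg.1 h1).1]
    simp only [map_mul, map_add, map_div₀, Complex.conj_ofReal, Complex.conj_I, map_ofNat,
      RCLike.star_def]
    ring
  rw [h3, Complex.add_conj, Complex.ofReal_im]

theorem M_im (u : RationalPotential P) : u.M.im = 0 := by
  have h := u.re_sum_c
  rw [M]
  simp [Complex.mul_im, Complex.mul_re, h]

theorem wave_ofReal (u : RationalPotential P) (ε lam x : ℝ) :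
    u.wave ε lam x = u.wave ε lam 0 * u.osc ε lam x := by
  have hd : ∀ t : ℝ, HasDerivAt (fun x : ℝ => u.wave ε lam x * (u.osc ε lam x)⁻¹) 0 t := by
    intro t
    have h0 : u.osc ε lam t ≠ 0 := Complex.exp_ne_zero _
    have h1 := (hasDerivAt_wave (ofReal_mem_cutUp (u := u) t) ε lam).comp_ofReal
    refine (h1.mul ((u.hasDerivAt_osc ε lam t).inv h0)).congr_deriv ?_
    simp only [Pi.inv_apply]
    field_simp
    ring
  have h := is_const_of_deriv_eq_zero (fun t => (hd t).differentiableAt) (fun t => (hd t).deriv) x 0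
  have h0 : u.osc ε lam 0 = 1 := by simp [osc, phase]
  have h1 : u.osc ε lam x ≠ 0 := Complex.exp_ne_zero _
  rw [h0, inv_one, mul_one, Complex.ofReal_zero] at h
  rw [← h]
  field_simp

theorem norm_wave_zero (u : RationalPotential P) (ε lam : ℝ) : ‖u.wave ε lam 0‖ = 1 := by
  have h1 : (u.h lam 0).im = 0 := by
    have := u.f_ofReal_im 0
    rw [Complex.ofReal_zero] at this
    simp [h, this]
  have h2 : u.h lam 0 = ((u.h lam 0).re : ℂ) := Complex.ext (by simp) (by simpa using h1)
  rw [wave, h2, show -Complex.I * ((u.h lam 0).re : ℂ) / ε =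
    ((-((u.h lam 0).re / ε) : ℝ) : ℂ) * Complex.I by push_cast; ring, Complex.norm_exp_ofReal_mul_I]

theorem norm_exp_M (u : RationalPotential P) (ε : ℝ) :
    ‖Complex.exp (Complex.I * u.M / ε)‖ = 1 := by
  have h2 : u.M = (u.M.re : ℂ) := Complex.ext (by simp) (by simpa using u.M_im)
  rw [h2, show Complex.I * (u.M.re : ℂ) / ε = ((u.M.re / ε : ℝ) : ℂ) * Complex.I by
    push_cast; ring, Complex.norm_exp_ofReal_mul_I]

/-- The improper integral defining the reflection coefficient converges. -/
theorem IsJost.exists_reflection {v : Fin P → ℂ} {w : ℂ → ℂ} (hw : u.IsJost ε lam 1 v w)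
    (hlam : 0 < lam) (hε : 0 < ε) (hε1 : ε ≤ 1) : ∃ β : ℂ,
      Tendsto (fun R : ℝ × ℝ => Complex.I / ε * Complex.exp (Complex.I * u.M / ε) *
        ∫ x in R.1..R.2, Complex.exp (-Complex.I * u.h lam x / ε) *
          ((u.u₀ x : ℂ) - ∑ p, v p / ((x : ℂ) - u.z p))) (atBot ×ˢ atTop) (𝓝 β) ∧
      ε * ‖β‖ ^ 2 = 4 * Real.pi * (∑ p, v p).re := by
  have hε' : (ε : ℂ) ≠ 0 := by exact_mod_cast hε.ne'
  have hlam' : (lam : ℂ) ≠ 0 := by exact_mod_cast hlam.ne'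
  have hI := Complex.I_ne_zero
  obtain ⟨K, hK, hKn⟩ := hw.exists_limit hlam hε hε1
  set c := u.wave ε lam 0 with hc
  set E := Complex.exp (Complex.I * u.M / ε)
  -- Subtracting 1 turns the right-hand side q into Σ v_p/(x − z_p) − u₀, minus the bracket in the
  -- definition of β. So g is, up to a constant, a primitive of that integrand. At +∞ the identity
  -- λ(w − 1) = (q − λ) − k gives the limit −K/λ.
  set g : ℝ → ℂ := fun x => u.osc ε lam x * (w x - 1) with hg
  set r : ℝ → ℂ := fun x => ∑ p, v p / ((x : ℂ) - u.z p) - u.u₀ x with hr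
  have hgd : ∀ x : ℝ, HasDerivAt g (u.osc ε lam x * (r x / (Complex.I * ε))) x := by
    intro x
    refine u.hasDerivAt_osc_mul hε.ne' ((hw.hasDerivAt_ofReal x).sub_const 1) ?_
    have h1 := hw.ode x (by simp) fun p => (u.ofReal_ne x p).1
    simp only [hr, ← u.uC_ofReal]
    rw [q, one_mul] at h1
    linear_combination h1
  have hrc : Continuous r := by
    refine (continuous_finsetSum _ fun p _ => ?_).sub
      (Complex.continuous_ofReal.comp u.continuous_u₀)
    exact continuous_const.div (by fun_prop) fun x => sub_ne_zero.2 (u.ofReal_ne x p).1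
  have hoc : Continuous (u.osc ε lam) := continuous_iff_continuousAt.2 fun x =>
    (u.hasDerivAt_osc ε lam x).continuousAt
  have hint : ∀ R : ℝ × ℝ, ∫ x in R.1..R.2, Complex.exp (-Complex.I * u.h lam x / ε) *
      ((u.u₀ x : ℂ) - ∑ p, v p / ((x : ℂ) - u.z p)) =
      -(Complex.I * ε) * c * (g R.2 - g R.1) := by
    intro R
    rw [← intervalIntegral.integral_eq_sub_of_hasDerivAt (fun x _ => hgd x)
      ((hoc.mul (hrc.div_const _)).intervalIntegrable _ _),
      ← intervalIntegral.integral_const_mul]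
    refine intervalIntegral.integral_congr fun x _ => ?_
    have h1 : Complex.exp (-Complex.I * u.h lam x / ε) = c * u.osc ε lam x :=
      u.wave_ofReal ε lam x
    simp only [h1, hr]
    field_simp
    ring
  have hbot : Tendsto g atBot (𝓝 0) := by
    have h1 : Tendsto (fun x : ℝ => w x - 1) atBot (𝓝 0) := by simpa using hw.lim.sub_const 1
    refine squeeze_zero_norm (fun x => ?_) (tendsto_zero_iff_norm_tendsto_zero.1 h1)
    rw [hg]
    simp only
    rw [norm_mul, norm_osc, one_mul]
  have htop : Tendsto g atTop (𝓝 (-K / lam)) := by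
    have h1 : Tendsto (fun x : ℝ => u.osc ε lam x * (u.q lam 1 v x - lam)) atTop (𝓝 0) := by
      have h2 : Tendsto (fun x : ℝ => u.q lam 1 v x - lam) atTop (𝓝 0) := by
        simpa using (u.tendsto_q_atTop lam 1 v).sub_const (lam : ℂ)
      refine squeeze_zero_norm (fun x => ?_) (tendsto_zero_iff_norm_tendsto_zero.1 h2)
      rw [norm_mul, norm_osc, one_mul]
    have h2 := (h1.sub hK).div_const (lam : ℂ)
    rw [zero_sub] at h2
    refine h2.congr fun x => ?_
    simp only [hg]
    field_simp
    ring
  refine ⟨Complex.I / ε * E * (-(Complex.I * ε) * c * (-K / lam - 0)), ?_, ?_⟩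
  · simp only [hint]
    exact (((htop.comp tendsto_snd).sub (hbot.comp tendsto_fst)).const_mul _).const_mul _
  · have h1 : ‖Complex.I / ε * E * (-(Complex.I * ε) * c * (-K / lam - 0))‖ = ‖K‖ / lam := by
      rw [sub_zero]
      simp only [norm_mul, norm_div, norm_neg, Complex.norm_I, Complex.norm_real, E, hc,
        norm_exp_M, norm_wave_zero, Real.norm_of_nonneg hε.le, Real.norm_of_nonneg hlam.le]
      field_simp
    rw [h1, div_pow, ← mul_div_assoc, hKn, star_one, one_mul]
    field_simp

/-- A kernel vector of A gives a Jost function with κ = 0, whose size is then at most 0. So the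
square matrix is injective, hence bijective, and boundary values being unique, every instance of the
system is this one. -/
theorem exists_unique_system {C : ℝ} (hP : 0 < P) (hε : 0 < ε) (hlam : 0 < lam)
    (hC : ∀ κ v w, u.IsJost ε lam κ v w → size κ v ≤ C * ‖κ‖) :
    ∃ v w, u.IsJost ε lam 1 v w ∧ ∀ v', u.SolvesJostSystem ε lam v' ↔ v' = v := by
  obtain ⟨A, b, hA, hb, hJ⟩ := u.exists_system hP hε hlam
  have hinj : Function.Injective A.mulVec := by
    intro v v' hvv
    have h1 : A.mulVec (v - v') = (0 : ℂ) • b := by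
      rw [Matrix.mulVec_sub, hvv, sub_self, zero_smul]
    obtain ⟨w, hw⟩ := hJ 0 _ h1
    have h2 := hC _ _ _ hw
    rw [norm_zero, mul_zero] at h2
    exact sub_eq_zero.1 (eq_zero_of_size (le_antisymm h2 (size_nonneg _ _))).2
  have hsurj : Function.Surjective A.mulVec :=
    (LinearMap.injective_iff_surjective (f := A.mulVecLin)).1 hinj
  obtain ⟨v, hv⟩ := hsurj b
  obtain ⟨w, hw⟩ := hJ 1 v (by rw [hv, one_smul])
  refine ⟨v, w, hw, fun v' => ⟨?_, ?_⟩⟩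
  · rintro ⟨A', b', hA', hb', h⟩
    have e1 : A' = A := by
      ext m p
      exact (hA' m p).unique (hA m p)
    have e2 : b' = b := funext fun m => (hb' m).unique (hb m)
    rw [e1, e2] at h
    exact hinj (h.trans hv.symm)
  · rintro rfl
    exact ⟨A, b, hA, hb, hv⟩

end RationalPotential

end

/-! ### The modulus formula -/

theorem mainTheorem6 {P : ℕ} (u : RationalPotential P) (hKS : u.IsKlausShaw)
    (hneg : ∀ x, u.u₀ x < 0) (lam : ℝ) (hlam : lam ∈ u.bulk) :
    (∀ᶠ ε : ℝ in 𝓝[>] 0, ∃! β : ℂ, u.IsReflectionCoefficient ε lam β) ∧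
    ∃ xm xp : ℝ, xm < xp ∧ {x : ℝ | u.u₀ x = -lam} = {xm, xp} ∧
      ∀ β : ℝ → ℂ, (∀ᶠ ε : ℝ in 𝓝[>] 0, u.IsReflectionCoefficient ε lam (β ε)) →
        Tendsto (fun ε : ℝ => ε * ‖β ε‖ ^ 2) (𝓝[>] 0)
          (𝓝 (2 * Real.pi * lam * (xp - xm))) := by
  obtain ⟨xm, xp, ht⟩ := RationalPotential.exists_turningPoints hKS hneg hlam
  -- Without poles the potential vanishes identically, contrary to its negativity.
  have hP : 0 < P := by
    rcases Nat.eq_zero_or_pos P with h | h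
    · subst h
      have := hneg 0
      simp [RationalPotential.u₀] at this
    · exact h
  obtain ⟨C, hC⟩ := RationalPotential.exists_bound_size hP ht
  have hsmall : ∀ᶠ ε : ℝ in 𝓝[>] 0, 0 < ε ∧ ε ≤ 1 := by
    filter_upwards [Ioo_mem_nhdsGT (zero_lt_one' ℝ)] with ε hε
    exact ⟨hε.1, hε.2.le⟩
  have hmain : ∀ᶠ ε : ℝ in 𝓝[>] 0, ∃ v w β, u.IsJost ε lam 1 v w ∧
      (∀ β', u.IsReflectionCoefficient ε lam β' ↔ β' = β) ∧
      ε * ‖β‖ ^ 2 = 4 * Real.pi * (∑ p, v p).re := by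
    filter_upwards [hC, hsmall] with ε hCε hε
    obtain ⟨v, w, hw, hv⟩ := RationalPotential.exists_unique_system hP hε.1 ht.lam_pos hCε
    obtain ⟨β, hβ, hβn⟩ := hw.exists_reflection ht.lam_pos hε.1 hε.2
    refine ⟨v, w, β, hw, fun β' => ⟨?_, ?_⟩, hβn⟩
    · rintro ⟨v', hv', h⟩
      rw [(hv v').1 hv'] at h
      exact tendsto_nhds_unique h hβ
    · rintro rfl
      exact ⟨v, (hv v).2 rfl, hβ⟩
  refine ⟨?_, xm, xp, ht.lt, ht.setOf_eq, fun β hβ => ?_⟩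
  · filter_upwards [hmain] with ε ⟨v, w, β, _, hβ, _⟩
    exact ⟨β, (hβ β).2 rfl, fun β' h => (hβ β').1 h⟩
  -- By the exact formula the distance to the limit is 2π|2 Re Σ v_p − λ(x₊ − x₋)|, which explains
  -- the tolerance η/(2π).
  · rw [Metric.tendsto_nhds]
    intro η hη
    have hη' : 0 < η / (2 * Real.pi) := by positivity
    filter_upwards [hmain, hβ, RationalPotential.eventually_re_sum hP ht hη'] with ε
      ⟨v, w, β', hw, hβ', hn⟩ h2 h3
    have h4 := h3 v w hw
    rw [(hβ' _).1 h2, hn, Real.dist_eq,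
      show 4 * Real.pi * (∑ p, v p).re - 2 * Real.pi * lam * (xp - xm) =
        2 * Real.pi * (2 * (∑ p, v p).re - lam * (xp - xm)) by ring, abs_mul,
      abs_of_pos (by positivity : 0 < 2 * Real.pi)]
    rwa [lt_div_iff₀' (by positivity)] at h4
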